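/- Let $\mathbf k$ be a field. For a permutation $\sigma\in\Sigma_n$ and homogeneous $a_1,\dots,a_n$ let $\epsilon(\sigma)=\epsilon(\sigma;a_1,\dots,a_n)$ be the Koszul sign, $a_1\wedge\cdots\wedge a_n=\epsilon(\sigma)\,a_{\sigma(1)}\wedge\cdots\wedge a_{\sigma(n)}$ in the free graded commutative algebra, and let $\chi(\sigma)=\operatorname{sgn}(\sigma)\,\epsilon(\sigma)$. Let $K_n$ be the associahedron (the $(n-2)$-dimensional polytope whose faces are the bracketings of $1\cdots n$; $K_1$ is a point) and $W_n$ the cyclohedron (the $(n-1)$-dimensional polytope whose faces are the cyclic bracketings of $1\cdots n$). The cellular chains $\overline{\mathcal A}=CC_*(\overline K)$ of the symmetrized associahedra $\overline K_n=\Sigma_n\times K_n$ form a differential graded operad over $\mathbf k$, and the cellular chains $\mathcal M=CC_*(\overline W)$ of the symmetrized cyclohedra $\overline W_n=\Sigma_{n-1}\times W_n$ (the faces of $\overline W_n$ are the cyclic bracketings of $\sigma(1)\cdots\sigma(n)$, $\sigma\in\Sigma_n$) form a right $\overline{\mathcal A}$-module; both structures are given by inserting a bracketing for a letter. If $A$ is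 an $\overline{\mathcal A}$-algebra and $(W,\delta)$ is a differential graded vector space, $\deg\delta=-1$, an $\mathcal M$-trace over $A$ with values in $W$ is a morphism $t:\mathcal M\to\mathcal E_{A,W}$, $\mathcal E_{A,W}(n)=\operatorname{Hom}(A^{\otimes n},W)$, of right differential graded $\overline{\mathcal A}$-modules. An $A(\infty)$-algebra is a $\mathbb Z$-graded vector space $A$ with linear maps $m_k:A^{\otimes k}\to A$, $k\ge1$, of degree $k-2$ such that for all $n\ge 1$ and homogeneous $a_1,\dots,a_n\in A$ $$\sum_{k=1}^{n}\sum_{\lambda=0}^{n-k}(-1)^{k+\lambda+k\lambda+k(|a_1|+\cdots+|a_\lambda|)}\,m_{n-k+1}(a_1,\dots,a_\lambda,m_k(a_{\lambda+1},\dots,a_{\lambda+k}),a_{\lambda+k+1},\dots,a_n)=0 .$$ **Proposition.** The top-dimensional cells $c_n$ of $K_n$ ($n\ge2$) and $f_n$ of $W_n$ ($n\ge1$) can be oriented so that the following holds for every $A(\infty)$-algebra $A=(A;m_1=\partial,m_2,m_3,\dots)$. There is exactly one $\overline{\mathcal A}$-algebra structure on the complex $(A,\partial)$ in which $c_n$ acts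 as $m_n$ for all $n\ge2$. For this structure and for every differential graded vector space $(W,\delta)$, $\deg\delta=-1$, the assignment $t\mapsto\{T_n:=t(f_n)\}_{n\ge1}$ is a bijection from the set of $\mathcal M$-traces over $A$ with values in $W$ onto the set of systems of linear maps $T_n:A^{\otimes n}\to W$ of degree $n-1$, $n\geq1$, such that for all $n\ge1$ and all homogeneous $a_1,\dots,a_n\in A$ (i) $T_n(a_1,\dots,a_n)=\chi(\sigma)\,T_n(a_{\sigma(1)},\dots,a_{\sigma(n)})$ for all cyclic permutations $\sigma\in\Sigma_n$, and (ii) $\displaystyle \delta T_n(a_1,\dots,a_n)=\sum_{\sigma}\chi(\sigma)\sum_{1\le k\le n}(-1)^{k+n}\,T_{n-k+1}\bigl(m_k(a_{\sigma(1)},\dots,a_{\sigma(k)}),a_{\sigma(k+1)},\dots,a_{\sigma(n)}\bigr)$, where $\sigma$ runs over the $n$ cyclic permutations of $1,\dots,n$. Such systems are called homotopy traces over $A$. -/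

import Mathlib

universe u v w

noncomputable section

open scoped Classical

namespace Cyclohedron

section Words

variable {m n : ℕ}

/-! ### Words and bracketings

Letters are `0, …, n` (so the arity is `n + 1`).  Inserting a word of arity `n + 1` at the letter
`i` of a word of arity `m + 1` gives a word of arity `m + n + 1`. -/

/-- New name of the letter `j ≠ i` of the outer word after `n + 1` letters replace `i`. -/
def outLab (n : ℕ) (i j : Fin (m + 1)) : Fin (m + n + 1) :=
  ⟨if (j : ℕ) ≤ i then (j : ℕ) else j + n, by have := j.2; split <;> omega⟩

/-- New name of the letter `y` of the word that is inserted at the letter `i`. -/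
def inLab (n : ℕ) (i : Fin (m + 1)) (y : Fin (n + 1)) : Fin (m + n + 1) :=
  ⟨i + y, by have := i.2; have := y.2; omega⟩

theorem outLab_inj {i j j' : Fin (m + 1)} (h : outLab n i j = outLab n i j') : j = j' := by
  simp only [outLab, Fin.mk.injEq] at h
  ext
  split at h <;> split at h <;> omega

theorem inLab_inj {i : Fin (m + 1)} {y y' : Fin (n + 1)} (h : inLab n i y = inLab n i y') :
    y = y' := by
  simp only [inLab, Fin.mk.injEq] at h
  ext; omega

theorem outLab_ne_inLab {i j : Fin (m + 1)} (hj : j ≠ i) (y : Fin (n + 1)) :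
    outLab n i j ≠ inLab n i y := by
  intro h
  simp only [outLab, inLab, Fin.mk.injEq] at h
  have := y.2
  have : (j : ℕ) ≠ i := fun h => hj (Fin.ext h)
  split at h <;> omega

theorem lab_cases (i : Fin (m + 1)) (x : Fin (m + n + 1)) :
    (∃ j, j ≠ i ∧ x = outLab n i j) ∨ ∃ y, x = inLab n i y := by
  have hx := x.2
  have hi := i.2
  rcases lt_or_ge (x : ℕ) i with h | h
  · left
    refine ⟨⟨x, by omega⟩, ?_, ?_⟩
    · intro h'; rw [← h'] at h; simp at h
    · ext; simp [outLab, h.le]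
  · rcases lt_or_ge ((i : ℕ) + n) x with h2 | h2
    · left
      refine ⟨⟨x - n, by omega⟩, ?_, ?_⟩
      · intro h'; have := congrArg Fin.val h'; simp at this; omega
      · ext; simp only [outLab]; rw [if_neg (by omega)]; omega
    · right
      exact ⟨⟨x - i, by omega⟩, by ext; simp only [inLab]; omega⟩

/-- Replace the letter `i` of the word `l` by the word `v`, and rename the letters. -/
def substWord (i : Fin (m + 1)) (v : List (Fin (n + 1))) (l : List (Fin (m + 1))) :
    List (Fin (m + n + 1)) :=
  l.flatMap fun j => if j = i then v.map (inLab n i) else [outLab n i j]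

@[simp] theorem subst_nil (i : Fin (m + 1)) (v : List (Fin (n + 1))) : substWord i v [] = [] := rfl

theorem subst_cons_self (i : Fin (m + 1)) (v : List (Fin (n + 1))) (l) :
    substWord i v (i :: l) = v.map (inLab n i) ++ substWord i v l := by
  simp [substWord]

theorem subst_cons_ne {i j : Fin (m + 1)} (h : j ≠ i) (v : List (Fin (n + 1))) (l) :
    substWord i v (j :: l) = outLab n i j :: substWord i v l := by
  simp [substWord, h]

theorem subst_append (i : Fin (m + 1)) (v : List (Fin (n + 1))) (l l') :
    substWord i v (l ++ l') = substWord i v l ++ substWord i v l' := by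
  simp [substWord]

theorem outLab_mem_subst {i j : Fin (m + 1)} (hj : j ≠ i) {v : List (Fin (n + 1))} {l} :
    outLab n i j ∈ substWord i v l ↔ j ∈ l := by
  simp only [substWord, List.mem_flatMap]
  constructor
  · rintro ⟨x, hx, h⟩
    split at h
    · obtain ⟨y, -, hy⟩ := List.mem_map.1 h
      exact absurd hy.symm (outLab_ne_inLab hj y)
    · rw [List.mem_singleton] at h
      rwa [outLab_inj h]
  · intro h
    exact ⟨j, h, by simp [hj]⟩

theorem inLab_mem_subst {i : Fin (m + 1)} {y : Fin (n + 1)} {v : List (Fin (n + 1))} {l} :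
    inLab n i y ∈ substWord i v l ↔ i ∈ l ∧ y ∈ v := by
  simp only [substWord, List.mem_flatMap]
  constructor
  · rintro ⟨x, hx, h⟩
    split at h
    · obtain ⟨y', hy', h'⟩ := List.mem_map.1 h
      rw [inLab_inj h'] at hy'
      subst x
      exact ⟨hx, hy'⟩
    · rename_i hne
      rw [List.mem_singleton] at h
      exact absurd h.symm (outLab_ne_inLab hne y)
  · rintro ⟨h, h'⟩
    exact ⟨i, h, by simpa using ⟨y, h', rfl⟩⟩

theorem subst_nodup {i : Fin (m + 1)} {v : List (Fin (n + 1))} (hv : v.Nodup) {l}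
    (hl : l.Nodup) : (substWord i v l).Nodup := by
  induction l with
  | nil => simp
  | cons j l ih =>
    rw [List.nodup_cons] at hl
    by_cases hj : j = i
    · subst j
      rw [subst_cons_self, List.nodup_append]
      refine ⟨hv.map fun _ _ => inLab_inj, ih hl.2, ?_⟩
      intro a ha b hb hab
      obtain ⟨y, -, rfl⟩ := List.mem_map.1 ha
      subst b
      exact hl.1 (inLab_mem_subst.1 hb).1
    · rw [subst_cons_ne hj, List.nodup_cons, outLab_mem_subst hj]
      exact ⟨hl.1, ih hl.2⟩

theorem subst_disjoint {i : Fin (m + 1)} {v : List (Fin (n + 1))} {l l'}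
    (h : l.Disjoint l') : (substWord i v l).Disjoint (substWord i v l') := by
  intro x hx hx'
  rcases lab_cases (n := n) i x with ⟨j, hj, rfl⟩ | ⟨y, rfl⟩
  · exact h ((outLab_mem_subst hj).1 hx) ((outLab_mem_subst hj).1 hx')
  · exact h (inLab_mem_subst.1 hx).1 (inLab_mem_subst.1 hx').1

theorem length_le_subst {i : Fin (m + 1)} {v : List (Fin (n + 1))} (hv : v ≠ []) (l) :
    l.length ≤ (substWord i v l).length := by
  induction l with
  | nil => simp
  | cons j l ih =>
    have := List.length_pos_iff.2 hv
    by_cases hj : j = i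
    · subst j; rw [subst_cons_self]; simp; omega
    · rw [subst_cons_ne hj]; simp; omega

theorem subst_inj {i : Fin (m + 1)} {v : List (Fin (n + 1))} (hv : v ≠ []) {l l'}
    (h : substWord i v l = substWord i v l') : l = l' := by
  induction l generalizing l' with
  | nil =>
    have := length_le_subst (i := i) hv l'
    rw [← h] at this
    simpa using (List.length_eq_zero_iff.1 (Nat.le_zero.1 this)).symm
  | cons j l ih =>
    cases l' with
    | nil =>
      have := length_le_subst (i := i) hv (j :: l)
      rw [h] at this
      simp at this
    | cons j' l' =>
      obtain ⟨y, v, rfl⟩ := List.exists_cons_of_ne_nil hv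
      by_cases hj : j = i <;> by_cases hj' : j' = i
      · subst hj hj'
        rw [subst_cons_self, subst_cons_self] at h
        rw [ih (List.append_cancel_left h)]
      · subst hj
        rw [subst_cons_self, subst_cons_ne hj', List.map_cons, List.cons_append] at h
        exact absurd (List.cons.inj h).1.symm (outLab_ne_inLab hj' y)
      · subst hj'
        rw [subst_cons_self, subst_cons_ne hj, List.map_cons, List.cons_append] at h
        exact absurd (List.cons.inj h).1 (outLab_ne_inLab hj y)
      · rw [subst_cons_ne hj, subst_cons_ne hj'] at h
        obtain ⟨h1, h2⟩ := List.cons.inj h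
        rw [outLab_inj h1, ih h2]

theorem subst_isRotated (i : Fin (m + 1)) (v : List (Fin (n + 1))) {l l'} (h : l ~r l') :
    substWord i v l ~r substWord i v l' := by
  obtain ⟨r, hr, rfl⟩ := List.isRotated_iff_mod.1 h
  rw [List.rotate_eq_drop_append_take hr, subst_append]
  conv_lhs => rw [← List.take_append_drop r l, subst_append]
  exact List.isRotated_append

/-- Two bracketed subwords are compatible: one contains the other, or they are disjoint. -/
def Nested {α : Type*} (l l' : List α) : Prop := l <:+: l' ∨ l' <:+: l ∨ l.Disjoint l'

theorem Nested.symm {α : Type*} {l l' : List α} (h : Nested l l') : Nested l' l := by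
  rcases h with h | h | h
  exacts [Or.inr (Or.inl h), Or.inl h, Or.inr (Or.inr h.symm)]

theorem Nested.map {α β : Type*} {f : α → β} (hf : Function.Injective f) {l l' : List α}
    (h : Nested l l') : Nested (l.map f) (l'.map f) := by
  rcases h with h | h | h
  exacts [Or.inl (h.map f), Or.inr (Or.inl (h.map f)), Or.inr (Or.inr (List.disjoint_map hf h))]

theorem Nested.subst {i : Fin (m + 1)} {v : List (Fin (n + 1))} {l l'} (h : Nested l l') :
    Nested (substWord i v l) (substWord i v l') := by
  rcases h with h | h | h
  exacts [Or.inl (h.flatMap _), Or.inr (Or.inl (h.flatMap _)), Or.inr (Or.inr (subst_disjoint h))]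

theorem map_infix_subst {i : Fin (m + 1)} {v u : List (Fin (n + 1))} (hu : u <:+: v) {l}
    (hi : i ∈ l) : u.map (inLab n i) <:+: substWord i v l := by
  refine (hu.map _).trans ?_
  obtain ⟨s, t, rfl⟩ := List.append_of_mem hi
  rw [subst_append, subst_cons_self]
  exact ⟨_, _, List.append_assoc _ _ _⟩

theorem nested_subst_map {i : Fin (m + 1)} {v u : List (Fin (n + 1))} (hu : u <:+: v) (l) :
    Nested (substWord i v l) (u.map (inLab n i)) := by
  by_cases hi : i ∈ l
  · exact Or.inr (Or.inl (map_infix_subst hu hi))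
  · refine Or.inr (Or.inr fun x hx hx' => ?_)
    obtain ⟨y, -, rfl⟩ := List.mem_map.1 hx'
    exact hi (inLab_mem_subst.1 hx).1

theorem subst_ne_map {i : Fin (m + 1)} {v u : List (Fin (n + 1))} {l} (hl : l.Nodup)
    (h2 : 2 ≤ l.length) : substWord i v l ≠ u.map (inLab n i) := by
  intro h
  obtain ⟨j, hj, hne⟩ : ∃ j ∈ l, j ≠ i := by
    by_contra! hall
    have : l = List.replicate l.length i := List.eq_replicate_iff.2 ⟨rfl, hall⟩
    rw [this, List.nodup_replicate] at hl
    omega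
  have hm := (outLab_mem_subst (n := n) hne (v := v)).2 hj
  rw [h] at hm
  obtain ⟨y, -, hy⟩ := List.mem_map.1 hm
  exact outLab_ne_inLab hne y hy.symm

end Words


/-- A meaningful bracketing of `σ(1) ⋯ σ(n+1)` for an arbitrary permutation `σ`: the word
`σ(1) ⋯ σ(n+1)` and the finite set of the subwords that are enclosed by a pair of brackets.
The pair of brackets around everything, usually not written, is always included (if there are at
least two letters), so that bracketings are planar trees with labelled leaves, brackets being the
vertices.  These are the faces of the symmetrized associahedron `Σ_{n+1} × K_{n+1}`. -/
@[ext] structure LinBr (n : ℕ) where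
  word : List (Fin (n + 1))
  nodup : word.Nodup
  complete : ∀ x, x ∈ word
  br : Finset (List (Fin (n + 1)))
  br_infix : ∀ l ∈ br, l <:+: word
  two_le : ∀ l ∈ br, 2 ≤ l.length
  nested : ∀ l ∈ br, ∀ l' ∈ br, Nested l l'
  outer : 0 < n → word ∈ br

/-- A cyclic bracketing of `n+1` letters: a cyclic word `σ(1) ⋯ σ(n+1)` (`σ` an arbitrary
permutation) and the finite set of the bracketed subwords of its rotations.  A pair of brackets
around all the letters is allowed but not required; it remembers where the cyclic word is cut.
These are the faces of the symmetrized cyclohedron, `n!` copies of `W_{n+1}`. -/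
@[ext] structure CycBr (n : ℕ) where
  word : Cycle (Fin (n + 1))
  nodup : word.Nodup
  complete : ∀ x, x ∈ word
  br : Finset (List (Fin (n + 1)))
  br_infix : ∀ l ∈ br, ∃ w : List (Fin (n + 1)), (w : Cycle (Fin (n + 1))) = word ∧ l <:+: w
  two_le : ∀ l ∈ br, 2 ≤ l.length
  nested : ∀ l ∈ br, ∀ l' ∈ br, Nested l l'

section Bracketings

variable {m n : ℕ}

theorem LinBr.word_ne_nil (b : LinBr n) : b.word ≠ [] := List.ne_nil_of_mem (b.complete 0)

/-- The last letter of the word. -/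
def LinBr.last (b : LinBr n) : Fin (n + 1) := b.word.getLast b.word_ne_nil

theorem LinBr.br_nodup (b : LinBr n) {l} (hl : l ∈ b.br) : l.Nodup :=
  b.nodup.sublist (b.br_infix l hl).sublist

theorem CycBr.br_nodup (b : CycBr n) {l} (hl : l ∈ b.br) : l.Nodup := by
  obtain ⟨w, hw, hlw⟩ := b.br_infix l hl
  have := b.nodup
  rw [← hw] at this
  exact (Cycle.nodup_coe_iff.1 this).sublist hlw.sublist

instance : Finite (LinBr n) := by
  refine Finite.of_injective (β := {l : List (Fin (n + 1)) // l.Nodup} ×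
    Set {l : List (Fin (n + 1)) // l.Nodup}) (fun b => (⟨b.word, b.nodup⟩, {l | l.1 ∈ b.br})) ?_
  intro b b' h
  simp only [Prod.mk.injEq, Subtype.mk.injEq] at h
  refine LinBr.ext h.1 (Finset.ext fun l => ⟨fun hl => ?_, fun hl => ?_⟩)
  · have : (⟨l, b.br_nodup hl⟩ : {l : List (Fin (n + 1)) // l.Nodup}) ∈
      {l : {l : List (Fin (n + 1)) // l.Nodup} | l.1 ∈ b.br} := hl
    rw [h.2] at this
    exact this
  · have : (⟨l, b'.br_nodup hl⟩ : {l : List (Fin (n + 1)) // l.Nodup}) ∈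
      {l : {l : List (Fin (n + 1)) // l.Nodup} | l.1 ∈ b'.br} := hl
    rw [← h.2] at this
    exact this

instance : Finite (CycBr n) := by
  refine Finite.of_injective (β := {l : Cycle (Fin (n + 1)) // l.Nodup} ×
    Set {l : List (Fin (n + 1)) // l.Nodup}) (fun b => (⟨b.word, b.nodup⟩, {l | l.1 ∈ b.br})) ?_
  intro b b' h
  simp only [Prod.mk.injEq, Subtype.mk.injEq] at h
  refine CycBr.ext h.1 (Finset.ext fun l => ⟨fun hl => ?_, fun hl => ?_⟩)
  · have : (⟨l, b.br_nodup hl⟩ : {l : List (Fin (n + 1)) // l.Nodup}) ∈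
      {l : {l : List (Fin (n + 1)) // l.Nodup} | l.1 ∈ b.br} := hl
    rw [h.2] at this
    exact this
  · have : (⟨l, b'.br_nodup hl⟩ : {l : List (Fin (n + 1)) // l.Nodup}) ∈
      {l : {l : List (Fin (n + 1)) // l.Nodup} | l.1 ∈ b'.br} := hl
    rw [← h.2] at this
    exact this

/-- Brackets of the composite: those of the outer word, with the letter `i` replaced by the inner
word, and those of the inner word (the outermost pair included). -/
def brComp (i : Fin (m + 1)) (B : Finset (List (Fin (m + 1)))) (b' : LinBr n) :
    Finset (List (Fin (m + n + 1))) :=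
  B.image (substWord i b'.word) ∪ b'.br.image (List.map (inLab n i))

theorem brComp_nested (i : Fin (m + 1)) {B : Finset (List (Fin (m + 1)))}
    (hB : ∀ l ∈ B, ∀ l' ∈ B, Nested l l') (b' : LinBr n) :
    ∀ l ∈ brComp i B b', ∀ l' ∈ brComp i B b', Nested l l' := by
  intro l hl l' hl'
  simp only [brComp, Finset.mem_union, Finset.mem_image] at hl hl'
  rcases hl with ⟨u, hu, rfl⟩ | ⟨u, hu, rfl⟩ <;> rcases hl' with ⟨u', hu', rfl⟩ | ⟨u', hu', rfl⟩
  · exact (hB u hu u' hu').subst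
  · exact nested_subst_map (b'.br_infix _ hu') _
  · exact (nested_subst_map (b'.br_infix _ hu) _).symm
  · exact (b'.nested u hu u' hu').map fun _ _ => inLab_inj

theorem brComp_two_le (i : Fin (m + 1)) {B : Finset (List (Fin (m + 1)))}
    (hB : ∀ l ∈ B, 2 ≤ l.length) (b' : LinBr n) : ∀ l ∈ brComp i B b', 2 ≤ l.length := by
  intro l hl
  simp only [brComp, Finset.mem_union, Finset.mem_image] at hl
  rcases hl with ⟨u, hu, rfl⟩ | ⟨u, hu, rfl⟩
  · exact (hB u hu).trans (length_le_subst b'.word_ne_nil u)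
  · simpa using b'.two_le u hu

theorem brComp_card (i : Fin (m + 1)) {B : Finset (List (Fin (m + 1)))}
    (hB : ∀ l ∈ B, 2 ≤ l.length) (hB' : ∀ l ∈ B, l.Nodup) (b' : LinBr n) :
    (brComp i B b').card = B.card + b'.br.card := by
  rw [brComp, Finset.card_union_of_disjoint, Finset.card_image_of_injective,
    Finset.card_image_of_injective]
  · exact List.map_injective_iff.2 fun _ _ => inLab_inj
  · exact fun _ _ => subst_inj b'.word_ne_nil
  · rw [Finset.disjoint_left]
    intro l hl hl'
    obtain ⟨u, hu, rfl⟩ := Finset.mem_image.1 hl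
    obtain ⟨u', hu', h⟩ := Finset.mem_image.1 hl'
    exact subst_ne_map (hB' u hu) (hB u hu) h.symm

theorem subst_complete (i : Fin (m + 1)) {w : List (Fin (m + 1))} (hw : ∀ x, x ∈ w)
    (b' : LinBr n) (x) : x ∈ substWord i b'.word w := by
  rcases lab_cases (n := n) i x with ⟨j, hj, rfl⟩ | ⟨y, rfl⟩
  · exact (outLab_mem_subst hj).2 (hw j)
  · exact inLab_mem_subst.2 ⟨hw i, b'.complete y⟩

/-- Insert the bracketing `b'` (with its outermost brackets) at the letter `i` of `b`. -/
def LinBr.comp (i : Fin (m + 1)) (b : LinBr m) (b' : LinBr n) : LinBr (m + n) where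
  word := substWord i b'.word b.word
  nodup := subst_nodup b'.nodup b.nodup
  complete := subst_complete i b.complete b'
  br := brComp i b.br b'
  br_infix := by
    intro l hl
    simp only [brComp, Finset.mem_union, Finset.mem_image] at hl
    rcases hl with ⟨u, hu, rfl⟩ | ⟨u, hu, rfl⟩
    · exact (b.br_infix u hu).flatMap _
    · exact map_infix_subst (b'.br_infix u hu) (b.complete i)
  two_le := brComp_two_le i b.two_le b'
  nested := brComp_nested i b.nested b'
  outer := by
    intro h
    simp only [brComp, Finset.mem_union, Finset.mem_image]
    rcases Nat.eq_zero_or_pos m with rfl | hm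
    · right
      refine ⟨b'.word, b'.outer (by omega), ?_⟩
      obtain ⟨x, hx⟩ : ∃ x, b.word = [x] := by
        rw [← List.length_eq_one_iff]
        have h1 := b.nodup.length_le_card
        have h2 := List.length_pos_iff.2 b.word_ne_nil
        simp at h1
        omega
      obtain rfl : x = i := Fin.ext (by omega)
      rw [hx, subst_cons_self, subst_nil, List.append_nil]
    · exact Or.inl ⟨b.word, b.outer hm, rfl⟩

/-- Replace the letter `i` of a cyclic word by a word. -/
def substCycle (i : Fin (m + 1)) (v : List (Fin (n + 1))) :
    Cycle (Fin (m + 1)) → Cycle (Fin (m + n + 1)) :=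
  Quotient.map' (substWord i v) fun _ _ h => subst_isRotated i v h

@[simp] theorem substCycle_coe (i : Fin (m + 1)) (v : List (Fin (n + 1))) 
    (w : List (Fin (m + 1))) : substCycle i v (w : Cycle (Fin (m + 1))) =
      ((substWord i v w : List (Fin (m + n + 1))) : Cycle (Fin (m + n + 1))) := rfl

/-- Insert the bracketing `b'` (with its outermost brackets) at the letter `i` of `b`. -/
def CycBr.comp (i : Fin (m + 1)) (b : CycBr m) (b' : LinBr n) : CycBr (m + n) where
  word := substCycle i b'.word b.word
  nodup := by
    obtain ⟨w, hw⟩ := Quotient.exists_rep b.word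
    have := b.nodup
    rw [← hw] at this ⊢
    exact Cycle.nodup_coe_iff.2 (subst_nodup b'.nodup (Cycle.nodup_coe_iff.1 this))
  complete := by
    obtain ⟨w, hw⟩ := Quotient.exists_rep b.word
    have := b.complete
    rw [← hw] at this ⊢
    exact fun x => Cycle.mem_coe_iff.2
      (subst_complete i (fun x => Cycle.mem_coe_iff.1 (this x)) b' x)
  br := brComp i b.br b'
  br_infix := by
    intro l hl
    simp only [brComp, Finset.mem_union, Finset.mem_image] at hl
    rcases hl with ⟨u, hu, rfl⟩ | ⟨u, hu, rfl⟩
    · obtain ⟨w, hw, huw⟩ := b.br_infix u hu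
      exact ⟨substWord i b'.word w, by rw [← hw, substCycle_coe], huw.flatMap _⟩
    · obtain ⟨w, hw⟩ := Quotient.exists_rep b.word
      have := b.complete i
      rw [← hw] at this ⊢
      exact ⟨substWord i b'.word w, rfl,
        map_infix_subst (b'.br_infix u hu) (Cycle.mem_coe_iff.1 this)⟩
  two_le := brComp_two_le i b.two_le b'
  nested := brComp_nested i b.nested b'

/-- Rename the letters of all brackets by `σ⁻¹`. -/
def relabelBr (σ : Equiv.Perm (Fin (n + 1))) (B : Finset (List (Fin (n + 1)))) :
    Finset (List (Fin (n + 1))) := B.image (List.map ⇑(σ⁻¹))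

theorem relabelBr_nested (σ : Equiv.Perm (Fin (n + 1))) {B : Finset (List (Fin (n + 1)))}
    (hB : ∀ l ∈ B, ∀ l' ∈ B, Nested l l') :
    ∀ l ∈ relabelBr σ B, ∀ l' ∈ relabelBr σ B, Nested l l' := by
  intro l hl l' hl'
  obtain ⟨u, hu, rfl⟩ := Finset.mem_image.1 hl
  obtain ⟨u', hu', rfl⟩ := Finset.mem_image.1 hl'
  exact (hB u hu u' hu').map (Equiv.injective _)

theorem relabelBr_two_le (σ : Equiv.Perm (Fin (n + 1))) {B : Finset (List (Fin (n + 1)))}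
    (hB : ∀ l ∈ B, 2 ≤ l.length) : ∀ l ∈ relabelBr σ B, 2 ≤ l.length := by
  intro l hl
  obtain ⟨u, hu, rfl⟩ := Finset.mem_image.1 hl
  simpa using hB u hu

theorem relabelBr_card (σ : Equiv.Perm (Fin (n + 1))) (B : Finset (List (Fin (n + 1)))) :
    (relabelBr σ B).card = B.card :=
  Finset.card_image_of_injective _ (List.map_injective_iff.2 (Equiv.injective _))

/-- Right action of the symmetric group: the letter `j` becomes `σ⁻¹ j`. -/
def LinBr.relabel (b : LinBr n) (σ : Equiv.Perm (Fin (n + 1))) : LinBr n where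
  word := b.word.map ⇑(σ⁻¹)
  nodup := b.nodup.map (Equiv.injective _)
  complete x := List.mem_map.2 ⟨σ x, b.complete _, by simp⟩
  br := relabelBr σ b.br
  br_infix := by
    intro l hl
    obtain ⟨u, hu, rfl⟩ := Finset.mem_image.1 hl
    exact (b.br_infix u hu).map _
  two_le := relabelBr_two_le σ b.two_le
  nested := relabelBr_nested σ b.nested
  outer h := Finset.mem_image_of_mem _ (b.outer h)

/-- Right action of the symmetric group: the letter `j` becomes `σ⁻¹ j`. -/
def CycBr.relabel (b : CycBr n) (σ : Equiv.Perm (Fin (n + 1))) : CycBr n where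
  word := b.word.map ⇑(σ⁻¹)
  nodup := by
    obtain ⟨w, hw⟩ := Quotient.exists_rep b.word
    have := b.nodup
    rw [← hw] at this ⊢
    exact Cycle.nodup_coe_iff.2 ((Cycle.nodup_coe_iff.1 this).map (Equiv.injective _))
  complete x := Cycle.mem_map.2 ⟨σ x, b.complete _, by simp⟩
  br := relabelBr σ b.br
  br_infix := by
    intro l hl
    obtain ⟨u, hu, rfl⟩ := Finset.mem_image.1 hl
    obtain ⟨w, hw, huw⟩ := b.br_infix u hu
    exact ⟨w.map ⇑(σ⁻¹), by rw [← hw, Cycle.map_coe], huw.map _⟩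
  two_le := relabelBr_two_le σ b.two_le
  nested := relabelBr_nested σ b.nested

/-- The top face of `K_{n+1}`: the word `1 2 ⋯ n+1` without inner brackets. -/
def LinBr.top (n : ℕ) : LinBr n where
  word := List.finRange (n + 1)
  nodup := List.nodup_finRange _
  complete := List.mem_finRange
  br := if 0 < n then {List.finRange (n + 1)} else ∅
  br_infix := by
    intro l hl
    split at hl <;> simp at hl
    rw [hl]
  two_le := by
    intro l hl
    split at hl <;> simp at hl
    rw [hl, List.length_finRange]; omega
  nested := by
    intro l hl l' hl'
    split at hl <;> simp_all
    exact Or.inl List.infix_rfl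
  outer h := by simp [h]

/-- The top face of `W_{n+1}`: the cyclic word `1 2 ⋯ n+1` without brackets. -/
def CycBr.top (n : ℕ) : CycBr n where
  word := (List.finRange (n + 1) : List (Fin (n + 1)))
  nodup := Cycle.nodup_coe_iff.2 (List.nodup_finRange _)
  complete x := Cycle.mem_coe_iff.2 (List.mem_finRange x)
  br := ∅
  br_infix := by simp
  two_le := by simp
  nested := by simp

end Bracketings

section Chains

variable {k : Type u} [Field k] {m n : ℕ}

/-! ### Cellular chains of a polytope given by bracketings

In the convex realization of the associahedron and of the cyclohedron there is one coordinate
`t_x` for each gap between consecutive letters; it is indexed here by the letter `x` to the left of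
the gap.  A bracket `l = x₁ ⋯ x_r` has the gaps `x₁, …, x_{r-1}`, and corresponds to the facet on
which the inequality `t_{x₁} + ⋯ + t_{x_{r-1}} ≥ c` is an equality. -/

/-- The functional `t ↦ ∑_{x ∈ l} t_x`. -/
def sumOver (k : Type u) [Field k] (l : List (Fin (n + 1))) : Module.Dual k (Fin (n + 1) → k) :=
  (l.map fun x => LinearMap.proj x).sum

/-- Sum of the coordinates over the gaps inside the bracket `l`. -/
def gapSum (k : Type u) [Field k] (l : List (Fin (n + 1))) : Module.Dual k (Fin (n + 1) → k) :=
  sumOver k l.dropLast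

/-- The faces of a disjoint union of polytopes in the gap coordinates.  A face `b` lies on the facets
of the brackets in `br b`; `hull b` is the direction space of the affine hull of the component
that contains `b`; `le b' b` says that `b'` is a face of `b`. -/
structure FacePoset (k : Type u) [Field k] (n : ℕ) where
  Cell : Type
  fin : Fintype Cell
  br : Cell → Finset (List (Fin (n + 1)))
  hull : Cell → Submodule k (Fin (n + 1) → k)
  le : Cell → Cell → Prop
  br_subset : ∀ {b' b}, le b' b → br b ⊆ br b'
  hull_eq : ∀ {b' b}, le b' b → hull b' = hull b

attribute [instance] FacePoset.fin

namespace FacePoset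

variable (X : FacePoset k n)

/-- Direction space of the face `b` (with coefficients in `k`). -/
def dir (b : X.Cell) : Submodule k (Fin (n + 1) → k) :=
  X.hull b ⊓ ⨅ l ∈ X.br b, LinearMap.ker (gapSum k l)

theorem mem_dir {b : X.Cell} {t} :
    t ∈ X.dir b ↔ t ∈ X.hull b ∧ ∀ l ∈ X.br b, gapSum k l t = 0 := by
  simp [dir]

/-- Cellular `d`-chains: `⨁_b Λ^d (dir b)`, the sum over the faces `b` of dimension `d`, which are
those with `n - d` brackets.  Here `Λ^d (dir b)`, the top exterior power of the direction space of
`b`, is the orientation line of `b`; it is realized inside the exterior algebra of `k^{n+1}`.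
All faces together with their orientations are thus treated at once, without choices. -/
def chains (d : ℕ) : Submodule k (X.Cell →₀ ExteriorAlgebra k (Fin (n + 1) → k)) where
  carrier := {c | ∀ b, c b ∈ ((X.dir b).map (ExteriorAlgebra.ι k)) ^ d ∧
    (c b ≠ 0 → (X.br b).card + d = n)}
  add_mem' {c c'} hc hc' b := by
    refine ⟨Submodule.add_mem _ (hc b).1 (hc' b).1, fun h => ?_⟩
    by_cases h0 : c b = 0
    · refine (hc' b).2 fun h1 => h ?_
      rw [Finsupp.add_apply, h0, h1, add_zero]
    · exact (hc b).2 h0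
  zero_mem' b := by simp
  smul_mem' r c hc b := by
    refine ⟨Submodule.smul_mem _ r (hc b).1, fun h => (hc b).2 fun h0 => h ?_⟩
    rw [Finsupp.smul_apply, h0, smul_zero]

theorem single_mem_chains {d : ℕ} {b : X.Cell} {ω} (hω : ω ∈ ((X.dir b).map (ExteriorAlgebra.ι k)) ^ d)
    (hd : (X.br b).card + d = n) : Finsupp.single b ω ∈ X.chains d := by
  intro b'
  by_cases h : b = b'
  · subst h
    simpa using ⟨hω, fun _ => hd⟩
  · simp [Finsupp.single_eq_of_ne' h]

/-- `b'` is a codimension one face of `b`. -/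
def IsFacet (b' b : X.Cell) : Prop := X.le b' b ∧ (X.br b').card = (X.br b).card + 1

/-- The outward conormal of the facet `b'` of `b` : minus the gap sum of the new bracket. -/
def outward (b' b : X.Cell) : Module.Dual k (Fin (n + 1) → k) :=
  -∑ l ∈ X.br b' \ X.br b, gapSum k l

/-- The cellular boundary: on each facet, contraction of the orientation with the outward conormal
(the outward normal comes first). -/
def boundaryAux : (X.Cell →₀ ExteriorAlgebra k (Fin (n + 1) → k)) →ₗ[k]
    (X.Cell →₀ ExteriorAlgebra k (Fin (n + 1) → k)) :=
  Finsupp.lsum k fun b => ∑ b' with X.IsFacet b' b,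
    Finsupp.lsingle b' ∘ₗ CliffordAlgebra.contractLeft (X.outward b' b)

end FacePoset

section Contract

variable {V : Type u} [AddCommGroup V] [Module k V]

theorem contractLeft_eq_zero (φ : Module.Dual k V) {S : Submodule k V} (hS : ∀ v ∈ S, φ v = 0)
    (d : ℕ) (ω : ExteriorAlgebra k V) (hω : ω ∈ (S.map (ExteriorAlgebra.ι k)) ^ d) :
    CliffordAlgebra.contractLeft φ ω = 0 := by
  induction d generalizing ω with
  | zero =>
    rw [pow_zero, Submodule.mem_one] at hω
    obtain ⟨r, rfl⟩ := hω
    exact CliffordAlgebra.contractLeft_algebraMap _ _ _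
  | succ d ih =>
    rw [pow_succ'] at hω
    induction hω using Submodule.mul_induction_on' with
    | mem_mul_mem a ha b hb =>
      obtain ⟨v, hv, rfl⟩ := ha
      rw [CliffordAlgebra.contractLeft_ι_mul, hS v hv, ih b hb, zero_smul, mul_zero, sub_zero]
    | add a _ b _ ha hb => rw [map_add, ha, hb, add_zero]

theorem contractLeft_mem (φ : Module.Dual k V) (S : Submodule k V) (d : ℕ)
    (ω : ExteriorAlgebra k V) (hω : ω ∈ (S.map (ExteriorAlgebra.ι k)) ^ (d + 1)) :
    CliffordAlgebra.contractLeft φ ω ∈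
      ((S ⊓ LinearMap.ker φ).map (ExteriorAlgebra.ι k)) ^ d := by
  by_cases hφ : ∀ v ∈ S, φ v = 0
  · rw [contractLeft_eq_zero φ hφ _ ω hω]
    exact Submodule.zero_mem _
  push Not at hφ
  obtain ⟨u₀, hu₀, hne⟩ := hφ
  obtain ⟨u, hu, hu1⟩ : ∃ u ∈ S, φ u = 1 :=
    ⟨(φ u₀)⁻¹ • u₀, S.smul_mem _ hu₀, by simp [hne]⟩
  set K := (S ⊓ LinearMap.ker φ).map (ExteriorAlgebra.ι k) with hK
  have split : ∀ v ∈ S, ExteriorAlgebra.ι k (v - φ v • u) ∈ K := fun v hv =>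
    Submodule.mem_map_of_mem ⟨S.sub_mem hv (S.smul_mem _ hu), by simp [hu1]⟩
  have key : ∀ (d : ℕ) (ω : ExteriorAlgebra k V),
      ω ∈ (S.map (ExteriorAlgebra.ι k)) ^ (d + 1) →
      ∃ α ∈ K ^ (d + 1), ∃ β ∈ K ^ d, ω = α + ExteriorAlgebra.ι k u * β := by
    intro d
    induction d with
    | zero =>
      intro ω hω
      rw [zero_add, pow_one] at hω
      obtain ⟨v, hv, rfl⟩ := hω
      refine ⟨_, by rw [zero_add, pow_one]; exact split v hv, algebraMap k _ (φ v), ?_, ?_⟩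
      · rw [pow_zero]; exact Submodule.algebraMap_mem _
      · rw [← Algebra.commutes, ← Algebra.smul_def, map_sub, map_smul, sub_add_cancel]
    | succ d ih =>
      intro ω hω
      rw [pow_succ'] at hω
      induction hω using Submodule.mul_induction_on' with
      | mem_mul_mem a ha b hb =>
        obtain ⟨v, hv, rfl⟩ := ha
        obtain ⟨α, hα, β, hβ, rfl⟩ := ih b hb
        set w := ExteriorAlgebra.ι k (v - φ v • u) with hw
        have hv' : ExteriorAlgebra.ι k v = w + φ v • ExteriorAlgebra.ι k u := by
          rw [hw, map_sub, map_smul, sub_add_cancel]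
        have hwu : w * ExteriorAlgebra.ι k u = -(ExteriorAlgebra.ι k u * w) :=
          eq_neg_of_add_eq_zero_left (ExteriorAlgebra.ι_add_mul_swap _ _)
        have huu : ExteriorAlgebra.ι k u * ExteriorAlgebra.ι k u = 0 :=
          ExteriorAlgebra.ι_sq_zero u
        refine ⟨w * α, ?_, φ v • α - w * β, ?_, ?_⟩
        · rw [pow_succ' K (d + 1)]; exact Submodule.mul_mem_mul (split v hv) hα
        · refine Submodule.sub_mem _ (Submodule.smul_mem _ _ hα) ?_
          rw [pow_succ']; exact Submodule.mul_mem_mul (split v hv) hβ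
        · rw [hv', add_mul, mul_add, smul_mul_assoc, mul_add, ← mul_assoc w, hwu,
            ← mul_assoc (ExteriorAlgebra.ι k u) (ExteriorAlgebra.ι k u), huu, zero_mul, add_zero,
            mul_sub, mul_smul_comm, neg_mul, mul_assoc (ExteriorAlgebra.ι k u)]
          abel
      | add a _ b _ ha hb =>
        obtain ⟨α, hα, β, hβ, rfl⟩ := ha
        obtain ⟨α', hα', β', hβ', rfl⟩ := hb
        exact ⟨α + α', Submodule.add_mem _ hα hα', β + β', Submodule.add_mem _ hβ hβ', by
          rw [mul_add]; abel⟩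
  obtain ⟨α, hα, β, hβ, rfl⟩ := key d ω hω
  have hK0 : ∀ v ∈ S ⊓ LinearMap.ker φ, φ v = 0 := fun v hv => hv.2
  rw [map_add, CliffordAlgebra.contractLeft_ι_mul, contractLeft_eq_zero φ hK0 _ α hα,
    contractLeft_eq_zero φ hK0 _ β hβ, hu1, one_smul, mul_zero, sub_zero, zero_add]
  exact hβ

end Contract

theorem pow_map_mono {V : Type u} [AddCommGroup V] [Module k V] {S T : Submodule k V}
    (h : S ≤ T) (d : ℕ) :
    (S.map (ExteriorAlgebra.ι k)) ^ d ≤ (T.map (ExteriorAlgebra.ι k)) ^ d :=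
  pow_le_pow_left' (Submodule.map_mono h) d

theorem map_mem_pow {V V' : Type u} [AddCommGroup V] [Module k V] [AddCommGroup V'] [Module k V']
    (f : V →ₗ[k] V') {S : Submodule k V} {T : Submodule k V'} (h : ∀ v ∈ S, f v ∈ T) {d : ℕ} {ω}
    (hω : ω ∈ (S.map (ExteriorAlgebra.ι k)) ^ d) :
    ExteriorAlgebra.map f ω ∈ (T.map (ExteriorAlgebra.ι k)) ^ d := by
  have h1 := Submodule.mem_map_of_mem (f := (ExteriorAlgebra.map f).toLinearMap) hω
  rw [Submodule.map_pow, ← Submodule.map_comp, ExteriorAlgebra.map_comp_ι,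
    Submodule.map_comp] at h1
  exact pow_map_mono (Submodule.map_le_iff_le_comap.2 h) d h1

namespace FacePoset

variable (X : FacePoset k n)

theorem dir_facet_le {b' b : X.Cell} (h : X.IsFacet b' b) :
    X.dir b ⊓ LinearMap.ker (X.outward b' b) ≤ X.dir b' := by
  intro t ht
  obtain ⟨h1, h2⟩ := h
  have hs := X.br_subset h1
  have hc : (X.br b' \ X.br b).card = 1 := by
    rw [Finset.card_sdiff_of_subset hs]; omega
  obtain ⟨l₀, hl₀⟩ := Finset.card_eq_one.1 hc
  obtain ⟨ht1, ht2⟩ := X.mem_dir.1 ht.1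
  have ht3 := ht.2
  rw [SetLike.mem_coe, LinearMap.mem_ker, outward, hl₀, Finset.sum_singleton, LinearMap.neg_apply,
    neg_eq_zero] at ht3
  refine X.mem_dir.2 ⟨by rwa [X.hull_eq h1], fun l hl => ?_⟩
  by_cases hlb : l ∈ X.br b
  · exact ht2 l hlb
  · have : l ∈ X.br b' \ X.br b := Finset.mem_sdiff.2 ⟨hl, hlb⟩
    rw [hl₀, Finset.mem_singleton] at this
    rwa [this]

theorem boundaryAux_mem {d : ℕ} {c} (hc : c ∈ X.chains (d + 1)) :
    X.boundaryAux c ∈ X.chains d := by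
  rw [boundaryAux, Finsupp.lsum_apply]
  refine Submodule.sum_mem _ fun b hb => ?_
  beta_reduce
  rw [LinearMap.sum_apply]
  refine Submodule.sum_mem _ fun b' hb' => ?_
  have hf := (Finset.mem_filter.1 hb').2
  refine X.single_mem_chains (pow_map_mono (X.dir_facet_le hf) d
    (contractLeft_mem _ _ _ _ (hc b).1)) ?_
  have := (hc b).2 (Finsupp.mem_support_iff.1 hb)
  have := hf.2
  omega

/-- The cellular boundary. -/
def boundary (d : ℕ) : X.chains (d + 1) →ₗ[k] X.chains d :=
  X.boundaryAux.restrict fun _ => X.boundaryAux_mem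

end FacePoset

end Chains

section Geometry

variable (k : Type u) [Field k] {m n : ℕ}

/-- The symmetrized associahedron `Σ_{n+1} × K_{n+1}`.  The coordinate of the last letter, which has
no gap to its right, is `0`; the sum of the others is constant. -/
abbrev associahedron (n : ℕ) : FacePoset k n where
  Cell := LinBr n
  fin := Fintype.ofFinite _
  br := LinBr.br
  hull b := LinearMap.ker (LinearMap.proj b.last : (Fin (n + 1) → k) →ₗ[k] k)
  le b' b := b'.word = b.word ∧ b.br ⊆ b'.br
  br_subset h := h.2
  hull_eq {b' b} h := by
    have : b'.last = b.last := by simp only [LinBr.last, h.1]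
    rw [this]

/-- The symmetrized cyclohedron, `n!` copies of `W_{n+1}`, in the hyperplane in `k^{n+1}` on which
the sum of the coordinates is constant. -/
abbrev cyclohedron (n : ℕ) : FacePoset k n where
  Cell := CycBr n
  fin := Fintype.ofFinite _
  br := CycBr.br
  hull _ := LinearMap.ker (∑ x, LinearMap.proj x : (Fin (n + 1) → k) →ₗ[k] k)
  le b' b := b'.word = b.word ∧ b.br ⊆ b'.br
  br_subset h := h.2
  hull_eq _ := rfl

variable {k}

/-- The linear map with `e_j ↦ e_{g j}`. -/
def push {a b : ℕ} (g : Fin a → Fin b) : (Fin a → k) →ₗ[k] (Fin b → k) :=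
  LinearMap.pi fun x => ∑ j with g j = x, LinearMap.proj j

theorem push_apply {a b : ℕ} (g : Fin a → Fin b) (t : Fin a → k) (x : Fin b) :
    push g t x = ∑ j with g j = x, t j := by
  simp [push]

theorem push_apply_self {a b : ℕ} {g : Fin a → Fin b} (hg : Function.Injective g)
    (t : Fin a → k) (j : Fin a) : push g t (g j) = t j := by
  rw [push_apply, Finset.sum_eq_single j]
  · intro j' h h'; exact absurd (hg (Finset.mem_filter.1 h).2) h'
  · simp

theorem push_apply_zero {a b : ℕ} {g : Fin a → Fin b} (t : Fin a → k) {x : Fin b}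
    (hx : ∀ j, g j ≠ x) : push g t x = 0 := by
  rw [push_apply]
  exact Finset.sum_eq_zero fun j hj => absurd (Finset.mem_filter.1 hj).2 (hx j)

theorem sum_push {a b : ℕ} (g : Fin a → Fin b) (t : Fin a → k) :
    ∑ x, push g t x = ∑ j, t j := by
  simp only [push_apply]
  exact Finset.sum_fiberwise _ _ _

/-- Where the gap after the letter `j` goes when `b'` is inserted at `i`: the gap after `i` becomes
the gap after the last letter of `b'`. -/
def LinBr.outGap (b' : LinBr n) (i j : Fin (m + 1)) : Fin (m + n + 1) :=
  if j = i then inLab n i b'.last else outLab n i j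

theorem LinBr.outGap_inj (b' : LinBr n) (i : Fin (m + 1)) : Function.Injective (b'.outGap i) := by
  intro j j' h
  simp only [outGap] at h
  split at h <;> split at h
  · simp_all
  · rename_i h2; exact absurd h.symm (outLab_ne_inLab h2 _)
  · rename_i h2 _; exact absurd h (outLab_ne_inLab h2 _)
  · exact outLab_inj h

@[simp] theorem sumOver_nil (t : Fin (n + 1) → k) : sumOver k [] t = 0 := by simp [sumOver]

@[simp] theorem sumOver_cons (x) (l) (t : Fin (n + 1) → k) :
    sumOver k (x :: l) t = t x + sumOver k l t := by simp [sumOver]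

theorem sumOver_append (l l') (t : Fin (n + 1) → k) :
    sumOver k (l ++ l') t = sumOver k l t + sumOver k l' t := by simp [sumOver]

theorem sumOver_eq_zero {l} {t : Fin (n + 1) → k} (h : ∀ x ∈ l, t x = 0) : sumOver k l t = 0 := by
  induction l with
  | nil => simp
  | cons x l ih => simp_all

theorem sumOver_map {a b : ℕ} {g : Fin (a + 1) → Fin (b + 1)} (hg : Function.Injective g)
    (l) (t : Fin (a + 1) → k) : sumOver k (l.map g) (push g t) = sumOver k l t := by
  induction l with
  | nil => simp
  | cons x l ih => simp [push_apply_self hg, ih]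

theorem gapSum_map {a b : ℕ} {g : Fin (a + 1) → Fin (b + 1)} (hg : Function.Injective g)
    (l) (t : Fin (a + 1) → k) : gapSum k (l.map g) (push g t) = gapSum k l t := by
  rw [gapSum, ← List.map_dropLast, sumOver_map hg, gapSum]

theorem inLab_injective (i : Fin (m + 1)) : Function.Injective (inLab n i) := fun _ _ => inLab_inj

theorem LinBr.word_eq (b : LinBr n) : b.word = b.word.dropLast ++ [b.last] :=
  (List.dropLast_append_getLast b.word_ne_nil).symm

theorem last_notMem_dropLast {α : Type*} {l : List α} {x : α} (h : (l ++ [x]).Nodup) : x ∉ l := by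
  intro hx
  exact (List.nodup_append.1 h).2.2 x hx x (by simp) rfl

theorem LinBr.last_notMem (b : LinBr n) : b.last ∉ b.word.dropLast := by
  have := b.nodup
  rw [b.word_eq] at this
  exact last_notMem_dropLast this

theorem LinBr.last_notMem_br (b : LinBr n) {u} (hu : u ∈ b.br) : b.last ∉ u.dropLast := by
  obtain ⟨s, t, hst⟩ := b.br_infix u hu
  have hne : u ≠ [] := by
    rintro rfl
    simpa using b.two_le _ hu
  have hu' := (List.dropLast_append_getLast hne).symm
  intro hmem
  have hnd := b.nodup
  have hd : b.word.dropLast = s ++ (u.dropLast ++ ([u.getLast hne] ++ t).dropLast) := by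
    rw [← hst]
    conv_lhs => rw [hu']
    rw [List.append_assoc, List.append_assoc, List.dropLast_append_of_ne_nil (by simp),
      List.dropLast_append_of_ne_nil (by simp)]
  exact b.last_notMem (by rw [hd]; simp [hmem])

theorem LinBr.push_out_in (b' : LinBr n) (i : Fin (m + 1)) (t : Fin (m + 1) → k) {y}
    (hy : y ≠ b'.last) : push (b'.outGap i) t (inLab n i y) = 0 := by
  refine push_apply_zero t fun j h => ?_
  simp only [outGap] at h
  split at h
  · exact hy (inLab_inj h).symm
  · rename_i hj; exact outLab_ne_inLab hj _ h

theorem LinBr.sumOver_in_out (b' : LinBr n) (i : Fin (m + 1)) (t : Fin (m + 1) → k)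
    {u : List (Fin (n + 1))}    (hu : b'.last ∉ u) : sumOver k (u.map (inLab n i)) (push (b'.outGap i) t) = 0 := by
  refine sumOver_eq_zero fun x hx => ?_
  obtain ⟨y, hy, rfl⟩ := List.mem_map.1 hx
  exact b'.push_out_in i t fun h => hu (h ▸ hy)

theorem LinBr.sumOver_word_out (b' : LinBr n) (i : Fin (m + 1)) (t : Fin (m + 1) → k) :
    sumOver k (b'.word.map (inLab n i)) (push (b'.outGap i) t) = t i := by
  rw [b'.word_eq, List.map_append, sumOver_append, b'.sumOver_in_out i t b'.last_notMem]
  have : inLab n i b'.last = b'.outGap i i := by simp [outGap]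
  simp [this, push_apply_self (b'.outGap_inj i)]

theorem LinBr.sumOver_subst_out (b' : LinBr n) (i : Fin (m + 1)) (t : Fin (m + 1) → k) (l) :
    sumOver k (substWord i b'.word l) (push (b'.outGap i) t) = sumOver k l t := by
  induction l with
  | nil => simp
  | cons j l ih =>
    by_cases hj : j = i
    · subst hj
      rw [subst_cons_self, sumOver_append, b'.sumOver_word_out, ih, sumOver_cons]
    · have : outLab n i j = b'.outGap i j := by simp [outGap, hj]
      rw [subst_cons_ne hj, sumOver_cons, this, push_apply_self (b'.outGap_inj i), ih, sumOver_cons]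

theorem push_in_out {i j : Fin (m + 1)} (hj : j ≠ i) (s : Fin (n + 1) → k) :
    push (inLab n i) s (outLab n i j) = 0 :=
  push_apply_zero s fun y h => outLab_ne_inLab hj y h.symm

theorem LinBr.sumOver_subst_in (b' : LinBr n) (i : Fin (m + 1)) {s : Fin (n + 1) → k}
    (hs : sumOver k b'.word s = 0) (l) :
    sumOver k (substWord i b'.word l) (push (inLab n i) s) = 0 := by
  induction l with
  | nil => simp
  | cons j l ih =>
    by_cases hj : j = i
    · subst hj
      rw [subst_cons_self, sumOver_append, sumOver_map (inLab_injective _), ih, hs, add_zero]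
    · rw [subst_cons_ne hj, sumOver_cons, push_in_out hj, ih, add_zero]

theorem LinBr.dropLast_subst (b' : LinBr n) (i : Fin (m + 1)) (l z) :
    (substWord i b'.word (l ++ [z])).dropLast = substWord i b'.word l ++
      if z = i then b'.word.dropLast.map (inLab n i) else [] := by
  rw [subst_append]
  split
  · subst z
    rw [subst_cons_self, subst_nil, List.append_nil, List.dropLast_append_of_ne_nil
      (by simpa using b'.word_ne_nil), List.map_dropLast]
  · rename_i hz
    rw [subst_cons_ne hz, subst_nil, List.dropLast_append_of_ne_nil (by simp)]
    rfl

theorem LinBr.gapSum_subst_out (b' : LinBr n) (i : Fin (m + 1)) (t : Fin (m + 1) → k) (l) :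
    gapSum k (substWord i b'.word l) (push (b'.outGap i) t) = gapSum k l t := by
  rcases List.eq_nil_or_concat l with rfl | ⟨l, z, rfl⟩
  · simp [gapSum]
  · rw [List.concat_eq_append, gapSum, b'.dropLast_subst, sumOver_append, b'.sumOver_subst_out,
      gapSum, List.dropLast_concat]
    split
    · rw [b'.sumOver_in_out i t b'.last_notMem, add_zero]
    · simp

theorem LinBr.mem_dir (b' : LinBr n) {s : Fin (n + 1) → k} (hs : s ∈ (associahedron k n).dir b') :
    s b'.last = 0 ∧ sumOver k b'.word.dropLast s = 0 ∧ sumOver k b'.word s = 0 ∧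
      ∀ l ∈ b'.br, gapSum k l s = 0 := by
  obtain ⟨h1, h2⟩ := (FacePoset.mem_dir _).1 hs
  have h1 : s b'.last = 0 := h1
  have h3 : sumOver k b'.word.dropLast s = 0 := by
    rcases Nat.eq_zero_or_pos n with rfl | hn
    · have hl := b'.nodup.length_le_card
      simp only [Fintype.card_fin] at hl
      have : b'.word.dropLast = [] := List.length_eq_zero_iff.1 (by
        rw [List.length_dropLast]; omega)
      rw [this, sumOver_nil]
    · exact h2 _ (b'.outer hn)
  refine ⟨h1, h3, ?_, h2⟩
  rw [b'.word_eq, sumOver_append, h3]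
  simp [h1]

theorem LinBr.gapSum_subst_in (b' : LinBr n) (i : Fin (m + 1)) {s : Fin (n + 1) → k}
    (hs : s ∈ (associahedron k n).dir b') (l) :
    gapSum k (substWord i b'.word l) (push (inLab n i) s) = 0 := by
  obtain ⟨-, h2, h3, -⟩ := b'.mem_dir hs
  rcases List.eq_nil_or_concat l with rfl | ⟨l, z, rfl⟩
  · simp [gapSum]
  · rw [List.concat_eq_append, gapSum, b'.dropLast_subst, sumOver_append,
      b'.sumOver_subst_in i h3, zero_add]
    split
    · rw [sumOver_map (inLab_injective _), h2]
    · simp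

theorem LinBr.gapSum_comp_out (b' : LinBr n) (i : Fin (m + 1)) {B} {t : Fin (m + 1) → k}
    (ht : ∀ l ∈ B, gapSum k l t = 0) :
    ∀ l ∈ brComp i B b', gapSum k l (push (b'.outGap i) t) = 0 := by
  intro l hl
  simp only [brComp, Finset.mem_union, Finset.mem_image] at hl
  rcases hl with ⟨u, hu, rfl⟩ | ⟨u, hu, rfl⟩
  · rw [b'.gapSum_subst_out, ht u hu]
  · rw [gapSum, ← List.map_dropLast, b'.sumOver_in_out i t (b'.last_notMem_br hu)]

theorem LinBr.gapSum_comp_in (b' : LinBr n) (i : Fin (m + 1)) {B} {s : Fin (n + 1) → k}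
    (hs : s ∈ (associahedron k n).dir b') :
    ∀ l ∈ brComp i B b', gapSum k l (push (inLab n i) s) = 0 := by
  intro l hl
  simp only [brComp, Finset.mem_union, Finset.mem_image] at hl
  rcases hl with ⟨u, hu, rfl⟩ | ⟨u, hu, rfl⟩
  · exact b'.gapSum_subst_in i hs u
  · rw [gapSum_map (inLab_injective i), (b'.mem_dir hs).2.2.2 u hu]

theorem LinBr.last_comp (i : Fin (m + 1)) (b : LinBr m) (b' : LinBr n) :
    (b.comp i b').last = b'.outGap i b.last := by
  have h : (b.comp i b').word = substWord i b'.word b.word := rfl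
  have h2 : (b.comp i b').word.getLast? = some (b'.outGap i b.last) := by
    rw [h, b.word_eq, subst_append, outGap]
    split
    · rename_i hi
      rw [hi, subst_cons_self, subst_nil, List.append_nil, b'.word_eq]
      simp
    · rename_i hi
      rw [subst_cons_ne hi]
      simp
  rw [List.getLast?_eq_getLast_of_ne_nil (b.comp i b').word_ne_nil, Option.some_inj] at h2
  exact h2

theorem LinBr.push_out_dir (i : Fin (m + 1)) (b : LinBr m) (b' : LinBr n) :
    ∀ t ∈ (associahedron k m).dir b,
      push (b'.outGap i) t ∈ (associahedron k (m + n)).dir (b.comp i b') := by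
  intro t ht
  refine (FacePoset.mem_dir _).2 ⟨?_, b'.gapSum_comp_out i (b.mem_dir ht).2.2.2⟩
  change push (b'.outGap i) t (b.comp i b').last = 0
  rw [last_comp, push_apply_self (b'.outGap_inj i), (b.mem_dir ht).1]

theorem LinBr.push_in_dir (i : Fin (m + 1)) (b : LinBr m) (b' : LinBr n) :
    ∀ s ∈ (associahedron k n).dir b',
      push (inLab n i) s ∈ (associahedron k (m + n)).dir (b.comp i b') := by
  intro s hs
  refine (FacePoset.mem_dir _).2 ⟨?_, b'.gapSum_comp_in i hs⟩
  change push (inLab n i) s (b.comp i b').last = 0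
  rw [last_comp, outGap]
  split
  · rw [push_apply_self (inLab_injective i), (b'.mem_dir hs).1]
  · rename_i hi; exact push_in_out hi s

theorem CycBr.mem_dir (b : CycBr n) {t : Fin (n + 1) → k} :
    t ∈ (cyclohedron k n).dir b ↔ ∑ x, t x = 0 ∧ ∀ l ∈ b.br, gapSum k l t = 0 := by
  refine (FacePoset.mem_dir _).trans (and_congr ?_ Iff.rfl)
  change (∑ x, LinearMap.proj x : (Fin (n + 1) → k) →ₗ[k] k) t = 0 ↔ _
  simp

theorem sumOver_word (w : List (Fin (n + 1))) (hw : w.Nodup) (hc : ∀ x, x ∈ w)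
    (s : Fin (n + 1) → k) : sumOver k w s = ∑ x, s x := by
  have h : w.toFinset = Finset.univ := Finset.eq_univ_of_forall fun x => List.mem_toFinset.2 (hc x)
  rw [← h, List.sum_toFinset _ hw, sumOver]
  clear h hc hw
  induction w with
  | nil => simp
  | cons x w ih => simp [ih]

theorem CycBr.push_out_dir (i : Fin (m + 1)) (b : CycBr m) (b' : LinBr n) :
    ∀ t ∈ (cyclohedron k m).dir b,
      push (b'.outGap i) t ∈ (cyclohedron k (m + n)).dir (b.comp i b') := by
  intro t ht
  obtain ⟨h1, h2⟩ := b.mem_dir.1 ht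
  exact (CycBr.mem_dir _).2 ⟨by rw [sum_push, h1], b'.gapSum_comp_out i h2⟩

theorem CycBr.push_in_dir (i : Fin (m + 1)) (b : CycBr m) (b' : LinBr n) :
    ∀ s ∈ (associahedron k n).dir b',
      push (inLab n i) s ∈ (cyclohedron k (m + n)).dir (b.comp i b') := by
  intro s hs
  refine (CycBr.mem_dir _).2 ⟨?_, b'.gapSum_comp_in i hs⟩
  rw [sum_push, ← sumOver_word b'.word b'.nodup b'.complete, (b'.mem_dir hs).2.2.1]

theorem gapSum_relabel (σ : Equiv.Perm (Fin (n + 1))) {B} {t : Fin (n + 1) → k}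
    (ht : ∀ l ∈ B, gapSum k l t = 0) :
    ∀ l ∈ relabelBr σ B, gapSum k l (push ⇑(σ⁻¹) t) = 0 := by
  intro l hl
  obtain ⟨u, hu, rfl⟩ := Finset.mem_image.1 hl
  rw [gapSum_map (Equiv.injective _), ht u hu]

theorem LinBr.push_relabel_dir (σ : Equiv.Perm (Fin (n + 1))) (b : LinBr n) :
    ∀ t ∈ (associahedron k n).dir b, push ⇑(σ⁻¹) t ∈ (associahedron k n).dir (b.relabel σ) := by
  intro t ht
  refine (FacePoset.mem_dir _).2 ⟨?_, gapSum_relabel σ (b.mem_dir ht).2.2.2⟩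
  change push ⇑(σ⁻¹) t (b.relabel σ).last = 0
  have : (b.relabel σ).last = σ⁻¹ b.last := by
    simp only [LinBr.last, LinBr.relabel, List.getLast_map]
  rw [this, push_apply_self (Equiv.injective _), (b.mem_dir ht).1]

theorem CycBr.push_relabel_dir (σ : Equiv.Perm (Fin (n + 1))) (b : CycBr n) :
    ∀ t ∈ (cyclohedron k n).dir b, push ⇑(σ⁻¹) t ∈ (cyclohedron k n).dir (b.relabel σ) := by
  intro t ht
  obtain ⟨h1, h2⟩ := b.mem_dir.1 ht
  exact (CycBr.mem_dir _).2 ⟨by rw [sum_push, h1], gapSum_relabel σ h2⟩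

end Geometry

section Operations

variable {k : Type u} [Field k] {m n : ℕ}

/-- Action of a permutation on oriented faces. -/
def relabelAux (X : FacePoset k n) (act : X.Cell → X.Cell) (σ : Equiv.Perm (Fin (n + 1))) :
    (X.Cell →₀ ExteriorAlgebra k (Fin (n + 1) → k)) →ₗ[k]
      (X.Cell →₀ ExteriorAlgebra k (Fin (n + 1) → k)) :=
  Finsupp.lsum k fun b =>
    Finsupp.lsingle (act b) ∘ₗ (ExteriorAlgebra.map (push ⇑(σ⁻¹))).toLinearMap

theorem relabelAux_mem {X : FacePoset k n} {act : X.Cell → X.Cell}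
    {σ : Equiv.Perm (Fin (n + 1))} (hc : ∀ b, (X.br (act b)).card = (X.br b).card)
    (hd : ∀ b, ∀ t ∈ X.dir b, push ⇑(σ⁻¹) t ∈ X.dir (act b)) {d : ℕ} {x} (hx : x ∈ X.chains d) :
    relabelAux X act σ x ∈ X.chains d := by
  rw [relabelAux, Finsupp.lsum_apply]
  refine Submodule.sum_mem _ fun b hb => ?_
  exact X.single_mem_chains (map_mem_pow _ (hd b) (hx b).1)
    (by rw [hc]; exact (hx b).2 (Finsupp.mem_support_iff.1 hb))

/-- Right action of the symmetric group on the cellular chains of the associahedra. -/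
def assocRelabel (d : ℕ) (σ : Equiv.Perm (Fin (n + 1))) :
    (associahedron k n).chains d →ₗ[k] (associahedron k n).chains d :=
  (relabelAux (associahedron k n) (fun b => LinBr.relabel b σ) σ).restrict fun _ =>
    relabelAux_mem (fun b => relabelBr_card σ (LinBr.br b)) (LinBr.push_relabel_dir σ)

/-- Right action of the symmetric group on the cellular chains of the cyclohedra. -/
def cycloRelabel (d : ℕ) (σ : Equiv.Perm (Fin (n + 1))) :
    (cyclohedron k n).chains d →ₗ[k] (cyclohedron k n).chains d :=
  (relabelAux (cyclohedron k n) (fun b => CycBr.relabel b σ) σ).restrict fun _ =>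
    relabelAux_mem (fun b => relabelBr_card σ (CycBr.br b)) (CycBr.push_relabel_dir σ)

/-- The map of cellular chains induced by the identification of the product of two faces `b`, `b'`
with the face `comp b b'`.  The direction space of `comp b b'` is the direct sum of those of `b` and
of `b'`, and is given the product orientation. -/
def compAux (X : FacePoset k m) (Z : FacePoset k (m + n)) (comp : X.Cell → LinBr n → Z.Cell)
    (i : Fin (m + 1)) (x : X.Cell →₀ ExteriorAlgebra k (Fin (m + 1) → k))
    (y : LinBr n →₀ ExteriorAlgebra k (Fin (n + 1) → k)) :
    Z.Cell →₀ ExteriorAlgebra k (Fin (m + n + 1) → k) :=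
  x.sum fun b ω => y.sum fun b' ω' => Finsupp.single (comp b b')
    (ExteriorAlgebra.map (push (b'.outGap i)) ω * ExteriorAlgebra.map (push (inLab n i)) ω')

theorem compAux_mem {X : FacePoset k m} {Z : FacePoset k (m + n)}
    {comp : X.Cell → LinBr n → Z.Cell} {i : Fin (m + 1)}
    (hc : ∀ b b', (Z.br (comp b b')).card = (X.br b).card + b'.br.card)
    (ho : ∀ b b', ∀ t ∈ X.dir b, push (b'.outGap i) t ∈ Z.dir (comp b b'))
    (hi : ∀ b b', ∀ s ∈ (associahedron k n).dir b', push (inLab n i) s ∈ Z.dir (comp b b'))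
    {p q : ℕ} {x y} (hx : x ∈ X.chains p) (hy : y ∈ (associahedron k n).chains q) :
    compAux X Z comp i x y ∈ Z.chains (p + q) := by
  refine Submodule.sum_mem _ fun b hb => Submodule.sum_mem _ fun b' hb' => ?_
  refine Z.single_mem_chains ?_ ?_
  · rw [pow_add]
    exact Submodule.mul_mem_mul (map_mem_pow _ (ho b b') (hx b).1)
      (map_mem_pow _ (hi b b') (hy b').1)
  · have h1 := (hx b).2 (Finsupp.mem_support_iff.1 hb)
    have h2 : b'.br.card + q = n := (hy b').2 (Finsupp.mem_support_iff.1 hb')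
    rw [hc]; omega

/-- Operad composition `∘_i` of cellular chains of associahedra. -/
def assocComp {p q : ℕ} (i : Fin (m + 1)) (x : (associahedron k m).chains p)
    (y : (associahedron k n).chains q) : (associahedron k (m + n)).chains (p + q) :=
  ⟨compAux (associahedron k m) (associahedron k (m + n)) (fun b b' => LinBr.comp i b b') i x.1 y.1,
    compAux_mem (fun b b' => brComp_card i (LinBr.two_le b) (fun _ => LinBr.br_nodup b) b')
      (LinBr.push_out_dir i) (LinBr.push_in_dir i) x.2 y.2⟩

/-- Module structure `∘_i` of the cellular chains of cyclohedra over those of associahedra. -/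
def cycloComp {p q : ℕ} (i : Fin (m + 1)) (x : (cyclohedron k m).chains p)
    (y : (associahedron k n).chains q) : (cyclohedron k (m + n)).chains (p + q) :=
  ⟨compAux (cyclohedron k m) (cyclohedron k (m + n)) (fun b b' => CycBr.comp i b b') i x.1 y.1,
    compAux_mem (fun b b' => brComp_card i (CycBr.two_le b) (fun _ => CycBr.br_nodup b) b')
      (CycBr.push_out_dir i) (CycBr.push_in_dir i) x.2 y.2⟩

/-- The operad unit: the point `K_1`. -/
def assocUnit (k : Type u) [Field k] : (associahedron k 0).chains 0 :=
  ⟨Finsupp.single (LinBr.top 0) 1, FacePoset.single_mem_chains _ (by simp) (by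
    change (LinBr.top 0).br.card + 0 = 0
    simp [LinBr.top])⟩

theorem ιMulti_mem {V : Type u} [AddCommGroup V] [Module k V] {S : Submodule k V} {d : ℕ}
    {v : Fin d → V} (hv : ∀ j, v j ∈ S) :
    ExteriorAlgebra.ιMulti k d v ∈ (S.map (ExteriorAlgebra.ι k)) ^ d := by
  induction d with
  | zero => simp
  | succ d ih =>
    rw [ExteriorAlgebra.ιMulti_succ_apply, pow_succ']
    exact Submodule.mul_mem_mul (Submodule.mem_map_of_mem (hv 0)) (ih fun j => hv _)

/-- The top cell of `K_{n+2}` with the orientation `(e_1 - e_{n+1}) ∧ ⋯ ∧ (e_n - e_{n+1})`; it is one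
of its two orientations, the other one being the opposite. -/
def assocTop (k : Type u) [Field k] (n : ℕ) : (associahedron k (n + 1)).chains n :=
  ⟨Finsupp.single (LinBr.top (n + 1)) (ExteriorAlgebra.ιMulti k n fun j =>
      Pi.single j.castSucc.castSucc 1 - Pi.single (Fin.last n).castSucc 1),
    FacePoset.single_mem_chains _ (ιMulti_mem fun j => by
      have hw : (LinBr.top (n + 1)).word = (List.finRange (n + 1)).map Fin.castSucc ++
        [Fin.last (n + 1)] := List.finRange_succ_last
      have hl : (LinBr.top (n + 1)).last = Fin.last (n + 1) := by
        simp only [LinBr.last, hw, List.getLast_append_singleton]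
      refine (FacePoset.mem_dir _).2 ⟨?_, ?_⟩
      · change (Pi.single j.castSucc.castSucc 1 - Pi.single (Fin.last n).castSucc 1 :
          Fin (n + 2) → k) (LinBr.top (n + 1)).last = 0
        rw [hl]
        simp [Pi.single_apply, Fin.ext_iff]
        omega
      · intro l h
        have h : l ∈ (LinBr.top (n + 1)).br := h
        have : l = (LinBr.top (n + 1)).word := by simpa [LinBr.top] using h
        rw [this, gapSum, hw, List.dropLast_concat]
        have hs := sumOver_word (LinBr.top (n + 1)).word (LinBr.top (n + 1)).nodup
          (LinBr.top (n + 1)).complete (Pi.single j.castSucc.castSucc (1 : k) -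
            Pi.single (Fin.last n).castSucc 1 : Fin (n + 2) → k)
        rw [hw, sumOver_append] at hs
        have h1 : ∑ x, (Pi.single j.castSucc.castSucc (1 : k) -
            Pi.single (Fin.last n).castSucc 1 : Fin (n + 2) → k) x = 0 := by simp
        have h2 : (Pi.single j.castSucc.castSucc (1 : k) -
            Pi.single (Fin.last n).castSucc 1 : Fin (n + 2) → k) (Fin.last (n + 1)) = 0 := by
          simp [Pi.single_apply, Fin.ext_iff]
          omega
        rw [h1, sumOver_cons, sumOver_nil, h2, add_zero, add_zero] at hs
        exact hs) (by
    change (LinBr.top (n + 1)).br.card + n = n + 1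
    simp [LinBr.top, add_comm])⟩

/-- The top cell of `W_{n+1}` with the orientation `(e_1 - e_{n+1}) ∧ ⋯ ∧ (e_n - e_{n+1})`. -/
def cycloTop (k : Type u) [Field k] (n : ℕ) : (cyclohedron k n).chains n :=
  ⟨Finsupp.single (CycBr.top n) (ExteriorAlgebra.ιMulti k n fun j =>
      Pi.single j.castSucc 1 - Pi.single (Fin.last n) 1),
    FacePoset.single_mem_chains _ (ιMulti_mem fun j => (CycBr.mem_dir _).2
      ⟨by simp, by simp [CycBr.top]⟩) (by
    change (CycBr.top n).br.card + n = n
    simp [CycBr.top])⟩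

end Operations

section Algebras

variable {k : Type u} [Field k]
variable {A : Type v} [AddCommGroup A] [Module k A] {W : Type w} [AddCommGroup W] [Module k W]

/-! ### Algebras and traces

Graded vector spaces are vector spaces with a decomposition `𝒜 : ℤ → Submodule k A`.  Identities
with signs are stated on homogeneous elements `a j ∈ 𝒜 (p j)`.  The multilinear map with index `n`
has `n + 1` arguments. -/

/-- The Koszul sign: `a_1 ∧ ⋯ ∧ a_n = ε(σ) a_{σ(1)} ∧ ⋯ ∧ a_{σ(n)}` in the free graded commutative
algebra on `a_1, …, a_n` of degrees `p`. -/
def koszulSign {n : ℕ} (σ : Equiv.Perm (Fin n)) (p : Fin n → ℤ) : ℤˣ :=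
  ∏ x : Fin n × Fin n with x.1 < x.2 ∧ σ x.2 < σ x.1, Int.negOnePow (p (σ x.1) * p (σ x.2))

/-- `χ(σ) = sgn(σ) ε(σ)`. -/
def chi {n : ℕ} (σ : Equiv.Perm (Fin n)) (p : Fin n → ℤ) : ℤˣ :=
  Equiv.Perm.sign σ * koszulSign σ p

/-- Total degree of the arguments in front of position `i`. -/
def degBefore {n : ℕ} (i : ℕ) (p : Fin n → ℤ) : ℤ := ∑ j ∈ Finset.univ.filter (fun j : Fin n => (j : ℕ) < i), p j

/-- The arguments `(a_0, …, a_{i-1}, g(a_i, …, a_{i+l}), a_{i+l+1}, …, a_n)`. -/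
def plug {m l n : ℕ} (h : m + l = n) (i : Fin (m + 1)) (g : (Fin (l + 1) → A) → A)
    (a : Fin (n + 1) → A) : Fin (m + 1) → A := fun j =>
  if (j : ℕ) < i then a ⟨j, by omega⟩
  else if j = i then g fun r => a ⟨i + r, by omega⟩
  else a ⟨j + l, by omega⟩

/-- `f : A^{⊗n} → W` has degree `d`. -/
def HasDegree (𝒜 : ℤ → Submodule k A) (𝒲 : ℤ → Submodule k W) (d : ℤ) {n : ℕ}
    (f : MultilinearMap k (fun _ : Fin n => A) W) : Prop :=
  ∀ (p : Fin n → ℤ) (a : Fin n → A), (∀ j, a j ∈ 𝒜 (p j)) → f a ∈ 𝒲 (∑ j, p j + d)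

/-- `A(∞)`-algebras: `m_r` (here `m n`, `r = n + 1`) has degree `r - 2`, and for all `N ≥ 1`
`∑_{λ, r} (-1)^{r + λ + rλ + r(|a_1| + ⋯ + |a_λ|)}
  m_{N-r+1}(a_1, …, a_λ, m_r(a_{λ+1}, …, a_{λ+r}), …, a_N) = 0`. -/
structure IsAInfinityAlgebra (𝒜 : ℤ → Submodule k A)
    (m : ∀ n : ℕ, MultilinearMap k (fun _ : Fin (n + 1) => A) A) : Prop where
  degree : ∀ n : ℕ, HasDegree 𝒜 𝒜 ((n : ℤ) - 1) (m n)
  relation : ∀ (n : ℕ) (p : Fin (n + 1) → ℤ) (a : Fin (n + 1) → A), (∀ j, a j ∈ 𝒜 (p j)) →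
    ∑ l : Fin (n + 1), ∑ i : Fin (n - l + 1),
      Int.negOnePow (((l : ℤ) + 1) + i + i * ((l : ℤ) + 1) + ((l : ℤ) + 1) * degBefore i p) •
        m (n - l) (plug (Nat.sub_add_cancel (Nat.le_of_lt_succ l.2)) i (m l) a) = 0

/-- A map of one argument as a linear map; `unary (m 0)` is the differential `∂ = m_1`. -/
def unary (f : MultilinearMap k (fun _ : Fin 1 => A) A) : A →ₗ[k] A :=
  (MultilinearMap.ofSubsingleton k A A 0).symm f

/-- The differential of `Hom(A^{⊗n}, W)`: `f ↦ δ f - (-1)^{|f|} f ∂`, for `f` of degree `d`. -/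
def homDiff (δ : W →ₗ[k] W) (D : A →ₗ[k] A) (d : ℕ) {n : ℕ}
    (f : MultilinearMap k (fun _ : Fin n => A) W) (p : Fin n → ℤ) (a : Fin n → A) : W :=
  δ (f a) - Int.negOnePow d • ∑ i : Fin n,
    Int.negOnePow (degBefore i p) • f (Function.update a i (D (a i)))

/-- `α` is a morphism of symmetric differential graded operads from the cellular chains of the
symmetrized associahedra to the endomorphism operad of the complex `(A, D)`: it preserves degrees,
differentials, symmetric group actions, the unit and the compositions `∘_i`.  The symmetric group
acts on `f : A^{⊗n} → A` by `(f σ)(a_1, …, a_n) = ± f(a_{σ⁻¹(1)}, …, a_{σ⁻¹(n)})`, and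
`(f ∘_i g)(a) = ± f(…, g(…), …)`, with Koszul signs. -/
structure IsOperadAlgebra (𝒜 : ℤ → Submodule k A) (D : A →ₗ[k] A)
    (α : ∀ n d : ℕ, (associahedron k n).chains d →ₗ[k]
      MultilinearMap k (fun _ : Fin (n + 1) => A) A) : Prop where
  degree : ∀ (n d : ℕ) x, HasDegree 𝒜 𝒜 d (α n d x)
  boundary_zero : ∀ (n : ℕ) x (p : Fin (n + 1) → ℤ) a, (∀ j, a j ∈ 𝒜 (p j)) →
    homDiff D D 0 (α n 0 x) p a = 0
  boundary_succ : ∀ (n d : ℕ) x (p : Fin (n + 1) → ℤ) a, (∀ j, a j ∈ 𝒜 (p j)) →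
    α n d ((associahedron k n).boundary d x) a = homDiff D D (d + 1) (α n (d + 1) x) p a
  equivariant : ∀ (n d : ℕ) (σ : Equiv.Perm (Fin (n + 1))) x (p : Fin (n + 1) → ℤ) a,
    (∀ j, a j ∈ 𝒜 (p j)) →
    α n d (assocRelabel d σ x) a = koszulSign σ⁻¹ p • α n d x (a ∘ ⇑(σ⁻¹))
  unit : ∀ a, α 0 0 (assocUnit k) a = a 0
  comp : ∀ (m n d e : ℕ) (i : Fin (m + 1)) (x : (associahedron k m).chains d)
    (y : (associahedron k n).chains e) (p : Fin (m + n + 1) → ℤ) a, (∀ j, a j ∈ 𝒜 (p j)) →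
    α (m + n) (d + e) (assocComp i x y) a =
      Int.negOnePow (e * degBefore i p) • α m d x (plug rfl i (α n e y) a)

/-- `t` is a trace over the cellular chains of the symmetrized cyclohedra, on the algebra given by
`α`, with values in `(W, δ)`: a morphism of right differential graded modules from these chains to
`n ↦ Hom(A^{⊗n}, W)`, on which the operad acts through `α`. -/
structure IsCyclohedronTrace (𝒜 : ℤ → Submodule k A) (D : A →ₗ[k] A)
    (α : ∀ n d : ℕ, (associahedron k n).chains d →ₗ[k]
      MultilinearMap k (fun _ : Fin (n + 1) => A) A)
    (𝒲 : ℤ → Submodule k W) (δ : W →ₗ[k] W)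
    (t : ∀ n d : ℕ, (cyclohedron k n).chains d →ₗ[k]
      MultilinearMap k (fun _ : Fin (n + 1) => A) W) : Prop where
  degree : ∀ (n d : ℕ) x, HasDegree 𝒜 𝒲 d (t n d x)
  boundary_zero : ∀ (n : ℕ) x (p : Fin (n + 1) → ℤ) a, (∀ j, a j ∈ 𝒜 (p j)) →
    homDiff δ D 0 (t n 0 x) p a = 0
  boundary_succ : ∀ (n d : ℕ) x (p : Fin (n + 1) → ℤ) a, (∀ j, a j ∈ 𝒜 (p j)) →
    t n d ((cyclohedron k n).boundary d x) a = homDiff δ D (d + 1) (t n (d + 1) x) p a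
  equivariant : ∀ (n d : ℕ) (σ : Equiv.Perm (Fin (n + 1))) x (p : Fin (n + 1) → ℤ) a,
    (∀ j, a j ∈ 𝒜 (p j)) →
    t n d (cycloRelabel d σ x) a = koszulSign σ⁻¹ p • t n d x (a ∘ ⇑(σ⁻¹))
  comp : ∀ (m n d e : ℕ) (i : Fin (m + 1)) (x : (cyclohedron k m).chains d)
    (y : (associahedron k n).chains e) (p : Fin (m + n + 1) → ℤ) a, (∀ j, a j ∈ 𝒜 (p j)) →
    t (m + n) (d + e) (cycloComp i x y) a =
      Int.negOnePow (e * degBefore i p) • t m d x (plug rfl i (α n e y) a)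

/-- Homotopy traces on an `A(∞)`-algebra; `T n` is `T_{n+1}`, of degree `n`.  The cyclic sum is over
the powers of the rotation. -/
structure IsHomotopyTrace (𝒜 : ℤ → Submodule k A)
    (m : ∀ n : ℕ, MultilinearMap k (fun _ : Fin (n + 1) => A) A)
    (𝒲 : ℤ → Submodule k W) (δ : W →ₗ[k] W)
    (T : ∀ n : ℕ, MultilinearMap k (fun _ : Fin (n + 1) => A) W) : Prop where
  degree : ∀ n : ℕ, HasDegree 𝒜 𝒲 n (T n)
  cyclic : ∀ (n : ℕ), ∀ σ ∈ Subgroup.zpowers (finRotate (n + 1)),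
    ∀ (p : Fin (n + 1) → ℤ) a, (∀ j, a j ∈ 𝒜 (p j)) → T n a = chi σ p • T n (a ∘ σ)
  boundary : ∀ (n : ℕ) (p : Fin (n + 1) → ℤ) a, (∀ j, a j ∈ 𝒜 (p j)) →
    δ (T n a) = ∑ σ with σ ∈ Subgroup.zpowers (finRotate (n + 1)), chi σ p •
      ∑ l : Fin (n + 1), Int.negOnePow (((l : ℤ) + 1) + ((n : ℤ) + 1)) •
        T (n - l) (plug (Nat.sub_add_cancel (Nat.le_of_lt_succ l.2)) 0 (m l) (a ∘ σ))

/-- `δ` is a differential of degree `-1`. -/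
structure IsDGSpace (𝒲 : ℤ → Submodule k W) (δ : W →ₗ[k] W) : Prop where
  degree : ∀ j, ∀ w ∈ 𝒲 j, δ w ∈ 𝒲 (j - 1)
  sq_zero : ∀ w, δ (δ w) = 0

end Algebras

end Cyclohedron

end

/-! The cellular chains of the associahedra are generated, as an operad, by the unit and the top
cells; those of the cyclohedra are generated by their top cells as a right module. Indeed, a cell
with enough brackets is, after a relabelling, the composite of cells with fewer brackets
(`assoc_generation`, `cyclo_generation`). Morphisms are therefore determined by their values on top
cells, which gives the uniqueness of the algebra structure and the injectivity on traces. What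
remains is to extend given operations from the top cells to all cells, and to see that the extension
respects boundaries because of the A(∞) relation, respectively of condition (ii).

Extension. A bracketing is a planar forest whose vertices are the brackets: one tree for a linear
bracketing, a cyclic sequence of trees for a cyclic one. An oriented cell acts by evaluating its
forest, vertices acting by the operations `m` and, in the cyclic case, the collection of trees being
fed into `T`. Two devices organise the signs. First, cells are oriented by `orient`: the volume form
of the gap coordinates is contracted with one functional for each bracket and with the functional
that cuts out the hull, so brackets behave like odd symbols. Second, the operations are moved to the
suspension (`shifted`), where each `m` becomes odd of degree -1, like a bracket, and where `T` is
cyclically invariant up to the plain Koszul sign (`evalList_rotate`). `Forest.sign` is the exponent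
of the sign that translates back. That it matches the product orientation of a composite
(`orient_comp`) with the Koszul sign of a composition is the computation `Forest.sign_comp`,
repackaged in `sign_comp_eq`; for relabellings it is `sign_map_perm`.

The forest of a cyclic bracketing is unique only up to a rotation of its trees (`CycBr.Rep.unique`).
The operation is well defined because evaluating the rotated forest costs the same sign
(`twist_forestOp_swap`) as rotating the brackets in the orientation (`orient_swap`); this is where
condition (i) enters. Conversely every trace satisfies (i), because a rotation fixes the top face of
the cyclohedron and changes its orientation by the sign of the permutation
(`cycloRelabel_cycloTop`).

Boundaries. A facet of a product of two faces is a facet of one factor times the other factor, so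
the cellular boundary is a derivation for the compositions (`CompFacets.boundaryAux_compAux`). So is
the differential of multilinear maps (`homDiff_comp`), and both are equivariant. Compatibility has
to be checked on generators only. The facets of the top cell of an associahedron are the insertions
of one inner bracket; they give the terms of the A(∞) relation in which both operations have at
least two arguments, and the other terms are the differential of the top operation
(`assocTop_boundaryCompat`). The facets of the top cell of a cyclohedron are the cyclic intervals
with at least two letters, indexed by a rotation and a length; they give the terms of (ii) in which
`m` has at least two arguments, while the unary terms add up to `T` composed with the differential
of the tensor power (`cycloRaw_topCell_iff`). This last lemma is an equivalence, so it serves in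
both directions: a homotopy trace extends to a module morphism, and a trace `t`, which by generation
is the extension of its own cyclic values on the top cells, yields (ii). -/

noncomputable section

open scoped Classical

namespace Cyclohedron

section

/-! ### Signs with exponents modulo 2. -/

section Signs

/-- The sign `(-1)^z`. -/
def sg (z : ZMod 2) : ℤˣ := if z = 0 then 1 else -1

@[simp] theorem sg_zero : sg 0 = 1 := rfl
@[simp] theorem sg_one : sg 1 = -1 := rfl

theorem sg_add (x y : ZMod 2) : sg (x + y) = sg x * sg y := by
  revert x y; decide

theorem sg_mul_self (x : ZMod 2) : sg x * sg x = 1 := by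
  revert x; decide

theorem negOnePow_eq_sg (n : ℤ) : Int.negOnePow n = sg (n : ZMod 2) := by
  rcases Int.even_or_odd n with h | h
  · rw [Int.negOnePow_even n h, (ZMod.intCast_eq_zero_iff_even).2 h, sg_zero]
  · rw [Int.negOnePow_odd n h, (ZMod.intCast_eq_one_iff_odd).2 h, sg_one]

theorem map_units_int {F M N : Type*} [AddCommGroup M] [AddCommGroup N] [FunLike F M N]
    [AddMonoidHomClass F M N] (f : F) (u : ℤˣ) (x : M) : f (u • x) = u • f x := by
  rcases Int.units_eq_one_or u with rfl | rfl <;> simp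

theorem sg_smul_smul {M : Type*} [AddCommGroup M] (x y : ZMod 2) (a : M) :
    sg x • sg y • a = sg (x + y) • a := by
  rw [sg_add, mul_smul]

theorem units_mem {k M : Type*} [Ring k] [AddCommGroup M] [Module k M] (S : Submodule k M)
    (u : ℤˣ) {x : M} (h : x ∈ S) : u • x ∈ S := by
  rcases Int.units_eq_one_or u with rfl | rfl <;> simpa using h

end Signs

/-! ### Iterated contractions in the exterior algebra. -/

section Contraction

variable {k : Type u} [Field k] {V V' : Type u} [AddCommGroup V] [Module k V] [AddCommGroup V']
  [Module k V']

open CliffordAlgebra (contractLeft)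

local notation "ι" => ExteriorAlgebra.ι k

theorem contractLeft_ι_mul (φ : Module.Dual k V) (v : V) (ω : ExteriorAlgebra k V) :
    contractLeft φ (ι v * ω) = φ v • ω - ι v * contractLeft φ ω :=
  CliffordAlgebra.contractLeft_ι_mul φ v ω

theorem ext_induction {P : ExteriorAlgebra k V → Prop}
    (algebraMap : ∀ r : k, P (algebraMap k (ExteriorAlgebra k V) r))
    (add : ∀ x y, P x → P y → P (x + y)) (ι_mul : ∀ x m, P x → P (ι m * x)) (x) : P x :=
  CliffordAlgebra.left_induction (P := P) (0 : QuadraticForm k V) algebraMap add ι_mul x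

/-- Iterated contraction; the head of the list is applied last. -/
def contr (Φ : List (Module.Dual k V)) (ω : ExteriorAlgebra k V) : ExteriorAlgebra k V :=
  Φ.foldr (fun φ ω => contractLeft φ ω) ω

@[simp] theorem contr_nil (ω : ExteriorAlgebra k V) : contr [] ω = ω := rfl

@[simp] theorem contr_cons (φ : Module.Dual k V) (Φ) (ω : ExteriorAlgebra k V) :
    contr (φ :: Φ) ω = contractLeft φ (contr Φ ω) := rfl

theorem contr_append (Φ Ψ : List (Module.Dual k V)) (ω : ExteriorAlgebra k V) :
    contr (Φ ++ Ψ) ω = contr Φ (contr Ψ ω) := List.foldr_append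

theorem contr_units (Φ : List (Module.Dual k V)) (c : ℤˣ) (ω : ExteriorAlgebra k V) :
    contr Φ (c • ω) = c • contr Φ ω := by
  induction Φ with
  | nil => rfl
  | cons φ Φ ih => rw [contr_cons, ih, map_units_int, contr_cons]

theorem contr_swap_one (φ : Module.Dual k V) (Φ) (ω : ExteriorAlgebra k V) :
    contr Φ (contractLeft φ ω) = sg Φ.length • contractLeft φ (contr Φ ω) := by
  induction Φ with
  | nil => simp
  | cons ψ Φ ih =>
    rw [contr_cons, ih, map_units_int, CliffordAlgebra.contractLeft_comm, contr_cons, smul_neg,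
      List.length_cons, Nat.cast_add, sg_add, Nat.cast_one, sg_one, mul_neg_one, Units.neg_smul]

/-- Contractions anticommute in pairs, so an exchange of two blocks costs the product of their
lengths. All reorderings of brackets in an orientation come from this. -/
theorem contr_swap (Φ Ψ : List (Module.Dual k V)) (ω : ExteriorAlgebra k V) :
    contr (Φ ++ Ψ) ω = sg (Φ.length * Ψ.length) • contr (Ψ ++ Φ) ω := by
  induction Ψ generalizing Φ with
  | nil => simp
  | cons ψ Ψ ih =>
    rw [contr_append, contr_cons, contr_swap_one, ← contr_append, ih, map_units_int, sg_smul_smul,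
      List.cons_append, contr_cons, List.length_cons]
    congr 2
    push_cast; ring

/-- If `φ v = 0`, contraction with `φ` anticommutes with multiplication by `v`, so being annihilated
by `v` survives each contraction. -/
theorem ι_mul_contr {v : V} (Φ : List (Module.Dual k V)) (h : ∀ φ ∈ Φ, φ v = 0)
    {ω : ExteriorAlgebra k V} (hω : ι v * ω = 0) : ι v * contr Φ ω = 0 := by
  induction Φ with
  | nil => exact hω
  | cons φ Φ ih =>
    have := ih fun φ hφ => h φ (List.mem_cons_of_mem _ hφ)
    have h2 := contractLeft_ι_mul φ v (contr Φ ω)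
    rw [h φ (List.mem_cons_self), zero_smul, zero_sub, this, map_zero] at h2
    exact neg_eq_zero.1 h2.symm

/-- Contraction is an antiderivation. Here the term in which it hits the right factor vanishes; in
the companion lemma the functional vanishes on the vectors that make up the left factor, and only
that term is left, with a sign. -/
theorem contractLeft_mul_of_right {φ : Module.Dual k V} {Y : ExteriorAlgebra k V}
    (hY : contractLeft φ Y = 0) (X : ExteriorAlgebra k V) :
    contractLeft φ (X * Y) = contractLeft φ X * Y := by
  induction X using ext_induction with
  | algebraMap r =>
    rw [CliffordAlgebra.contractLeft_algebraMap_mul, hY, CliffordAlgebra.contractLeft_algebraMap,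
      mul_zero, zero_mul]
  | add x y hx hy => rw [add_mul, map_add, map_add, add_mul, hx, hy]
  | ι_mul x m hx =>
    rw [mul_assoc, contractLeft_ι_mul, contractLeft_ι_mul, hx, sub_mul, smul_mul_assoc, mul_assoc]

theorem contractLeft_mul_of_left {φ : Module.Dual k V} {S : Submodule k V}
    (hS : ∀ v ∈ S, φ v = 0) {d : ℕ} {X : ExteriorAlgebra k V} (hX : X ∈ (S.map ι) ^ d)
    (Y : ExteriorAlgebra k V) : contractLeft φ (X * Y) = sg d • (X * contractLeft φ Y) := by
  induction d generalizing X with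
  | zero =>
    rw [pow_zero, Submodule.mem_one] at hX
    obtain ⟨r, rfl⟩ := hX
    rw [CliffordAlgebra.contractLeft_algebraMap_mul]; simp
  | succ d ih =>
    rw [pow_succ'] at hX
    induction hX using Submodule.mul_induction_on' with
    | mem_mul_mem a ha b hb =>
      obtain ⟨v, hv, rfl⟩ := ha
      rw [mul_assoc, mul_assoc, contractLeft_ι_mul, hS v hv, zero_smul, zero_sub, ih hb,
        Nat.cast_add, Nat.cast_one, sg_add, sg_one, mul_neg_one, Units.neg_smul, mul_smul_comm]
    | add a _ b _ ha hb => rw [add_mul, map_add, ha, hb, add_mul, smul_add]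

theorem contr_mul_of_right {Φ : List (Module.Dual k V)} {Y : ExteriorAlgebra k V}
    (hY : ∀ φ ∈ Φ, contractLeft φ Y = 0) (X : ExteriorAlgebra k V) :
    contr Φ (X * Y) = contr Φ X * Y := by
  induction Φ with
  | nil => rfl
  | cons φ Φ ih =>
    rw [contr_cons, ih fun φ hφ => hY φ (List.mem_cons_of_mem _ hφ), contr_cons,
      contractLeft_mul_of_right (hY φ List.mem_cons_self)]

theorem contr_mul_of_left {Φ : List (Module.Dual k V)} {S : Submodule k V}
    (hS : ∀ φ ∈ Φ, ∀ v ∈ S, φ v = 0) {d : ℕ} {X : ExteriorAlgebra k V} (hX : X ∈ (S.map ι) ^ d)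
    (Y : ExteriorAlgebra k V) : contr Φ (X * Y) = sg (Φ.length * d) • (X * contr Φ Y) := by
  induction Φ with
  | nil => simp
  | cons φ Φ ih =>
    rw [contr_cons, ih fun φ hφ => hS φ (List.mem_cons_of_mem _ hφ), map_units_int,
      contractLeft_mul_of_left (hS φ List.mem_cons_self) hX, sg_smul_smul, contr_cons,
      List.length_cons]
    congr 2
    push_cast; ring

theorem contractLeft_map (f : V →ₗ[k] V') (φ : Module.Dual k V') (ω : ExteriorAlgebra k V) :
    contractLeft φ (ExteriorAlgebra.map f ω) =
      ExteriorAlgebra.map f (contractLeft (φ ∘ₗ f) ω) := by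
  induction ω using ext_induction with
  | algebraMap r =>
    rw [CliffordAlgebra.contractLeft_algebraMap, map_zero]
    exact (congrArg _ (AlgHom.commutes _ r)).trans (CliffordAlgebra.contractLeft_algebraMap _ _ _)
  | add x y hx hy => simp only [map_add, hx, hy]
  | ι_mul x m hx =>
    rw [contractLeft_ι_mul, map_mul, ExteriorAlgebra.map_apply_ι, contractLeft_ι_mul, hx, map_sub, map_smul,
      map_mul (ExteriorAlgebra.map f), ExteriorAlgebra.map_apply_ι]
    rfl

theorem contr_map (f : V →ₗ[k] V') (Φ : List (Module.Dual k V')) (ω : ExteriorAlgebra k V) :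
    contr Φ (ExteriorAlgebra.map f ω) =
      ExteriorAlgebra.map f (contr (Φ.map fun φ => φ ∘ₗ f) ω) := by
  induction Φ with
  | nil => rfl
  | cons φ Φ ih => rw [contr_cons, ih, contractLeft_map, List.map_cons, contr_cons]

theorem contr_mem (Φ : List (Module.Dual k V)) {S : Submodule k V} {d : ℕ}
    {ω : ExteriorAlgebra k V} (hω : ω ∈ (S.map ι) ^ (d + Φ.length)) :
    contr Φ ω ∈ ((S ⊓ ⨅ φ ∈ Φ, LinearMap.ker φ).map ι) ^ d := by
  induction Φ generalizing d with
  | nil => simpa using hω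
  | cons φ Φ ih =>
    have := contractLeft_mem φ _ d _ (ih (d := d + 1) (by
      rw [List.length_cons] at hω
      convert hω using 2
      omega))
    refine pow_map_mono ?_ d this
    intro v hv
    simp only [Submodule.mem_inf, Submodule.mem_iInf, List.mem_cons] at hv ⊢
    refine ⟨hv.1.1, ?_⟩
    rintro ψ (rfl | h)
    exacts [hv.2, hv.1.2 ψ h]

/-- Functionals together with a triangular dual system of vectors. -/
def Tri : List (Module.Dual k V × V) → Prop
  | [] => True
  | P :: l => P.1 P.2 = 1 ∧ (∀ Q ∈ l, Q.1 P.2 = 0) ∧ Tri l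

/-- The functionals are peeled off one at a time: if `φ v = 1` and `φ` contracts `ω` to zero, then
`ω` is the contraction of `v ∧ ω`, an element of one degree more that the other functionals still
contract to zero. In top degree everything is a multiple of the volume form. So the orientation line
of a face is one-dimensional, without a dimension count. -/
theorem exists_eq_smul_contr {N : ℕ} {vol : ExteriorAlgebra k V}
    (hvol : ∀ ω ∈ (LinearMap.range (ι : V →ₗ[k] _)) ^ N, ∃ c : k, ω = c • vol)
    (P : List (Module.Dual k V × V)) (hP : Tri P) {d : ℕ} (hd : d + P.length = N)
    {ω : ExteriorAlgebra k V} (hω : ω ∈ (LinearMap.range (ι : V →ₗ[k] _)) ^ d)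
    (h0 : ∀ Q ∈ P, contractLeft Q.1 ω = 0) : ∃ c : k, ω = c • contr (P.map Prod.fst) vol := by
  induction P generalizing d ω with
  | nil =>
    obtain rfl : d = N := by simpa using hd
    exact hvol ω hω
  | cons Q P ih =>
    obtain ⟨h1, h2, h3⟩ := hP
    have hd' : d + 1 + P.length = N := by simp at hd; omega
    obtain ⟨c, hc⟩ := ih h3 hd' (ω := ι Q.2 * ω)
      (by rw [pow_succ']; exact Submodule.mul_mem_mul ⟨_, rfl⟩ hω) (by
        intro R hR
        rw [contractLeft_ι_mul, h2 R hR, zero_smul, h0 R (List.mem_cons_of_mem _ hR), mul_zero, sub_zero])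
    refine ⟨c, ?_⟩
    have h4 : contractLeft Q.1 (ι Q.2 * ω) = ω := by
      rw [contractLeft_ι_mul, h1, one_smul, h0 Q List.mem_cons_self, mul_zero, sub_zero]
    rw [← h4, hc, map_smul]
    rfl

/-- Let `η` be the contraction by all functionals but the first. The vector `v` dual to the first
one annihilates `η` by `ι_mul_contr`, and contracting `v ∧ η = 0` with the first functional shows
that `η` would vanish together with its contraction. -/
theorem contr_ne_zero {vol : ExteriorAlgebra k V} (hvol : vol ≠ 0) (hv : ∀ v, ι v * vol = 0)
    (P : List (Module.Dual k V × V)) (hP : Tri P) : contr (P.map Prod.fst) vol ≠ 0 := by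
  induction P with
  | nil => exact hvol
  | cons Q P ih =>
    obtain ⟨h1, h2, h3⟩ := hP
    intro h
    have h4 : ι Q.2 * contr (P.map Prod.fst) vol = 0 := ι_mul_contr _ (by
      intro φ hφ
      obtain ⟨R, hR, rfl⟩ := List.mem_map.1 hφ
      exact h2 R hR) (hv _)
    have h5 := contractLeft_ι_mul Q.1 Q.2 (contr (P.map Prod.fst) vol)
    have h7 : contractLeft Q.1 (contr (P.map Prod.fst) vol) = 0 := h
    rw [h4, h1, h7, map_zero, mul_zero, sub_zero, one_smul] at h5
    exact ih h3 h5.symm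

end Contraction

/-! ### The volume form and products of basis vectors. -/

section Volume

variable {k : Type u} [Field k] {n : ℕ}

local notation "ι" => ExteriorAlgebra.ι k

variable (k) in
/-- The product of the basis vectors with the given labels. -/
def basisProd (l : List (Fin n)) : ExteriorAlgebra k (Fin n → k) :=
  (l.map fun x => ι (Pi.single x 1 : Fin n → k)).prod

@[simp] theorem basisProd_nil : basisProd k ([] : List (Fin n)) = 1 := rfl

theorem basisProd_cons (x : Fin n) (l) :
    basisProd k (x :: l) = ι (Pi.single x 1) * basisProd k l := by simp [basisProd]

theorem basisProd_append (l l' : List (Fin n)) :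
    basisProd k (l ++ l') = basisProd k l * basisProd k l' := by simp [basisProd]

theorem basisProd_mem (l : List (Fin n)) :
    basisProd k l ∈ (((Submodule.span k (Set.range fun x : {x // x ∈ l} =>
      (Pi.single x.1 1 : Fin n → k)))).map ι) ^ l.length := by
  have : ∀ (S : Submodule k (Fin n → k)), (∀ x ∈ l, Pi.single x 1 ∈ S) →
      basisProd k l ∈ (S.map ι) ^ l.length := by
    intro S hS
    induction l with
    | nil => simp [basisProd]
    | cons x l ih =>
      rw [basisProd_cons, List.length_cons, pow_succ']
      exact Submodule.mul_mem_mul (Submodule.mem_map_of_mem (hS x List.mem_cons_self))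
        (ih fun y hy => hS y (List.mem_cons_of_mem _ hy))
  exact this _ fun x hx => Submodule.subset_span ⟨⟨x, hx⟩, rfl⟩

theorem basisProd_comm (l l' : List (Fin n)) :
    basisProd k l * basisProd k l' = sg (l.length * l'.length) •
      (basisProd k l' * basisProd k l) := by
  have h1 : ∀ (v : Fin n → k) (l : List (Fin n)),
      basisProd k l * ι v = sg l.length • (ι v * basisProd k l) := by
    intro v l
    induction l with
    | nil => simp
    | cons x l ih =>
      rw [basisProd_cons, mul_assoc, ih, mul_smul_comm, ← mul_assoc,
        eq_neg_of_add_eq_zero_left (ExteriorAlgebra.ι_add_mul_swap (Pi.single x 1) v),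
        List.length_cons, Nat.cast_add, sg_add, Nat.cast_one, sg_one, mul_neg_one, Units.neg_smul,
        neg_mul, smul_neg, mul_assoc]
  induction l' with
  | nil => simp
  | cons x l' ih =>
    rw [basisProd_cons, ← mul_assoc, h1, smul_mul_assoc, mul_assoc, ih, mul_smul_comm,
      sg_smul_smul, mul_assoc, List.length_cons]
    congr 2
    push_cast; ring

theorem contractLeft_proj_basisProd {l l' : List (Fin n)} {y : Fin n} (hl : y ∉ l) (hl' : y ∉ l') :
    CliffordAlgebra.contractLeft (LinearMap.proj y) (basisProd k (l ++ y :: l')) =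
      sg l.length • basisProd k (l ++ l') := by
  have h0 : ∀ l : List (Fin n), y ∉ l →
      CliffordAlgebra.contractLeft (LinearMap.proj y) (basisProd k l) = 0 := fun l hl => by
    refine contractLeft_eq_zero _ ?_ _ _ (basisProd_mem l)
    intro v hv
    refine Submodule.span_induction ?_ (by simp) ?_ ?_ hv
    · rintro _ ⟨x, rfl⟩
      have : y ≠ x.1 := fun h => hl (h ▸ x.2)
      simp [this]
    · intro a b _ _ ha hb; rw [map_add, ha, hb, add_zero]
    · intro c a _ ha; rw [map_smul, ha, smul_zero]
  induction l with
  | nil =>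
    rw [List.nil_append, basisProd_cons, contractLeft_ι_mul, h0 l' hl']; simp
  | cons x l ih =>
    rw [List.mem_cons, not_or] at hl
    rw [List.cons_append, basisProd_cons, contractLeft_ι_mul, ih hl.2, List.cons_append, basisProd_cons, List.length_cons, Nat.cast_add, sg_add,
      Nat.cast_one, sg_one, mul_neg_one, Units.neg_smul, mul_smul_comm]
    have : y ≠ x := hl.1
    simp [this]

theorem map_push_basisProd {m : ℕ} (g : Fin n → Fin m) (l : List (Fin n)) :
    ExteriorAlgebra.map (push g) (basisProd k l) = basisProd k (l.map g) := by
  have h : ∀ x, push g (Pi.single x (1 : k)) = Pi.single (g x) 1 := by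
    intro x
    ext y
    rw [push_apply, Finset.sum_filter, Finset.sum_eq_single x]
    · by_cases h : g x = y
      · subst h; simp
      · rw [if_neg h, Pi.single_eq_of_ne (Ne.symm h)]
    · intro j _ hj; simp [hj]
    · simp
  induction l with
  | nil => simp
  | cons x l ih =>
    rw [basisProd_cons, map_mul, ih, ExteriorAlgebra.map_apply_ι, h, List.map_cons, basisProd_cons]

/-- The volume form `e_0 ∧ ⋯ ∧ e_n`. -/
def vol (k : Type u) [Field k] (n : ℕ) : ExteriorAlgebra k (Fin n → k) :=
  basisProd k (List.finRange n)

theorem vol_eq_ιMulti : vol k n = ExteriorAlgebra.ιMulti k n fun j => Pi.single j 1 := by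
  rw [vol, basisProd, ExteriorAlgebra.ιMulti_apply, List.ofFn_eq_map]

theorem map_push_vol (σ : Equiv.Perm (Fin n)) :
    ExteriorAlgebra.map (push σ) (vol k n) = Equiv.Perm.sign σ • vol k n := by
  rw [vol, map_push_basisProd, ← vol, vol_eq_ιMulti, ← AlternatingMap.map_perm, basisProd,
    ExteriorAlgebra.ιMulti_apply, List.ofFn_eq_map, List.map_map]
  rfl

/-- The universal alternating map and the determinant times the volume form agree on permutations of
the basis, hence everywhere. -/
theorem exists_smul_vol (ω) (hω : ω ∈ (LinearMap.range (ι : (Fin n → k) →ₗ[k] _)) ^ n) :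
    ∃ c : k, ω = c • vol k n := by
  have h1 : ω ∈ Submodule.span k (Set.range (ExteriorAlgebra.ιMulti k n (M := Fin n → k))) := by
    rw [ExteriorAlgebra.ιMulti_span_fixedDegree]; exact hω
  suffices h : Submodule.span k (Set.range (ExteriorAlgebra.ιMulti k n (M := Fin n → k))) ≤
      Submodule.span k {vol k n} by
    obtain ⟨c, hc⟩ := Submodule.mem_span_singleton.1 (h h1)
    exact ⟨c, hc.symm⟩
  rw [Submodule.span_le]
  rintro _ ⟨v, rfl⟩
  refine Submodule.mem_span_singleton.2 ⟨(Pi.basisFun k (Fin n)).det v, ?_⟩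
  have : ExteriorAlgebra.ιMulti k n (M := Fin n → k) =
      (LinearMap.toSpanSingleton k _ (vol k n)).compAlternatingMap (Pi.basisFun k (Fin n)).det := by
    refine (Pi.basisFun k (Fin n)).ext_alternating fun w hw => ?_
    let σ : Equiv.Perm (Fin n) := Equiv.ofBijective w (Finite.injective_iff_bijective.1 hw)
    have hσ : (fun i => Pi.basisFun k (Fin n) (w i)) = (Pi.basisFun k (Fin n)) ∘ σ := rfl
    rw [hσ, AlternatingMap.map_perm, AlternatingMap.map_perm, LinearMap.compAlternatingMap_apply,
      Module.Basis.det_self, LinearMap.toSpanSingleton_apply, one_smul, vol_eq_ιMulti]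
    congr 2
    ext j
    simp
  rw [this]; rfl

/-- The product involves `n + 1` vectors of an `n`-dimensional space. -/
theorem ι_mul_vol (v : Fin n → k) : ι v * vol k n = 0 := by
  rw [vol_eq_ιMulti]
  have := ExteriorAlgebra.ιMulti_succ_apply (R := k)
    (Fin.cons v fun j : Fin n => (Pi.single j 1 : Fin n → k))
  simp only [Fin.cons_zero] at this
  refine this.symm.trans (AlternatingMap.map_linearDependent _ _ fun h => ?_)
  have := h.fintype_card_le_finrank
  simp at this

/-- The determinant, extended by zero to the other degrees, is a functional on the exterior algebra
that takes the value 1 on the volume form. -/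
theorem vol_ne_zero : vol k n ≠ 0 := by
  intro h
  have h1 := ExteriorAlgebra.liftAlternating_apply_ιMulti (R := k) (M := Fin n → k) (N := k)
    (fun i => if h : i = n then h ▸ (Pi.basisFun k (Fin n)).det else 0)
    (fun j : Fin n => (Pi.single j 1 : Fin n → k))
  rw [← vol_eq_ιMulti, h, map_zero, dif_pos rfl] at h1
  have h2 : (fun j : Fin n => (Pi.single j 1 : Fin n → k)) = Pi.basisFun k (Fin n) := by
    ext j; simp
  simp only [h2] at h1
  rw [Module.Basis.det_self] at h1
  exact zero_ne_one h1

theorem vol_mem : vol k n ∈ ((⊤ : Submodule k (Fin n → k)).map ι) ^ n := by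
  have := pow_map_mono le_top _ (basisProd_mem (k := k) (List.finRange n))
  rwa [List.length_finRange] at this

/-- As `w` squares to zero, a final factor `w` absorbs every `w` subtracted before it. This relates
the orientations built from differences of basis vectors to the volume form. -/
theorem prod_sub_mul {α : Type*} {V : Type u} [AddCommGroup V] [Module k V] (l : List α)
    (f : α → V) (w : V) : (l.map fun x => ι (f x - w)).prod * ι w =
      (l.map fun x => ι (f x)).prod * ι w := by
  have h : ∀ l : List α, ι w * ((l.map fun x => ι (f x)).prod * ι w) = 0 := by
    intro l
    induction l with
    | nil => simp
    | cons x l ih =>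
      rw [List.map_cons, List.prod_cons, mul_assoc, ← mul_assoc,
        eq_neg_of_add_eq_zero_left (ExteriorAlgebra.ι_add_mul_swap w (f x)), neg_mul, mul_assoc, ih,
        mul_zero, neg_zero]
  induction l with
  | nil => simp
  | cons x l ih =>
    rw [List.map_cons, List.prod_cons, mul_assoc, ih, map_sub, sub_mul, h, sub_zero, List.map_cons,
      List.prod_cons, mul_assoc]

end Volume

end

section

/-! ### Subwords of words without repetitions. -/

section ListLemmas

variable {α : Type*}

theorem infix_of_disjoint {l u t : List α} (h : l <:+: u ++ t) (hne : l ≠ []) (hd : l.Disjoint u) :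
    l <:+: t := by
  induction u with
  | nil => exact h
  | cons a u ih =>
    rw [List.cons_append, List.infix_cons_iff] at h
    rcases h with h | h
    · obtain ⟨b, l, rfl⟩ := List.exists_cons_of_ne_nil hne
      obtain ⟨s, hs⟩ := h
      rw [List.cons_append] at hs
      obtain ⟨rfl, -⟩ := List.cons.inj hs
      exact absurd List.mem_cons_self fun h => hd List.mem_cons_self h
    · exact ih h fun x hx hx' => hd hx (List.mem_cons_of_mem _ hx')

theorem infix_cons_of_notMem {l t : List α} {x : α} (h : l <:+: x :: t) (hne : l ≠ []) (hx : x ∉ l) :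
    l <:+: t :=
  infix_of_disjoint (u := [x]) h hne fun _ hy hy' => hx (List.mem_singleton.1 hy' ▸ hy)

/-- A subword that crosses the cut of `p ++ q` begins in `p`, and one that crosses the cut of `q ++
p` begins in `q`; both cannot happen. Thus brackets visible from two cuts of a cyclic word cross
neither of them. -/
theorem infix_or_of_infix_swap {l p q : List α} (hn : (p ++ q).Nodup) (h : l <:+: p ++ q)
    (h' : l <:+: q ++ p) : l <:+: p ∨ l <:+: q := by
  have hd : p.Disjoint q := List.disjoint_of_nodup_append hn
  rw [List.infix_append_iff] at h h'
  rcases h with h | h | ⟨a, b, hab, ha, hb⟩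
  · exact Or.inl h
  · exact Or.inr h
  rcases h' with h' | h' | ⟨a', b', hab', ha', hb'⟩
  · exact Or.inr h'
  · exact Or.inl h'
  rcases a with _ | ⟨x, a⟩
  · right; rw [hab, List.nil_append]; exact hb.isInfix
  rcases a' with _ | ⟨x', a'⟩
  · left; rw [hab', List.nil_append]; exact hb'.isInfix
  rw [hab] at hab'
  obtain ⟨rfl, -⟩ := List.cons.inj hab'
  exact (hd (ha.subset List.mem_cons_self) (ha'.subset List.mem_cons_self)).elim

end ListLemmas

/-! ### Planar forests and their brackets. -/

/-- Planar forests with labelled leaves: `leaf x r` is the tree consisting of the leaf `x` followed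
by the forest `r`, and `node c r` is the tree with a root vertex under which there is the forest `c`,
followed by the forest `r`. -/
inductive Forest (α : Type*)
  | nil : Forest α
  | leaf (x : α) (r : Forest α) : Forest α
  | node (c r : Forest α) : Forest α

namespace Forest

variable {α β γ : Type*}

/-- The word of the labels of the leaves. -/
def leaves : Forest α → List α
  | nil => []
  | leaf x r => x :: leaves r
  | node c r => leaves c ++ leaves r

/-- The brackets (one for each vertex), outer ones first, and then from left to right. -/
def brs : Forest α → List (List α)
  | nil => []
  | leaf _ r => brs r
  | node c r => leaves c :: (brs c ++ brs r)

/-- The number of trees. -/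
def width : Forest α → ℕ
  | nil => 0
  | leaf _ r => width r + 1
  | node _ r => width r + 1

/-- Every vertex has at least two children. -/
def Good : Forest α → Prop
  | nil => True
  | leaf _ r => Good r
  | node c r => 2 ≤ width c ∧ Good c ∧ Good r

/-- Rename the leaves. -/
def map (f : α → β) : Forest α → Forest β
  | nil => nil
  | leaf x r => leaf (f x) (map f r)
  | node c r => node (map f c) (map f r)

/-- Concatenation. -/
def append : Forest α → Forest α → Forest α
  | nil, G => G
  | leaf x r, G => leaf x (append r G)
  | node c r, G => node c (append r G)

/-- Replace every leaf by a forest. -/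
def graft (f : α → Forest β) : Forest α → Forest β
  | nil => nil
  | leaf x r => append (f x) (graft f r)
  | node c r => node (graft f c) (graft f r)

/-- The forest without vertices. -/
def ofLeaves : List α → Forest α
  | [] => nil
  | x :: l => leaf x (ofLeaves l)

@[simp] theorem leaves_nil : (nil : Forest α).leaves = [] := rfl
@[simp] theorem leaves_leaf (x : α) (r) : (leaf x r).leaves = x :: r.leaves := rfl
@[simp] theorem leaves_node (c r : Forest α) : (node c r).leaves = c.leaves ++ r.leaves := rfl
@[simp] theorem brs_nil : (nil : Forest α).brs = [] := rfl
@[simp] theorem brs_leaf (x : α) (r) : (leaf x r).brs = r.brs := rfl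
@[simp] theorem brs_node (c r : Forest α) : (node c r).brs = c.leaves :: (c.brs ++ r.brs) := rfl

@[simp] theorem leaves_ofLeaves (l : List α) : (ofLeaves l).leaves = l := by
  induction l with
  | nil => rfl
  | cons x l ih => simp [ofLeaves, ih]

@[simp] theorem brs_ofLeaves (l : List α) : (ofLeaves l).brs = [] := by
  induction l with
  | nil => rfl
  | cons x l ih => simp [ofLeaves, ih]

theorem good_ofLeaves (l : List α) : (ofLeaves l).Good := by
  induction l with
  | nil => trivial
  | cons x l ih => exact ih

theorem width_ofLeaves (l : List α) : (ofLeaves l).width = l.length := by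
  induction l with
  | nil => rfl
  | cons x l ih => simp [ofLeaves, ih, width]

@[simp] theorem leaves_append (F G : Forest α) : (F.append G).leaves = F.leaves ++ G.leaves := by
  induction F with
  | nil => rfl
  | leaf x r ih => simp [append, ih]
  | node c r _ ih => simp [append, ih]

@[simp] theorem brs_append (F G : Forest α) : (F.append G).brs = F.brs ++ G.brs := by
  induction F with
  | nil => rfl
  | leaf x r ih => simp [append, ih]
  | node c r _ ih => simp [append, ih]

theorem width_append (F G : Forest α) : (F.append G).width = F.width + G.width := by
  induction F with
  | nil => simp [append, width]
  | leaf x r ih => simp only [append, ih, width]; omega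
  | node c r _ ih => simp only [append, ih, width]; omega

theorem good_append {F G : Forest α} : (F.append G).Good ↔ F.Good ∧ G.Good := by
  induction F with
  | nil => simp [append, Good]
  | leaf x r ih => simp only [append, ih, Good]
  | node c r _ ih => simp only [append, ih, Good]; tauto

@[simp] theorem leaves_map (f : α → β) (F : Forest α) : (F.map f).leaves = F.leaves.map f := by
  induction F with
  | nil => rfl
  | leaf x r ih => simp [map, ih]
  | node c r ih ih' => simp [map, ih, ih']

@[simp] theorem brs_map (f : α → β) (F : Forest α) : (F.map f).brs = F.brs.map (List.map f) := by
  induction F with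
  | nil => rfl
  | leaf x r ih => simp [map, ih]
  | node c r ih ih' => simp [map, ih, ih']

theorem width_map (f : α → β) (F : Forest α) : (F.map f).width = F.width := by
  induction F with
  | nil => rfl
  | leaf x r ih => simp [map, ih, width]
  | node c r ih ih' => simp [map, ih', width]

theorem good_map {f : α → β} {F : Forest α} : (F.map f).Good ↔ F.Good := by
  induction F with
  | nil => rfl
  | leaf x r ih => simp [map, ih, Good]
  | node c r ih ih' => simp [map, ih, ih', Good, width_map]

theorem map_map (f : α → β) (g : β → γ) (F : Forest α) : (F.map f).map g = F.map (g ∘ f) := by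
  induction F with
  | nil => rfl
  | leaf x r ih => simp [map, ih]
  | node c r ih ih' => simp [map, ih, ih']

theorem map_congr {f g : α → β} {F : Forest α} (h : ∀ x ∈ F.leaves, f x = g x) :
    F.map f = F.map g := by
  induction F with
  | nil => rfl
  | leaf x r ih =>
    simp only [map]
    rw [h x (by simp), ih fun y hy => h y (by simp [hy])]
  | node c r ih ih' =>
    simp only [map]
    rw [ih fun y hy => h y (by simp [hy]), ih' fun y hy => h y (by simp [hy])]

theorem map_append (f : α → β) (F G : Forest α) :
    (F.append G).map f = (F.map f).append (G.map f) := by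
  induction F with
  | nil => rfl
  | leaf x r ih => simp [map, append, ih]
  | node c r ih ih' => simp [map, append, ih']

@[simp] theorem leaves_graft (f : α → Forest β) (F : Forest α) :
    (F.graft f).leaves = F.leaves.flatMap fun x => (f x).leaves := by
  induction F with
  | nil => rfl
  | leaf x r ih => simp [graft, ih]
  | node c r ih ih' => simp [graft, ih, ih']

theorem mem_brs_graft {f : α → Forest β} {F : Forest α} {l : List β} : l ∈ (F.graft f).brs ↔
    (∃ u ∈ F.brs, l = u.flatMap fun x => (f x).leaves) ∨ ∃ x ∈ F.leaves, l ∈ (f x).brs := by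
  induction F with
  | nil => simp [graft]
  | leaf x r ih => simpa [graft, ih] using or_left_comm
  | node c r ih ih' =>
    simp only [graft, brs_node, List.mem_cons, List.mem_append, ih, ih', leaves_graft, leaves_node]
    constructor
    · rintro (h | (⟨u, hu, h⟩ | ⟨x, hx, h⟩) | (⟨u, hu, h⟩ | ⟨x, hx, h⟩))
      · exact Or.inl ⟨_, Or.inl rfl, h⟩
      · exact Or.inl ⟨u, Or.inr (Or.inl hu), h⟩
      · exact Or.inr ⟨x, Or.inl hx, h⟩
      · exact Or.inl ⟨u, Or.inr (Or.inr hu), h⟩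
      · exact Or.inr ⟨x, Or.inr hx, h⟩
    · rintro (⟨u, rfl | hu | hu, h⟩ | ⟨x, hx | hx, h⟩)
      · exact Or.inl h
      · exact Or.inr (Or.inl (Or.inl ⟨u, hu, h⟩))
      · exact Or.inr (Or.inr (Or.inl ⟨u, hu, h⟩))
      · exact Or.inr (Or.inl (Or.inr ⟨x, hx, h⟩))
      · exact Or.inr (Or.inr (Or.inr ⟨x, hx, h⟩))

theorem width_graft {f : α → Forest β} (hf : ∀ x, (f x).width = 1) (F : Forest α) :
    (F.graft f).width = F.width := by
  induction F with
  | nil => rfl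
  | leaf x r ih => simp only [graft, width_append, hf, ih, width]; omega
  | node c r ih ih' => simp [graft, width, ih']

theorem good_graft {f : α → Forest β} (hf : ∀ x, (f x).width = 1) (hg : ∀ x, (f x).Good)
    {F : Forest α} (hF : F.Good) : (F.graft f).Good := by
  induction F with
  | nil => trivial
  | leaf x r ih => exact good_append.2 ⟨hg x, ih hF⟩
  | node c r ih ih' => exact ⟨by rw [width_graft hf]; exact hF.1, ih hF.2.1, ih' hF.2.2⟩

theorem map_graft (g : β → γ) (f : α → Forest β) (F : Forest α) :
    (F.graft f).map g = F.graft fun x => (f x).map g := by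
  induction F with
  | nil => rfl
  | leaf x r ih => simp [graft, map_append, ih]
  | node c r ih ih' => simp [graft, map, ih, ih']

theorem graft_map (g : α → β) (f : β → Forest γ) (F : Forest α) :
    (F.map g).graft f = F.graft (f ∘ g) := by
  induction F with
  | nil => rfl
  | leaf x r ih => simp [graft, map, ih]
  | node c r ih ih' => simp [graft, map, ih, ih']

theorem graft_congr {f g : α → Forest β} {F : Forest α} (h : ∀ x ∈ F.leaves, f x = g x) :
    F.graft f = F.graft g := by
  induction F with
  | nil => rfl
  | leaf x r ih =>
    simp only [graft]
    rw [h x (by simp), ih fun y hy => h y (by simp [hy])]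
  | node c r ih ih' =>
    simp only [graft]
    rw [ih fun y hy => h y (by simp [hy]), ih' fun y hy => h y (by simp [hy])]

theorem graft_leaf (F : Forest α) : (F.graft fun x => leaf x nil) = F := by
  induction F with
  | nil => rfl
  | leaf x r ih => simp [graft, append, ih]
  | node c r ih ih' => simp [graft, ih, ih']

theorem width_le_length {F : Forest α} (h : F.Good) : F.width ≤ F.leaves.length := by
  induction F with
  | nil => simp [width]
  | leaf x r ih => simpa [width] using ih h
  | node c r ih ih' =>
    have := ih h.2.1
    have := ih' h.2.2
    have := h.1
    simp only [width, leaves_node, List.length_append]; omega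

theorem infix_of_mem_brs {F : Forest α} {l : List α} (h : l ∈ F.brs) : l <:+: F.leaves := by
  induction F with
  | nil => simp at h
  | leaf x r ih => exact (ih h).trans (List.suffix_cons _ _).isInfix
  | node c r ih ih' =>
    simp only [brs_node, List.mem_cons, List.mem_append] at h
    rcases h with rfl | h | h
    · exact (List.prefix_append _ _).isInfix
    · exact (ih h).trans (List.prefix_append _ _).isInfix
    · exact (ih' h).trans (List.suffix_append _ _).isInfix

theorem two_le_of_mem_brs {F : Forest α} (hF : F.Good) {l : List α} (h : l ∈ F.brs) :
    2 ≤ l.length := by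
  induction F with
  | nil => simp at h
  | leaf x r ih => exact ih hF h
  | node c r ih ih' =>
    simp only [brs_node, List.mem_cons, List.mem_append] at h
    rcases h with rfl | h | h
    · exact hF.1.trans (width_le_length hF.2.1)
    · exact ih hF.2.1 h
    · exact ih' hF.2.2 h

theorem ne_nil_of_mem_brs {F : Forest α} (hF : F.Good) {l : List α} (h : l ∈ F.brs) : l ≠ [] := by
  rintro rfl
  simpa using two_le_of_mem_brs hF h

theorem leaves_ne_nil {F : Forest α} (hF : F.Good) (h : 1 ≤ F.width) : F.leaves ≠ [] := by
  intro h'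
  have := width_le_length hF
  rw [h'] at this
  simp at this
  omega

/-- A bracket lies within one tree, and each further tree has a leaf outside of it. This
distinguishes the bracket of a vertex from the brackets below the vertex. -/
theorem length_lt_of_mem_brs {F : Forest α} (hF : F.Good) (h2 : 2 ≤ F.width) {l : List α}
    (h : l ∈ F.brs) : l.length < F.leaves.length := by
  cases F with
  | nil => simp at h
  | leaf x r =>
    have := (infix_of_mem_brs (F := r) h).length_le
    simp; omega
  | node c r =>
    have h3 := width_le_length hF.2.1
    have h4 := width_le_length hF.2.2
    have h5 := hF.1
    simp only [width] at h2
    simp only [brs_node, List.mem_cons, List.mem_append] at h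
    simp only [leaves_node, List.length_append]
    rcases h with rfl | h | h
    · omega
    · have := (infix_of_mem_brs h).length_le; omega
    · have := (infix_of_mem_brs h).length_le; omega

theorem nested_of_mem_brs {F : Forest α} (hn : F.leaves.Nodup) {l l' : List α} (h : l ∈ F.brs)
    (h' : l' ∈ F.brs) : Nested l l' := by
  induction F with
  | nil => simp at h
  | leaf x r ih => exact ih (List.nodup_cons.1 hn).2 h h'
  | node c r ih ih' =>
    have hd : c.leaves.Disjoint r.leaves := List.disjoint_of_nodup_append hn
    have hn := List.nodup_append.1 hn
    simp only [brs_node, List.mem_cons, List.mem_append] at h h'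
    rcases h with rfl | h | h <;> rcases h' with rfl | h' | h'
    · exact Or.inl List.infix_rfl
    · exact Or.inr (Or.inl (infix_of_mem_brs h'))
    · exact Or.inr (Or.inr fun x hx hx' => hd hx ((infix_of_mem_brs h').subset hx'))
    · exact Or.inl (infix_of_mem_brs h)
    · exact ih hn.1 h h'
    · exact Or.inr (Or.inr fun x hx hx' =>
        hd ((infix_of_mem_brs h).subset hx) ((infix_of_mem_brs h').subset hx'))
    · exact Or.inr (Or.inr fun x hx hx' => hd hx' ((infix_of_mem_brs h).subset hx))
    · exact Or.inr (Or.inr fun x hx hx' =>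
        hd ((infix_of_mem_brs h').subset hx') ((infix_of_mem_brs h).subset hx))
    · exact ih' hn.2.1 h h'

theorem not_subset_left {c r : Forest α} (hF : (node c r).Good) (hn : (node c r).leaves.Nodup)
    {l : List α} (h : l ∈ r.brs) (hs : l ⊆ c.leaves) : False := by
  obtain ⟨x, hx⟩ := List.exists_mem_of_ne_nil l (ne_nil_of_mem_brs hF.2.2 h)
  exact List.disjoint_of_nodup_append hn (hs hx) ((infix_of_mem_brs h).subset hx)

theorem mem_brs_left {c r : Forest α} (hF : (node c r).Good) (hn : (node c r).leaves.Nodup)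
    {l : List α} : l ∈ c.brs ↔ l ∈ (node c r).brs ∧ l ⊆ c.leaves ∧ l ≠ c.leaves := by
  constructor
  · intro h
    refine ⟨by simp [h], (infix_of_mem_brs h).subset, ?_⟩
    rintro rfl
    exact lt_irrefl _ (length_lt_of_mem_brs hF.2.1 hF.1 h)
  · rintro ⟨h, h1, h2⟩
    simp only [brs_node, List.mem_cons, List.mem_append] at h
    rcases h with h | h | h
    · exact absurd h h2
    · exact h
    · exact (not_subset_left hF hn h h1).elim

theorem mem_brs_right {c r : Forest α} (hF : (node c r).Good) (hn : (node c r).leaves.Nodup)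
    {l : List α} : l ∈ r.brs ↔ l ∈ (node c r).brs ∧ l ⊆ r.leaves := by
  constructor
  · intro h
    exact ⟨by simp [h], (infix_of_mem_brs h).subset⟩
  · rintro ⟨h, h1⟩
    have hd := List.disjoint_of_nodup_append hn
    obtain ⟨x, hx⟩ := List.exists_mem_of_ne_nil l (ne_nil_of_mem_brs hF h)
    simp only [brs_node, List.mem_cons, List.mem_append] at h
    rcases h with rfl | h | h
    · exact (hd hx (h1 hx)).elim
    · exact (hd ((infix_of_mem_brs h).subset hx) (h1 hx)).elim
    · exact h

theorem brs_nodup {F : Forest α} (hF : F.Good) (hn : F.leaves.Nodup) : F.brs.Nodup := by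
  induction F with
  | nil => simp
  | leaf x r ih => exact ih hF (List.nodup_cons.1 hn).2
  | node c r ih ih' =>
    have hn' := List.nodup_append.1 hn
    rw [brs_node, List.nodup_cons, List.mem_append, List.nodup_append]
    refine ⟨?_, ih hF.2.1 hn'.1, ih' hF.2.2 hn'.2.1, ?_⟩
    · rintro (h | h)
      · exact lt_irrefl _ (length_lt_of_mem_brs hF.2.1 hF.1 h)
      · exact not_subset_left hF hn h fun _ h => h
    · rintro a ha b hb rfl
      exact not_subset_left hF hn hb (infix_of_mem_brs ha).subset

/-- A bracket that starts with the first letter belongs to the first tree. So the bracket of the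
leftmost root vertex is recognised as the longest bracket that is a prefix of the word. -/
theorem length_le_of_mem_brs_node {c r : Forest α} (hF : (node c r).Good)
    (hn : (node c r).leaves.Nodup) {l : List α} (h : l ∈ (node c r).brs)
    (hp : l <+: c.leaves ++ r.leaves) : l.length ≤ c.leaves.length := by
  simp only [brs_node, List.mem_cons, List.mem_append] at h
  rcases h with rfl | h | h
  · exact le_rfl
  · exact (infix_of_mem_brs h).length_le
  · obtain ⟨x, l', rfl⟩ := List.exists_cons_of_ne_nil (ne_nil_of_mem_brs hF.2.2 h)
    obtain ⟨y, t, hy⟩ := List.exists_cons_of_ne_nil (leaves_ne_nil hF.2.1 (by have := hF.1; omega))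
    rw [hy, List.cons_append, List.cons_prefix_cons] at hp
    refine (List.disjoint_of_nodup_append hn (a := x) ?_
      ((infix_of_mem_brs h).subset List.mem_cons_self)).elim
    rw [hy, hp.1]; exact List.mem_cons_self

/-- The forest can be rebuilt from its word and its brackets. The first tree is a leaf if no bracket
starts with the first letter; otherwise its root is the longest bracket that does, and the brackets
below this root and to the right of it are recognised by containment. -/
theorem eq_of_brs {F F' : Forest α} (hF : F.Good) (hF' : F'.Good) (hn : F.leaves.Nodup)
    (hl : F.leaves = F'.leaves) (hb : ∀ l, l ∈ F.brs ↔ l ∈ F'.brs) : F = F' := by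
  induction F generalizing F' with
  | nil =>
    cases F' with
    | nil => rfl
    | leaf x r => simp at hl
    | node c r => exact absurd hl.symm (leaves_ne_nil hF' (by simp [width]))
  | leaf x r ih =>
    cases F' with
    | nil => simp at hl
    | leaf x' r' =>
      obtain ⟨rfl, h'⟩ := List.cons.inj hl
      rw [ih (F' := r') hF hF' (List.nodup_cons.1 hn).2 h' hb]
    | node c r' =>
      obtain ⟨y, t, hy⟩ := List.exists_cons_of_ne_nil
        (leaves_ne_nil hF'.2.1 (by have := hF'.1; omega))
      rw [leaves_node, leaves_leaf, hy, List.cons_append] at hl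
      have h1 : c.leaves ∈ (leaf x r).brs := (hb _).2 (by simp)
      have h2 : x ∈ r.leaves := (infix_of_mem_brs (F := r) h1).subset
        (by rw [hy, (List.cons.inj hl).1]; exact List.mem_cons_self)
      exact ((List.nodup_cons.1 hn).1 h2).elim
  | node c r ih ih' =>
    cases F' with
    | nil => exact absurd hl (leaves_ne_nil hF (by simp [width]))
    | leaf x r' =>
      obtain ⟨y, t, hy⟩ := List.exists_cons_of_ne_nil
        (leaves_ne_nil hF.2.1 (by have := hF.1; omega))
      have hn' : (leaf x r').leaves.Nodup := hl ▸ hn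
      rw [leaves_node, leaves_leaf, hy, List.cons_append] at hl
      have h1 : c.leaves ∈ (leaf x r').brs := (hb _).1 (by simp)
      have h2 : x ∈ r'.leaves := (infix_of_mem_brs (F := r') h1).subset
        (by rw [hy, (List.cons.inj hl).1]; exact List.mem_cons_self)
      exact ((List.nodup_cons.1 hn').1 h2).elim
    | node c' r' =>
      have hn' : (node c' r').leaves.Nodup := hl ▸ hn
      have h1 := length_le_of_mem_brs_node hF' hn' ((hb c.leaves).1 (by simp))
        (by rw [← leaves_node, ← hl]; exact List.prefix_append _ _)
      have h2 := length_le_of_mem_brs_node hF hn ((hb c'.leaves).2 (by simp))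
        (by rw [← leaves_node, hl]; exact List.prefix_append _ _)
      obtain ⟨h3, h4⟩ := List.append_inj hl (le_antisymm h1 h2)
      have hn2 := List.nodup_append.1 hn
      rw [ih hF.2.1 hF'.2.1 hn2.1 h3 fun l => by
          rw [mem_brs_left hF hn, mem_brs_left hF' hn', hb, h3],
        ih' hF.2.2 hF'.2.2 hn2.2.1 h4 fun l => by
          rw [mem_brs_right hF hn, mem_brs_right hF' hn', hb, h4]]

/-- Induction on the number of letters plus the number of brackets. If a bracket is a prefix of the
word, take a longest one, `u`: nestedness forces every other bracket to lie inside `u` or behind it.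
If there is none, the first letter is a tree by itself. -/
theorem exists_of_nested (w : List α) (hw : w.Nodup) (B : Finset (List α))
    (hi : ∀ l ∈ B, l <:+: w) (h2 : ∀ l ∈ B, 2 ≤ l.length)
    (hN : ∀ l ∈ B, ∀ l' ∈ B, Nested l l') :
    ∃ F : Forest α, F.Good ∧ F.leaves = w ∧ ∀ l, l ∈ F.brs ↔ l ∈ B := by
  induction h : w.length + B.card using Nat.strong_induction_on generalizing w B with
  | _ N ih =>
  have hne : ∀ l ∈ B, l ≠ [] := by
    rintro l hl rfl
    simpa using h2 _ hl
  rcases w with _ | ⟨x, w⟩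
  · refine ⟨nil, trivial, rfl, fun l => ?_⟩
    simp only [brs_nil, List.not_mem_nil, false_iff]
    exact fun hl => hne l hl (List.infix_nil.1 (hi l hl))
  by_cases hu : ∃ u ∈ B, u <+: x :: w
  · obtain ⟨u, hu, hmax⟩ := (B.filter (· <+: x :: w)).exists_max_image List.length
      (by obtain ⟨u, hu⟩ := hu; exact ⟨u, Finset.mem_filter.2 hu⟩)
    obtain ⟨huB, hup⟩ := Finset.mem_filter.1 hu
    obtain ⟨t, ht⟩ := id hup
    obtain ⟨u', hu'⟩ : ∃ u', u = x :: u' := by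
      rcases u with _ | ⟨y, u'⟩
      · exact absurd rfl (hne _ huB)
      · exact ⟨u', by rw [(List.cons.inj ht).1]⟩
    have hxu : x ∈ u := by rw [hu']; exact List.mem_cons_self
    have hut : (u ++ t).Nodup := ht ▸ hw
    have hn2 := List.nodup_append.1 hut
    set B₁ := B.filter fun l => l <:+: u ∧ l ≠ u with hB₁
    set B₂ := B.filter fun l => l <:+: t with hB₂
    have hsplit : ∀ l ∈ B, l = u ∨ l ∈ B₁ ∨ l ∈ B₂ := by
      intro l hl
      by_cases hlu : l = u
      · exact Or.inl hlu
      rcases hN l hl u huB with h | h | h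
      · exact Or.inr (Or.inl (Finset.mem_filter.2 ⟨hl, h, hlu⟩))
      · rcases List.infix_cons_iff.1 (hi l hl) with h' | h'
        · have := hmax l (Finset.mem_filter.2 ⟨hl, h'⟩)
          exact absurd (h.eq_of_length_le this).symm hlu
        · exact absurd (h'.subset (h.subset hxu)) (List.nodup_cons.1 hw).1
      · refine Or.inr (Or.inr (Finset.mem_filter.2 ⟨hl, ?_⟩))
        exact infix_of_disjoint (by rw [ht]; exact hi l hl) (hne l hl) h
    have hlen : (u ++ t).length = (x :: w).length := by rw [ht]
    rw [List.length_append] at hlen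
    have hupos : 0 < u.length := List.length_pos_of_mem hxu
    -- Removing `u` itself makes the induction work even when `u` is the whole word.
    have hc1 : B₁.card < B.card := Finset.card_lt_card ⟨Finset.filter_subset _ _, fun hs =>
      (Finset.mem_filter.1 (hs huB)).2.2 rfl⟩
    have hc2 : B₂.card ≤ B.card := Finset.card_le_card (Finset.filter_subset _ _)
    obtain ⟨c, hc, hcl, hcb⟩ := ih (u.length + B₁.card) (by omega) u hn2.1 B₁
      (fun l hl => (Finset.mem_filter.1 hl).2.1) (fun l hl => h2 l (Finset.mem_filter.1 hl).1)
      (fun l hl l' hl' => hN l (Finset.mem_filter.1 hl).1 l' (Finset.mem_filter.1 hl').1) rfl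
    obtain ⟨r, hr, hrl, hrb⟩ := ih (t.length + B₂.card) (by omega) t hn2.2.1 B₂
      (fun l hl => (Finset.mem_filter.1 hl).2) (fun l hl => h2 l (Finset.mem_filter.1 hl).1)
      (fun l hl l' hl' => hN l (Finset.mem_filter.1 hl).1 l' (Finset.mem_filter.1 hl').1) rfl
    -- A single tree below the vertex would be a leaf, against `u` having two letters, or a vertex
    -- whose bracket is again `u`, which is not in `B₁`.
    have hcw : 2 ≤ c.width := by
      by_contra hcw
      rcases c with _ | ⟨y, c⟩ | ⟨c, c'⟩
      · rw [← hcl] at hupos; simp at hupos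
      · rcases c with _ | ⟨z, c⟩ | ⟨c, c'⟩
        · have := h2 u huB
          rw [← hcl] at this
          simp at this
        · simp [width] at hcw
        · simp [width] at hcw
      · rcases c' with _ | ⟨z, c'⟩ | ⟨c', c''⟩
        · have : c.leaves ∈ B₁ := (hcb _).1 (by simp)
          refine (Finset.mem_filter.1 this).2.2 ?_
          rw [← hcl]; simp
        · simp [width] at hcw
        · simp [width] at hcw
    refine ⟨node c r, ⟨hcw, hc, hr⟩, by rw [leaves_node, hcl, hrl, ht], fun l => ?_⟩
    simp only [brs_node, List.mem_cons, List.mem_append, hcb, hrb, hcl]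
    constructor
    · rintro (rfl | h | h)
      exacts [huB, (Finset.mem_filter.1 h).1, (Finset.mem_filter.1 h).1]
    · exact hsplit l
  · obtain ⟨r, hr, hrl, hrb⟩ := ih (w.length + B.card) (by simp at h; omega) w
      (List.nodup_cons.1 hw).2 B (fun l hl => by
        rcases List.infix_cons_iff.1 (hi l hl) with h | h
        · exact absurd ⟨l, hl, h⟩ hu
        · exact h) h2 hN rfl
    exact ⟨leaf x r, hr, by rw [leaves_leaf, hrl], hrb⟩

/-- If no bracket crosses the cut, no tree does: the bracket of the root of a tree contains all
leaves of that tree. -/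
theorem exists_append_of_leaves {F : Forest α} (hF : F.Good) (hn : F.leaves.Nodup) {p q : List α}
    (h : F.leaves = p ++ q) (hb : ∀ l ∈ F.brs, l <:+: p ∨ l <:+: q) :
    ∃ F₁ F₂ : Forest α, F = F₁.append F₂ ∧ F₁.leaves = p ∧ F₂.leaves = q := by
  induction F generalizing p with
  | nil =>
    obtain ⟨rfl, rfl⟩ := List.append_eq_nil_iff.1 h.symm
    exact ⟨nil, nil, rfl, rfl, rfl⟩
  | leaf x r ih =>
    rcases p with _ | ⟨y, p⟩
    · exact ⟨nil, leaf x r, rfl, rfl, h⟩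
    obtain ⟨rfl, h'⟩ := List.cons.inj h
    obtain ⟨F₁, F₂, h1, h2, h3⟩ := ih hF (List.nodup_cons.1 hn).2 h' (by
      intro l hl
      refine (hb l hl).imp (fun h => ?_) id
      refine infix_cons_of_notMem h (ne_nil_of_mem_brs (F := r) hF hl) fun hx => ?_
      exact (List.nodup_cons.1 hn).1 ((infix_of_mem_brs (F := r) hl).subset hx))
    exact ⟨leaf x F₁, F₂, by rw [h1]; rfl, by rw [leaves_leaf, h2], h3⟩
  | node c r _ ih =>
    rcases p with _ | ⟨y, p⟩
    · exact ⟨nil, node c r, rfl, rfl, h⟩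
    have hd := List.disjoint_of_nodup_append hn
    have hd' : (y :: p).Disjoint q := List.disjoint_of_nodup_append (h ▸ hn)
    obtain ⟨z, t, hz⟩ := List.exists_cons_of_ne_nil
      (leaves_ne_nil hF.2.1 (by have := hF.1; omega))
    have hyz : z = y := by
      rw [leaves_node, hz] at h
      exact (List.cons.inj h).1
    have h1 : c.leaves <:+: y :: p := by
      refine (hb c.leaves (by simp)).resolve_right fun h' => ?_
      exact hd' List.mem_cons_self (h'.subset (by rw [hz, hyz]; exact List.mem_cons_self))
    obtain ⟨s, hs⟩ : c.leaves <+: y :: p :=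
      List.prefix_of_prefix_length_le (l₃ := (y :: p) ++ q)
        (by rw [← h]; exact List.prefix_append _ _) (List.prefix_append _ _) h1.length_le
    rw [← hs, leaves_node, List.append_assoc] at h
    obtain ⟨F₁, F₂, h1, h2, h3⟩ := ih hF.2.2 (List.nodup_append.1 hn).2.1
      (List.append_cancel_left h) (by
        intro l hl
        refine (hb l (by simp [hl])).imp (fun h => ?_) id
        rw [← hs] at h
        exact infix_of_disjoint h (ne_nil_of_mem_brs hF.2.2 hl)
          fun x hx hx' => hd hx' ((infix_of_mem_brs hl).subset hx))
    exact ⟨node c F₁, F₂, by rw [h1]; rfl, by rw [leaves_node, h2, hs], h3⟩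

/-- A forest with a vertex arises by replacing a leaf of a smaller forest by a tree. -/
theorem exists_collapse {F : Forest α} (hF : F.Good) (hn : F.leaves.Nodup) (hb : F.brs ≠ []) :
    ∃ (F₀ : Forest α) (x : α) (c : Forest α) (w₁ w₂ : List α),
      F = F₀.graft (fun y => if y = x then node c nil else leaf y nil) ∧
      F₀.Good ∧ F₀.width = F.width ∧ (node c nil).Good ∧ c.brs = [] ∧ x ∈ c.leaves ∧
      F₀.leaves = w₁ ++ x :: w₂ ∧ F.leaves = w₁ ++ (c.leaves ++ w₂) ∧
      F.brs.length = F₀.brs.length + (node c nil).brs.length := by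
  induction F with
  | nil => simp at hb
  | leaf y r ih =>
    obtain ⟨F₀, x, c, w₁, w₂, h1, h2, h3, h4, h0, h5, h6, h7, h8⟩ := ih hF (List.nodup_cons.1 hn).2 hb
    have hyx : y ≠ x := by
      rintro rfl
      refine (List.nodup_cons.1 hn).1 ?_
      rw [h7]; simp [h5]
    refine ⟨leaf y F₀, x, c, y :: w₁, w₂, ?_, h2, by simp [width, h3], h4, h0, h5, by simp [h6],
      by simp [h7], by simpa using h8⟩
    rw [graft, if_neg hyx, ← h1]; rfl
  | node c r ih' _ =>
    have hr : ∀ (x : α) (c' : Forest α), x ∈ c.leaves →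
        (r.graft fun y => if y = x then node c' nil else leaf y nil) = r := by
      intro x c' hx
      conv_rhs => rw [← graft_leaf r]
      refine graft_congr fun y hy => if_neg ?_
      rintro rfl
      exact List.disjoint_of_nodup_append hn hx hy
    by_cases hb' : c.brs = []
    · obtain ⟨x, t, hx⟩ := List.exists_cons_of_ne_nil
        (leaves_ne_nil hF.2.1 (by have := hF.1; omega))
      have hxc : x ∈ c.leaves := by rw [hx]; exact List.mem_cons_self
      -- A tree with no inner vertices is replaced by its first leaf, so that no new label is
      -- needed.
      refine ⟨leaf x r, x, c, [], r.leaves, ?_, hF.2.2, rfl, ⟨hF.1, hF.2.1, trivial⟩, hb', hxc,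
        rfl, rfl, ?_⟩
      · rw [graft, if_pos rfl, hr x c hxc]; rfl
      · simp; omega
    · obtain ⟨F₀, x, c', w₁, w₂, h1, h2, h3, h4, h0, h5, h6, h7, h8⟩ :=
        ih' hF.2.1 (List.nodup_append.1 hn).1 hb'
      have hxc : x ∈ c.leaves := by rw [h7]; simp [h5]
      refine ⟨node F₀ r, x, c', w₁, w₂ ++ r.leaves, ?_, ⟨by rw [h3]; exact hF.1, h2, hF.2.2⟩, rfl,
        h4, h0, h5, by simp [h6], by simp [h7], ?_⟩
      · rw [graft, ← h1, hr x c' hxc]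
      · simp only [brs_node, List.length_cons, List.length_append] at h8 ⊢; omega

end Forest

end

/-! ### The correspondence between bracketings and forests. -/

section

variable {m n : ℕ}

/-- The forest of a bracketing: a tree whose vertices are the brackets. -/
structure LinBr.Rep (b : LinBr n) (F : Forest (Fin (n + 1))) : Prop where
  good : F.Good
  width : F.width = 1
  leaves : F.leaves = b.word
  mem_brs : ∀ l, l ∈ F.brs ↔ l ∈ b.br

/-- A forest of a cyclic bracketing: cut the cyclic word outside of all brackets. -/
structure CycBr.Rep (b : CycBr n) (F : Forest (Fin (n + 1))) : Prop where
  good : F.Good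
  leaves : (F.leaves : Cycle (Fin (n + 1))) = b.word
  mem_brs : ∀ l, l ∈ F.brs ↔ l ∈ b.br

namespace LinBr.Rep

variable {b b' : LinBr n} {F F' : Forest (Fin (n + 1))}

theorem nodup (h : b.Rep F) : F.leaves.Nodup := h.leaves ▸ b.nodup

theorem complete (h : b.Rep F) (x) : x ∈ F.leaves := h.leaves ▸ b.complete x

theorem unique (h : b.Rep F) (h' : b.Rep F') : F = F' :=
  Forest.eq_of_brs h.good h'.good h.nodup (h.leaves.trans h'.leaves.symm) fun l =>
    (h.mem_brs l).trans (h'.mem_brs l).symm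

theorem eq (h : b.Rep F) (h' : b'.Rep F) : b = b' :=
  LinBr.ext (h.leaves.symm.trans h'.leaves) (Finset.ext fun l =>
    (h.mem_brs l).symm.trans (h'.mem_brs l))

theorem card_br (h : b.Rep F) : b.br.card = F.brs.length := by
  have : b.br = F.brs.toFinset := Finset.ext fun l => by rw [List.mem_toFinset, h.mem_brs]
  rw [this, List.toFinset_card_of_nodup (Forest.brs_nodup h.good h.nodup)]

end LinBr.Rep

namespace CycBr.Rep

variable {b b' : CycBr n} {F F' : Forest (Fin (n + 1))}

theorem nodup (h : b.Rep F) : F.leaves.Nodup := Cycle.nodup_coe_iff.1 (h.leaves ▸ b.nodup)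

theorem complete (h : b.Rep F) (x) : x ∈ F.leaves := Cycle.mem_coe_iff.1 (h.leaves ▸ b.complete x)

theorem eq (h : b.Rep F) (h' : b'.Rep F) : b = b' :=
  CycBr.ext (h.leaves.symm.trans h'.leaves) (Finset.ext fun l =>
    (h.mem_brs l).symm.trans (h'.mem_brs l))

theorem card_br (h : b.Rep F) : b.br.card = F.brs.length := by
  have : b.br = F.brs.toFinset := Finset.ext fun l => by rw [List.mem_toFinset, h.mem_brs]
  rw [this, List.toFinset_card_of_nodup (Forest.brs_nodup h.good h.nodup)]

/-- The forest is unique up to cyclic permutations of its trees. -/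
theorem unique (h : b.Rep F) (h' : b.Rep F') :
    ∃ F₁ F₂ : Forest (Fin (n + 1)), F = F₁.append F₂ ∧ F' = F₂.append F₁ := by
  have hr : F.leaves ~r F'.leaves := Cycle.coe_eq_coe.1 (h.leaves.trans h'.leaves.symm)
  obtain ⟨r, hr, h2⟩ := List.isRotated_iff_mod.1 hr
  rw [List.rotate_eq_drop_append_take hr] at h2
  set p := F.leaves.take r
  set q := F.leaves.drop r
  have h1 : F.leaves = p ++ q := (List.take_append_drop _ _).symm
  -- Each bracket is a subword of both linear words, hence crosses neither cut.
  obtain ⟨F₁, F₂, hF, hp, hq⟩ := Forest.exists_append_of_leaves h.good h.nodup h1 fun l hl =>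
    infix_or_of_infix_swap (h1 ▸ h.nodup) (h1 ▸ Forest.infix_of_mem_brs hl)
      (h2 ▸ Forest.infix_of_mem_brs ((h'.mem_brs l).2 ((h.mem_brs l).1 hl)))
  refine ⟨F₁, F₂, hF, ?_⟩
  have hg := Forest.good_append.1 (hF ▸ h.good)
  refine Forest.eq_of_brs h'.good (Forest.good_append.2 ⟨hg.2, hg.1⟩) h'.nodup
    (by rw [Forest.leaves_append, hp, hq, h2]) fun l => ?_
  rw [h'.mem_brs, ← h.mem_brs, hF]
  simp [or_comm]

end CycBr.Rep

/-- The outermost bracket, present as soon as there are two letters, forces the forest to be one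
tree, since a forest with several trees has no bracket around all its leaves. -/
theorem LinBr.exists_rep (b : LinBr n) : ∃ F, b.Rep F := by
  obtain ⟨F, hg, hl, hb⟩ := Forest.exists_of_nested b.word b.nodup b.br b.br_infix b.two_le b.nested
  refine ⟨F, hg, ?_, hl, hb⟩
  have hne := b.word_ne_nil
  rcases Nat.eq_zero_or_pos n with rfl | hn
  · have h1 := Forest.width_le_length hg
    have h2 := b.nodup.length_le_card
    rw [hl] at h1
    simp only [Fintype.card_fin] at h2
    have : F.width ≠ 0 := by
      intro h0
      rcases F with _ | _ | _
      · exact hne hl.symm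
      · simp [Forest.width] at h0
      · simp [Forest.width] at h0
    omega
  · have h3 : F.leaves ∈ F.brs := by rw [hb, hl]; exact b.outer hn
    by_contra hw
    rcases Nat.lt_or_ge F.width 2 with h4 | h4
    · have : F.width = 0 := by omega
      rcases F with _ | _ | _
      · exact hne hl.symm
      · simp [Forest.width] at this
      · simp [Forest.width] at this
    · exact lt_irrefl _ (Forest.length_lt_of_mem_brs hg h4 h3)

/-- Cutting just before a longest bracket cuts no other bracket: those meeting it are contained in
it, and those disjoint from it cannot pass over its first letter. It reduces cyclic bracketings to
linear words. -/
theorem CycBr.exists_word (b : CycBr n) : ∃ w : List (Fin (n + 1)),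
    (w : Cycle (Fin (n + 1))) = b.word ∧ ∀ l ∈ b.br, l <:+: w := by
  rcases b.br.eq_empty_or_nonempty with he | hne
  · obtain ⟨w, hw⟩ := Quotient.exists_rep b.word
    exact ⟨w, hw, by simp [he]⟩
  obtain ⟨u, hu, hmax⟩ := b.br.exists_max_image List.length hne
  obtain ⟨w', hw', s, t, hst⟩ := b.br_infix u hu
  have hrot : (s ++ u ++ t) ~r (u ++ (t ++ s)) := by
    rw [List.append_assoc, ← List.append_assoc u]; exact List.isRotated_append
  have hw : ((u ++ (t ++ s) : List (Fin (n + 1))) : Cycle (Fin (n + 1))) = b.word := by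
    rw [← hw', ← hst]; exact (Cycle.coe_eq_coe.2 hrot).symm
  have hlne : ∀ l ∈ b.br, l ≠ [] := by
    rintro l hl rfl
    simpa using b.two_le _ hl
  refine ⟨_, hw, fun l hl => ?_⟩
  rcases b.nested l hl u hu with h | h | h
  · exact h.trans (List.prefix_append _ _).isInfix
  · rw [← h.eq_of_length_le (hmax l hl)]; exact (List.prefix_append _ _).isInfix
  · obtain ⟨w'', hw'', s', t', hst'⟩ := b.br_infix l hl
    have h1 : (u ++ (t ++ s)) ~r (l ++ (t' ++ s')) := by
      refine Cycle.coe_eq_coe.1 (hw.trans (hw''.symm.trans ?_))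
      rw [← hst', List.append_assoc, ← List.append_assoc l]
      exact Cycle.coe_eq_coe.2 List.isRotated_append
    obtain ⟨r, hr, h2⟩ := List.isRotated_iff_mod.1 h1
    rw [List.rotate_eq_drop_append_take hr] at h2
    set x := (u ++ (t ++ s)).take r
    set y := (u ++ (t ++ s)).drop r
    have hxy : u ++ (t ++ s) = x ++ y := (List.take_append_drop _ _).symm
    have hlp : l <+: y ++ x := ⟨_, h2.symm⟩
    -- The word is `x ++ y`, and `l` starts where `y` starts. If `l` did not fit into `y` it would
    -- run on into `x`, whose first letter is the first letter of `u`.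
    rcases le_total l.length y.length with hle | hle
    · rw [hxy]
      exact (List.prefix_of_prefix_length_le hlp (List.prefix_append _ _) hle).isInfix.trans
        (List.suffix_append _ _).isInfix
    · obtain ⟨z, hz⟩ := List.prefix_of_prefix_length_le (List.prefix_append _ _) hlp hle
      have h3 : z <+: x := by
        rw [← hz] at hlp
        exact (List.prefix_append_right_inj _).1 hlp
      have hz := hz.symm
      rcases z with _ | ⟨a, z⟩
      · rw [hxy, hz, List.append_nil]; exact (List.suffix_append _ _).isInfix
      · obtain ⟨x', hx'⟩ := h3
        obtain ⟨c, u', rfl⟩ := List.exists_cons_of_ne_nil (hlne _ hu)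
        rw [← hx'] at hxy
        simp only [List.cons_append] at hxy
        refine (h (a := a) (by rw [hz]; simp) ?_).elim
        rw [(List.cons.inj hxy).1]; exact List.mem_cons_self

theorem CycBr.exists_rep (b : CycBr n) : ∃ F, b.Rep F := by
  obtain ⟨w, hw, hi⟩ := b.exists_word
  have hn : w.Nodup := Cycle.nodup_coe_iff.1 (hw ▸ b.nodup)
  obtain ⟨F, hg, hl, hb⟩ := Forest.exists_of_nested w hn b.br hi b.two_le b.nested
  exact ⟨F, hg, by rw [hl, hw], hb⟩

theorem LinBr.exists_of_forest {F : Forest (Fin (n + 1))} (hg : F.Good) (hw : F.width = 1)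
    (hn : F.leaves.Nodup) (hc : ∀ x, x ∈ F.leaves) : ∃ b : LinBr n, b.Rep F := by
  refine ⟨⟨F.leaves, hn, hc, F.brs.toFinset, ?_, ?_, ?_, ?_⟩, ⟨hg, hw, rfl, fun l => by simp⟩⟩
  · exact fun l hl => Forest.infix_of_mem_brs (List.mem_toFinset.1 hl)
  · exact fun l hl => Forest.two_le_of_mem_brs hg (List.mem_toFinset.1 hl)
  · exact fun l hl l' hl' =>
      Forest.nested_of_mem_brs hn (List.mem_toFinset.1 hl) (List.mem_toFinset.1 hl')
  · intro hpos
    have hlen : 2 ≤ F.leaves.length := by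
      have h1 : F.leaves.toFinset = Finset.univ :=
        Finset.eq_univ_of_forall fun x => List.mem_toFinset.2 (hc x)
      have h2 := List.toFinset_card_of_nodup hn
      rw [h1, Finset.card_univ, Fintype.card_fin] at h2
      omega
    rcases F with _ | ⟨x, _ | _ | _⟩ | ⟨c, _ | _ | _⟩ <;> simp [Forest.width] at hw hlen ⊢

theorem CycBr.exists_of_forest {F : Forest (Fin (n + 1))} (hg : F.Good)
    (hn : F.leaves.Nodup) (hc : ∀ x, x ∈ F.leaves) : ∃ b : CycBr n, b.Rep F := by
  refine ⟨⟨F.leaves, Cycle.nodup_coe_iff.2 hn, fun x => Cycle.mem_coe_iff.2 (hc x),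
    F.brs.toFinset, ?_, ?_, ?_⟩, ⟨hg, rfl, fun l => by simp⟩⟩
  · exact fun l hl => ⟨_, rfl, Forest.infix_of_mem_brs (List.mem_toFinset.1 hl)⟩
  · exact fun l hl => Forest.two_le_of_mem_brs hg (List.mem_toFinset.1 hl)
  · exact fun l hl l' hl' =>
      Forest.nested_of_mem_brs hn (List.mem_toFinset.1 hl) (List.mem_toFinset.1 hl')

/-! ### Relabelling of forests. -/

section Relabel

theorem LinBr.Rep.relabel {b : LinBr n} {F} (h : b.Rep F) (σ : Equiv.Perm (Fin (n + 1))) :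
    (b.relabel σ).Rep (F.map ⇑(σ⁻¹)) := by
  refine ⟨Forest.good_map.2 h.good, by rw [Forest.width_map, h.width],
    by rw [Forest.leaves_map, h.leaves]; rfl, fun l => ?_⟩
  rw [Forest.brs_map, List.mem_map]
  change _ ↔ l ∈ relabelBr σ b.br
  simp only [relabelBr, Finset.mem_image, h.mem_brs]

theorem CycBr.Rep.relabel {b : CycBr n} {F} (h : b.Rep F) (σ : Equiv.Perm (Fin (n + 1))) :
    (b.relabel σ).Rep (F.map ⇑(σ⁻¹)) := by
  refine ⟨Forest.good_map.2 h.good, ?_, fun l => ?_⟩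
  · rw [Forest.leaves_map, ← Cycle.map_coe, h.leaves]; rfl
  · rw [Forest.brs_map, List.mem_map]
    change _ ↔ l ∈ relabelBr σ b.br
    simp only [relabelBr, Finset.mem_image, h.mem_brs]

end Relabel

/-! ### Composition of bracketings as grafting of forests. -/

section Composition

/-- What replaces the leaf `j` when `G` is inserted at the leaf `i`. -/
def Forest.insertAt (i : Fin (m + 1)) (G : Forest (Fin (n + 1))) (j : Fin (m + 1)) :
    Forest (Fin (m + n + 1)) :=
  if j = i then G.map (inLab n i) else Forest.leaf (outLab n i j) Forest.nil

/-- Insert the tree `G` at the leaf `i`. -/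
def Forest.comp (i : Fin (m + 1)) (F : Forest (Fin (m + 1))) (G : Forest (Fin (n + 1))) :
    Forest (Fin (m + n + 1)) := F.graft (Forest.insertAt i G)

theorem Forest.leaves_insertAt (i : Fin (m + 1)) (G : Forest (Fin (n + 1))) (j : Fin (m + 1)) :
    (Forest.insertAt i G j).leaves =
      if j = i then G.leaves.map (inLab n i) else [outLab n i j] := by
  simp only [insertAt]
  split <;> simp

theorem Forest.leaves_comp (i : Fin (m + 1)) (F : Forest (Fin (m + 1)))
    (G : Forest (Fin (n + 1))) : (F.comp i G).leaves = substWord i G.leaves F.leaves := by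
  simp only [comp, leaves_graft, leaves_insertAt]
  rfl

theorem Forest.mem_brs_comp {i : Fin (m + 1)} {F : Forest (Fin (m + 1))}
    {G : Forest (Fin (n + 1))} (hi : i ∈ F.leaves) {l} : l ∈ (F.comp i G).brs ↔
      (∃ u ∈ F.brs, substWord i G.leaves u = l) ∨ ∃ u ∈ G.brs, u.map (inLab n i) = l := by
  rw [comp, mem_brs_graft]
  simp only [leaves_insertAt]
  refine or_congr ⟨?_, ?_⟩ ⟨?_, ?_⟩
  · rintro ⟨u, hu, h⟩; exact ⟨u, hu, h.symm⟩
  · rintro ⟨u, hu, h⟩; exact ⟨u, hu, h.symm⟩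
  · rintro ⟨x, hx, h⟩
    simp only [insertAt] at h
    split at h
    · simpa using h
    · simp at h
  · rintro ⟨u, hu, h⟩
    exact ⟨i, hi, by rw [insertAt, if_pos rfl, brs_map, ← h]; exact List.mem_map_of_mem hu⟩

theorem Forest.good_comp {i : Fin (m + 1)} {F : Forest (Fin (m + 1))}
    {G : Forest (Fin (n + 1))} (hF : F.Good) (hG : G.Good) (hw : G.width = 1) :
    (F.comp i G).Good ∧ (F.comp i G).width = F.width := by
  have h1 : ∀ j, (insertAt i G j).width = 1 := fun j => by
    simp only [insertAt]; split
    · rw [width_map, hw]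
    · rfl
  refine ⟨good_graft h1 (fun j => ?_) hF, width_graft h1 F⟩
  simp only [insertAt]; split
  · exact good_map.2 hG
  · trivial

theorem LinBr.Rep.comp {b : LinBr m} {b' : LinBr n} {F G} (h : b.Rep F) (h' : b'.Rep G)
    (i : Fin (m + 1)) : (b.comp i b').Rep (F.comp i G) := by
  have hg := Forest.good_comp (i := i) h.good h'.good h'.width
  refine ⟨hg.1, hg.2.trans h.width, ?_, fun l => ?_⟩
  · rw [Forest.leaves_comp, h.leaves, h'.leaves]; rfl
  · rw [Forest.mem_brs_comp (h.complete i)]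
    change _ ↔ l ∈ brComp i b.br b'
    simp only [brComp, Finset.mem_union, Finset.mem_image, h.mem_brs, h'.mem_brs, h'.leaves]

theorem CycBr.Rep.comp {b : CycBr m} {b' : LinBr n} {F G} (h : b.Rep F) (h' : b'.Rep G)
    (i : Fin (m + 1)) : (b.comp i b').Rep (F.comp i G) := by
  have hg := Forest.good_comp (i := i) h.good h'.good h'.width
  refine ⟨hg.1, ?_, fun l => ?_⟩
  · rw [Forest.leaves_comp, h'.leaves, ← substCycle_coe, h.leaves]; rfl
  · rw [Forest.mem_brs_comp (h.complete i)]
    change _ ↔ l ∈ brComp i b.br b'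
    simp only [brComp, Finset.mem_union, Finset.mem_image, h.mem_brs, h'.mem_brs, h'.leaves]

/-- A forest with a vertex is, up to a renaming of the leaves, a composite. -/
theorem Forest.exists_comp {F : Forest (Fin (n + 1))} (hF : F.Good) (hn : F.leaves.Nodup)
    (hc : ∀ x, x ∈ F.leaves) (hb : F.brs ≠ []) :
    ∃ (m' n' : ℕ) (h : n = m' + n') (G : Forest (Fin (m' + 1))) (c : Forest (Fin (n' + 1)))
      (σ : Equiv.Perm (Fin (n + 1))),
      F = (h ▸ G.comp 0 (node c nil) : Forest (Fin (n + 1))).map ⇑(σ⁻¹) ∧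
      G.Good ∧ G.width = F.width ∧ G.leaves.Nodup ∧ (∀ x, x ∈ G.leaves) ∧
      (node c nil).Good ∧ (node c nil).leaves.Nodup ∧ (∀ x, x ∈ (node c nil).leaves) ∧
      c.brs = [] ∧ F.brs.length = G.brs.length + 1 := by
  obtain ⟨F₀, x₀, c, w₁, w₂, h1, h2, h3, h4, h0, h5, h6, h7, h8⟩ := exists_collapse hF hn hb
  have hlen : F.leaves.length = n + 1 := by
    have h1 : F.leaves.toFinset = Finset.univ :=
      Finset.eq_univ_of_forall fun x => List.mem_toFinset.2 (hc x)
    rw [← List.toFinset_card_of_nodup hn, h1, Finset.card_univ, Fintype.card_fin]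
  obtain ⟨n', hn'⟩ : ∃ n', c.leaves.length = n' + 1 :=
    ⟨c.leaves.length - 1, by have := List.length_pos_of_mem h5; omega⟩
  obtain ⟨m', hm'⟩ : ∃ m', m' = w₁.length + w₂.length := ⟨_, rfl⟩
  have hnm : n = m' + n' := by
    rw [h7] at hlen; simp at hlen; omega
  subst hnm
  -- The letters are renumbered so that those of the collapsed tree come first. The insertion then
  -- takes place at the letter 0, and a letter of the composite is its position in this list.
  set ord := c.leaves ++ (w₁ ++ w₂) with hord
  have hperm : ord.Perm F.leaves := by
    rw [hord, h7, ← List.append_assoc, ← List.append_assoc]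
    exact List.perm_append_comm.append_right _
  have hon : ord.Nodup := hperm.nodup_iff.2 hn
  have hol : ord.length = m' + n' + 1 := hperm.length_eq.trans hlen
  have hoc : ∀ x, x ∈ ord := fun x => hperm.mem_iff.2 (hc x)
  let e : Equiv.Perm (Fin (m' + n' + 1)) := (finCongr hol.symm).trans
    (List.Nodup.getEquivOfForallMemList ord hon hoc)
  let pos : Fin (m' + n' + 1) → Fin (m' + n' + 1) := e.symm
  have hpos : ∀ j (hj : j < ord.length), pos ord[j] = ⟨j, by omega⟩ := by
    intro j hj
    change e.symm _ = _
    rw [Equiv.symm_apply_eq]; rfl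
  have hdn := List.nodup_append.1 hon
  have hposc : ∀ x ∈ c.leaves, (pos x : ℕ) ≤ n' := by
    intro x hx
    obtain ⟨j, hj, rfl⟩ := List.getElem_of_mem hx
    have : c.leaves[j] = ord[j]'(by rw [hord, List.length_append]; omega) := by
      rw [List.getElem_append_left hj]
    rw [this, hpos]
    simp only; omega
  have hposw : ∀ x ∈ w₁ ++ w₂, n' < (pos x : ℕ) := by
    intro x hx
    obtain ⟨j, hj, rfl⟩ := List.getElem_of_mem hx
    have : (w₁ ++ w₂)[j] = ord[c.leaves.length + j]'(by
        rw [List.length_append] at hj; omega) := by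
      refine Eq.trans ?_ (List.getElem_append_right (by omega)).symm
      congr 1; omega
    rw [this, hpos]
    simp only; omega
  have hxw : ∀ y ∈ w₁ ++ w₂, y ≠ x₀ := by
    rintro y hy rfl
    exact hdn.2.2 _ h5 _ hy rfl
  have hF₀ : ∀ y, y ∈ F₀.leaves ↔ y = x₀ ∨ y ∈ w₁ ++ w₂ := by
    intro y; rw [h6]; simp; tauto
  -- Outer letters are shifted down by `n'`, which leaves 0 for the collapsed tree. The `min` in `f`
  -- only makes it total; on the leaves of `c` it has no effect.
  let g : Fin (m' + n' + 1) → Fin (m' + 1) := fun y =>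
    if y = x₀ then 0 else ⟨(pos y : ℕ) - n', by omega⟩
  let f : Fin (m' + n' + 1) → Fin (n' + 1) := fun y => ⟨min (pos y) n', by omega⟩
  have hf : ∀ y ∈ c.leaves, inLab n' (0 : Fin (m' + 1)) (f y) = pos y := by
    intro y hy
    have := hposc y hy
    ext; simp [inLab, f, this]
  have hg0 : ∀ y ∈ w₁ ++ w₂, g y ≠ 0 ∧ outLab n' (0 : Fin (m' + 1)) (g y) = pos y := by
    intro y hy
    have h10 := hposw y hy
    have h11 : g y = ⟨(pos y : ℕ) - n', by omega⟩ := if_neg (hxw y hy)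
    constructor
    · intro h
      rw [h11] at h
      have := congrArg Fin.val h
      simp at this
      omega
    · rw [h11]
      refine Fin.ext ?_
      have h12 : ¬ ((pos y : ℕ) - n' ≤ 0) := by omega
      exact (if_neg h12).trans (by simp only; omega)
  have hgl : (F₀.map g).leaves.Nodup := by
    have hn0 : F₀.leaves.Nodup := by
      rw [h6]
      have h10 : (w₁ ++ w₂).Nodup := hdn.2.1
      rw [List.nodup_middle, List.nodup_cons]
      exact ⟨fun h => hxw _ h rfl, h10⟩
    rw [leaves_map]
    refine List.Nodup.map_on ?_ hn0
    intro y hy z hz hyz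
    rcases (hF₀ y).1 hy with rfl | hy <;> rcases (hF₀ z).1 hz with rfl | hz
    · rfl
    · exact absurd hyz.symm (by rw [show g y = 0 from if_pos rfl]; exact (hg0 z hz).1)
    · exact absurd hyz (by rw [show g z = 0 from if_pos rfl]; exact (hg0 y hy).1)
    · have := (hg0 y hy).2
      rw [hyz, (hg0 z hz).2] at this
      exact (e.symm.injective this).symm
  have hcl : ((node c nil).map f).leaves.Nodup := by
    simp only [map, leaves_node, leaves_nil, List.append_nil, leaves_map]
    refine List.Nodup.map_on ?_ hdn.1
    intro y hy z hz hyz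
    have := hf y hy
    rw [hyz, hf z hz] at this
    exact (e.symm.injective this).symm
  have hcomplete : ∀ {N : ℕ} {l : List (Fin N)}, l.Nodup → l.length = N → ∀ x, x ∈ l := by
    intro N l hl hN x
    have : l.toFinset = Finset.univ := Finset.eq_univ_of_card _ (by
      rw [List.toFinset_card_of_nodup hl, hN, Fintype.card_fin])
    rw [← List.mem_toFinset, this]; exact Finset.mem_univ _
  refine ⟨m', n', rfl, F₀.map g, c.map f, e⁻¹, ?_, good_map.2 h2, by rw [width_map, h3], hgl,
    hcomplete hgl (by rw [leaves_map, List.length_map, h6]; simp; omega),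
    good_map.2 h4, hcl, hcomplete hcl (by simp [hn']),
    by rw [brs_map, h0]; rfl, by rw [h8, brs_map, List.length_map]; simp [h0]⟩
  rw [inv_inv]
  have h9 : F.map pos = (F₀.map g).comp 0 (node (c.map f) nil) := by
    rw [h1, map_graft, comp, graft_map]
    refine graft_congr fun y hy => ?_
    rcases (hF₀ y).1 hy with rfl | hy
    · rw [if_pos rfl, Function.comp, show g y = 0 from if_pos rfl, insertAt, if_pos rfl]
      simp only [map, map_map]
      congr 1
      exact map_congr fun z hz => (hf z hz).symm
    · rw [if_neg (hxw y hy), Function.comp, insertAt, if_neg (hg0 y hy).1, (hg0 y hy).2]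
      rfl
  change F = ((F₀.map g).comp 0 (node (c.map f) nil)).map e
  rw [← h9, map_map]
  have : (⇑e ∘ pos) = id := by funext y; exact e.apply_symm_apply y
  rw [this]
  conv_lhs => rw [← graft_leaf F]
  clear * -
  induction F with
  | nil => rfl
  | leaf x r ih => simp only [graft, append, map, ih, id]
  | node c r ih ih' => simp only [graft, map, ih, ih']

end Composition

end

section

variable {k : Type u} [Field k] {m n : ℕ}

local notation "ι" => ExteriorAlgebra.ι k

/-! ### Linear independence of the gap sums of the brackets. -/

section Triangular

theorem sumOver_single_of_notMem {l : List (Fin (n + 1))} {x} (h : x ∉ l) :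
    sumOver k l (Pi.single x 1) = 0 :=
  sumOver_eq_zero fun y hy => by
    rw [Pi.single_eq_of_ne]
    rintro rfl
    exact h hy

theorem sumOver_single_of_mem {l : List (Fin (n + 1))} (hl : l.Nodup) {x} (h : x ∈ l) :
    sumOver k l (Pi.single x 1) = 1 := by
  induction l with
  | nil => simp at h
  | cons y l ih =>
    rw [List.nodup_cons] at hl
    rw [sumOver_cons]
    rcases List.mem_cons.1 h with rfl | h
    · rw [sumOver_single_of_notMem hl.1]; simp
    · rw [ih hl.2 h, Pi.single_eq_of_ne, zero_add]
      rintro rfl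
      exact hl.1 h

/-- The last letter of a word has no gap to its right inside the word, hence names no gap of any
bracket. -/
theorem notMem_dropLast_of_infix {α : Type*} {u w : List α} {x : α} (hn : (w ++ [x]).Nodup)
    (h : u <:+: w ++ [x]) : x ∉ u.dropLast := by
  rcases List.eq_nil_or_concat u with rfl | ⟨u, y, rfl⟩
  · simp
  obtain ⟨s, t, hst⟩ := h
  rw [List.concat_eq_append] at hst ⊢
  rw [List.dropLast_concat]
  intro hx
  have h1 : (s ++ u ++ ([y] ++ t)) = w ++ [x] := by rw [← hst]; simp
  rcases List.eq_nil_or_concat t with rfl | ⟨t, z, rfl⟩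
  · rw [List.append_nil] at h1
    obtain ⟨h2, -⟩ := List.append_inj' h1 rfl
    exact last_notMem_dropLast hn (h2 ▸ by simp [hx])
  · rw [List.concat_eq_append, ← List.append_assoc, ← List.append_assoc] at h1
    obtain ⟨h2, -⟩ := List.append_inj' h1 rfl
    exact last_notMem_dropLast hn (h2 ▸ by simp [hx])

theorem tri_append (P Q : List (Module.Dual k (Fin (n + 1) → k) × (Fin (n + 1) → k))) :
    Tri (P ++ Q) ↔ Tri P ∧ Tri Q ∧ ∀ p ∈ P, ∀ q ∈ Q, q.1 p.2 = 0 := by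
  induction P with
  | nil => simp [Tri]
  | cons p P ih =>
    simp only [List.cons_append, Tri, ih, List.mem_append, List.mem_cons]
    constructor
    · rintro ⟨h1, h2, h3, h4, h5⟩
      refine ⟨⟨h1, fun q hq => h2 q (Or.inl hq), h3⟩, h4, ?_⟩
      rintro p' (rfl | hp) q hq
      exacts [h2 q (Or.inr hq), h5 p' hp q hq]
    · rintro ⟨⟨h1, h2, h3⟩, h4, h5⟩
      refine ⟨h1, ?_, h3, h4, fun p' hp q hq => h5 p' (Or.inr hp) q hq⟩
      rintro q (hq | hq)
      exacts [h2 q hq, h5 p (Or.inl rfl) q hq]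

/-- The gap between the first two trees lies inside no tree, hence inside no bracket; it is named by
the last letter of the first tree. -/
theorem Forest.exists_first_gap {c : Forest (Fin (n + 1))} (hc : c.Good) (h2 : 2 ≤ c.width)
    (hn : c.leaves.Nodup) : ∃ g ∈ c.leaves.dropLast, ∀ u ∈ c.brs, g ∉ u.dropLast := by
  cases c with
  | nil => simp [width] at h2
  | leaf g r =>
    have hr : r.leaves ≠ [] := leaves_ne_nil hc (by simp [width] at h2; omega)
    refine ⟨g, ?_, fun u hu hg => ?_⟩
    · rw [leaves_leaf, List.dropLast_cons_of_ne_nil hr]; exact List.mem_cons_self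
    · exact (List.nodup_cons.1 hn).1
        ((infix_of_mem_brs (F := r) hu).subset (List.dropLast_subset _ hg))
  | node c r =>
    have hr : r.leaves ≠ [] := leaves_ne_nil hc.2.2 (by simp [width] at h2; omega)
    have hcn : c.leaves ≠ [] := leaves_ne_nil hc.2.1 (by have := hc.1; omega)
    have hg := List.dropLast_append_getLast hcn
    set g := c.leaves.getLast hcn
    have hgc : g ∈ c.leaves := List.getLast_mem hcn
    have hcd : (c.leaves.dropLast ++ [g]).Nodup := by rw [hg]; exact (List.nodup_append.1 hn).1
    refine ⟨g, ?_, fun u hu => ?_⟩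
    · rw [leaves_node, List.dropLast_append_of_ne_nil hr]; simp [hgc]
    · simp only [brs_node, List.mem_cons, List.mem_append] at hu
      rcases hu with rfl | hu | hu
      · exact notMem_dropLast_of_infix hcd (by rw [hg])
      · exact notMem_dropLast_of_infix hcd (by rw [hg]; exact infix_of_mem_brs hu)
      · exact fun hg => List.disjoint_of_nodup_append hn hgc
          ((infix_of_mem_brs hu).subset (List.dropLast_subset _ hg))

/-- To a vertex belongs the gap between its first two children. Its unit vector has value 1 on the
gap sum of the vertex and 0 on those of the later brackets, which lie below the vertex or to the
right of it. So the gap sums form a triangular system over any field. -/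
theorem Forest.exists_tri {F : Forest (Fin (n + 1))} (hF : F.Good) (hn : F.leaves.Nodup) :
    ∃ P : List (Module.Dual k (Fin (n + 1) → k) × (Fin (n + 1) → k)),
      P.map Prod.fst = F.brs.map (gapSum k) ∧ Tri P ∧
      ∀ p ∈ P, ∃ x ∈ F.leaves, p.2 = Pi.single x 1 := by
  induction F with
  | nil => exact ⟨[], rfl, trivial, by simp⟩
  | leaf x r ih =>
    obtain ⟨P, h1, h2, h3⟩ := ih hF (List.nodup_cons.1 hn).2
    exact ⟨P, h1, h2, fun p hp => by obtain ⟨y, hy, h⟩ := h3 p hp; exact ⟨y, by simp [hy], h⟩⟩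
  | node c r ih ih' =>
    have hn' := List.nodup_append.1 hn
    have hd := List.disjoint_of_nodup_append hn
    obtain ⟨P, h1, h2, h3⟩ := ih hF.2.1 hn'.1
    obtain ⟨Q, h4, h5, h6⟩ := ih' hF.2.2 hn'.2.1
    obtain ⟨g, hg, hgb⟩ := exists_first_gap hF.2.1 hF.1 hn'.1
    have hQ : ∀ x ∈ c.leaves, ∀ q ∈ Q, q.1 (Pi.single x 1) = 0 := by
      intro x hx q hq
      have : q.1 ∈ Q.map Prod.fst := List.mem_map_of_mem hq
      rw [h4] at this
      obtain ⟨u, hu, hq⟩ := List.mem_map.1 this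
      rw [← hq]
      exact sumOver_single_of_notMem fun hx' => hd hx
        ((infix_of_mem_brs hu).subset (List.dropLast_subset _ hx'))
    refine ⟨(gapSum k c.leaves, Pi.single g 1) :: (P ++ Q), by simp [h1, h4], ⟨?_, ?_, ?_⟩, ?_⟩
    · exact sumOver_single_of_mem (hn'.1.sublist (List.dropLast_sublist _)) hg
    · intro q hq
      rcases List.mem_append.1 hq with hq | hq
      · have : q.1 ∈ P.map Prod.fst := List.mem_map_of_mem hq
        rw [h1] at this
        obtain ⟨u, hu, hq⟩ := List.mem_map.1 this
        rw [← hq]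
        exact sumOver_single_of_notMem (hgb u hu)
      · exact hQ g (List.dropLast_subset _ hg) q hq
    · refine (tri_append P Q).2 ⟨h2, h5, fun p hp q hq => ?_⟩
      obtain ⟨x, hx, h⟩ := h3 p hp
      rw [h]; exact hQ x hx q hq
    · intro p hp
      rcases List.mem_cons.1 hp with rfl | hp
      · exact ⟨g, by simp [List.dropLast_subset _ hg], rfl⟩
      rcases List.mem_append.1 hp with hp | hp
      · obtain ⟨x, hx, h⟩ := h3 p hp; exact ⟨x, by simp [hx], h⟩
      · obtain ⟨x, hx, h⟩ := h6 p hp; exact ⟨x, by simp [hx], h⟩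

end Triangular

/-! ### Oriented cells. -/

section Orientation

/-- The orientation of the cell with the brackets `L` (in this order) in the hyperplane
`ker φ`. -/
def orient (φ : Module.Dual k (Fin (n + 1) → k)) (L : List (List (Fin (n + 1)))) :
    ExteriorAlgebra k (Fin (n + 1) → k) := contr (φ :: L.map (gapSum k)) (vol k (n + 1))

theorem orient_swap (φ : Module.Dual k (Fin (n + 1) → k)) (L₁ L₂ L₃ : List (List (Fin (n + 1)))) :
    orient φ (L₁ ++ (L₂ ++ L₃)) =
      sg (L₂.length * L₃.length) • orient φ (L₁ ++ (L₃ ++ L₂)) := by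
  rw [orient, orient, List.map_append, List.map_append, List.map_append, List.map_append,
    contr_cons, contr_cons, contr_append, contr_swap, contr_units, map_units_int, ← contr_append]
  simp

variable {X : FacePoset k n} {b : X.Cell} {F : Forest (Fin (n + 1))}
  {φ : Module.Dual k (Fin (n + 1) → k)}

theorem orient_mem (hh : X.hull b = LinearMap.ker φ) (hb : ∀ l, l ∈ F.brs ↔ l ∈ X.br b) {d : ℕ}
    (hd : F.brs.length + d = n) : orient φ F.brs ∈ ((X.dir b).map ι) ^ d := by
  refine pow_map_mono ?_ d (contr_mem (S := ⊤) _ (d := d) ?_)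
  · intro v hv
    simp only [Submodule.mem_inf, Submodule.mem_iInf, List.mem_cons, List.mem_map] at hv
    refine X.mem_dir.2 ⟨by rw [hh]; exact hv.2 _ (Or.inl rfl), fun l hl => ?_⟩
    exact hv.2 _ (Or.inr ⟨l, (hb l).2 hl, rfl⟩)
  · have := vol_mem (k := k) (n := n + 1)
    convert this using 2
    simp; omega

/-- All gap sums vanish on the unit vector of the last letter, so the functional that defines the
hull can be put in front of the triangular system. -/
theorem exists_tri_cons (hF : F.Good) (hn : F.leaves.Nodup) {w : List (Fin (n + 1))} {x}
    (hw : F.leaves = w ++ [x]) (hφ : φ (Pi.single x 1) = 1) :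
    ∃ P, P.map Prod.fst = φ :: F.brs.map (gapSum k) ∧ Tri P := by
  obtain ⟨P, h1, h2, -⟩ := Forest.exists_tri (k := k) hF hn
  refine ⟨(φ, Pi.single x 1) :: P, by simp [h1], hφ, fun q hq => ?_, h2⟩
  have : q.1 ∈ P.map Prod.fst := List.mem_map_of_mem hq
  rw [h1] at this
  obtain ⟨u, hu, hq⟩ := List.mem_map.1 this
  rw [← hq]
  exact sumOver_single_of_notMem (notMem_dropLast_of_infix (hw ▸ hn)
    (hw ▸ Forest.infix_of_mem_brs hu))

/-- An element of the exterior power of the direction space is contracted to zero by the hull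
functional and by all gap sums, so `exists_eq_smul_contr` applies to it. -/
theorem exists_smul_orient (hF : F.Good) (hn : F.leaves.Nodup) {w : List (Fin (n + 1))} {x}
    (hw : F.leaves = w ++ [x]) (hφ : φ (Pi.single x 1) = 1)
    (hh : X.hull b = LinearMap.ker φ) (hb : ∀ l, l ∈ F.brs ↔ l ∈ X.br b) {d : ℕ}
    (hd : F.brs.length + d = n) {ω} (hω : ω ∈ ((X.dir b).map ι) ^ d) :
    ∃ c : k, ω = c • orient φ F.brs := by
  obtain ⟨P, h1, h2⟩ := exists_tri_cons hF hn hw hφ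
  obtain ⟨c, hc⟩ := exists_eq_smul_contr (exists_smul_vol (k := k) (n := n + 1)) P h2 (d := d)
    (by
      have := congrArg List.length h1
      simp at this
      omega) (by
      have := pow_map_mono (le_top : X.dir b ≤ ⊤) d hω
      rwa [Submodule.map_top] at this) (by
      intro q hq
      have : q.1 ∈ P.map Prod.fst := List.mem_map_of_mem hq
      rw [h1] at this
      refine contractLeft_eq_zero _ (fun v hv => ?_) _ _ hω
      obtain ⟨h3, h4⟩ := X.mem_dir.1 hv
      rcases List.mem_cons.1 this with h | h
      · rw [h]; rw [hh] at h3; exact h3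
      · obtain ⟨u, hu, h⟩ := List.mem_map.1 h
        rw [← h]; exact h4 u ((hb u).1 hu))
  exact ⟨c, by rw [hc, h1]; rfl⟩

theorem orient_ne_zero (hF : F.Good) (hn : F.leaves.Nodup) {w : List (Fin (n + 1))} {x}
    (hw : F.leaves = w ++ [x]) (hφ : φ (Pi.single x 1) = 1) : orient φ F.brs ≠ 0 := by
  obtain ⟨P, h1, h2⟩ := exists_tri_cons hF hn hw hφ
  rw [orient, ← h1]
  exact contr_ne_zero vol_ne_zero ι_mul_vol P h2

/-- The functionals of the relabelled cell pull back to the original ones, and the volume form is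
multiplied by the sign of the permutation. -/
theorem map_push_orient {φ' : Module.Dual k (Fin (n + 1) → k)} (σ : Equiv.Perm (Fin (n + 1)))
    (h : φ' ∘ₗ push ⇑σ = φ) (L : List (List (Fin (n + 1)))) :
    ExteriorAlgebra.map (push ⇑σ) (orient φ L) =
      Equiv.Perm.sign σ • orient φ' (L.map (List.map σ)) := by
  have h1 : (φ' :: (L.map (List.map σ)).map (gapSum k)).map (fun ψ => ψ ∘ₗ push ⇑σ) =
      φ :: L.map (gapSum k) := by
    rw [List.map_cons, h, List.map_map, List.map_map]
    congr 1
    refine List.map_congr_left fun l _ => LinearMap.ext fun t => ?_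
    exact gapSum_map σ.injective l t
  rw [orient, ← h1, ← contr_map, map_push_vol, contr_units]
  rfl

end Orientation

/-! ### The orientation of a composite cell. -/

section Composition

theorem mul_contr {V : Type u} [AddCommGroup V] [Module k V] {Φ : List (Module.Dual k V)}
    {S : Submodule k V} (hS : ∀ φ ∈ Φ, ∀ v ∈ S, φ v = 0) {d : ℕ} {X : ExteriorAlgebra k V}
    (hX : X ∈ (S.map ι) ^ d) (Y : ExteriorAlgebra k V) :
    X * contr Φ Y = sg (Φ.length * d) • contr Φ (X * Y) := by
  rw [contr_mul_of_left hS hX, ← mul_smul, sg_mul_self, one_smul]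

/-- Each vertex merges at least two trees into one. This bounds the codimension of a cell. -/
theorem Forest.length_brs_le {α : Type*} {F : Forest α} (hF : F.Good) :
    F.brs.length + F.width ≤ F.leaves.length := by
  induction F with
  | nil => simp [width]
  | leaf x r ih =>
    have := ih hF
    simp only [brs_leaf, width, leaves_leaf, List.length_cons]; omega
  | node c r ih ih' =>
    have := ih hF.2.1
    have := ih' hF.2.2
    have := hF.1
    simp only [brs_node, width, leaves_node, List.length_cons, List.length_append]; omega

theorem eq_finRange {N : ℕ} {l : List (Fin N)} (h : l.Pairwise (· < ·)) (hc : ∀ x, x ∈ l) :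
    l = List.finRange N := by
  refine List.Perm.eq_of_pairwise (le := (· < ·)) (fun a b _ _ h h' => absurd h h'.asymm) h ?_ ?_
  · exact List.pairwise_lt_finRange N
  · exact (List.perm_ext_iff_of_nodup (h.imp fun h => h.ne) (List.nodup_finRange N)).2 fun x =>
      ⟨fun _ => List.mem_finRange x, fun _ => hc x⟩

theorem substWord_finRange (i : Fin (m + 1)) :
    substWord i (List.finRange (n + 1)) (List.finRange (m + 1)) = List.finRange (m + n + 1) := by
  refine eq_finRange ?_ fun x => ?_
  · rw [substWord, List.pairwise_flatMap]
    constructor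
    · intro j _
      split
      · rw [List.pairwise_map]
        refine (List.pairwise_lt_finRange _).imp fun {a b} h => ?_
        simp only [inLab, Fin.lt_def] at h ⊢; omega
      · simp
    · refine (List.pairwise_lt_finRange _).imp fun {a b} h => ?_
      intro x hx y hy
      rw [Fin.lt_def] at h
      split at hx <;> split at hy
      · subst a b; omega
      · subst a
        obtain ⟨z, -, rfl⟩ := List.mem_map.1 hx
        rw [List.mem_singleton.1 hy]
        have := z.2
        simp only [inLab, outLab, Fin.lt_def]; rw [if_neg (by omega)]; omega
      · subst b
        obtain ⟨z, -, rfl⟩ := List.mem_map.1 hy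
        rw [List.mem_singleton.1 hx]
        simp only [inLab, outLab, Fin.lt_def]; rw [if_pos (by omega)]; omega
      · rw [List.mem_singleton.1 hx, List.mem_singleton.1 hy]
        simp only [outLab, Fin.lt_def]; split <;> split <;> omega
  · rcases lab_cases (n := n) i x with ⟨j, hj, rfl⟩ | ⟨y, rfl⟩
    · exact (outLab_mem_subst hj).2 (List.mem_finRange _)
    · exact inLab_mem_subst.2 ⟨List.mem_finRange _, List.mem_finRange _⟩

theorem exists_finRange_eq {N : ℕ} (i : Fin N) : ∃ a b : List (Fin N),
    List.finRange N = a ++ i :: b ∧ a.length = i ∧ b.length + i + 1 = N ∧ i ∉ a ∧ i ∉ b := by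
  obtain ⟨a, b, h⟩ := List.append_of_mem (List.mem_finRange i)
  have hl := congrArg List.length h
  simp at hl
  have hn := h ▸ List.nodup_finRange N
  rw [List.nodup_middle, List.nodup_cons, List.mem_append, not_or] at hn
  have h1 : a.length = i := by
    have h2 : (List.finRange N)[a.length]'(by simp; omega) = i := by simp [h]
    rw [List.getElem_finRange] at h2
    rw [← h2]; rfl
  exact ⟨a, b, h, h1, by omega, hn.1.1, hn.1.2⟩

theorem substWord_of_notMem {i : Fin (m + 1)} (v : List (Fin (n + 1))) {l : List (Fin (m + 1))}
    (h : i ∉ l) : substWord i v l = l.map (outLab n i) := by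
  induction l with
  | nil => rfl
  | cons j l ih =>
    rw [List.mem_cons, not_or] at h
    rw [subst_cons_ne (Ne.symm h.1), ih h.2, List.map_cons]

/-- The gap after the last inner letter is identified with the outer gap at `i`; contraction removes
its second copy. The `n` remaining inner vectors move past the `m - i` outer vectors behind position
`i`, and the signs caused by the shared vector cancel: `n` from the inner vectors passing it, and
together again `n` from the contraction and from putting it into its place. -/
theorem vol_comp (b' : LinBr n) (i : Fin (m + 1)) :
    ExteriorAlgebra.map (push (b'.outGap i)) (vol k (m + 1)) *
      ExteriorAlgebra.map (push (inLab n i))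
        (CliffordAlgebra.contractLeft (LinearMap.proj b'.last) (vol k (n + 1))) =
      sg (n * (m + i)) • vol k (m + n + 1) := by
  obtain ⟨a, c, h, ha, hac, hia, hic⟩ := exists_finRange_eq i
  obtain ⟨e, f, h', he, hef, hie, hif⟩ := exists_finRange_eq b'.last
  have hmap : ∀ l : List (Fin (m + 1)), i ∉ l → l.map (b'.outGap i) = l.map (outLab n i) := by
    intro l hl
    refine List.map_congr_left fun x hx => if_neg ?_
    rintro rfl
    exact hl hx
  rw [vol, vol, h, h', contractLeft_proj_basisProd hie hif, map_units_int, map_push_basisProd,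
    map_push_basisProd, mul_smul_comm, vol, ← substWord_finRange i, h, h', subst_append,
    subst_cons_self, substWord_of_notMem _ hia, substWord_of_notMem _ hic, List.map_append,
    List.map_cons, hmap a hia, hmap c hic, LinBr.outGap, if_pos rfl]
  simp only [List.map_append, List.map_cons, basisProd_append, basisProd_cons]
  have h1 := basisProd_comm (k := k) (inLab n i b'.last :: c.map (outLab n i))
    (e.map (inLab n i) ++ f.map (inLab n i))
  have h2 := basisProd_comm (k := k) [inLab n i b'.last] (e.map (inLab n i))
  simp only [basisProd_append, basisProd_cons, basisProd_nil, mul_one, List.length_cons,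
    List.length_nil, List.length_append, List.length_map] at h1 h2
  rw [mul_assoc, h1, mul_smul_comm, sg_smul_smul]
  have h3 : basisProd k (e.map (inLab n i)) * basisProd k (f.map (inLab n i)) *
      (ι (Pi.single (inLab n i b'.last) 1) * basisProd k (c.map (outLab n i))) =
      sg f.length • (basisProd k (e.map (inLab n i)) * (ι (Pi.single (inLab n i b'.last) 1) *
        basisProd k (f.map (inLab n i))) * basisProd k (c.map (outLab n i))) := by
    have h4 := basisProd_comm (k := k) (f.map (inLab n i)) [inLab n i b'.last]
    simp only [basisProd_cons, basisProd_nil, mul_one, List.length_map, List.length_cons,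
      List.length_nil] at h4
    rw [mul_assoc, ← mul_assoc (basisProd k (f.map _)), h4, smul_mul_assoc, mul_smul_comm]
    simp [mul_assoc]
  rw [h3, mul_smul_comm, sg_smul_smul]
  congr 1
  · have e1 : (n : ZMod 2) = e.length + f.length := by
      rw [he, ← Nat.cast_add]; congr 1; omega
    have e2 : (m : ZMod 2) = i + c.length := by
      rw [← Nat.cast_add]; congr 1; omega
    congr 1
    rw [e1, e2]
    push_cast
    grind

/-- The functionals of the outer cell contract the inner orientation to zero, and the gap sums of
the inner brackets vanish on the image of the outer coordinates. Hence the two strings of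
contractions can be collected into one string that acts on the product of the volume forms, which is
`vol_comp`. -/
theorem orient_comp {b' : LinBr n} {G : Forest (Fin (n + 1))} (hG : b'.Rep G) (i : Fin (m + 1))
    {φ : Module.Dual k (Fin (m + 1) → k)} {ψ : Module.Dual k (Fin (m + n + 1) → k)}
    (hφ : ψ ∘ₗ push (b'.outGap i) = φ)
    (hψ : ∀ s ∈ (associahedron k n).dir b', ψ (push (inLab n i) s) = 0)
    (L : List (List (Fin (m + 1)))) :
    ExteriorAlgebra.map (push (b'.outGap i)) (orient φ L) *
      ExteriorAlgebra.map (push (inLab n i)) (orient (LinearMap.proj b'.last) G.brs) =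
      sg (G.brs.length * m + n * (m + i)) •
        orient ψ (L.map (substWord i b'.word) ++ G.brs.map (List.map (inLab n i))) := by
  have hcard : G.brs.length ≤ n := by
    have h1 := Forest.length_brs_le hG.good
    have h2 := hG.nodup.length_le_card
    rw [hG.width] at h1
    simp only [Fintype.card_fin] at h2
    omega
  have hmem := orient_mem (k := k) (X := associahedron k n) (b := b')
    (φ := LinearMap.proj b'.last) rfl hG.mem_brs (Nat.add_sub_cancel' hcard)
  set X := ExteriorAlgebra.map (push (b'.outGap i)) (vol k (m + 1)) with hX
  have h1 : ExteriorAlgebra.map (push (b'.outGap i)) (orient φ L) =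
      contr (ψ :: (L.map (substWord i b'.word)).map (gapSum k)) X := by
    rw [hX, contr_map, orient, List.map_cons, hφ, List.map_map, List.map_map]
    have h0 : ∀ l : List (Fin (m + 1)), (((fun ψ => ψ ∘ₗ push (b'.outGap i)) ∘ gapSum k) ∘
        substWord i b'.word) l = gapSum k l := fun l => LinearMap.ext fun t =>
      b'.gapSum_subst_out i t l
    rw [List.map_congr_left fun l _ => h0 l]
  have h2 : ExteriorAlgebra.map (push (inLab n i)) (orient (LinearMap.proj b'.last) G.brs) =
      sg G.brs.length • contr ((G.brs.map (List.map (inLab n i))).map (gapSum k))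
        (ExteriorAlgebra.map (push (inLab n i))
        (CliffordAlgebra.contractLeft (LinearMap.proj b'.last) (vol k (n + 1)))) := by
    have h3 : ((G.brs.map (List.map (inLab n i))).map (gapSum k)).map
        (fun ψ => ψ ∘ₗ push (inLab n i)) = G.brs.map (gapSum k) := by
      rw [List.map_map, List.map_map]
      refine List.map_congr_left fun l _ => LinearMap.ext fun t => ?_
      exact gapSum_map (inLab_injective i) l t
    rw [contr_map, h3, contr_swap_one, map_units_int, sg_smul_smul, List.length_map,
      CharTwo.add_self_eq_zero, sg_zero, one_smul]
    rfl
  have h4 : ∀ χ ∈ ψ :: (L.map (substWord i b'.word)).map (gapSum k), CliffordAlgebra.contractLeft χ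
      (ExteriorAlgebra.map (push (inLab n i)) (orient (LinearMap.proj b'.last) G.brs)) = 0 := by
    intro χ hχ
    rw [contractLeft_map, contractLeft_eq_zero _ _ _ _ hmem, map_zero]
    intro s hs
    rcases List.mem_cons.1 hχ with rfl | hχ
    · exact hψ s hs
    · simp only [List.map_map, List.mem_map] at hχ
      obtain ⟨l, -, rfl⟩ := hχ
      exact b'.gapSum_subst_in i hs l
  have h5 : X ∈ ((LinearMap.range (push (k := k) (b'.outGap i))).map ι) ^ (m + 1) :=
    map_mem_pow _ (fun v _ => LinearMap.mem_range_self _ v) vol_mem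
  have h6 : ∀ χ ∈ (G.brs.map (List.map (inLab n i))).map (gapSum k),
      ∀ v ∈ LinearMap.range (push (k := k) (b'.outGap i)), χ v = 0 := by
    rintro χ hχ _ ⟨t, rfl⟩
    simp only [List.map_map, List.mem_map] at hχ
    obtain ⟨l, hl, rfl⟩ := hχ
    rw [Function.comp, gapSum, ← List.map_dropLast,
      b'.sumOver_in_out i t (b'.last_notMem_br ((hG.mem_brs l).1 hl))]
  rw [h1, ← contr_mul_of_right h4, h2, mul_smul_comm, mul_contr h6 h5, hX, vol_comp,
    contr_units, contr_units, contr_units, contr_units, sg_smul_smul, sg_smul_smul, orient,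
    List.map_append, contr_cons, contr_cons, contr_append]
  congr 2
  simp only [List.length_map]
  push_cast
  grind

end Composition

end

section

variable {m n : ℕ}

/-! ### Sums over ordered pairs of letters. -/

section PairSum

variable {α β : Type*}

/-- Sum of `s` over the pairs of entries of a list, taken in their order. -/
def pairSum (s : α → α → ZMod 2) : List α → ZMod 2
  | [] => 0
  | x :: l => (l.map (s x)).sum + pairSum s l

theorem pairSum_append (s : α → α → ZMod 2) (l l' : List α) :
    pairSum s (l ++ l') =
      pairSum s l + (l.map fun x => (l'.map (s x)).sum).sum + pairSum s l' := by
  induction l with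
  | nil => simp [pairSum]
  | cons x l ih =>
    simp only [List.cons_append, pairSum, ih, List.map_append, List.sum_append, List.map_cons,
      List.sum_cons]
    ring

theorem pairSum_map (s : β → β → ZMod 2) (f : α → β) (l : List α) :
    pairSum s (l.map f) = pairSum (fun x y => s (f x) (f y)) l := by
  induction l with
  | nil => rfl
  | cons x l ih => simp only [List.map_cons, pairSum, ih, List.map_map]; rfl

theorem pairSum_add (s t : α → α → ZMod 2) (l : List α) :
    pairSum (fun x y => s x y + t x y) l = pairSum s l + pairSum t l := by
  induction l with
  | nil => simp [pairSum]
  | cons x l ih =>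
    simp only [pairSum, ih, List.sum_map_add]
    ring

theorem pairSum_congr {s t : α → α → ZMod 2} {l : List α}
    (h : l.Pairwise fun x y => s x y = t x y) : pairSum s l = pairSum t l := by
  induction l with
  | nil => rfl
  | cons x l ih =>
    rw [List.pairwise_cons] at h
    rw [pairSum, pairSum, ih h.2, List.map_congr_left h.1]

theorem pairSum_perm {s : α → α → ZMod 2} (hs : ∀ x y, s x y = s y x) {l l' : List α}
    (h : l.Perm l') : pairSum s l = pairSum s l' := by
  induction h with
  | nil => rfl
  | cons x h ih => rw [pairSum, pairSum, ih, (h.map _).sum_eq]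
  | swap x y l => simp only [pairSum, List.map_cons, List.sum_cons, hs x y]; ring
  | trans _ _ h h' => rw [h, h']

theorem pairSum_sorted {N : ℕ} (s : Fin N → Fin N → ZMod 2) {l : List (Fin N)}
    (h : l.Pairwise (· < ·)) : pairSum s l =
      (l.map fun x => (l.map fun y => if x < y then s x y else 0).sum).sum := by
  induction l with
  | nil => rfl
  | cons x l ih =>
    rw [List.pairwise_cons] at h
    have h1 : (l.map fun y => if x < y then s x y else 0) = l.map (s x) :=
      List.map_congr_left fun y hy => if_pos (h.1 y hy)
    have h2 : (l.map fun a => ((x :: l).map fun y => if a < y then s a y else 0).sum) =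
        l.map fun a => (l.map fun y => if a < y then s a y else 0).sum := by
      refine List.map_congr_left fun a ha => ?_
      rw [List.map_cons, List.sum_cons, if_neg (h.1 a ha).asymm, zero_add]
    rw [pairSum, ih h.2, List.map_cons, List.sum_cons, h2, List.map_cons, List.sum_cons,
      if_neg (lt_irrefl x), zero_add, h1]

theorem sum_map_finRange {N : ℕ} {M : Type*} [AddCommMonoid M] (f : Fin N → M) :
    ((List.finRange N).map f).sum = ∑ x, f x := by
  rw [← List.ofFn_eq_map, List.sum_ofFn]

theorem pairSum_finRange {N : ℕ} (s : Fin N → Fin N → ZMod 2) :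
    pairSum s (List.finRange N) = ∑ x, ∑ y, if x < y then s x y else 0 := by
  rw [pairSum_sorted s (List.pairwise_lt_finRange N), sum_map_finRange]
  simp only [sum_map_finRange]

theorem prod_sg {ι : Type*} (s : Finset ι) (f : ι → ZMod 2) :
    ∏ x ∈ s, sg (f x) = sg (∑ x ∈ s, f x) := by
  induction s using Finset.induction_on with
  | empty => simp
  | insert a s ha ih => rw [Finset.prod_insert ha, Finset.sum_insert ha, ih, sg_add]

end PairSum

/-! ### Koszul signs of words. -/

section WordSign

variable {N : ℕ}

/-- Exponent of the Koszul sign of a word in letters of degrees `p`. -/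
def kos (p : Fin N → ZMod 2) : List (Fin N) → ZMod 2 :=
  pairSum fun x y => if y < x then p x * p y else 0

/-- Sum of the degrees of the letters, weighted by the number of letters that follow. -/
def follow (p : Fin N → ZMod 2) : List (Fin N) → ZMod 2 := pairSum fun x _ => p x

/-- Exponent of the sign of a word. -/
def wordSign (p : Fin N → ZMod 2) (w : List (Fin N)) : ZMod 2 :=
  kos p w + kos (fun _ => 1) w + follow p w

theorem sg_kos_finRange (τ : Equiv.Perm (Fin N)) (p : Fin N → ℤ) :
    koszulSign τ p = sg (kos (fun x => (p x : ZMod 2)) ((List.finRange N).map τ)) := by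
  rw [koszulSign, kos, pairSum_map, pairSum_finRange, ← Finset.sum_product',
    ← Finset.sum_filter_add_sum_filter_not (Finset.univ ×ˢ Finset.univ)
      (fun x : Fin N × Fin N => x.1 < x.2 ∧ τ x.2 < τ x.1)]
  have h2 : ∑ x ∈ (Finset.univ ×ˢ Finset.univ) with ¬(x.1 < x.2 ∧ τ x.2 < τ x.1),
      (if x.1 < x.2 then if τ x.2 < τ x.1 then (p (τ x.1) : ZMod 2) * p (τ x.2) else 0 else 0) = 0 := by
    refine Finset.sum_eq_zero fun x hx => ?_
    have := (Finset.mem_filter.1 hx).2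
    by_cases h : x.1 < x.2
    · rw [if_pos h, if_neg fun h' => this ⟨h, h'⟩]
    · rw [if_neg h]
  rw [h2, add_zero, ← prod_sg]
  refine Finset.prod_congr (by simp) fun x hx => ?_
  have := (Finset.mem_filter.1 hx).2
  rw [if_pos this.1, if_pos this.2, negOnePow_eq_sg]
  push_cast; rfl

theorem sign_eq_sg_kos (τ : Equiv.Perm (Fin N)) :
    Equiv.Perm.sign τ = sg (kos (fun _ => 1) ((List.finRange N).map τ)) := by
  have h := sg_kos_finRange τ fun _ => 1
  simp only [Int.cast_one] at h
  rw [← h, koszulSign, Equiv.Perm.sign_eq_prod_prod_Ioi, Finset.prod_filter,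
    ← Finset.univ_product_univ, Finset.prod_product]
  refine Finset.prod_congr rfl fun x _ => ?_
  rw [← Finset.prod_filter_mul_prod_filter_not Finset.univ (fun y => x < y)]
  have h2 : ∏ y with ¬ x < y, (if x < y ∧ τ y < τ x then (1 * 1 : ℤ).negOnePow else 1) = 1 :=
    Finset.prod_eq_one fun y hy => if_neg fun h => (Finset.mem_filter.1 hy).2 h.1
  rw [h2, mul_one]
  refine Finset.prod_congr (by ext; simp) fun y hy => ?_
  have hxy : x < y := by simpa using hy
  by_cases h3 : τ y < τ x
  · rw [if_pos (show (x, y).1 < (x, y).2 ∧ τ (x, y).2 < τ (x, y).1 from ⟨hxy, h3⟩),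
      if_neg (not_lt.2 h3.le)]; rfl
  · rw [if_neg fun h : (x, y).1 < (x, y).2 ∧ τ (x, y).2 < τ (x, y).1 => h3 h.2, if_pos]
    exact lt_of_le_of_ne (not_lt.1 h3) fun h => hxy.ne (τ.injective h)

/-- Whether a pair is inverted before and after applying `τ` both depend on the order of its
letters, but modulo 2 the sum of the two indicators does not. The sum of `s` is therefore the same
for `w` and for the sorted word, on which one of the two contributions is zero. -/
theorem kos_map_perm (τ : Equiv.Perm (Fin N)) (p : Fin N → ZMod 2) {w : List (Fin N)}
    (hw : w.Nodup) (hc : ∀ x, x ∈ w) :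
    kos p (w.map τ) = kos p ((List.finRange N).map τ) + kos (p ∘ τ) w := by
  let s : Fin N → Fin N → ZMod 2 := fun x y => if x = y then 0 else
    (if τ y < τ x then p (τ x) * p (τ y) else 0) + (if y < x then p (τ x) * p (τ y) else 0)
  have hs : ∀ x y, s x y = s y x := by
    intro x y
    by_cases hxy : x = y
    · rw [hxy]
    have h1 : τ x ≠ τ y := fun h => hxy (τ.injective h)
    simp only [s, if_neg hxy, if_neg (Ne.symm hxy)]
    rcases lt_or_gt_of_ne hxy with h | h <;> rcases lt_or_gt_of_ne h1 with h' | h' <;>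
      simp only [h, h', h.asymm, h'.asymm, if_true, if_false] <;> grind
  have hperm : w.Perm (List.finRange N) :=
    (List.perm_ext_iff_of_nodup hw (List.nodup_finRange N)).2 fun x =>
      ⟨fun _ => List.mem_finRange x, fun _ => hc x⟩
  have h1 : pairSum s w = kos p (w.map τ) + kos (p ∘ τ) w := by
    rw [kos, pairSum_map, kos, ← pairSum_add]
    exact pairSum_congr (hw.imp fun h => if_neg h)
  have h2 : pairSum s (List.finRange N) = kos p ((List.finRange N).map τ) := by
    rw [kos, pairSum_map]
    refine pairSum_congr ((List.pairwise_lt_finRange N).imp fun h => ?_)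
    simp only [s, if_neg h.ne, if_neg h.asymm, add_zero]
  rw [← h2, ← pairSum_perm hs hperm, h1]
  grind

theorem wordSign_map_perm (τ : Equiv.Perm (Fin N)) (p : Fin N → ZMod 2) {w : List (Fin N)}
    (hw : w.Nodup) (hc : ∀ x, x ∈ w) :
    wordSign p (w.map τ) = kos p ((List.finRange N).map τ) +
      kos (fun _ => 1) ((List.finRange N).map τ) + wordSign (p ∘ τ) w := by
  have h1 := kos_map_perm τ p hw hc
  have h2 := kos_map_perm τ (fun _ => 1) hw hc
  have h3 : follow p (w.map τ) = follow (p ∘ τ) w := by rw [follow, pairSum_map]; rfl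
  rw [wordSign, wordSign, h1, h2, h3]
  simp only [Function.comp_def]
  ring

theorem kos_finRange (p : Fin N → ZMod 2) : kos p (List.finRange N) = 0 := by
  rw [kos, pairSum_finRange]
  refine Finset.sum_eq_zero fun x _ => Finset.sum_eq_zero fun y _ => ?_
  by_cases h : x < y
  · rw [if_pos h, if_neg h.asymm]
  · rw [if_neg h]

theorem wordSign_finRange (p : Fin N → ZMod 2) :
    wordSign p (List.finRange N) = follow p (List.finRange N) := by
  rw [wordSign, kos_finRange, kos_finRange, zero_add, zero_add]

end WordSign

/-! ### The sign of a forest and its behaviour under grafting. -/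

section CompSign

/-- Sum of the values of `g` on the letters of a word. -/
def tot {α : Type*} (g : α → ZMod 2) (l : List α) : ZMod 2 := (l.map g).sum

@[simp] theorem tot_nil {α : Type*} (g : α → ZMod 2) : tot g [] = 0 := rfl
@[simp] theorem tot_cons {α : Type*} (g : α → ZMod 2) (x l) : tot g (x :: l) = g x + tot g l := by
  simp [tot]
@[simp] theorem tot_append {α : Type*} (g : α → ZMod 2) (l l') :
    tot g (l ++ l') = tot g l + tot g l' := by simp [tot]
theorem tot_map {α β : Type*} (g : β → ZMod 2) (f : α → β) (l : List α) :
    tot g (l.map f) = tot (fun x => g (f x)) l := by simp [tot, Function.comp_def]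
theorem tot_add {α : Type*} (f g : α → ZMod 2) (l : List α) :
    tot (fun x => f x + g x) l = tot f l + tot g l := List.sum_map_add
theorem tot_mul {α : Type*} (c : ZMod 2) (g : α → ZMod 2) (l : List α) :
    tot (fun x => c * g x) l = c * tot g l := by
  induction l with
  | nil => simp
  | cons x l ih => rw [tot_cons, tot_cons, ih, mul_add]
theorem tot_one {α : Type*} (l : List α) : tot (fun _ => 1) l = l.length := by
  induction l with
  | nil => simp
  | cons x l ih => rw [tot_cons, ih, List.length_cons]; push_cast; ring
theorem tot_congr {α : Type*} {f g : α → ZMod 2} {l : List α} (h : ∀ x ∈ l, f x = g x) :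
    tot f l = tot g l := by rw [tot, tot, List.map_congr_left h]

theorem outLab_strictMono (i : Fin (m + 1)) : StrictMono (outLab n i) := by
  intro x y h
  rw [Fin.lt_def] at h
  simp only [outLab, Fin.lt_def]
  split <;> split <;> omega

theorem inLab_strictMono (i : Fin (m + 1)) : StrictMono (inLab n i) := by
  intro x y h
  rw [Fin.lt_def] at h
  simp only [inLab, Fin.lt_def]
  omega

theorem inLab_lt_outLab {i x : Fin (m + 1)} (hx : x ≠ i) (y : Fin (n + 1)) :
    inLab n i y < outLab n i x ↔ i < x := by
  have := y.2
  have : (x : ℕ) ≠ i := fun h => hx (Fin.ext h)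
  simp only [inLab, outLab, Fin.lt_def]
  split <;> omega

theorem outLab_lt_inLab {i x : Fin (m + 1)} (hx : x ≠ i) (y : Fin (n + 1)) :
    outLab n i x < inLab n i y ↔ x < i := by
  have := y.2
  have : (x : ℕ) ≠ i := fun h => hx (Fin.ext h)
  simp only [inLab, outLab, Fin.lt_def]
  split <;> omega

theorem kos_map_outLab (i : Fin (m + 1)) (p : Fin (m + n + 1) → ZMod 2)
    {p' : Fin (m + 1) → ZMod 2} {w : List (Fin (m + 1))} (h : ∀ x ∈ w, p' x = p (outLab n i x)) :
    kos p (w.map (outLab n i)) = kos p' w := by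
  rw [kos, pairSum_map]
  refine pairSum_congr (List.pairwise_of_forall_mem_list ?_)
  intro x hx y hy
  rw [h x hx, h y hy]
  simp only [(outLab_strictMono i).lt_iff_lt]

/-- Pairs inside the inserted block and pairs of outer letters are as before. A pair formed by the
block and an outer letter is inverted as a whole, with the degree of the block in place of `p' i`;
these differ by `e`, whence the correction over the outer letters that form an inversion with `i`.
-/
theorem kos_subst {i : Fin (m + 1)} {w₁ w₂ : List (Fin (m + 1))} (h1 : i ∉ w₁) (h2 : i ∉ w₂)
    (v : List (Fin (n + 1))) (p : Fin (m + n + 1) → ZMod 2) (p' : Fin (m + 1) → ZMod 2)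
    (e : ZMod 2) (hp : ∀ j, j ≠ i → p' j = p (outLab n i j))
    (hi : p' i = tot (fun y => p (inLab n i y)) v + e) :
    kos p (substWord i v (w₁ ++ i :: w₂)) = kos p' (w₁ ++ i :: w₂) +
      kos (fun y => p (inLab n i y)) v +
      e * (tot (fun x => if i < x then p' x else 0) w₁ +
        tot (fun x => if x < i then p' x else 0) w₂) := by
  have hp1 : ∀ x ∈ w₁, p' x = p (outLab n i x) := fun x hx => hp x fun h => h1 (h ▸ hx)
  have hp2 : ∀ x ∈ w₂, p' x = p (outLab n i x) := fun x hx => hp x fun h => h2 (h ▸ hx)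
  have hv : kos p (v.map (inLab n i)) = kos (fun y => p (inLab n i y)) v := by
    rw [kos, pairSum_map]
    simp only [(inLab_strictMono i).lt_iff_lt]; rfl
  rw [subst_append, subst_cons_self, substWord_of_notMem _ h1, substWord_of_notMem _ h2]
  have e1 := kos_map_outLab (n := n) i p hp1
  have e2 := kos_map_outLab (n := n) i p hp2
  set P := fun y => p (inLab n i y) with hP
  have c12 : ((w₁.map (outLab n i)).map fun x => ((w₂.map (outLab n i)).map fun y =>
      if y < x then p x * p y else 0).sum).sum =
      (w₁.map fun x => (w₂.map fun y => if y < x then p' x * p' y else 0).sum).sum := by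
    simp only [List.map_map, Function.comp_def, (outLab_strictMono i).lt_iff_lt]
    congr 1
    refine List.map_congr_left fun x hx => ?_
    congr 1
    refine List.map_congr_left fun y hy => ?_
    rw [hp1 x hx, hp2 y hy]
  have c1v : ((w₁.map (outLab n i)).map fun x => ((v.map (inLab n i)).map fun y =>
      if y < x then p x * p y else 0).sum).sum =
      tot (fun x => if i < x then p' x else 0) w₁ * tot P v := by
    rw [mul_comm, ← tot_mul]
    simp only [List.map_map, Function.comp_def, tot]
    congr 1
    refine List.map_congr_left fun x hx => ?_
    have hxi : x ≠ i := fun h => h1 (h ▸ hx)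
    simp only [inLab_lt_outLab hxi, ← hp1 x hx]
    by_cases h : i < x
    · simp only [if_pos h, hP]
      rw [List.sum_map_mul_left, mul_comm]
    · simp [if_neg h]
  have cv2 : ((v.map (inLab n i)).map fun x => ((w₂.map (outLab n i)).map fun y =>
      if y < x then p x * p y else 0).sum).sum =
      tot (fun x => if x < i then p' x else 0) w₂ * tot P v := by
    rw [← tot_mul]
    simp only [List.map_map, Function.comp_def, tot]
    congr 1
    refine List.map_congr_left fun y hy => ?_
    have hh : ∀ x ∈ w₂, (if outLab n i x < inLab n i y then p (inLab n i y) * p (outLab n i x)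
        else 0) = (if x < i then p' x else 0) * p (inLab n i y) := by
      intro x hx
      have hxi : x ≠ i := fun h => h2 (h ▸ hx)
      simp only [outLab_lt_inLab hxi, ← hp2 x hx]
      split <;> ring
    rw [List.map_congr_left hh, List.sum_map_mul_right]
  have c1i : (w₁.map fun x => ((i :: w₂).map fun y => if y < x then p' x * p' y else 0).sum).sum =
      tot (fun x => if i < x then p' x else 0) w₁ * p' i +
      (w₁.map fun x => (w₂.map fun y => if y < x then p' x * p' y else 0).sum).sum := by
    simp only [List.map_cons, List.sum_cons, List.sum_map_add]
    congr 1
    rw [mul_comm, ← tot_mul, tot]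
    congr 1
    refine List.map_congr_left fun x _ => ?_
    split <;> ring
  have ci2 : (w₂.map fun y => if y < i then p' i * p' y else 0).sum =
      tot (fun x => if x < i then p' x else 0) w₂ * p' i := by
    rw [mul_comm, ← tot_mul, tot]
    congr 1
    refine List.map_congr_left fun x _ => ?_
    split <;> ring
  have k1 : kos p (w₁.map (outLab n i) ++ (v.map (inLab n i) ++ w₂.map (outLab n i))) =
      kos p (w₁.map (outLab n i)) + (((w₁.map (outLab n i)).map fun x => ((v.map (inLab n i)).map
        fun y => if y < x then p x * p y else 0).sum).sum +
        ((w₁.map (outLab n i)).map fun x => ((w₂.map (outLab n i)).map fun y =>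
          if y < x then p x * p y else 0).sum).sum) + (kos p (v.map (inLab n i)) +
        ((v.map (inLab n i)).map fun x => ((w₂.map (outLab n i)).map fun y =>
          if y < x then p x * p y else 0).sum).sum + kos p (w₂.map (outLab n i))) := by
    rw [kos, pairSum_append, pairSum_append]
    simp only [List.map_append, List.sum_append, List.sum_map_add]
  have k2 : kos p' (w₁ ++ i :: w₂) = kos p' w₁ +
      (w₁.map fun x => ((i :: w₂).map fun y => if y < x then p' x * p' y else 0).sum).sum +
      ((w₂.map fun y => if y < i then p' i * p' y else 0).sum + kos p' w₂) := by
    rw [kos, pairSum_append]; rfl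
  rw [k1, k2, c12, c1v, cv2, c1i, ci2, e1, e2, hv, hi]
  grind

theorem follow_append {N : ℕ} (p : Fin N → ZMod 2) (l l' : List (Fin N)) :
    follow p (l ++ l') = follow p l + l'.length * tot p l + follow p l' := by
  rw [follow, pairSum_append]
  congr 2
  rw [← tot_mul, tot]
  congr 1
  refine List.map_congr_left fun x _ => ?_
  simp

/-- Each letter in front of the block gains `n` followers, and the defect `e` of the degree of the
block is counted once for each letter behind it. -/
theorem follow_subst {i : Fin (m + 1)} {w₁ w₂ : List (Fin (m + 1))} (h1 : i ∉ w₁) (h2 : i ∉ w₂)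
    (v : List (Fin (n + 1))) (hv : v.length = n + 1) (p : Fin (m + n + 1) → ZMod 2)
    (p' : Fin (m + 1) → ZMod 2)
    (e : ZMod 2) (hp : ∀ j, j ≠ i → p' j = p (outLab n i j))
    (hi : p' i = tot (fun y => p (inLab n i y)) v + e) :
    follow p (substWord i v (w₁ ++ i :: w₂)) = follow p' (w₁ ++ i :: w₂) +
      follow (fun y => p (inLab n i y)) v + n * tot p' w₁ + e * w₂.length := by
  have hp1 : ∀ x ∈ w₁, p (outLab n i x) = p' x := fun x hx => (hp x fun h => h1 (h ▸ hx)).symm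
  have hp2 : ∀ x ∈ w₂, p (outLab n i x) = p' x := fun x hx => (hp x fun h => h2 (h ▸ hx)).symm
  have hf : ∀ w : List (Fin (m + 1)), (∀ x ∈ w, p (outLab n i x) = p' x) →
      follow p (w.map (outLab n i)) = follow p' w := by
    intro w hw
    rw [follow, pairSum_map]
    exact pairSum_congr (List.pairwise_of_forall_mem_list fun x hx _ _ => hw x hx)
  rw [subst_append, subst_cons_self, substWord_of_notMem _ h1, substWord_of_notMem _ h2,
    follow_append, follow_append, follow_append, hf w₁ hp1, tot_map, tot_congr hp1]
  have h3 : follow p' (i :: w₂) = w₂.length * p' i + follow p' w₂ := by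
    rw [follow, pairSum]
    congr 1
    simp
  have h4 : follow p (v.map (inLab n i)) = follow (fun y => p (inLab n i y)) v := by
    rw [follow, pairSum_map]; rfl
  rw [h3, h4, hi, hf w₂ hp2, tot_map]
  simp only [List.length_append, List.length_map, List.length_cons, hv]
  push_cast
  grind

namespace Forest

variable {α β : Type*}

/-- Exponent of the sign that arises when the vertices are moved in front of the leaves. -/
def inter (p : α → ZMod 2) : Forest α → ZMod 2
  | nil => 0
  | leaf x r => (p x + 1) * (brs r).length + inter p r
  | node c r => inter p c + tot (fun x => p x + 1) c.leaves * (brs r).length + inter p r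

theorem inter_map (p : β → ZMod 2) (f : α → β) (F : Forest α) :
    inter p (F.map f) = inter (p ∘ f) F := by
  induction F with
  | nil => rfl
  | leaf x r ih => simp [map, inter, ih]
  | node c r ih ih' => simp [map, inter, ih, ih', tot_map]

theorem inter_congr {p p' : α → ZMod 2} {F : Forest α} (h : ∀ x ∈ F.leaves, p x = p' x) :
    inter p F = inter p' F := by
  induction F with
  | nil => rfl
  | leaf x r ih =>
    rw [inter, inter, h x (by simp), ih fun y hy => h y (by simp [hy])]
  | node c r ih ih' =>
    rw [inter, inter, ih fun y hy => h y (by simp [hy]), ih' fun y hy => h y (by simp [hy]),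
      tot_congr fun y hy => by rw [h y (by simp [hy])]]

theorem inter_append (p : α → ZMod 2) (F G : Forest α) : inter p (F.append G) =
    inter p F + tot (fun x => p x + 1) F.leaves * G.brs.length + inter p G := by
  induction F with
  | nil => simp [append, inter]
  | leaf x r ih =>
    simp only [append, inter, ih, brs_append, List.length_append, leaves_leaf, tot_cons]
    push_cast; ring
  | node c r _ ih =>
    simp only [append, inter, ih, brs_append, List.length_append, leaves_node, tot_append]
    push_cast; ring

theorem inter_ofLeaves (p : α → ZMod 2) (l : List α) : inter p (ofLeaves l) = 0 := by
  induction l with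
  | nil => rfl
  | cons x l ih => simp [ofLeaves, inter, ih]

theorem comp_of_notMem {i : Fin (m + 1)} {F : Forest (Fin (m + 1))} (G : Forest (Fin (n + 1)))
    (h : i ∉ F.leaves) : F.comp i G = F.map (outLab n i) := by
  rw [comp]
  conv_rhs => rw [← graft_leaf F, map_graft]
  refine graft_congr fun x hx => if_neg ?_
  rintro rfl
  exact h hx

/-- The vertices of the inserted tree form one block in the list of brackets: `L₁` are the outer
vertices met before the leaf `i`, and `L₂` those met after it. The condition on `p' i` says that the
suspended degree of the inserted tree is that of its leaves, each vertex being odd. The correction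
to `inter` comes from the inner vertices passing the leaves `w₁`, and from their share in the degree
of `i` when the vertices `L₂` pass it. -/
theorem comp_split {i : Fin (m + 1)} {F : Forest (Fin (m + 1))} (G : Forest (Fin (n + 1)))
    (hn : F.leaves.Nodup) (hi : i ∈ F.leaves) :
    ∃ w₁ w₂ L₁ L₂, F.leaves = w₁ ++ i :: w₂ ∧ i ∉ w₁ ∧ i ∉ w₂ ∧ F.brs = L₁ ++ L₂ ∧
      (F.comp i G).brs = L₁.map (substWord i G.leaves) ++ (G.brs.map (List.map (inLab n i)) ++
        L₂.map (substWord i G.leaves)) ∧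
      ∀ (p : Fin (m + n + 1) → ZMod 2) (p' : Fin (m + 1) → ZMod 2),
        (∀ j, j ≠ i → p' j = p (outLab n i j)) →
        p' i + 1 = tot (fun y => p (inLab n i y) + 1) G.leaves + G.brs.length →
        inter p (F.comp i G) = inter p' F + inter (fun y => p (inLab n i y)) G +
          G.brs.length * (tot (fun x => p' x + 1) w₁ + L₂.length) := by
  have hmapbrs : ∀ r : Forest (Fin (m + 1)), i ∉ r.leaves →
      (r.map (outLab n i)).brs = r.brs.map (substWord i G.leaves) := by
    intro r hr
    rw [brs_map]
    refine List.map_congr_left fun l hl => (substWord_of_notMem _ fun h => hr ?_).symm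
    exact (infix_of_mem_brs hl).subset h
  have hmapint : ∀ (r : Forest (Fin (m + 1))) (p : Fin (m + n + 1) → ZMod 2)
      (p' : Fin (m + 1) → ZMod 2), i ∉ r.leaves → (∀ j, j ≠ i → p' j = p (outLab n i j)) →
      inter p (r.map (outLab n i)) = inter p' r := by
    intro r p p' hr hp
    rw [inter_map]
    exact inter_congr fun x hx => (hp x fun h => hr (h ▸ hx)).symm
  induction F with
  | nil => simp at hi
  | leaf x r ih =>
    have hn' := List.nodup_cons.1 hn
    by_cases hx : x = i
    · subst x
      have hc : (leaf i r).comp i G = (G.map (inLab n i)).append (r.map (outLab n i)) := by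
        rw [← comp_of_notMem G hn'.1]
        simp [comp, graft, insertAt]
      refine ⟨[], r.leaves, [], r.brs, rfl, by simp, hn'.1, rfl, ?_, ?_⟩
      · rw [hc, brs_append, hmapbrs r hn'.1, brs_map]; rfl
      · intro p p' hp hpi
        rw [hc, inter_append, inter_map, hmapint r p p' hn'.1 hp, leaves_map, tot_map, inter,
          brs_map, List.length_map, hpi, tot_nil]
        simp only [Function.comp_def]
        grind
    · have hir : i ∈ r.leaves := (List.mem_cons.1 hi).resolve_left (Ne.symm hx)
      obtain ⟨w₁, w₂, L₁, L₂, h1, h2, h3, h4, h5, h6⟩ := ih hn'.2 hir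
      have hc : (leaf x r).comp i G = leaf (outLab n i x) (r.comp i G) := by
        simp [comp, graft, insertAt, hx, append]
      refine ⟨x :: w₁, w₂, L₁, L₂, by simp [h1], by simp [h2, Ne.symm hx], h3, h4,
        by rw [hc]; exact h5, ?_⟩
      intro p p' hp hpi
      have hl := congrArg List.length h5
      have hl4 := congrArg List.length h4
      simp only [List.length_append, List.length_map] at hl hl4
      rw [hc, inter, inter, h6 p p' hp hpi, ← hp x hx, hl, hl4, tot_cons]
      push_cast
      ring
  | node c r ih ih' =>
    have hn' := List.nodup_append.1 hn
    have hd := List.disjoint_of_nodup_append hn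
    by_cases hic : i ∈ c.leaves
    · have hir : i ∉ r.leaves := fun h => hd hic h
      obtain ⟨w₁, w₂, L₁, L₂, h1, h2, h3, h4, h5, h6⟩ := ih hn'.1 hic
      have hc : (node c r).comp i G = node (c.comp i G) (r.map (outLab n i)) := by
        rw [← comp_of_notMem G hir]; rfl
      refine ⟨w₁, w₂ ++ r.leaves, c.leaves :: L₁, L₂ ++ r.brs, by simp [h1], h2,
        by simp [h3, hir], by simp [h4], ?_, ?_⟩
      · rw [hc, brs_node, h5, leaves_comp, hmapbrs r hir]; simp
      · intro p p' hp hpi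
        have ht : tot (fun x => p x + 1) (c.comp i G).leaves =
            tot (fun x => p' x + 1) c.leaves + G.brs.length := by
          have hw : ∀ w : List (Fin (m + 1)), i ∉ w →
              tot (fun x => p (outLab n i x) + 1) w = tot (fun x => p' x + 1) w :=
            fun w hw => tot_congr fun x hx => by rw [hp x fun h => hw (h ▸ hx)]
          rw [leaves_comp, h1, subst_append, subst_cons_self, substWord_of_notMem _ h2,
            substWord_of_notMem _ h3, tot_append, tot_append, tot_append, tot_cons, tot_map,
            tot_map, tot_map, hpi, hw _ h2, hw _ h3]
          grind
        rw [hc, inter, inter, h6 p p' hp hpi, hmapint r p p' hir hp, ht, brs_map]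
        simp only [List.length_append, List.length_map]
        push_cast
        ring
    · have hir : i ∈ r.leaves := (List.mem_append.1 hi).resolve_left hic
      obtain ⟨w₁, w₂, L₁, L₂, h1, h2, h3, h4, h5, h6⟩ := ih' hn'.2.1 hir
      have hc : (node c r).comp i G = node (c.map (outLab n i)) (r.comp i G) := by
        rw [← comp_of_notMem G hic]; rfl
      refine ⟨c.leaves ++ w₁, w₂, c.leaves :: (c.brs ++ L₁), L₂, by simp [h1], by simp [h2, hic],
        h3, by simp [h4], ?_, ?_⟩
      · rw [hc, brs_node, h5, leaves_map, hmapbrs c hic]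
        simp [substWord_of_notMem _ hic]
      · intro p p' hp hpi
        have ht : tot (fun x => p x + 1) (c.map (outLab n i)).leaves =
            tot (fun x => p' x + 1) c.leaves := by
          rw [leaves_map, tot_map]
          exact tot_congr fun x hx => by rw [hp x fun h => hic (h ▸ hx)]
        have hl := congrArg List.length h5
        have hl4 := congrArg List.length h4
        simp only [List.length_append, List.length_map] at hl hl4
        rw [hc, inter, inter, h6 p p' hp hpi, hmapint c p p' hic hp, ht, hl, hl4, tot_append]
        push_cast
        ring

/-- Exponent of the sign of a forest. -/
def sign {N : ℕ} (p : Fin N → ZMod 2) (F : Forest (Fin N)) : ZMod 2 :=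
  wordSign p F.leaves + inter p F

/-- On the left, besides the sign of the composite, are the sign of its product orientation and that
of moving the inner brackets in front of `L₂`. On the right, besides the signs of the two forests,
is the Koszul sign of carrying an operation of degree `n - |G.brs|` past the arguments before `i`.
The identity adds up the corrections of the word, permutation, `follow` and `inter` parts. -/
theorem sign_comp {i : Fin (m + 1)} {F : Forest (Fin (m + 1))} {G : Forest (Fin (n + 1))}
    (hn : F.leaves.Nodup) (hc : ∀ x, x ∈ F.leaves) (hG : G.leaves.length = n + 1) :
    ∃ L₁ L₂, F.brs = L₁ ++ L₂ ∧
      (F.comp i G).brs = L₁.map (substWord i G.leaves) ++ (G.brs.map (List.map (inLab n i)) ++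
        L₂.map (substWord i G.leaves)) ∧
      ∀ (p : Fin (m + n + 1) → ZMod 2) (p' : Fin (m + 1) → ZMod 2),
        (∀ j, j ≠ i → p' j = p (outLab n i j)) →
        p' i = tot (fun y => p (inLab n i y)) G.leaves + (n + G.brs.length) →
        sign p (F.comp i G) + (G.brs.length * m + n * (m + i)) + G.brs.length * L₂.length =
          (n + G.brs.length) * (∑ x, if x < i then p' x else 0) + sign p' F +
            sign (fun y => p (inLab n i y)) G := by
  obtain ⟨w₁, w₂, L₁, L₂, h1, h2, h3, h4, h5, h6⟩ := comp_split G hn (hc i)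
  refine ⟨L₁, L₂, h4, h5, fun p p' hp hpi => ?_⟩
  have ho := h6 p p' hp (by
    rw [tot_add, tot_one, hG, hpi]; push_cast; grind)
  have hk := kos_subst h2 h3 G.leaves p p' _ hp hpi
  have hk1 := kos_subst h2 h3 G.leaves (fun _ => 1) (fun _ => 1) (n : ZMod 2) (fun _ _ => rfl) (by
    rw [tot_one, hG]; push_cast; grind)
  have hf := follow_subst h2 h3 G.leaves hG p p' _ hp hpi
  have hsum : ∀ g : Fin (m + 1) → ZMod 2, ∑ x, g x = tot g w₁ + (g i + tot g w₂) := by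
    intro g
    have hl : F.leaves.toFinset = Finset.univ :=
      Finset.eq_univ_of_forall fun x => List.mem_toFinset.2 (hc x)
    rw [← hl, List.sum_toFinset _ hn, h1, ← tot_cons, ← tot_append]; rfl
  -- Inversions depend on whether a letter is smaller than `i`, the other terms on whether it stands
  -- before `i`; splitting both sides of `i` makes the two kinds comparable.
  have hsplit : ∀ (g : Fin (m + 1) → ZMod 2) (w : List (Fin (m + 1))), i ∉ w →
      tot g w = tot (fun x => if x < i then g x else 0) w +
        tot (fun x => if i < x then g x else 0) w := by
    intro g w hw
    rw [← tot_add]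
    refine tot_congr fun x hx => ?_
    rcases lt_trichotomy x i with h | h | h
    · rw [if_pos h, if_neg h.asymm, add_zero]
    · exact absurd (h ▸ hx) hw
    · rw [if_pos h, if_neg h.asymm, zero_add]
  have hdeg := hsum fun x => if x < i then p' x else 0
  have hcard := hsum fun x => if x < i then 1 else 0
  simp only [lt_irrefl, if_false, zero_add] at hdeg hcard
  have hi : (∑ x : Fin (m + 1), if x < i then (1 : ZMod 2) else 0) = i := by
    rw [Finset.sum_boole, Finset.filter_gt_eq_Iio, Fin.card_Iio]
  rw [hi] at hcard
  have hlen : (m : ZMod 2) = w₁.length + w₂.length := by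
    have := congrArg List.length h1
    have h7 := List.toFinset_card_of_nodup hn
    have hl : F.leaves.toFinset = Finset.univ :=
      Finset.eq_univ_of_forall fun x => List.mem_toFinset.2 (hc x)
    rw [hl, Finset.card_univ, Fintype.card_fin] at h7
    rw [← Nat.cast_add]
    congr 1
    simp at this
    omega
  have s1 := hsplit (fun _ => 1) w₁ h2
  have s2 := hsplit (fun _ => 1) w₂ h3
  have s3 := hsplit p' w₁ h2
  rw [tot_one] at s1 s2
  have s4 : tot (fun x => p' x + 1) w₁ = tot p' w₁ + w₁.length := by rw [tot_add, tot_one]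
  rw [s4] at ho
  rw [sign, sign, sign, leaves_comp, h1, wordSign, wordSign, wordSign, hk, hk1, hf, ho, hdeg]
  generalize kos p' (w₁ ++ i :: w₂) = z1 at *
  generalize kos (fun y => p (inLab n i y)) G.leaves = z2 at *
  generalize kos (fun _ => 1) (w₁ ++ i :: w₂) = z3 at *
  generalize kos (fun _ => 1) G.leaves = z4 at *
  generalize follow p' (w₁ ++ i :: w₂) = z5 at *
  generalize follow (fun y => p (inLab n i y)) G.leaves = z6 at *
  generalize inter p' F = z7 at *
  generalize inter (fun y => p (inLab n i y)) G = z8 at *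
  clear hk hk1 hf ho h6 hsum hsplit hdeg hi
  rw [s3, hcard, hlen, s1, s2]
  grind

end Forest

end CompSign

end

section

variable {k : Type u} [Field k]

/-! ### Multilinear maps and homogeneous arguments. -/

section Twist

variable {A : Type v} [AddCommGroup A] [Module k A] {B : Type w} [AddCommGroup B] [Module k B]
  (𝒜 : ℤ → Submodule k A) [DirectSum.Decomposition 𝒜] {N : ℕ}

/-- Every vector is a sum of homogeneous ones. Identities with signs only make sense on homogeneous
arguments, and this turns them into equalities of maps. -/
theorem multilinear_ext {f g : MultilinearMap k (fun _ : Fin N => A) B}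
    (h : ∀ (p : Fin N → ℤ) a, (∀ j, a j ∈ 𝒜 (p j)) → f a = g a) : f = g := by
  ext a
  have ha : a = fun j => ∑ i ∈ (DirectSum.decompose 𝒜 (a j)).support,
      (DirectSum.decompose 𝒜 (a j) i : A) :=
    funext fun j => (DirectSum.sum_support_decompose 𝒜 (a j)).symm
  rw [ha, MultilinearMap.map_sum_finset, MultilinearMap.map_sum_finset]
  exact Finset.sum_congr rfl fun r _ => h r _ fun j => SetLike.coe_mem _

theorem multilinear_units_smul (u : ℤˣ) (f : MultilinearMap k (fun _ : Fin N => A) B)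
    (a : Fin N → A) : (u • f) a = u • f a := by
  rcases Int.units_eq_one_or u with rfl | rfl <;> simp

/-- The projection onto the homogeneous elements whose degree has parity `s`. -/
def parityProj (s : ZMod 2) : A →ₗ[k] A :=
  DirectSum.toModule k ℤ A (fun i => if (i : ZMod 2) = s then (𝒜 i).subtype else 0) ∘ₗ
    (DirectSum.decomposeLinearEquiv 𝒜).toLinearMap

theorem parityProj_apply (s : ZMod 2) {p : ℤ} {a : A} (ha : a ∈ 𝒜 p) :
    parityProj 𝒜 s a = if (p : ZMod 2) = s then a else 0 := by
  have h : DirectSum.decomposeLinearEquiv 𝒜 a = DirectSum.lof k ℤ (fun i => 𝒜 i) p ⟨a, ha⟩ :=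
    DirectSum.decompose_of_mem 𝒜 ha
  rw [parityProj, LinearMap.comp_apply, LinearEquiv.coe_coe, h, DirectSum.toModule_lof]
  split <;> rfl

/-- Multiply a multilinear map by a sign that depends on the parities of the arguments. -/
def twist (S : (Fin N → ZMod 2) → ZMod 2) (f : MultilinearMap k (fun _ : Fin N => A) B) :
    MultilinearMap k (fun _ : Fin N => A) B :=
  ∑ P : Fin N → ZMod 2, sg (S P) • f.compLinearMap fun j => parityProj 𝒜 (P j)

theorem twist_apply (S : (Fin N → ZMod 2) → ZMod 2) (f : MultilinearMap k (fun _ : Fin N => A) B)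
    {p : Fin N → ℤ} {a : Fin N → A} (ha : ∀ j, a j ∈ 𝒜 (p j)) :
    twist 𝒜 S f a = sg (S fun j => (p j : ZMod 2)) • f a := by
  rw [twist, _root_.sum_apply, Finset.sum_eq_single fun j => (p j : ZMod 2)]
  · rw [multilinear_units_smul, MultilinearMap.compLinearMap_apply]
    congr 2
    funext j
    rw [parityProj_apply 𝒜 _ (ha j), if_pos rfl]
  · intro P _ hP
    obtain ⟨j, hj⟩ := Function.ne_iff.1 hP
    rw [multilinear_units_smul, MultilinearMap.compLinearMap_apply,
      f.map_coord_zero j (by rw [parityProj_apply 𝒜 _ (ha j), if_neg (Ne.symm hj)]), smul_zero]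
  · simp

end Twist

/-! ### Evaluation of forests by operations. -/

section Eval

variable {A : Type v} [AddCommGroup A] [Module k A] {B : Type w} [AddCommGroup B] [Module k B]
  {α β : Type*}

/-- Apply a family of multilinear maps to a nonempty list of arguments. -/
def evalList (f : ∀ n : ℕ, MultilinearMap k (fun _ : Fin (n + 1) => A) B) (l : List A) : B :=
  f (l.length - 1) fun i => l.getD i 0

theorem evalList_eq (f : ∀ n : ℕ, MultilinearMap k (fun _ : Fin (n + 1) => A) B) {n : ℕ}
    {l : List A} (h : l.length = n + 1) : evalList f l = f n fun i => l.getD i 0 := by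
  obtain rfl : n = l.length - 1 := by omega
  rfl

theorem evalList_ofFn (f : ∀ n : ℕ, MultilinearMap k (fun _ : Fin (n + 1) => A) B) {n : ℕ}
    (a : Fin (n + 1) → A) : evalList f (List.ofFn a) = f n a := by
  rw [evalList_eq f (List.length_ofFn)]
  congr 1
  funext i
  rw [List.getD_eq_getElem _ _ (by rw [List.length_ofFn]; exact i.2), List.getElem_ofFn]

theorem getD_append_cons {l₁ l₂ : List A} (y z : A) {n : ℕ} (h : l₁.length < n + 1) :
    (fun i : Fin (n + 1) => (l₁ ++ y :: l₂).getD i 0) =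
      Function.update (fun i : Fin (n + 1) => (l₁ ++ z :: l₂).getD i 0) ⟨l₁.length, h⟩ y := by
  funext i
  rcases lt_trichotomy (i : ℕ) l₁.length with h1 | h1 | h1
  · rw [Function.update_of_ne (by simp [Fin.ext_iff]; omega),
      List.getD_append _ _ _ _ h1, List.getD_append _ _ _ _ h1]
  · obtain rfl : i = ⟨l₁.length, h⟩ := Fin.ext h1
    rw [Function.update_self, List.getD_append_right _ _ _ _ (le_refl _)]
    simp
  · rw [Function.update_of_ne (by simp [Fin.ext_iff]; omega),
      List.getD_append_right _ _ _ _ h1.le, List.getD_append_right _ _ _ _ h1.le]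
    obtain ⟨c, hc⟩ : ∃ c, (i : ℕ) - l₁.length = c + 1 := ⟨i - l₁.length - 1, by omega⟩
    rw [hc, List.getD_cons_succ, List.getD_cons_succ]

theorem exists_evalList (f : ∀ n : ℕ, MultilinearMap k (fun _ : Fin (n + 1) => A) B)
    (l₁ l₂ : List A) : ∃ g : A →ₗ[k] B, ∀ y, evalList f (l₁ ++ y :: l₂) = g y := by
  refine ⟨(f (l₁.length + l₂.length)).toLinearMap
    (fun i => (l₁ ++ 0 :: l₂).getD i 0) ⟨l₁.length, by omega⟩, fun y => ?_⟩
  rw [evalList_eq f (n := l₁.length + l₂.length) (by simp; omega), MultilinearMap.toLinearMap_apply,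
    getD_append_cons y 0 (by omega)]

namespace Forest

variable (b : ∀ n : ℕ, MultilinearMap k (fun _ : Fin (n + 1) => A) A)

/-- The values of the trees of a forest, the vertices acting by the operations `b`. -/
def vals (a : α → A) : Forest α → List A
  | nil => []
  | leaf x r => a x :: vals a r
  | node c r => evalList b (vals a c) :: vals a r

@[simp] theorem vals_leaf (a : α → A) (x) (r) : vals b a (leaf x r) = a x :: vals b a r := rfl

@[simp] theorem vals_node (a : α → A) (c r) :
    vals b a (node c r) = evalList b (vals b a c) :: vals b a r := rfl

theorem length_vals (a : α → A) (F : Forest α) : (F.vals b a).length = F.width := by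
  induction F with
  | nil => rfl
  | leaf x r ih => simp [width, ih]
  | node c r _ ih => simp [width, ih]

theorem vals_append (a : α → A) (F G : Forest α) :
    (F.append G).vals b a = F.vals b a ++ G.vals b a := by
  induction F with
  | nil => rfl
  | leaf x r ih => simp [append, ih]
  | node c r _ ih => simp [append, ih]

theorem vals_map (f : α → β) (a : β → A) (F : Forest α) : (F.map f).vals b a = F.vals b (a ∘ f) := by
  induction F with
  | nil => rfl
  | leaf x r ih => simp [map, ih]
  | node c r ih' ih => simp [map, ih, ih']

theorem vals_congr {a a' : α → A} {F : Forest α} (h : ∀ x ∈ F.leaves, a x = a' x) :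
    F.vals b a = F.vals b a' := by
  induction F with
  | nil => rfl
  | leaf x r ih => simp_all
  | node c r ih' ih => simp_all

theorem vals_graft {f : α → Forest β} {a : β → A} {a' : α → A} {F : Forest α}
    (h : ∀ x ∈ F.leaves, (f x).vals b a = [a' x]) : (F.graft f).vals b a = F.vals b a' := by
  induction F with
  | nil => rfl
  | leaf x r ih => simp_all [graft, vals_append]
  | node c r ih' ih => simp_all [graft]

theorem vals_ofLeaves (a : α → A) (l : List α) : (ofLeaves l).vals b a = l.map a := by
  induction l with
  | nil => rfl
  | cons x l ih => simp [ofLeaves, ih]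

/-- A leaf lies in one tree only, so one value changes, and it does so linearly by induction. -/
theorem vals_update [DecidableEq α] (a : α → A) {F : Forest α} (hn : F.leaves.Nodup) {x}
    (hx : x ∈ F.leaves) : ∃ (l₁ l₂ : List A) (g : A →ₗ[k] A), ∀ y,
      F.vals b (Function.update a x y) = l₁ ++ g y :: l₂ := by
  induction F with
  | nil => simp at hx
  | leaf z r ih =>
    simp only [leaves_leaf, List.nodup_cons] at hn
    by_cases hz : z = x
    · subst z
      refine ⟨[], r.vals b a, LinearMap.id, fun y => ?_⟩
      rw [vals_leaf, Function.update_self, List.nil_append, LinearMap.id_apply]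
      congr 1
      refine vals_congr b fun z hz => Function.update_of_ne ?_ _ _
      rintro rfl
      exact hn.1 hz
    · obtain ⟨l₁, l₂, g, h⟩ := ih hn.2 (by simpa [Ne.symm hz] using hx)
      exact ⟨a z :: l₁, l₂, g, fun y => by
        rw [vals_leaf, h, Function.update_of_ne hz, List.cons_append]⟩
  | node c r ih' ih =>
    rw [leaves_node, List.nodup_append'] at hn
    rw [leaves_node, List.mem_append] at hx
    have hne : ∀ {F : Forest α}, x ∉ F.leaves → ∀ y,
        F.vals b (Function.update a x y) = F.vals b a := fun h y =>
      vals_congr b fun z hz => Function.update_of_ne (by rintro rfl; exact h hz) _ _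
    by_cases hc : x ∈ c.leaves
    · obtain ⟨l₁, l₂, g, h⟩ := ih' hn.1 hc
      obtain ⟨g', hg'⟩ := exists_evalList b l₁ l₂
      refine ⟨[], r.vals b a, g' ∘ₗ g, fun y => ?_⟩
      rw [vals_node, h, hg', hne fun hr => hn.2.2 hc hr]
      rfl
    · obtain ⟨l₁, l₂, g, h⟩ := ih hn.2.1 (hx.resolve_left hc)
      exact ⟨evalList b (c.vals b a) :: l₁, l₂, g, fun y => by
        rw [vals_node, h, hne hc, List.cons_append]⟩

end Forest

/-- A function that is linear in each argument. -/
def MultilinearMap.ofExists {N : ℕ} (f : (Fin N → A) → B)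
    (h : ∀ a x, ∃ g : A →ₗ[k] B, ∀ y, f (Function.update a x y) = g y) :
    MultilinearMap k (fun _ : Fin N => A) B :=
  MultilinearMap.mk' f
    (fun a x y z => by obtain ⟨g, hg⟩ := h a x; rw [hg, hg, hg, map_add])
    (fun a x c y => by obtain ⟨g, hg⟩ := h a x; rw [hg, hg, map_smul])

namespace Forest

variable (b : ∀ n : ℕ, MultilinearMap k (fun _ : Fin (n + 1) => A) A)
  (τ : ∀ n : ℕ, MultilinearMap k (fun _ : Fin (n + 1) => A) B) {N : ℕ}

/-- The operation of a tree. -/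
def treeOp (F : Forest (Fin N)) (hn : F.leaves.Nodup) (hc : ∀ x, x ∈ F.leaves)
    (hw : F.width = 1) : MultilinearMap k (fun _ : Fin N => A) A :=
  MultilinearMap.ofExists (fun a => (F.vals b a).headD 0) fun a x => by
    obtain ⟨l₁, l₂, g, h⟩ := vals_update b a hn (hc x)
    have hl := length_vals b (Function.update a x 0) F
    rw [h, hw, List.length_append, List.length_cons] at hl
    obtain rfl : l₁ = [] := List.length_eq_zero_iff.1 (by omega)
    exact ⟨g, fun y => by rw [h]; rfl⟩

/-- The operation of a cyclic forest, the root acting by `τ`. -/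
def forestOp (F : Forest (Fin N)) (hn : F.leaves.Nodup) (hc : ∀ x, x ∈ F.leaves) :
    MultilinearMap k (fun _ : Fin N => A) B :=
  MultilinearMap.ofExists (fun a => evalList τ (F.vals b a)) fun a x => by
    obtain ⟨l₁, l₂, g, h⟩ := vals_update b a hn (hc x)
    obtain ⟨g', h'⟩ := exists_evalList τ l₁ l₂
    exact ⟨g' ∘ₗ g, fun y => by rw [h, h']; rfl⟩

theorem treeOp_apply (F : Forest (Fin N)) (hn : F.leaves.Nodup) (hc : ∀ x, x ∈ F.leaves)
    (hw : F.width = 1) (a : Fin N → A) : treeOp b F hn hc hw a = (F.vals b a).headD 0 := rfl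

theorem vals_eq_treeOp (F : Forest (Fin N)) (hn : F.leaves.Nodup) (hc : ∀ x, x ∈ F.leaves)
    (hw : F.width = 1) (a : Fin N → A) : F.vals b a = [treeOp b F hn hc hw a] := by
  rw [treeOp_apply]
  have := length_vals b a F
  rw [hw] at this
  obtain ⟨y, hy⟩ := List.length_eq_one_iff.1 this
  rw [hy]; rfl

theorem forestOp_apply (F : Forest (Fin N)) (hn : F.leaves.Nodup) (hc : ∀ x, x ∈ F.leaves)
    (a : Fin N → A) : forestOp b τ F hn hc a = evalList τ (F.vals b a) := rfl

/-- The degrees of the values of the trees of a forest. -/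
def degs (p : α → ℤ) : Forest α → List ℤ
  | nil => []
  | leaf x r => p x :: degs p r
  | node c r => ((degs p c).sum + (degs p c).length - 2) :: degs p r

theorem length_degs (p : α → ℤ) (F : Forest α) : (F.degs p).length = F.width := by
  induction F with
  | nil => rfl
  | leaf x r ih => simp [degs, width, ih]
  | node c r _ ih => simp [degs, width, ih]

/-- In suspended degrees, one more than the given ones, degrees add up and each vertex lowers the
total by one. -/
theorem sum_degs (p : α → ℤ) (F : Forest α) : (F.degs p).sum =
    (F.leaves.map p).sum + F.leaves.length - F.width - F.brs.length := by
  induction F with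
  | nil => rfl
  | leaf x r ih => simp [degs, width, ih]; ring
  | node c r ih' ih => simp [degs, width, ih, ih', length_degs]; ring

end Forest

theorem evalList_mem {𝒜 : ℤ → Submodule k A} {ℬ : ℤ → Submodule k B} {d : ℕ → ℤ}
    {f : ∀ n : ℕ, MultilinearMap k (fun _ : Fin (n + 1) => A) B}
    (hf : ∀ n, HasDegree 𝒜 ℬ (d n) (f n)) {l : List A} {p : List ℤ}
    (h : List.Forall₂ (fun x q => x ∈ 𝒜 q) l p) (hl : l ≠ []) :
    evalList f l ∈ ℬ (p.sum + d (p.length - 1)) := by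
  obtain ⟨n, hn⟩ : ∃ n, l.length = n + 1 :=
    ⟨l.length - 1, by have := List.length_pos_iff.2 hl; omega⟩
  have hp : p.length = n + 1 := by rw [← h.length_eq, hn]
  have hs : p.sum = ∑ i : Fin (n + 1), p.getD i 0 := by
    conv_lhs => rw [← List.ofFn_getElem (xs := p)]
    rw [List.sum_ofFn]
    refine Fintype.sum_equiv (finCongr hp) _ _ fun i => ?_
    rw [List.getD_eq_getElem _ _ (by simp)]; rfl
  rw [evalList_eq f hn, hs, hp, Nat.add_sub_cancel]
  refine hf n _ _ fun j => ?_
  rw [List.getD_eq_getElem _ _ (by omega), List.getD_eq_getElem _ _ (by omega)]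
  exact h.get _ _

namespace Forest

variable {b : ∀ n : ℕ, MultilinearMap k (fun _ : Fin (n + 1) => A) A}

theorem vals_mem {𝒜 : ℤ → Submodule k A} (hb : ∀ n : ℕ, HasDegree 𝒜 𝒜 ((n : ℤ) - 1) (b n))
    {p : α → ℤ} {a : α → A} (ha : ∀ x, a x ∈ 𝒜 (p x)) {F : Forest α} (hF : F.Good) :
    List.Forall₂ (fun x q => x ∈ 𝒜 q) (F.vals b a) (F.degs p) := by
  induction F with
  | nil => exact List.Forall₂.nil
  | leaf x r ih => exact List.Forall₂.cons (ha x) (ih hF)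
  | node c r ih' ih =>
    refine List.Forall₂.cons ?_ (ih hF.2.2)
    have hl : c.vals b a ≠ [] := by
      rw [← List.length_pos_iff, length_vals]
      have := hF.1; omega
    have h := evalList_mem hb (ih' hF.2.1) hl
    rw [length_degs, Nat.cast_sub (by have := hF.1; omega)] at h
    rw [length_degs]
    convert h using 2
    push_cast; ring

end Forest

end Eval

end

/-! ### Chains as combinations of oriented cells. -/

section

variable {k : Type u} [Field k] {m n : ℕ}

local notation "ι" => ExteriorAlgebra.ι k

namespace FacePoset

theorem chains_induction {X : FacePoset k n} {d : ℕ} {P : X.chains d → Prop} (zero : P 0)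
    (add : ∀ x y, P x → P y → P (x + y))
    (single : ∀ b ω (hω : ω ∈ ((X.dir b).map ι) ^ d) (hd : (X.br b).card + d = n),
      P ⟨Finsupp.single b ω, X.single_mem_chains hω hd⟩) (x) : P x := by
  have key : ∀ s : Finset X.Cell, ∃ h : (∑ b ∈ s, Finsupp.single b (x.1 b)) ∈ X.chains d,
      P ⟨_, h⟩ := by
    intro s
    induction s using Finset.induction_on with
    | empty => exact ⟨by simp, zero⟩
    | insert b s hb ih =>
      obtain ⟨h, hP⟩ := ih
      rw [Finset.sum_insert hb]
      by_cases h0 : x.1 b = 0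
      · rw [h0, Finsupp.single_zero, zero_add]
        exact ⟨h, hP⟩
      · have h1 := X.single_mem_chains (x.2 b).1 ((x.2 b).2 h0)
        exact ⟨Submodule.add_mem _ h1 h, add ⟨_, h1⟩ ⟨_, h⟩ (single b _ (x.2 b).1 ((x.2 b).2 h0)) hP⟩
  obtain ⟨h, hP⟩ := key x.1.support
  have hx : (∑ b ∈ x.1.support, Finsupp.single b (x.1 b)) = x.1 := x.1.sum_single
  rw [show x = ⟨_, h⟩ from Subtype.ext hx.symm]
  exact hP

end FacePoset

/-- The functional whose kernel is the direction space of the cyclohedron. -/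
def total (k : Type u) [Field k] (n : ℕ) : Module.Dual k (Fin (n + 1) → k) :=
  ∑ x, LinearMap.proj x

theorem total_apply (t : Fin (n + 1) → k) : total k n t = ∑ x, t x := by simp [total]

theorem units_smul_val {X : FacePoset k n} {d : ℕ} (u : ℤˣ) (x : X.chains d) :
    (u • x).1 = u • x.1 := map_units_int (X.chains d).subtype u x

theorem single_units_smul {γ M : Type*} [AddCommGroup M] (b : γ) (u : ℤˣ) (x : M) :
    Finsupp.single b (u • x) = u • Finsupp.single b x :=
  map_units_int (Finsupp.singleAddHom b) u x

section Cells

theorem LinBr.Rep.leaves_eq {b : LinBr n} {F} (h : b.Rep F) :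
    F.leaves = b.word.dropLast ++ [b.last] := h.leaves.trans b.word_eq

theorem CycBr.Rep.exists_leaves_eq {b : CycBr n} {F} (h : b.Rep F) :
    ∃ w x, F.leaves = w ++ [x] := by
  rcases List.eq_nil_or_concat F.leaves with h' | ⟨w, x, h'⟩
  · have := h.complete 0
    rw [h'] at this
    simp at this
  · exact ⟨w, x, by rw [h', List.concat_eq_append]⟩

/-- An oriented cell of the associahedron. -/
def assocCell {b : LinBr n} {F} (h : b.Rep F) {d : ℕ} (hd : F.brs.length + d = n) :
    (associahedron k n).chains d :=
  ⟨Finsupp.single b (orient (LinearMap.proj b.last) F.brs),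
    FacePoset.single_mem_chains _ (orient_mem rfl h.mem_brs hd) (by
      change b.br.card + d = n
      rw [h.card_br, hd])⟩

/-- An oriented cell of the cyclohedron. -/
def cycloCell {b : CycBr n} {F} (h : b.Rep F) {d : ℕ} (hd : F.brs.length + d = n) :
    (cyclohedron k n).chains d :=
  ⟨Finsupp.single b (orient (total k n) F.brs),
    FacePoset.single_mem_chains _ (orient_mem rfl h.mem_brs hd) (by
      change b.br.card + d = n
      rw [h.card_br, hd])⟩

/-- Orientation lines being one-dimensional, each component of a chain is a multiple of the oriented
cell of its forest. -/
theorem assoc_induction {d : ℕ} {P : (associahedron k n).chains d → Prop} (zero : P 0)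
    (add : ∀ x y, P x → P y → P (x + y)) (smul : ∀ (c : k) x, P x → P (c • x))
    (cell : ∀ (b : LinBr n) F (h : b.Rep F) (hd : F.brs.length + d = n), P (assocCell h hd))
    (x) : P x := by
  refine FacePoset.chains_induction zero add (fun b ω hω hd => ?_) x
  obtain ⟨F, hF⟩ := LinBr.exists_rep b
  have hd' : F.brs.length + d = n := by rw [← hF.card_br]; exact hd
  obtain ⟨c, hc⟩ := exists_smul_orient (X := associahedron k n) (b := b) (d := d) hF.good hF.nodup
    hF.leaves_eq (φ := LinearMap.proj b.last) (by simp) rfl hF.mem_brs hd' hω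
  convert smul c _ (cell b F hF hd') using 1
  refine Subtype.ext ?_
  change Finsupp.single b ω = c • Finsupp.single b _
  rw [Finsupp.smul_single, hc]

theorem cyclo_induction {d : ℕ} {P : (cyclohedron k n).chains d → Prop} (zero : P 0)
    (add : ∀ x y, P x → P y → P (x + y)) (smul : ∀ (c : k) x, P x → P (c • x))
    (cell : ∀ (b : CycBr n) F (h : b.Rep F) (hd : F.brs.length + d = n), P (cycloCell h hd))
    (x) : P x := by
  refine FacePoset.chains_induction zero add (fun b ω hω hd => ?_) x
  obtain ⟨F, hF⟩ := CycBr.exists_rep b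
  have hd' : F.brs.length + d = n := by rw [← hF.card_br]; exact hd
  obtain ⟨w, z, hw⟩ := hF.exists_leaves_eq
  obtain ⟨c, hc⟩ := exists_smul_orient (X := cyclohedron k n) (b := b) (d := d) hF.good hF.nodup
    hw (φ := total k n) (by simp [total_apply]) rfl hF.mem_brs hd' hω
  convert smul c _ (cell b F hF hd') using 1
  refine Subtype.ext ?_
  change Finsupp.single b ω = c • Finsupp.single b _
  rw [Finsupp.smul_single, hc]

theorem relabelAux_single {X : FacePoset k n} (act : X.Cell → X.Cell)
    (σ : Equiv.Perm (Fin (n + 1))) (b ω) : relabelAux X act σ (Finsupp.single b ω) =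
      Finsupp.single (act b) (ExteriorAlgebra.map (push ⇑(σ⁻¹)) ω) := by
  rw [relabelAux, Finsupp.lsum_single]; rfl

theorem length_brs_map (σ : Equiv.Perm (Fin (n + 1))) {F : Forest (Fin (n + 1))} {d : ℕ}
    (hd : F.brs.length + d = n) : (F.map σ).brs.length + d = n := by
  rw [Forest.brs_map, List.length_map, hd]

theorem assocRelabel_cell {b : LinBr n} {F} (h : b.Rep F) {d : ℕ} (hd : F.brs.length + d = n)
    (σ : Equiv.Perm (Fin (n + 1))) : assocRelabel (k := k) d σ (assocCell h hd) =
      Equiv.Perm.sign σ⁻¹ • assocCell (h.relabel σ) (length_brs_map _ hd) := by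
  refine Subtype.ext ?_
  rw [units_smul_val]
  refine (relabelAux_single (X := associahedron k n) _ σ b _).trans ?_
  change _ = Equiv.Perm.sign σ⁻¹ • Finsupp.single _ _
  rw [map_push_orient (φ' := LinearMap.proj (b.relabel σ).last), single_units_smul,
    Forest.brs_map]
  have : (b.relabel σ).last = σ⁻¹ b.last := by
    simp only [LinBr.last, LinBr.relabel, List.getLast_map]
  rw [this]
  exact LinearMap.ext fun t => push_apply_self (Equiv.injective _) t _

theorem cycloRelabel_cell {b : CycBr n} {F} (h : b.Rep F) {d : ℕ} (hd : F.brs.length + d = n)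
    (σ : Equiv.Perm (Fin (n + 1))) : cycloRelabel (k := k) d σ (cycloCell h hd) =
      Equiv.Perm.sign σ⁻¹ • cycloCell (h.relabel σ) (length_brs_map _ hd) := by
  refine Subtype.ext ?_
  rw [units_smul_val]
  refine (relabelAux_single (X := cyclohedron k n) _ σ b _).trans ?_
  change _ = Equiv.Perm.sign σ⁻¹ • Finsupp.single _ _
  rw [map_push_orient (φ' := total k n), single_units_smul, Forest.brs_map]
  exact LinearMap.ext fun t => by
    rw [LinearMap.comp_apply, total_apply, total_apply, sum_push]

section CompAux

variable {X : FacePoset k m} {Z : FacePoset k (m + n)} (comp : X.Cell → LinBr n → Z.Cell)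
  (i : Fin (m + 1))

theorem compAux_single (b b' ω ω') :
    compAux X Z comp i (Finsupp.single b ω) (Finsupp.single b' ω') =
      Finsupp.single (comp b b') (ExteriorAlgebra.map (push (b'.outGap i)) ω *
        ExteriorAlgebra.map (push (inLab n i)) ω') := by
  rw [compAux, Finsupp.sum_single_index, Finsupp.sum_single_index]
  · simp
  · exact Finset.sum_eq_zero fun b' _ => by simp

theorem compAux_add_left (x x' y) : compAux X Z comp i (x + x') y =
    compAux X Z comp i x y + compAux X Z comp i x' y := by
  refine Finsupp.sum_add_index' (fun b => Finset.sum_eq_zero fun b' _ => by simp)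
    fun b ω₁ ω₂ => ?_
  rw [← Finsupp.sum_add]
  exact Finsupp.sum_congr fun b' _ => by rw [map_add, add_mul, Finsupp.single_add]

theorem compAux_smul_left (c : k) (x y) : compAux X Z comp i (c • x) y =
    c • compAux X Z comp i x y := by
  rw [compAux, compAux, Finsupp.sum_smul_index' fun b => Finset.sum_eq_zero fun b' _ => by simp,
    Finsupp.smul_sum]
  refine Finsupp.sum_congr fun b _ => ?_
  rw [Finsupp.smul_sum]
  exact Finsupp.sum_congr fun b' _ => by rw [map_smul, smul_mul_assoc, Finsupp.smul_single]

theorem compAux_add_right (x y y') : compAux X Z comp i x (y + y') =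
    compAux X Z comp i x y + compAux X Z comp i x y' := by
  rw [compAux, compAux, compAux, ← Finsupp.sum_add]
  refine Finsupp.sum_congr fun b _ => ?_
  exact Finsupp.sum_add_index' (fun b => by simp) fun b ω₁ ω₂ => by
    rw [map_add, mul_add, Finsupp.single_add]

theorem compAux_smul_right (c : k) (x y) : compAux X Z comp i x (c • y) =
    c • compAux X Z comp i x y := by
  rw [compAux, compAux, Finsupp.smul_sum]
  refine Finsupp.sum_congr fun b _ => ?_
  rw [Finsupp.sum_smul_index' (by simp), Finsupp.smul_sum]
  exact Finsupp.sum_congr fun b' _ => by rw [map_smul, mul_smul_comm, Finsupp.smul_single]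

end CompAux

/-- `orient_comp` lists the inner brackets behind all the outer ones, whereas the forest of the
composite has them in front of `L₂`. -/
theorem orient_comp_brs {b' : LinBr n} {G : Forest (Fin (n + 1))} (hG : b'.Rep G)
    (i : Fin (m + 1)) {φ : Module.Dual k (Fin (m + 1) → k)}
    {ψ : Module.Dual k (Fin (m + n + 1) → k)} (hφ : ψ ∘ₗ push (b'.outGap i) = φ)
    (hψ : ∀ s ∈ (associahedron k n).dir b', ψ (push (inLab n i) s) = 0)
    {F : Forest (Fin (m + 1))} {L₁ L₂} (hF : F.brs = L₁ ++ L₂)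
    (hc : (F.comp i G).brs = L₁.map (substWord i G.leaves) ++ (G.brs.map (List.map (inLab n i)) ++
      L₂.map (substWord i G.leaves))) :
    ExteriorAlgebra.map (push (b'.outGap i)) (orient φ F.brs) *
      ExteriorAlgebra.map (push (inLab n i)) (orient (LinearMap.proj b'.last) G.brs) =
      sg (G.brs.length * m + n * (m + i) + G.brs.length * L₂.length) •
        orient ψ (F.comp i G).brs := by
  rw [orient_comp hG i hφ hψ, hF, List.map_append, List.append_assoc, orient_swap, hc, hG.leaves,
    sg_smul_smul, List.length_map, List.length_map, mul_comm (L₂.length : ZMod 2)]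

theorem length_brs_comp {G : Forest (Fin (n + 1))} {i : Fin (m + 1)} {F : Forest (Fin (m + 1))} (hn : F.leaves.Nodup) (hi : i ∈ F.leaves)
    {d e : ℕ} (hd : F.brs.length + d = m) (he : G.brs.length + e = n) :
    (F.comp i G).brs.length + (d + e) = m + n := by
  obtain ⟨w₁, w₂, L₁, L₂, -, -, -, h4, h5, -⟩ := Forest.comp_split G hn hi
  rw [h4] at hd
  rw [h5]
  simp only [List.length_append, List.length_map] at *
  omega

theorem assocComp_cell {b : LinBr m} {F} (h : b.Rep F) {d : ℕ} (hd : F.brs.length + d = m)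
    {b' : LinBr n} {G} (h' : b'.Rep G) {e : ℕ} (he : G.brs.length + e = n) (i : Fin (m + 1))
    {L₁ L₂} (hF : F.brs = L₁ ++ L₂)
    (hc : (F.comp i G).brs = L₁.map (substWord i G.leaves) ++ (G.brs.map (List.map (inLab n i)) ++
      L₂.map (substWord i G.leaves))) :
    assocComp (k := k) i (assocCell h hd) (assocCell h' he) =
      sg (G.brs.length * m + n * (m + i) + G.brs.length * L₂.length) •
        assocCell (h.comp h' i) (length_brs_comp h.nodup (h.complete i) hd he) := by
  refine Subtype.ext ?_
  rw [units_smul_val]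
  refine (compAux_single _ i _ _ _ _).trans ?_
  change _ = sg _ • Finsupp.single _ _
  rw [orient_comp_brs h' i (ψ := LinearMap.proj (b.comp i b').last) _ _ hF hc, single_units_smul]
  · rw [LinBr.last_comp]
    exact LinearMap.ext fun t => push_apply_self (b'.outGap_inj i) t _
  · exact fun s hs => (LinBr.mem_dir _ (LinBr.push_in_dir i b b' s hs)).1

theorem cycloComp_cell {b : CycBr m} {F} (h : b.Rep F) {d : ℕ} (hd : F.brs.length + d = m)
    {b' : LinBr n} {G} (h' : b'.Rep G) {e : ℕ} (he : G.brs.length + e = n) (i : Fin (m + 1))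
    {L₁ L₂} (hF : F.brs = L₁ ++ L₂)
    (hc : (F.comp i G).brs = L₁.map (substWord i G.leaves) ++ (G.brs.map (List.map (inLab n i)) ++
      L₂.map (substWord i G.leaves))) :
    cycloComp (k := k) i (cycloCell h hd) (assocCell h' he) =
      sg (G.brs.length * m + n * (m + i) + G.brs.length * L₂.length) •
        cycloCell (h.comp h' i) (length_brs_comp h.nodup (h.complete i) hd he) := by
  refine Subtype.ext ?_
  rw [units_smul_val]
  refine (compAux_single _ i _ _ _ _).trans ?_
  change _ = sg _ • Finsupp.single _ _
  rw [orient_comp_brs h' i (ψ := total k (m + n)) _ _ hF hc, single_units_smul]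
  · exact LinearMap.ext fun t => by
      rw [LinearMap.comp_apply, total_apply, total_apply, sum_push]
  · intro s hs
    rw [total_apply, sum_push, ← sumOver_word b'.word b'.nodup b'.complete, (b'.mem_dir hs).2.2.1]

end Cells

/-! ### The reference orientations of the top cells. -/

section Tops

theorem basisProd_eq_mul_single {l : List (Fin n)} {x : Fin n} :
    basisProd k (l ++ [x]) = (l.map fun y => ι (Pi.single y 1 - Pi.single x 1)).prod *
      ι (Pi.single x 1) := by
  rw [prod_sub_mul, basisProd_append, basisProd_cons, basisProd_nil, mul_one, basisProd]

theorem topRep_assoc (n : ℕ) : (LinBr.top (n + 1)).Rep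
    (Forest.node (Forest.ofLeaves (List.finRange (n + 2))) Forest.nil) where
  good := ⟨by simp [Forest.width_ofLeaves], Forest.good_ofLeaves _, trivial⟩
  width := rfl
  leaves := by simp [LinBr.top]
  mem_brs := by simp [LinBr.top]

theorem topRep_cyclo (n : ℕ) : (CycBr.top n).Rep (Forest.ofLeaves (List.finRange (n + 1))) where
  good := Forest.good_ofLeaves _
  leaves := by simp [CycBr.top]
  mem_brs := by simp [CycBr.top]

/-- The volume form is `U ∧ e ∧ e'`, where `U` is the reference orientation. Both functionals vanish
on the vectors that make up `U`, so each of the two contractions contributes the sign of passing it,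
and these cancel. -/
theorem assocTop_eq (n : ℕ) : assocTop k n = assocCell (topRep_assoc n) (by simp; omega) := by
  refine Subtype.ext ?_
  change Finsupp.single _ _ = Finsupp.single _ _
  congr 1
  have hw : List.finRange (n + 2) = (List.finRange n).map (fun j => j.castSucc.castSucc) ++
      [(Fin.last n).castSucc] ++ [Fin.last (n + 1)] := by
    rw [List.finRange_succ_last, List.finRange_succ_last, List.map_append, List.map_map]; rfl
  have hl : (LinBr.top (n + 1)).last = Fin.last (n + 1) := by
    simp only [LinBr.last, LinBr.top, hw, List.getLast_append_singleton]
  set U := ExteriorAlgebra.ιMulti k n fun j : Fin n =>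
    (Pi.single j.castSucc.castSucc 1 - Pi.single (Fin.last n).castSucc 1 : Fin (n + 2) → k) with hU
  set e : Fin (n + 2) → k := Pi.single (Fin.last n).castSucc 1 with he
  set e' : Fin (n + 2) → k := Pi.single (Fin.last (n + 1)) 1 with he'
  have hvol : vol k (n + 2) = U * (ι e * ι e') := by
    rw [vol, hw, basisProd_append, basisProd_eq_mul_single, List.map_map, hU,
      ExteriorAlgebra.ιMulti_apply, List.ofFn_eq_map, mul_assoc, basisProd_cons, basisProd_nil,
      mul_one]
    rfl
  set φ : Module.Dual k (Fin (n + 2) → k) := gapSum k (List.finRange (n + 2)) with hφ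
  have hφs : ∀ t, φ t = ∑ x, t x - t (Fin.last (n + 1)) := by
    intro t
    have h1 := sumOver_word _ (List.nodup_finRange _) (fun x => List.mem_finRange x) t
    rw [List.finRange_succ_last, sumOver_append] at h1
    rw [hφ, gapSum, List.finRange_succ_last, List.dropLast_concat, ← h1]
    simp
  have hne : ∀ j : Fin n, Fin.last (n + 1) ≠ j.castSucc.castSucc := by
    intro j; rw [Ne, Fin.ext_iff]; simp; omega
  have hne' : Fin.last (n + 1) ≠ (Fin.last n).castSucc := by
    rw [Ne, Fin.ext_iff]; simp
  have h1 : U ∈ ((LinearMap.ker φ).map ι) ^ n := ιMulti_mem fun j => by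
    rw [LinearMap.mem_ker, hφs]
    simp [Pi.single_apply, hne, hne']
  have h2 : U ∈ ((LinearMap.ker (LinearMap.proj (Fin.last (n + 1)) :
      (Fin (n + 2) → k) →ₗ[k] k)).map ι) ^ n := ιMulti_mem fun j => by
    rw [LinearMap.mem_ker]
    simp [hne, hne']
  have h3 : φ e = 1 := by rw [hφs]; simp [he, Pi.single_apply, hne']
  have h4 : φ e' = 0 := by rw [hφs]; simp [he', Pi.single_apply]
  have hi : ∀ (ψ : Module.Dual k (Fin (n + 2) → k)) v, CliffordAlgebra.contractLeft ψ (ι v) =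
      algebraMap k _ (ψ v) := fun ψ v => CliffordAlgebra.contractLeft_ι _ _ _
  rw [hl]
  simp only [orient, Forest.brs_node, Forest.leaves_ofLeaves, Forest.brs_ofLeaves, Forest.brs_nil,
    List.append_nil, List.map_cons, List.map_nil, contr_cons, contr_nil]
  rw [← hφ, hvol, contractLeft_mul_of_left (fun v hv => hv) h1, contractLeft_ι_mul, h3, hi, h4,
    map_zero, mul_zero, sub_zero, one_smul, map_units_int,
    contractLeft_mul_of_left (fun v hv => hv) h2, hi, sg_smul_smul]
  have : sg ((n : ZMod 2) + n) = 1 := by rw [CharTwo.add_self_eq_zero, sg_zero]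
  rw [this, one_smul, he']
  simp

/-- As for the associahedron, but with a single contraction, so that the sign of passing the `n`
factors of `U` stays. -/
theorem cycloTop_eq (n : ℕ) :
    cycloTop k n = sg n • cycloCell (topRep_cyclo n) (by simp) := by
  refine Subtype.ext ?_
  rw [units_smul_val]
  change Finsupp.single _ _ = sg _ • Finsupp.single _ _
  rw [← single_units_smul]
  congr 1
  set U := ExteriorAlgebra.ιMulti k n fun j : Fin n =>
    (Pi.single j.castSucc 1 - Pi.single (Fin.last n) 1 : Fin (n + 1) → k) with hU
  have hvol : vol k (n + 1) = U * ι (Pi.single (Fin.last n) 1) := by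
    rw [vol, List.finRange_succ_last, basisProd_eq_mul_single, List.map_map, hU,
      ExteriorAlgebra.ιMulti_apply, List.ofFn_eq_map]
    rfl
  have h1 : U ∈ ((LinearMap.ker (total k n)).map ι) ^ n := ιMulti_mem fun j => by
    rw [LinearMap.mem_ker, total_apply]
    simp
  have hi : CliffordAlgebra.contractLeft (total k n) (ι (Pi.single (Fin.last n) 1)) =
      algebraMap k _ (total k n (Pi.single (Fin.last n) 1)) := CliffordAlgebra.contractLeft_ι _ _ _
  rw [orient, Forest.brs_ofLeaves, List.map_nil, contr_cons, contr_nil, hvol,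
    contractLeft_mul_of_left (fun v hv => hv) h1, hi, sg_smul_smul]
  have : sg ((n : ZMod 2) + n) = 1 := by rw [CharTwo.add_self_eq_zero, sg_zero]
  rw [this, one_smul, total_apply]
  simp

end Tops

end

section

variable {k : Type u} [Field k] {m n : ℕ}

/-! ### Generation by the top cells. -/

section Generation

theorem Forest.eq_ofLeaves {α : Type*} {F : Forest α} (h : F.brs = []) :
    F = Forest.ofLeaves F.leaves := by
  induction F with
  | nil => rfl
  | leaf x r ih => exact congrArg _ (ih h)
  | node c r => simp at h

theorem exists_perm_of_word {N : ℕ} {w : List (Fin N)} (hw : w.Nodup) (hc : ∀ x, x ∈ w) :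
    ∃ τ : Equiv.Perm (Fin N), (List.finRange N).map τ = w := by
  have hl : w.length = N := by
    have h : w.toFinset = Finset.univ := Finset.eq_univ_of_forall fun x => List.mem_toFinset.2 (hc x)
    rw [← List.toFinset_card_of_nodup hw, h, Finset.card_univ, Fintype.card_fin]
  refine ⟨(finCongr hl.symm).trans (List.Nodup.getEquivOfForallMemList w hw hc), ?_⟩
  refine List.ext_getElem (by simp [hl]) fun j h1 h2 => ?_
  rw [List.getElem_map, List.getElem_finRange]
  rfl

theorem length_leaves {N : ℕ} {F : Forest (Fin N)} (hn : F.leaves.Nodup) (hc : ∀ x, x ∈ F.leaves) :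
    F.leaves.length = N := by
  have h : F.leaves.toFinset = Finset.univ :=
    Finset.eq_univ_of_forall fun x => List.mem_toFinset.2 (hc x)
  rw [← List.toFinset_card_of_nodup hn, h, Finset.card_univ, Fintype.card_fin]

theorem Forest.map_ofLeaves {α β : Type*} (f : α → β) (l : List α) :
    (Forest.ofLeaves l).map f = Forest.ofLeaves (l.map f) := by
  induction l with
  | nil => rfl
  | cons x l ih => simp [ofLeaves, map, ih]

theorem assocCell_congr {b b' : LinBr n} {F F'} (h : b.Rep F) (h' : b'.Rep F') {d : ℕ}
    (hd : F.brs.length + d = n) (hd' : F'.brs.length + d = n) (hF : F = F') :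
    assocCell (k := k) h hd = assocCell h' hd' := by
  subst hF
  obtain rfl := h.eq h'
  rfl

theorem cycloCell_congr {b b' : CycBr n} {F F'} (h : b.Rep F) (h' : b'.Rep F') {d : ℕ}
    (hd : F.brs.length + d = n) (hd' : F'.brs.length + d = n) (hF : F = F') :
    cycloCell (k := k) h hd = cycloCell h' hd' := by
  subst hF
  obtain rfl := h.eq h'
  rfl

theorem cycloRelabel_units_smul {d : ℕ} (σ : Equiv.Perm (Fin (n + 1))) (u : ℤˣ)
    (x : (cyclohedron k n).chains d) : cycloRelabel d σ (u • x) = u • cycloRelabel d σ x := by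
  rcases Int.units_eq_one_or u with rfl | rfl
  · rw [one_smul, one_smul]
  · have h : ∀ y : (cyclohedron k n).chains d, (-1 : ℤˣ) • y = (-1 : k) • y := fun y => Subtype.ext (by
      rw [units_smul_val, Units.neg_smul, one_smul, Submodule.coe_smul, neg_smul, one_smul])
    rw [h, h]
    exact (cycloRelabel d σ).map_smul (-1 : k) x

theorem units_smul_closed {M : Type*} [AddCommGroup M] [Module k M] {P : M → Prop}
    (smul : ∀ (c : k) x, P x → P (c • x)) (u : ℤˣ) {x : M} (h : P x) : P (u • x) := by
  rcases Int.units_eq_one_or u with rfl | rfl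
  · rwa [one_smul]
  · have := smul (-1) x h
    rw [neg_smul, one_smul] at this
    rwa [Units.neg_smul, one_smul]

theorem assocUnit_eq {b : LinBr 0} {F} (h : b.Rep F) (hd : F.brs.length + 0 = 0) :
    assocCell h hd = assocUnit k := by
  have hl := length_leaves h.nodup h.complete
  have hb : b = LinBr.top 0 := by
    refine LinBr.ext ?_ ?_
    · rw [h.leaves] at hl
      obtain ⟨x, hx⟩ := List.length_eq_one_iff.1 hl
      rw [hx, Fin.eq_zero x]; rfl
    · have : b.br.card = 0 := by rw [h.card_br]; exact hd
      rw [Finset.card_eq_zero.1 this]; rfl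
  subst hb
  refine Subtype.ext ?_
  change Finsupp.single _ _ = Finsupp.single _ _
  congr 1
  rw [List.length_eq_zero_iff.1 (by simpa using hd : F.brs.length = 0), orient, List.map_nil,
    contr_cons, contr_nil, vol]
  have : List.finRange 1 = [] ++ (LinBr.top 0).last :: [] := by
    rw [Fin.eq_zero (LinBr.top 0).last]; rfl
  rw [this, contractLeft_proj_basisProd (by simp) (by simp)]
  simp

/-- Any order of the letters is reached from the standard one by a relabelling. -/
theorem assocCell_corolla {b : LinBr (n + 1)} {w} (h : b.Rep (Forest.node (Forest.ofLeaves w) .nil))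
    (hd) : ∃ (u : ℤˣ) (σ : Equiv.Perm (Fin (n + 2))),
      assocCell h (d := n) hd = u • assocRelabel n σ (assocTop k n) := by
  have hn := h.nodup
  have hc := h.complete
  simp only [Forest.leaves_node, Forest.leaves_ofLeaves, Forest.leaves_nil, List.append_nil]
    at hn hc
  obtain ⟨τ, hτ⟩ := exists_perm_of_word hn hc
  refine ⟨Equiv.Perm.sign τ⁻¹⁻¹, τ⁻¹, ?_⟩
  rw [assocTop_eq, assocRelabel_cell, smul_smul, Int.units_mul_self, one_smul]
  refine assocCell_congr _ _ _ _ ?_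
  simp only [Forest.map, Forest.map_ofLeaves, inv_inv, hτ]

theorem cycloCell_noBrackets {b : CycBr n} {w} (h : b.Rep (Forest.ofLeaves w))
    (hd) : ∃ (u : ℤˣ) (σ : Equiv.Perm (Fin (n + 1))),
      cycloCell h (d := n) hd = u • cycloRelabel n σ (cycloTop k n) := by
  have hn := h.nodup
  have hc := h.complete
  simp only [Forest.leaves_ofLeaves] at hn hc
  obtain ⟨τ, hτ⟩ := exists_perm_of_word hn hc
  refine ⟨Equiv.Perm.sign τ⁻¹⁻¹ * sg n, τ⁻¹, ?_⟩
  rw [cycloTop_eq, cycloRelabel_units_smul, cycloRelabel_cell, smul_smul, smul_smul,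
    mul_assoc, mul_assoc, ← mul_assoc (sg (n : ZMod 2)), sg_mul_self, one_mul, Int.units_mul_self, one_smul]
  refine cycloCell_congr _ _ _ _ ?_
  simp only [Forest.map_ofLeaves, inv_inv, hτ]

/-- Strong induction on the number of brackets. A cell with none is the unit, and one with a single
bracket is a relabelled top cell. Otherwise collapsing an innermost bracket writes it as a
relabelled composite of two cells with fewer brackets, the inner one having exactly one. -/
theorem assoc_generation {P : ∀ n d, (associahedron k n).chains d → Prop}
    (zero : ∀ n d, P n d 0) (add : ∀ n d x y, P n d x → P n d y → P n d (x + y))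
    (smul : ∀ n d (c : k) x, P n d x → P n d (c • x)) (unit : P 0 0 (assocUnit k))
    (top : ∀ n, P (n + 1) n (assocTop k n))
    (relabel : ∀ n d σ x, P n d x → P n d (assocRelabel d σ x))
    (comp : ∀ m n d e i x y, P m d x → P n e y → P (m + n) (d + e) (assocComp i x y)) :
    ∀ n d x, P n d x := by
  have us : ∀ n d (u : ℤˣ) (x : (associahedron k n).chains d), P n d x → P n d (u • x) :=
    fun n d u x hx => units_smul_closed (smul n d) u hx
  have key : ∀ r n d (b : LinBr n) F (h : b.Rep F) (hd : F.brs.length + d = n),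
      F.brs.length = r → P n d (assocCell h hd) := by
    intro r
    induction r using Nat.strong_induction_on with
    | _ r ih =>
    intro n d b F h hd hr
    rcases Nat.lt_or_ge r 2 with hr2 | hr2
    · have hw := h.width
      have hnil : ∀ r : Forest (Fin (n + 1)), r.width = 0 → r = Forest.nil := by
        rintro (_ | _ | _) hr <;> simp [Forest.width] at hr
        rfl
      rcases F with _ | ⟨x, r'⟩ | ⟨c, r'⟩
      · simp [Forest.width] at hw
      · obtain rfl := hnil r' (by simpa [Forest.width] using hw)
        have hl := length_leaves h.nodup h.complete
        obtain rfl : n = 0 := by simpa using hl.symm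
        obtain rfl : d = 0 := by omega
        rw [assocUnit_eq]
        exact unit
      · obtain rfl := hnil r' (by simpa [Forest.width] using hw)
        obtain ⟨w, rfl⟩ : ∃ w, c = Forest.ofLeaves w :=
          ⟨_, Forest.eq_ofLeaves (by
            rw [← List.length_eq_zero_iff]
            simp only [Forest.brs_node, Forest.brs_nil, List.length_cons, List.append_nil] at hr
            omega)⟩
        have hd' := hd
        simp only [Forest.brs_node, Forest.brs_nil, Forest.brs_ofLeaves, List.append_nil,
          List.length_cons, List.length_nil, zero_add] at hd'
        obtain rfl : n = d + 1 := by omega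
        obtain ⟨u, σ, hu⟩ := assocCell_corolla (k := k) h hd
        rw [hu]
        exact us _ _ u _ (relabel _ _ _ _ (top d))
    · obtain ⟨m', n', hmn, G, c, σ, h1, h2, h3, h4, h5, h6, h7, h8, h9, h10⟩ :=
        Forest.exists_comp h.good h.nodup h.complete (by
          intro h0; rw [h0] at hr; simp at hr; omega)
      subst hmn
      simp only at h1
      obtain ⟨bG, hG⟩ := LinBr.exists_of_forest h2 (h3.trans h.width) h4 h5
      obtain ⟨bc, hC⟩ := LinBr.exists_of_forest h6 rfl h7 h8
      have hcl : (Forest.node c Forest.nil).brs.length = 1 := by simp [h9]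
      obtain ⟨dG, hdG⟩ : ∃ dG, G.brs.length + dG = m' := by
        have := Forest.length_brs_le h2
        rw [length_leaves h4 h5, h3, h.width] at this
        exact ⟨m' - G.brs.length, by omega⟩
      obtain ⟨dc, hdc⟩ : ∃ dc, (Forest.node c Forest.nil).brs.length + dc = n' := by
        have := Forest.length_brs_le h6
        rw [length_leaves h7 h8] at this
        exact ⟨n' - (Forest.node c Forest.nil).brs.length, by simp [Forest.width] at *; omega⟩
      obtain rfl : d = dG + dc := by omega
      obtain ⟨_, _, L₁, L₂, -, -, -, hL, hL', -⟩ :=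
        Forest.comp_split (Forest.node c Forest.nil) h4 (h5 0)
      have hcomp := assocComp_cell (k := k) hG hdG hC hdc 0 hL hL'
      have hrel := assocRelabel_cell (k := k) (hG.comp hC 0)
        (length_brs_comp h4 (h5 0) hdG hdc) σ
      -- The inserted sign cancels that of `assocComp_cell`, so that exactly the composite cell is
      -- relabelled.
      have hP := relabel _ _ σ _ (us _ _
        (sg ((Forest.node c Forest.nil).brs.length * m' + n' * (m' + (0 : Fin (m' + 1))) +
          (Forest.node c Forest.nil).brs.length * L₂.length)) _
        (comp _ _ _ _ 0 _ _ (ih _ (by omega) _ _ _ _ hG hdG rfl)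
          (ih _ (by omega) _ _ _ _ hC hdc rfl)))
      rw [hcomp, smul_smul, sg_mul_self, one_smul, hrel] at hP
      have hP' := us _ _ (Equiv.Perm.sign σ⁻¹) _ hP
      rw [smul_smul, Int.units_mul_self, one_smul] at hP'
      rw [assocCell_congr h ((hG.comp hC 0).relabel σ) hd (length_brs_map _
        (length_brs_comp h4 (h5 0) hdG hdc)) h1]
      exact hP'
  intro n d x
  exact assoc_induction (zero n d) (add n d) (smul n d) (fun b F h hd => key _ n d b F h hd rfl) x

/-- Again innermost brackets are collapsed. In a module the inner factor may be an arbitrary chain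
of the operad, so only the outer cell, which has one bracket less, is subject to the induction. -/
theorem cyclo_generation {P : ∀ n d, (cyclohedron k n).chains d → Prop}
    (zero : ∀ n d, P n d 0) (add : ∀ n d x y, P n d x → P n d y → P n d (x + y))
    (smul : ∀ n d (c : k) x, P n d x → P n d (c • x))
    (top : ∀ n, P n n (cycloTop k n))
    (relabel : ∀ n d σ x, P n d x → P n d (cycloRelabel d σ x))
    (comp : ∀ m n d e i x y, P m d x → P (m + n) (d + e) (cycloComp (n := n) (q := e) i x y)) :
    ∀ n d x, P n d x := by
  have us : ∀ n d (u : ℤˣ) (x : (cyclohedron k n).chains d), P n d x → P n d (u • x) :=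
    fun n d u x hx => units_smul_closed (smul n d) u hx
  have key : ∀ r n d (b : CycBr n) F (h : b.Rep F) (hd : F.brs.length + d = n),
      F.brs.length = r → P n d (cycloCell h hd) := by
    intro r
    induction r with
    | zero =>
      intro n d b F h hd hr
      obtain ⟨w, rfl⟩ : ∃ w, F = Forest.ofLeaves w :=
        ⟨_, Forest.eq_ofLeaves (List.length_eq_zero_iff.1 hr)⟩
      obtain rfl : d = n := by omega
      obtain ⟨u, σ, hu⟩ := cycloCell_noBrackets (k := k) h hd
      rw [hu]
      exact us _ _ u _ (relabel _ _ _ _ (top d))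
    | succ r ih =>
      intro n d b F h hd hr
      obtain ⟨m', n', hmn, G, c, σ, h1, h2, h3, h4, h5, h6, h7, h8, h9, h10⟩ :=
        Forest.exists_comp h.good h.nodup h.complete (by
          intro h0; rw [h0] at hr; simp at hr)
      subst hmn
      simp only at h1
      obtain ⟨bG, hG⟩ := CycBr.exists_of_forest h2 h4 h5
      obtain ⟨bc, hC⟩ := LinBr.exists_of_forest h6 rfl h7 h8
      have hcl : (Forest.node c Forest.nil).brs.length = 1 := by simp [h9]
      obtain ⟨dG, hdG⟩ : ∃ dG, G.brs.length + dG = m' := by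
        have h11 := Forest.length_brs_le h2
        rw [length_leaves h4 h5] at h11
        have h12 : G.width ≠ 0 := by
          intro h0
          rcases G with _ | _ | _ <;> simp [Forest.width] at h0
          simpa using h5 0
        exact ⟨m' - G.brs.length, by omega⟩
      obtain ⟨dc, hdc⟩ : ∃ dc, (Forest.node c Forest.nil).brs.length + dc = n' := by
        have := Forest.length_brs_le h6
        rw [length_leaves h7 h8] at this
        exact ⟨n' - (Forest.node c Forest.nil).brs.length, by simp [Forest.width] at *; omega⟩
      obtain rfl : d = dG + dc := by omega
      obtain ⟨_, _, L₁, L₂, -, -, -, hL, hL', -⟩ :=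
        Forest.comp_split (Forest.node c Forest.nil) h4 (h5 0)
      have hcomp := cycloComp_cell (k := k) hG hdG hC hdc 0 hL hL'
      have hrel := cycloRelabel_cell (k := k) (hG.comp hC 0)
        (length_brs_comp h4 (h5 0) hdG hdc) σ
      have hP := relabel _ _ σ _ (us _ _
        (sg ((Forest.node c Forest.nil).brs.length * m' + n' * (m' + (0 : Fin (m' + 1))) +
          (Forest.node c Forest.nil).brs.length * L₂.length)) _
        (comp _ _ _ _ 0 _ (assocCell hC hdc) (ih _ _ _ _ hG hdG (by omega))))
      rw [hcomp, smul_smul, sg_mul_self, one_smul, hrel] at hP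
      have hP' := us _ _ (Equiv.Perm.sign σ⁻¹) _ hP
      rw [smul_smul, Int.units_mul_self, one_smul] at hP'
      rw [cycloCell_congr h ((hG.comp hC 0).relabel σ) hd (length_brs_map _
        (length_brs_comp h4 (h5 0) hdG hdc)) h1]
      exact hP'
  intro n d x
  exact cyclo_induction (zero n d) (add n d) (smul n d) (fun b F h hd => key _ n d b F h hd rfl) x

end Generation

end

section

variable {k : Type u} [Field k] {m n : ℕ}

/-! ### Operations on the suspension. -/

section Shift

variable {A : Type v} [AddCommGroup A] [Module k A] {B : Type w} [AddCommGroup B] [Module k B]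
  (𝒜 : ℤ → Submodule k A) [DirectSum.Decomposition 𝒜]

/-- The exponent of the sign that turns `m_{n+1}` into an operation of degree `-1` on the
suspension. -/
def shiftSign (n : ℕ) (P : Fin (n + 1) → ZMod 2) : ZMod 2 :=
  follow P (List.finRange (n + 1)) + ((n * (n + 1) / 2 : ℕ) : ZMod 2)

/-- The operations on the suspension. -/
def shifted (f : ∀ n : ℕ, MultilinearMap k (fun _ : Fin (n + 1) => A) B) (n : ℕ) :
    MultilinearMap k (fun _ : Fin (n + 1) => A) B := twist 𝒜 (shiftSign n) (f n)

theorem shifted_apply (f : ∀ n : ℕ, MultilinearMap k (fun _ : Fin (n + 1) => A) B) {n : ℕ}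
    {p : Fin (n + 1) → ℤ} {a : Fin (n + 1) → A} (ha : ∀ j, a j ∈ 𝒜 (p j)) :
    shifted 𝒜 f n a = sg (shiftSign n fun j => (p j : ZMod 2)) • f n a := twist_apply 𝒜 _ _ ha

theorem HasDegree.shifted {ℬ : ℤ → Submodule k B}
    {f : ∀ n : ℕ, MultilinearMap k (fun _ : Fin (n + 1) => A) B} {d : ℕ → ℤ}
    (hf : ∀ n, HasDegree 𝒜 ℬ (d n) (f n)) (n : ℕ) :
    HasDegree 𝒜 ℬ (d n) (shifted 𝒜 f n) := by
  intro p a ha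
  rw [shifted_apply 𝒜 f ha]
  exact units_mem _ _ (hf n p a ha)

end Shift

theorem exists_dual_eq_one {V : Type*} [AddCommGroup V] [Module k V] {v : V} (hv : v ≠ 0) :
    ∃ φ : V →ₗ[k] k, φ v = 1 := by
  have := mt (Module.forall_dual_apply_eq_zero_iff k v).1 hv
  push Not at this
  obtain ⟨φ, hφ⟩ := this
  exact ⟨(φ v)⁻¹ • φ, by simp [hφ]⟩

theorem chains_linear_units_smul {X : FacePoset k n} {d : ℕ} {M : Type*} [AddCommGroup M]
    [Module k M] (f : X.chains d →ₗ[k] M) (u : ℤˣ) (x) : f (u • x) = u • f x := by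
  have h : ∀ y : X.chains d, (-1 : ℤˣ) • y = (-1 : k) • y := fun y => Subtype.ext (by
    rw [units_smul_val, Units.neg_smul, one_smul, Submodule.coe_smul, neg_smul, one_smul])
  rcases Int.units_eq_one_or u with rfl | rfl
  · rw [one_smul, one_smul]
  · rw [h, f.map_smul, Units.neg_smul, one_smul, neg_smul, one_smul]

/-! ### The action of the cells of the associahedra. -/

section AssocMap

variable {A : Type v} [AddCommGroup A] [Module k A] 
  (𝒜 : ℤ → Submodule k A) [DirectSum.Decomposition 𝒜]
  (μ : ∀ n : ℕ, MultilinearMap k (fun _ : Fin (n + 1) => A) A)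

/-- The forest is unique and its orientation is not zero, so the value there can be prescribed; a
functional with value 1 on the orientation extends it to the whole exterior algebra. -/
theorem LinBr.exists_map (b : LinBr n) : ∃ f : ExteriorAlgebra k (Fin (n + 1) → k) →ₗ[k]
    MultilinearMap k (fun _ : Fin (n + 1) => A) A, ∀ F (h : b.Rep F),
      f (orient (LinearMap.proj b.last) F.brs) = twist 𝒜 (fun P => F.sign P)
        (F.treeOp (shifted 𝒜 μ) h.nodup h.complete h.width) := by
  obtain ⟨F, hF⟩ := b.exists_rep
  obtain ⟨φ, hφ⟩ := exists_dual_eq_one (k := k) (orient_ne_zero (k := k) hF.good hF.nodup hF.leaves_eq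
    (φ := LinearMap.proj b.last) (by simp))
  refine ⟨LinearMap.toSpanSingleton k _ (twist 𝒜 (fun P => F.sign P)
        (F.treeOp (shifted 𝒜 μ) hF.nodup hF.complete hF.width)) ∘ₗ φ, fun F' hF' => ?_⟩
  obtain rfl := hF.unique hF'
  rw [LinearMap.comp_apply, hφ, LinearMap.toSpanSingleton_apply, one_smul]

/-- The operations of the oriented cells of the associahedra. -/
def assocMap (n d : ℕ) : (associahedron k n).chains d →ₗ[k]
    MultilinearMap k (fun _ : Fin (n + 1) => A) A :=
  (Finsupp.lsum k fun b : LinBr n => (b.exists_map 𝒜 μ).choose) ∘ₗ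
    ((associahedron k n).chains d).subtype

theorem assocMap_cell {b : LinBr n} {F} (h : b.Rep F) {d : ℕ} (hd : F.brs.length + d = n) :
    assocMap 𝒜 μ n d (assocCell h hd) = twist 𝒜 (fun P => F.sign P)
        (F.treeOp (shifted 𝒜 μ) h.nodup h.complete h.width) := by
  refine Eq.trans ?_ ((b.exists_map 𝒜 μ).choose_spec F h)
  exact Finsupp.lsum_single k _ _ _

theorem assocMap_cell_apply {b : LinBr n} {F} (h : b.Rep F) {d : ℕ} (hd : F.brs.length + d = n)
    {p : Fin (n + 1) → ℤ} {a : Fin (n + 1) → A} (ha : ∀ j, a j ∈ 𝒜 (p j)) :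
    assocMap 𝒜 μ n d (assocCell h hd) a = sg (F.sign fun j => (p j : ZMod 2)) •
        F.treeOp (shifted 𝒜 μ) h.nodup h.complete h.width a := by
  rw [assocMap_cell, twist_apply 𝒜 _ _ ha]

variable {μ}

theorem treeOp_mem (hμ : ∀ n : ℕ, HasDegree 𝒜 𝒜 ((n : ℤ) - 1) (μ n)) {b : LinBr n} {F}
    (h : b.Rep F) {d : ℕ} (hd : F.brs.length + d = n)
    {p : Fin (n + 1) → ℤ} {a : Fin (n + 1) → A} (ha : ∀ j, a j ∈ 𝒜 (p j)) :
    F.treeOp (shifted 𝒜 μ) h.nodup h.complete h.width a ∈ 𝒜 (∑ j, p j + d) := by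
  have hv := Forest.vals_mem (HasDegree.shifted 𝒜 hμ) ha h.good
  rw [Forest.vals_eq_treeOp _ F h.nodup h.complete h.width a] at hv
  have hs := Forest.sum_degs p F
  obtain ⟨q, hq⟩ := List.length_eq_one_iff.1 ((Forest.length_degs p F).trans h.width)
  rw [hq] at hs hv
  have hq' : q = ∑ j, p j + d := by
    have h1 : (F.leaves.map p).sum = ∑ j, p j := by
      obtain ⟨τ, hτ⟩ := exists_perm_of_word h.nodup h.complete
      rw [← hτ, List.map_map, sum_map_finRange]
      exact Equiv.sum_comp τ p
    rw [h1, length_leaves h.nodup h.complete, h.width] at hs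
    simp at hs
    rw [hs]
    have : (n : ℤ) = F.brs.length + d := by exact_mod_cast hd.symm
    linarith
  rw [← hq']
  cases hv
  assumption

theorem assocMap_degree (hμ : ∀ n : ℕ, HasDegree 𝒜 𝒜 ((n : ℤ) - 1) (μ n)) (n d : ℕ) (x) :
    HasDegree 𝒜 𝒜 d (assocMap 𝒜 μ n d x) := by
  intro p a ha
  induction x using assoc_induction with
  | zero => rw [map_zero]; exact Submodule.zero_mem _
  | add x y hx hy => rw [map_add]; exact Submodule.add_mem _ hx hy
  | smul c x hx => rw [map_smul]; exact Submodule.smul_mem _ _ hx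
  | cell b F h hd =>
    rw [assocMap_cell_apply 𝒜 μ h hd ha]
    exact units_mem _ _ (treeOp_mem 𝒜 hμ h hd ha)

variable (μ)

/-- The sign of a word contains the sign of the permutation besides the Koszul sign. The orientation
of a relabelled cell contributes the former once more, and only the Koszul sign survives. -/
theorem sign_map_perm {N : ℕ} (τ : Equiv.Perm (Fin N)) (p : Fin N → ℤ) {F : Forest (Fin N)}
    (hn : F.leaves.Nodup) (hc : ∀ x, x ∈ F.leaves) :
    Equiv.Perm.sign τ * sg ((F.map τ).sign fun x => (p x : ZMod 2)) =
      koszulSign τ p * sg (F.sign fun x => (p (τ x) : ZMod 2)) := by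
  rw [Forest.sign, Forest.leaves_map, wordSign_map_perm τ _ hn hc, Forest.inter_map, Forest.sign,
    sg_kos_finRange, sign_eq_sg_kos]
  simp only [sg_add, Function.comp_def]
  generalize sg (kos (fun _ => 1) _) = s
  have : s * s = 1 := Int.units_mul_self s
  rw [← mul_one (sg (kos (fun x => (p x : ZMod 2)) ((List.finRange N).map τ)) *
    (sg (wordSign (fun x => (p (τ x) : ZMod 2)) F.leaves) *
      sg (F.inter fun x => (p (τ x) : ZMod 2)))), ← this]
  ac_rfl

theorem treeOp_congr (b : ∀ n : ℕ, MultilinearMap k (fun _ : Fin (n + 1) => A) A) {N N' : ℕ}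
    {F : Forest (Fin N)} {F' : Forest (Fin N')} (hn hc hw hn' hc' hw') {a a'}
    (h : F.vals b a = F'.vals b a') : F.treeOp b hn hc hw a = F'.treeOp b hn' hc' hw' a' := by
  rw [Forest.treeOp_apply, Forest.treeOp_apply, h]

theorem assocMap_equivariant (n d : ℕ) (σ : Equiv.Perm (Fin (n + 1))) (x)
    (p : Fin (n + 1) → ℤ) (a : Fin (n + 1) → A) (ha : ∀ j, a j ∈ 𝒜 (p j)) :
    assocMap 𝒜 μ n d (assocRelabel d σ x) a =
      koszulSign σ⁻¹ p • assocMap 𝒜 μ n d x (a ∘ ⇑(σ⁻¹)) := by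
  induction x using assoc_induction with
  | zero => simp
  | add x y hx hy => rw [map_add, map_add, map_add, _root_.add_apply, hx, hy,
      _root_.add_apply, smul_add]
  | smul c x hx => rw [map_smul, map_smul, map_smul, _root_.smul_apply, hx,
      _root_.smul_apply, smul_comm]
  | cell b F h hd =>
    rw [assocRelabel_cell, chains_linear_units_smul, multilinear_units_smul,
      assocMap_cell_apply 𝒜 μ _ _ ha, assocMap_cell_apply 𝒜 μ h hd (a := a ∘ ⇑σ⁻¹) (fun j => ha _), smul_smul,
      smul_smul, sign_map_perm _ p h.nodup h.complete]
    congr 1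
    exact treeOp_congr _ _ _ _ _ _ _ (Forest.vals_map _ _ _ _)

theorem unitRep : (LinBr.top 0).Rep (Forest.leaf 0 Forest.nil) where
  good := trivial
  width := rfl
  leaves := rfl
  mem_brs := by simp [LinBr.top]

theorem assocMap_unit (a : Fin 1 → A) : assocMap 𝒜 μ 0 0 (assocUnit k) a = a 0 := by
  have h : (assocMap 𝒜 μ 0 0 (assocUnit k) : MultilinearMap k (fun _ : Fin 1 => A) A) =
      MultilinearMap.ofSubsingleton k A A (0 : Fin 1) LinearMap.id := by
    refine multilinear_ext 𝒜 fun p a ha => ?_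
    rw [← assocUnit_eq unitRep (by simp)]
    refine (assocMap_cell_apply 𝒜 μ unitRep _ ha).trans ?_
    have : Forest.sign (fun j => (p j : ZMod 2)) (Forest.leaf 0 Forest.nil) = 0 := by
      simp [Forest.sign, wordSign, kos, follow, pairSum, Forest.inter]
    rw [this, sg_zero, one_smul]
    rfl
  rw [h]; rfl

/-! ### Inserting an operation into an argument of another. -/

section Plug

theorem sum_flatMap {α M : Type*} [AddCommMonoid M] (l : List α) (g : α → List M) :
    (l.flatMap g).sum = (l.map fun x => (g x).sum).sum := by
  induction l with
  | nil => rfl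
  | cons x l ih => simp [ih]

theorem sum_lab {M : Type*} [AddCommMonoid M] (i : Fin (m + 1)) (f : Fin (m + n + 1) → M) :
    ∑ j, f j = ∑ x, if x = i then ∑ y, f (inLab n i y) else f (outLab n i x) := by
  rw [← sum_map_finRange f, ← substWord_finRange i, substWord, List.map_flatMap,
    sum_flatMap, ← sum_map_finRange]
  congr 1
  refine List.map_congr_left fun x _ => ?_
  split
  · rw [List.map_map, sum_map_finRange]; rfl
  · simp

theorem plug_eq {A : Type*} (i : Fin (m + 1)) (g : (Fin (n + 1) → A) → A) (a : Fin (m + n + 1) → A) :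
    plug rfl i g a = Function.update (a ∘ outLab n i) i (g (a ∘ inLab n i)) := by
  funext j
  rcases lt_trichotomy j i with h | h | h
  · rw [Function.update_of_ne h.ne, plug, if_pos (by exact h)]
    congr 1
    exact Fin.ext (if_pos (by exact h.le)).symm
  · subst h
    rw [Function.update_self, plug, if_neg (lt_irrefl _), if_pos rfl]
    rfl
  · have h1 : (i : ℕ) < j := h
    rw [Function.update_of_ne h.ne', plug, if_neg (by omega), if_neg (by omega)]
    congr 1
    exact Fin.ext (if_neg (by omega)).symm

theorem plug_mem {𝒜 : ℤ → Submodule k A} {i : Fin (m + 1)} {g : (Fin (n + 1) → A) → A} {q : ℤ}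
    {p : Fin (m + n + 1) → ℤ} {a : Fin (m + n + 1) → A} (ha : ∀ j, a j ∈ 𝒜 (p j))
    (hg : g (a ∘ inLab n i) ∈ 𝒜 q) (j) :
    plug rfl i g a j ∈ 𝒜 (Function.update (p ∘ outLab n i) i q j) := by
  rw [plug_eq]
  by_cases h : j = i
  · subst h
    rwa [Function.update_self, Function.update_self]
  · rw [Function.update_of_ne h, Function.update_of_ne h]
    exact ha _

theorem degBefore_eq (i : Fin (m + 1)) (p : Fin (m + n + 1) → ℤ) (q : ℤ) :
    degBefore i p = ∑ x, if x < i then Function.update (p ∘ outLab n i) i q x else 0 := by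
  rw [degBefore, Finset.sum_filter, sum_lab i]
  refine Finset.sum_congr rfl fun x _ => ?_
  by_cases h : x = i
  · subst h
    rw [if_pos rfl, if_neg (lt_irrefl _)]
    exact Finset.sum_eq_zero fun y _ => if_neg (by simp [inLab])
  · rw [if_neg h, Function.update_of_ne h]
    have : ((outLab n i x : Fin (m + n + 1)) : ℕ) < i ↔ x < i := by
      rw [Fin.lt_def]
      simp only [outLab]
      split <;> omega
    simp only [this, Function.comp_apply]

theorem multilinear_update_units {B : Type w} [AddCommGroup B] [Module k B] {N : ℕ}
    (f : MultilinearMap k (fun _ : Fin N => A) B) (a : Fin N → A) (i : Fin N) (u : ℤˣ) (y : A) :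
    f (Function.update a i (u • y)) = u • f (Function.update a i y) :=
  map_units_int (f.toLinearMap a i) u y

theorem tot_leaves {N : ℕ} {F : Forest (Fin N)} (hn : F.leaves.Nodup) (hc : ∀ x, x ∈ F.leaves)
    (g : Fin N → ZMod 2) : tot g F.leaves = ∑ x, g x := by
  obtain ⟨τ, hτ⟩ := exists_perm_of_word hn hc
  rw [← hτ, tot, List.map_map, sum_map_finRange]
  exact Equiv.sum_comp τ g

theorem vals_comp (b : ∀ n : ℕ, MultilinearMap k (fun _ : Fin (n + 1) => A) A) {i : Fin (m + 1)}
    (F : Forest (Fin (m + 1))) {G : Forest (Fin (n + 1))} {a : Fin (m + n + 1) → A} {y : A}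
    (hG : G.vals b (a ∘ inLab n i) = [y]) :
    (F.comp i G).vals b a = F.vals b (Function.update (a ∘ outLab n i) i y) := by
  refine Forest.vals_graft b fun x _ => ?_
  rw [Forest.insertAt]
  by_cases hx : x = i
  · subst hx
    rw [if_pos rfl, Function.update_self, Forest.vals_map, hG]
  · rw [if_neg hx, Function.update_of_ne hx]; rfl

/-- The signs in the composition of two cells agree. -/
theorem sign_comp_eq {i : Fin (m + 1)} {F : Forest (Fin (m + 1))}
    (hn : F.leaves.Nodup) (hc : ∀ x, x ∈ F.leaves) {b' : LinBr n} {G} (h' : b'.Rep G)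
    {e : ℕ} (he : G.brs.length + e = n) : ∃ L₁ L₂, F.brs = L₁ ++ L₂ ∧
      (F.comp i G).brs = L₁.map (substWord i G.leaves) ++ (G.brs.map (List.map (inLab n i)) ++
        L₂.map (substWord i G.leaves)) ∧
      ∀ p : Fin (m + n + 1) → ℤ,
        sg (G.brs.length * m + n * (m + i) + G.brs.length * L₂.length) *
          sg ((F.comp i G).sign fun j => (p j : ZMod 2)) =
        Int.negOnePow (e * degBefore i p) *
          (sg (G.sign fun y => (p (inLab n i y) : ZMod 2)) *
          sg (F.sign fun j => ((Function.update (p ∘ outLab n i) i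
            (∑ y, p (inLab n i y) + e) j : ℤ) : ZMod 2))) := by
  obtain ⟨L₁, L₂, h1, h2, h3⟩ := Forest.sign_comp (i := i) (F := F) (G := G) hn hc
    (length_leaves h'.nodup h'.complete)
  refine ⟨L₁, L₂, h1, h2, fun p => ?_⟩
  have he2 : (e : ZMod 2) = n + G.brs.length := by
    have := congrArg (Nat.cast : ℕ → ZMod 2) he
    push_cast at this
    grind
  have h4 := h3 (fun j => (p j : ZMod 2)) (fun j => ((Function.update (p ∘ outLab n i) i
            (∑ y, p (inLab n i y) + e) j : ℤ) : ZMod 2))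
    (fun j hj => by rw [Function.update_of_ne hj]; rfl)
    (by rw [Function.update_self, tot_leaves h'.nodup h'.complete, ← he2]; push_cast; rfl)
  rw [negOnePow_eq_sg, ← sg_add, ← sg_add, ← sg_add]
  congr 1
  rw [degBefore_eq i p (∑ y, p (inLab n i y) + e)]
  push_cast
  rw [← he2] at h4
  linear_combination h4

end Plug

theorem assocComp_add_left {p q : ℕ} (i : Fin (m + 1)) (x x' : (associahedron k m).chains p)
    (y : (associahedron k n).chains q) :
    assocComp i (x + x') y = assocComp i x y + assocComp i x' y :=
  Subtype.ext (compAux_add_left _ _ _ _ _)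

theorem assocComp_add_right {p q : ℕ} (i : Fin (m + 1)) (x : (associahedron k m).chains p)
    (y y' : (associahedron k n).chains q) :
    assocComp i x (y + y') = assocComp i x y + assocComp i x y' :=
  Subtype.ext (compAux_add_right _ _ _ _ _)

theorem assocComp_smul_left {p q : ℕ} (i : Fin (m + 1)) (c : k) (x : (associahedron k m).chains p)
    (y : (associahedron k n).chains q) : assocComp i (c • x) y = c • assocComp i x y :=
  Subtype.ext (compAux_smul_left _ _ _ _ _)

theorem assocComp_smul_right {p q : ℕ} (i : Fin (m + 1)) (c : k) (x : (associahedron k m).chains p)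
    (y : (associahedron k n).chains q) : assocComp i x (c • y) = c • assocComp i x y :=
  Subtype.ext (compAux_smul_right _ _ _ _ _)

theorem cycloComp_add_left {p q : ℕ} (i : Fin (m + 1)) (x x' : (cyclohedron k m).chains p)
    (y : (associahedron k n).chains q) :
    cycloComp i (x + x') y = cycloComp i x y + cycloComp i x' y :=
  Subtype.ext (compAux_add_left _ _ _ _ _)

theorem cycloComp_add_right {p q : ℕ} (i : Fin (m + 1)) (x : (cyclohedron k m).chains p)
    (y y' : (associahedron k n).chains q) :
    cycloComp i x (y + y') = cycloComp i x y + cycloComp i x y' :=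
  Subtype.ext (compAux_add_right _ _ _ _ _)

theorem cycloComp_smul_left {p q : ℕ} (i : Fin (m + 1)) (c : k) (x : (cyclohedron k m).chains p)
    (y : (associahedron k n).chains q) : cycloComp i (c • x) y = c • cycloComp i x y :=
  Subtype.ext (compAux_smul_left _ _ _ _ _)

theorem cycloComp_smul_right {p q : ℕ} (i : Fin (m + 1)) (c : k) (x : (cyclohedron k m).chains p)
    (y : (associahedron k n).chains q) : cycloComp i x (c • y) = c • cycloComp i x y :=
  Subtype.ext (compAux_smul_right _ _ _ _ _)

/-- A bilinear compatibility with compositions needs to be checked on cells only. -/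
theorem comp_of_cells {B : Type w} [AddCommGroup B] [Module k B] {d e : ℕ} {i : Fin (m + 1)}
    {X : FacePoset k m} {Z : FacePoset k (m + n)}
    {c : X.chains d → (associahedron k n).chains e → Z.chains (d + e)}
    (addl : ∀ x x' y, c (x + x') y = c x y + c x' y)
    (addr : ∀ x y y', c x (y + y') = c x y + c x y')
    (smull : ∀ (r : k) x y, c (r • x) y = r • c x y) (smulr : ∀ (r : k) x y, c x (r • y) = r • c x y)
    {f : Z.chains (d + e) →ₗ[k] MultilinearMap k (fun _ : Fin (m + n + 1) => A) B}
    {g : X.chains d →ₗ[k] MultilinearMap k (fun _ : Fin (m + 1) => A) B}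
    {h : (associahedron k n).chains e →ₗ[k] MultilinearMap k (fun _ : Fin (n + 1) => A) A}
    {u : ℤˣ} {a : Fin (m + n + 1) → A} {Cx : X.chains d → Prop}
    (ind : ∀ {P : X.chains d → Prop}, P 0 → (∀ x y, P x → P y → P (x + y)) →
      (∀ (c : k) x, P x → P (c • x)) → (∀ x, Cx x → P x) → ∀ x, P x)
    (cell : ∀ x, Cx x → ∀ (b' : LinBr n) G (h' : b'.Rep G) (he : G.brs.length + e = n),
      f (c x (assocCell h' he)) a = u • g x (plug rfl i (h (assocCell h' he)) a)) (x y) :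
    f (c x y) a = u • g x (plug rfl i (h y) a) := by
  have hz : ∀ y, c 0 y = 0 := fun y => by simpa using smull 0 0 y
  have hz' : ∀ x, c x 0 = 0 := fun x => by simpa using smulr 0 x 0
  have hp : ∀ y, plug rfl i (h y) a = Function.update (a ∘ outLab n i) i (h y (a ∘ inLab n i)) :=
    fun y => plug_eq i _ a
  simp only [hp] at cell ⊢
  revert x
  refine ind ?_ (fun x x' hx hx' => ?_) (fun r x hx => ?_) fun x hx => ?_
  · simp [hz]
  · rw [addl, map_add, map_add, _root_.add_apply, hx, hx', _root_.add_apply, smul_add]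
  · rw [smull, map_smul, map_smul, _root_.smul_apply, hx, _root_.smul_apply, smul_comm]
  · induction y using assoc_induction with
    | zero => simp [hz']
    | add y y' hy hy' =>
      rw [addr, map_add, map_add, _root_.add_apply, hy, hy', _root_.add_apply,
        MultilinearMap.map_update_add, smul_add]
    | smul r y hy =>
      rw [smulr, map_smul, map_smul, _root_.smul_apply, hy, _root_.smul_apply,
        MultilinearMap.map_update_smul, smul_comm]
    | cell b' G h' he => exact cell x hx b' G h' he

variable {μ}

/-- On cells the composition grafts forests. The values agree by `vals_comp` and the signs by
`sign_comp_eq`; of the operations, only the degrees matter. -/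
theorem assocMap_comp (hμ : ∀ n : ℕ, HasDegree 𝒜 𝒜 ((n : ℤ) - 1) (μ n)) (m n d e : ℕ)
    (i : Fin (m + 1)) (x : (associahedron k m).chains d) (y : (associahedron k n).chains e)
    (p : Fin (m + n + 1) → ℤ) (a : Fin (m + n + 1) → A) (ha : ∀ j, a j ∈ 𝒜 (p j)) :
    assocMap 𝒜 μ (m + n) (d + e) (assocComp i x y) a =
      Int.negOnePow (e * degBefore i p) • assocMap 𝒜 μ m d x (plug rfl i (assocMap 𝒜 μ n e y) a) := by
  refine comp_of_cells (c := assocComp i) (assocComp_add_left i) (assocComp_add_right i)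
    (assocComp_smul_left i) (assocComp_smul_right i)
    (Cx := fun x => ∃ (b : LinBr m) (F : _) (h : b.Rep F) (hd : F.brs.length + d = m),
      x = assocCell h hd) (fun {P} h0 ha hs hc x => assoc_induction h0 ha hs
        (fun b F h hd => hc _ ⟨b, F, h, hd, rfl⟩) x) ?_ x y
  rintro _ ⟨b, F, h, hd, rfl⟩ b' G h' he
  obtain ⟨L₁, L₂, h1, h2, h3⟩ := sign_comp_eq (i := i) h.nodup h.complete h' he
  have hin : ∀ j, (a ∘ inLab n i) j ∈ 𝒜 ((p ∘ inLab n i) j) := fun j => ha _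
  have hmem := treeOp_mem 𝒜 hμ h' he hin
  have hG := assocMap_cell_apply 𝒜 μ h' he hin
  rw [assocComp_cell h hd h' he i h1 h2, chains_linear_units_smul, multilinear_units_smul,
    assocMap_cell_apply 𝒜 μ _ _ ha, smul_smul, h3 p, mul_smul, mul_smul, plug_eq, hG,
    multilinear_update_units]
  congr 2
  have ha' := plug_mem (i := i) (g := G.treeOp (shifted 𝒜 μ) h'.nodup h'.complete h'.width) ha hmem
  rw [plug_eq] at ha'
  rw [assocMap_cell_apply 𝒜 μ h hd ha']
  congr 1
  exact treeOp_congr _ _ _ _ _ _ _ (vals_comp _ F (Forest.vals_eq_treeOp _ G _ _ _ _))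

end AssocMap

end

section

variable {k : Type u} [Field k] {m n : ℕ}

/-! ### Cyclic symmetry on the suspension. -/

section Rotation

variable {A : Type v} [AddCommGroup A] [Module k A] {W : Type w} [AddCommGroup W] [Module k W]
  (𝒜 : ℤ → Submodule k A) [DirectSum.Decomposition 𝒜]

theorem map_getD {α β : Type*} (l : List α) (d : α) (f : α → β) {n : ℕ} (hl : l.length = n) :
    (List.finRange n).map (fun i : Fin n => f (l.getD i d)) = l.map f := by
  subst hl
  refine List.ext_getElem (by simp) fun j h1 h2 => ?_
  have h3 : j < l.length := by simpa using h2
  rw [List.getElem_map, List.getElem_map, List.getElem_finRange]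
  simp [h3]

theorem follow_finRange {n : ℕ} (P : Fin n → ZMod 2) :
    follow P (List.finRange n) = pairSum (fun x _ => x) ((List.finRange n).map P) := by
  rw [pairSum_map]; rfl

theorem forall₂_getD {𝒜 : ℤ → Submodule k A} {l : List A} {q : List ℤ}
    (h : List.Forall₂ (fun x q => x ∈ 𝒜 q) l q) (j : ℕ) : l.getD j 0 ∈ 𝒜 (q.getD j 0) := by
  induction h generalizing j with
  | nil => simp
  | cons hx _ ih =>
    cases j with
    | zero => simpa using hx
    | succ j => simpa using ih j

theorem evalList_shifted (f : ∀ n : ℕ, MultilinearMap k (fun _ : Fin (n + 1) => A) W) {l : List A}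
    {q : List ℤ} (h : List.Forall₂ (fun x q => x ∈ 𝒜 q) l q) {n : ℕ} (hl : l.length = n + 1) :
    evalList (shifted 𝒜 f) l = sg (pairSum (fun x _ => x) (q.map fun z : ℤ => (z : ZMod 2)) +
      ((n * (n + 1) / 2 : ℕ) : ZMod 2)) • evalList f l := by
  rw [evalList_eq _ hl, evalList_eq _ hl,
    shifted_apply 𝒜 f (p := fun i => q.getD i 0) fun j => forall₂_getD h j, shiftSign,
    follow_finRange, map_getD q 0 (fun z : ℤ => (z : ZMod 2)) (h.length_eq.symm.trans hl)]

theorem map_finRotate (n : ℕ) : (List.finRange (n + 1)).map (finRotate (n + 1)) =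
    (List.finRange n).map Fin.succ ++ [0] := by
  rw [List.finRange_succ_last, List.map_append, List.map_map, List.map_singleton, finRotate_last]
  congr 1
  refine List.map_congr_left fun i _ => ?_
  rw [Function.comp_apply, finRotate_apply, Fin.coeSucc_eq_succ]

theorem chi_finRotate (p : Fin (n + 1) → ℤ) : chi (finRotate (n + 1)) p =
    sg (n + (∑ j : Fin n, (p j.succ : ZMod 2)) * p 0) := by
  have h : ∀ P : Fin (n + 1) → ZMod 2, kos P ((List.finRange (n + 1)).map (finRotate (n + 1))) =
      (∑ j : Fin n, P j.succ) * P 0 := by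
    intro P
    rw [map_finRotate, kos, pairSum_append]
    have h1 : pairSum (fun x y => if y < x then P x * P y else 0)
        ((List.finRange n).map Fin.succ) = 0 := by
      rw [pairSum_map]
      simp only [Fin.succ_lt_succ_iff]
      exact kos_finRange fun x => P x.succ
    rw [h1]
    simp only [pairSum, List.map_map, List.map_singleton, List.map_nil, List.sum_singleton,
      List.sum_nil, zero_add, add_zero, Finset.sum_mul]
    rw [sum_map_finRange]
    simp
  rw [chi, sign_eq_sg_kos, sg_kos_finRange, h, h, ← sg_add]
  congr 2
  simp

variable {T : ∀ n : ℕ, MultilinearMap k (fun _ : Fin (n + 1) => A) W}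

/-- The shift signs absorb the sign of the rotation and turn the degrees `p` into `p + 1`. What is
left is the plain Koszul sign of carrying `x` past the other arguments on the suspension. -/
theorem evalList_rotate_one (hT : ∀ (n : ℕ) (p : Fin (n + 1) → ℤ) a, (∀ j, a j ∈ 𝒜 (p j)) →
      T n a = chi (finRotate (n + 1)) p • T n (a ∘ finRotate (n + 1)))
    {x : A} {z : ℤ} {l : List A} {q : List ℤ} (hx : x ∈ 𝒜 z)
    (h : List.Forall₂ (fun x q => x ∈ 𝒜 q) l q) :
    evalList (shifted 𝒜 T) (x :: l) = sg ((z + 1) * tot (fun y : ℤ => (y : ZMod 2) + 1) q) •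
      evalList (shifted 𝒜 T) (l ++ [x]) := by
  obtain ⟨n, hn⟩ : ∃ n, l.length = n := ⟨_, rfl⟩
  have hq : q.length = n := h.length_eq.symm.trans hn
  have h' : List.Forall₂ (fun x q => x ∈ 𝒜 q) (l ++ [x]) (q ++ [z]) :=
    List.rel_append h (List.Forall₂.cons hx List.Forall₂.nil)
  rw [evalList_shifted 𝒜 T (List.Forall₂.cons hx h) (n := n) (by simp [hn]),
    evalList_shifted 𝒜 T h' (n := n) (by simp [hn]), evalList_eq T (n := n) (by simp [hn]),
    evalList_eq T (n := n) (by simp [hn]),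
    hT n (fun i => (z :: q).getD i 0) _ fun j => forall₂_getD (List.Forall₂.cons hx h) j]
  have ha : (fun i : Fin (n + 1) => (x :: l).getD i 0) ∘ finRotate (n + 1) =
      fun i : Fin (n + 1) => (l ++ [x]).getD i 0 := by
    funext i
    rw [Function.comp_apply]
    refine Fin.lastCases ?_ (fun j => ?_) i
    · rw [finRotate_last, List.getD_append_right _ _ _ _ (by simp [hn])]
      simp [hn]
    · rw [finRotate_apply, Fin.coeSucc_eq_succ, List.getD_append _ _ _ _ (by simp [hn])]
      simp
  have hs : (∑ j : Fin n, (((z :: q).getD j.succ 0 : ℤ) : ZMod 2)) =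
      tot (fun y : ℤ => (y : ZMod 2)) q := by
    rw [tot, ← map_getD q 0 (fun z : ℤ => (z : ZMod 2)) hq, sum_map_finRange]
    simp
  rw [ha, chi_finRotate, hs, sg_smul_smul, sg_smul_smul]
  congr 2
  have h0 : (z :: q).getD ((0 : Fin (n + 1)) : ℕ) 0 = z := rfl
  rw [h0, tot_add, tot_one, hq, List.map_append, pairSum_append, List.map_cons, pairSum]
  have h1 : ((q.map fun z : ℤ => (z : ZMod 2)).map fun _ => (z : ZMod 2)).sum = n * z := by
    simp [hq, Function.comp_def]
  have h2 : ((q.map fun z : ℤ => (z : ZMod 2)).map fun x =>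
      ((List.map (fun z : ℤ => (z : ZMod 2)) [z]).map fun _ => x).sum).sum =
        tot (fun y : ℤ => (y : ZMod 2)) q := by
    rw [List.map_map, tot]
    simp [Function.comp_def]
  rw [h1, h2]
  simp only [pairSum, List.map_cons, List.map_nil, List.sum_nil]
  grind

theorem evalList_rotate (hT : ∀ (n : ℕ) (p : Fin (n + 1) → ℤ) a, (∀ j, a j ∈ 𝒜 (p j)) →
      T n a = chi (finRotate (n + 1)) p • T n (a ∘ finRotate (n + 1)))
    {l l' : List A} {q q' : List ℤ} (h : List.Forall₂ (fun x q => x ∈ 𝒜 q) l q)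
    (h' : List.Forall₂ (fun x q => x ∈ 𝒜 q) l' q') :
    evalList (shifted 𝒜 T) (l ++ l') = sg (tot (fun y : ℤ => (y : ZMod 2) + 1) q *
      tot (fun y : ℤ => (y : ZMod 2) + 1) q') • evalList (shifted 𝒜 T) (l' ++ l) := by
  induction h generalizing l' q' with
  | nil => simp
  | @cons x z l q hx hl ih =>
    have h1 := ih (List.rel_append h' (List.Forall₂.cons hx List.Forall₂.nil))
    rw [List.cons_append, evalList_rotate_one 𝒜 hT hx (List.rel_append hl h'), List.append_assoc,
      h1, List.append_assoc, sg_smul_smul]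
    congr 2
    simp only [tot_append, tot_cons, tot_nil]
    grind

end Rotation

/-! ### The action of the cells of the cyclohedra. -/

section CycloMap

variable {A : Type v} [AddCommGroup A] [Module k A] {W : Type w} [AddCommGroup W] [Module k W]
  (𝒜 : ℤ → Submodule k A) [DirectSum.Decomposition 𝒜]
  {μ : ∀ n : ℕ, MultilinearMap k (fun _ : Fin (n + 1) => A) A}
  {T : ∀ n : ℕ, MultilinearMap k (fun _ : Fin (n + 1) => A) W}

/-- A pair with one letter in each word is inverted in exactly one of the two concatenations. This
gives the products of degrees and of lengths, which the `follow` part completes to the product of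
the suspended degrees. -/
theorem wordSign_swap {N : ℕ} (p : Fin N → ZMod 2) {w w' : List (Fin N)} (h : w.Disjoint w') :
    wordSign p (w ++ w') = wordSign p (w' ++ w) +
      tot (fun x => p x + 1) w * tot (fun x => p x + 1) w' := by
  have hk : ∀ p : Fin N → ZMod 2, kos p (w ++ w') = kos p (w' ++ w) + tot p w * tot p w' := by
    intro p
    have key : ∀ v : List (Fin N), v.Disjoint w' →
        (v.map fun x => (w'.map fun y => if y < x then p x * p y else 0).sum).sum =
        (w'.map fun x => (v.map fun y => if y < x then p x * p y else 0).sum).sum +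
          tot p v * tot p w' := by
      intro v hv
      induction v with
      | nil => simp [tot]
      | cons x v ih =>
        have h1 : (w'.map fun z => (List.map (fun y => if y < z then p z * p y else 0)
            (x :: v)).sum).sum = tot (fun z => if x < z then p z * p x else 0) w' +
            (w'.map fun z => (v.map fun y => if y < z then p z * p y else 0).sum).sum := by
          rw [tot, ← List.sum_map_add]
          simp
        have h2 : tot (fun y => if y < x then p x * p y else 0) w' =
            tot (fun z => if x < z then p z * p x else 0) w' + p x * tot p w' := by
          rw [← tot_mul, ← tot_add]
          refine tot_congr fun y hy => ?_
          have hne : y ≠ x := by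
            rintro rfl
            exact hv List.mem_cons_self hy
          rcases lt_or_gt_of_ne hne with h | h
          · rw [if_pos h, if_neg h.asymm, zero_add]
          · rw [if_neg h.asymm, if_pos h]
            grind
        rw [List.map_cons, List.sum_cons, ih fun y hy => hv (List.mem_cons_of_mem _ hy), h1]
        change tot (fun y => if y < x then p x * p y else 0) w' + _ = _
        rw [h2, tot_cons]
        ring
    rw [kos, pairSum_append, pairSum_append, key w h]
    ring
  rw [wordSign, wordSign, hk, hk, follow_append, follow_append, tot_one, tot_one, tot_add, tot_add,
    tot_one, tot_one]
  grind

theorem sign_swap {N : ℕ} (p : Fin N → ZMod 2) {F G : Forest (Fin N)}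
    (h : F.leaves.Disjoint G.leaves) :
    (F.append G).sign p = (G.append F).sign p + (tot (fun x => p x + 1) F.leaves + F.brs.length) *
      (tot (fun x => p x + 1) G.leaves + G.brs.length) + F.brs.length * G.brs.length := by
  rw [Forest.sign, Forest.sign, Forest.leaves_append, Forest.leaves_append, wordSign_swap p h,
    Forest.inter_append, Forest.inter_append]
  grind

/-- Modulo 2, the suspended degree of a value is that of its leaves plus one for each vertex. -/
theorem tot_degs {α : Type*} (p : α → ℤ) (F : Forest α) :
    tot (fun y : ℤ => (y : ZMod 2) + 1) (F.degs p) =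
      tot (fun x => (p x : ZMod 2) + 1) F.leaves + F.brs.length := by
  induction F with
  | nil => simp [Forest.degs]
  | leaf x r ih => simp [Forest.degs, ih, add_assoc]
  | node c r ih' ih =>
    rw [Forest.degs, tot_cons, ih, Forest.leaves_node, tot_append, Forest.brs_node]
    have h : ((c.degs p).map Int.cast).sum = tot (Int.cast : ℤ → ZMod 2) (c.degs p) := rfl
    rw [tot_add, tot_one] at ih'
    push_cast
    rw [h]
    simp only [List.length_cons, List.length_append]
    push_cast
    have h2 : (2 : ZMod 2) = 0 := rfl
    rw [h2]
    linear_combination ih'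

/-- By `tot_degs`, rotating the values costs the product of the suspended degrees of the two
forests. The same product occurs in `sign_swap`, and after the cancellation the product of the
numbers of brackets is left. -/
theorem twist_forestOp_swap (hμ : ∀ n : ℕ, HasDegree 𝒜 𝒜 ((n : ℤ) - 1) (μ n))
    (hT : ∀ (n : ℕ) (p : Fin (n + 1) → ℤ) a, (∀ j, a j ∈ 𝒜 (p j)) →
      T n a = chi (finRotate (n + 1)) p • T n (a ∘ finRotate (n + 1)))
    {N : ℕ} {F G : Forest (Fin N)} (hF : F.Good) (hG : G.Good) (hn hc hn' hc') :
    twist 𝒜 (fun P => (F.append G).sign P)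
      ((F.append G).forestOp (shifted 𝒜 μ) (shifted 𝒜 T) hn hc) =
    sg (F.brs.length * G.brs.length) • twist 𝒜 (fun P => (G.append F).sign P)
      ((G.append F).forestOp (shifted 𝒜 μ) (shifted 𝒜 T) hn' hc') := by
  refine multilinear_ext 𝒜 fun p a ha => ?_
  have hd : F.leaves.Disjoint G.leaves := by
    rw [Forest.leaves_append] at hn
    exact List.disjoint_of_nodup_append hn
  rw [multilinear_units_smul, twist_apply 𝒜 _ _ ha, twist_apply 𝒜 _ _ ha, Forest.forestOp_apply,
    Forest.forestOp_apply, Forest.vals_append, Forest.vals_append,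
    evalList_rotate 𝒜 hT (Forest.vals_mem (HasDegree.shifted 𝒜 hμ) ha hF)
      (Forest.vals_mem (HasDegree.shifted 𝒜 hμ) ha hG), sg_smul_smul, sg_smul_smul, tot_degs,
      tot_degs, sign_swap _ hd]
  congr 2
  grind

/-- The value is prescribed by one of the forests of the cyclic bracketing. For another one, trees
and brackets are rotated; the sign of this in the orientation is that of `twist_forestOp_swap`, so
the value does not depend on the choice. -/
theorem CycBr.exists_map (hμ : ∀ n : ℕ, HasDegree 𝒜 𝒜 ((n : ℤ) - 1) (μ n))
    (hT : ∀ (n : ℕ) (p : Fin (n + 1) → ℤ) a, (∀ j, a j ∈ 𝒜 (p j)) →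
      T n a = chi (finRotate (n + 1)) p • T n (a ∘ finRotate (n + 1)))
    (b : CycBr n) : ∃ f : ExteriorAlgebra k (Fin (n + 1) → k) →ₗ[k]
    MultilinearMap k (fun _ : Fin (n + 1) => A) W, ∀ F (h : b.Rep F),
      f (orient (total k n) F.brs) = twist 𝒜 (fun P => F.sign P)
        (F.forestOp (shifted 𝒜 μ) (shifted 𝒜 T) h.nodup h.complete) := by
  obtain ⟨F, hF⟩ := b.exists_rep
  obtain ⟨w, x, hw⟩ := hF.exists_leaves_eq
  obtain ⟨φ, hφ⟩ := exists_dual_eq_one (k := k) (orient_ne_zero (k := k) hF.good hF.nodup hw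
    (φ := total k n) (by simp [total_apply]))
  refine ⟨LinearMap.toSpanSingleton k _ (twist 𝒜 (fun P => F.sign P)
        (F.forestOp (shifted 𝒜 μ) (shifted 𝒜 T) hF.nodup hF.complete)) ∘ₗ φ, fun F' hF' => ?_⟩
  obtain ⟨F₁, F₂, rfl, rfl⟩ := hF.unique hF'
  obtain ⟨h1, h2⟩ := Forest.good_append.1 hF.good
  have hsw := orient_swap (total k n) [] F₂.brs F₁.brs
  rw [List.nil_append, List.nil_append] at hsw
  rw [LinearMap.comp_apply, Forest.brs_append, hsw, ← Forest.brs_append, map_units_int φ, hφ,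
    LinearMap.toSpanSingleton_apply, twist_forestOp_swap 𝒜 hμ hT h2 h1 _ _ hF.nodup hF.complete]
  generalize sg _ = u
  rcases Int.units_eq_one_or u with rfl | rfl <;> simp

/-- The operations of the oriented cells of the cyclohedra. -/
def cycloMap (hμ : ∀ n : ℕ, HasDegree 𝒜 𝒜 ((n : ℤ) - 1) (μ n))
    (hT : ∀ (n : ℕ) (p : Fin (n + 1) → ℤ) a, (∀ j, a j ∈ 𝒜 (p j)) →
      T n a = chi (finRotate (n + 1)) p • T n (a ∘ finRotate (n + 1)))
    (n d : ℕ) : (cyclohedron k n).chains d →ₗ[k]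
    MultilinearMap k (fun _ : Fin (n + 1) => A) W :=
  (Finsupp.lsum k fun b : CycBr n => (b.exists_map 𝒜 hμ hT).choose) ∘ₗ
    ((cyclohedron k n).chains d).subtype

variable (hμ : ∀ n : ℕ, HasDegree 𝒜 𝒜 ((n : ℤ) - 1) (μ n))
    (hT : ∀ (n : ℕ) (p : Fin (n + 1) → ℤ) a, (∀ j, a j ∈ 𝒜 (p j)) →
      T n a = chi (finRotate (n + 1)) p • T n (a ∘ finRotate (n + 1)))

theorem cycloMap_cell {b : CycBr n} {F} (h : b.Rep F) {d : ℕ} (hd : F.brs.length + d = n) :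
    cycloMap 𝒜 hμ hT n d (cycloCell h hd) = twist 𝒜 (fun P => F.sign P)
        (F.forestOp (shifted 𝒜 μ) (shifted 𝒜 T) h.nodup h.complete) := by
  refine Eq.trans ?_ ((b.exists_map 𝒜 hμ hT).choose_spec F h)
  exact Finsupp.lsum_single k _ _ _

theorem cycloMap_cell_apply {b : CycBr n} {F} (h : b.Rep F) {d : ℕ} (hd : F.brs.length + d = n)
    {p : Fin (n + 1) → ℤ} {a : Fin (n + 1) → A} (ha : ∀ j, a j ∈ 𝒜 (p j)) :
    cycloMap 𝒜 hμ hT n d (cycloCell h hd) a = sg (F.sign fun j => (p j : ZMod 2)) •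
        F.forestOp (shifted 𝒜 μ) (shifted 𝒜 T) h.nodup h.complete a := by
  rw [cycloMap_cell, twist_apply 𝒜 _ _ ha]

theorem sum_leaves {N : ℕ} {F : Forest (Fin N)} (hn : F.leaves.Nodup) (hc : ∀ x, x ∈ F.leaves)
    (p : Fin N → ℤ) : (F.leaves.map p).sum = ∑ j, p j := by
  obtain ⟨τ, hτ⟩ := exists_perm_of_word hn hc
  rw [← hτ, List.map_map, sum_map_finRange]
  exact Equiv.sum_comp τ p

theorem cycloMap_degree {𝒲 : ℤ → Submodule k W} (hTd : ∀ n : ℕ, HasDegree 𝒜 𝒲 n (T n))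
    (n d : ℕ) (x) : HasDegree 𝒜 𝒲 d (cycloMap 𝒜 hμ hT n d x) := by
  intro p a ha
  induction x using cyclo_induction with
  | zero => rw [map_zero]; exact Submodule.zero_mem _
  | add x y hx hy => rw [map_add]; exact Submodule.add_mem _ hx hy
  | smul c x hx => rw [map_smul]; exact Submodule.smul_mem _ _ hx
  | cell b F h hd =>
    rw [cycloMap_cell_apply 𝒜 hμ hT h hd ha, Forest.forestOp_apply]
    refine units_mem _ _ ?_
    have hw : F.width ≠ 0 := by
      intro h0
      have h1 := h.complete 0
      rcases F with _ | _ | _ <;> simp [Forest.width] at h0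
      simp at h1
    have hne : F.vals (shifted 𝒜 μ) a ≠ [] := by
      rw [← List.length_pos_iff, Forest.length_vals]; omega
    have hm := evalList_mem (HasDegree.shifted 𝒜 hTd)
      (Forest.vals_mem (HasDegree.shifted 𝒜 hμ) ha h.good) hne
    rw [Forest.sum_degs, Forest.length_degs, sum_leaves h.nodup h.complete,
      length_leaves h.nodup h.complete, Nat.cast_sub (by omega)] at hm
    convert hm using 2
    have : (n : ℤ) = F.brs.length + d := by exact_mod_cast hd.symm
    push_cast
    linarith

theorem cycloMap_equivariant (n d : ℕ) (σ : Equiv.Perm (Fin (n + 1))) (x)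
    (p : Fin (n + 1) → ℤ) (a : Fin (n + 1) → A) (ha : ∀ j, a j ∈ 𝒜 (p j)) :
    cycloMap 𝒜 hμ hT n d (cycloRelabel d σ x) a =
      koszulSign σ⁻¹ p • cycloMap 𝒜 hμ hT n d x (a ∘ ⇑(σ⁻¹)) := by
  induction x using cyclo_induction with
  | zero => simp
  | add x y hx hy => rw [map_add, map_add, map_add, _root_.add_apply, hx, hy,
      _root_.add_apply, smul_add]
  | smul c x hx => rw [map_smul, map_smul, map_smul, _root_.smul_apply, hx,
      _root_.smul_apply, smul_comm]
  | cell b F h hd =>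
    rw [cycloRelabel_cell, chains_linear_units_smul, multilinear_units_smul,
      cycloMap_cell_apply 𝒜 hμ hT _ _ ha,
      cycloMap_cell_apply 𝒜 hμ hT h hd (a := a ∘ ⇑σ⁻¹) (fun j => ha _), smul_smul,
      smul_smul, sign_map_perm _ p h.nodup h.complete]
    congr 1
    rw [Forest.forestOp_apply, Forest.forestOp_apply, Forest.vals_map]

theorem cycloMap_comp (m n d e : ℕ)
    (i : Fin (m + 1)) (x : (cyclohedron k m).chains d) (y : (associahedron k n).chains e)
    (p : Fin (m + n + 1) → ℤ) (a : Fin (m + n + 1) → A) (ha : ∀ j, a j ∈ 𝒜 (p j)) :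
    cycloMap 𝒜 hμ hT (m + n) (d + e) (cycloComp i x y) a =
      Int.negOnePow (e * degBefore i p) •
        cycloMap 𝒜 hμ hT m d x (plug rfl i (assocMap 𝒜 μ n e y) a) := by
  refine comp_of_cells (c := cycloComp i) (cycloComp_add_left i) (cycloComp_add_right i)
    (cycloComp_smul_left i) (cycloComp_smul_right i)
    (Cx := fun x => ∃ (b : CycBr m) (F : _) (h : b.Rep F) (hd : F.brs.length + d = m),
      x = cycloCell h hd) (fun {P} h0 ha hs hc x => cyclo_induction h0 ha hs
        (fun b F h hd => hc _ ⟨b, F, h, hd, rfl⟩) x) ?_ x y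
  rintro _ ⟨b, F, h, hd, rfl⟩ b' G h' he
  obtain ⟨L₁, L₂, h1, h2, h3⟩ := sign_comp_eq (i := i) h.nodup h.complete h' he
  have hin : ∀ j, (a ∘ inLab n i) j ∈ 𝒜 ((p ∘ inLab n i) j) := fun j => ha _
  have hmem := treeOp_mem 𝒜 hμ h' he hin
  have hG := assocMap_cell_apply 𝒜 μ h' he hin
  rw [cycloComp_cell h hd h' he i h1 h2, chains_linear_units_smul, multilinear_units_smul,
    cycloMap_cell_apply 𝒜 hμ hT _ _ ha, smul_smul, h3 p, mul_smul, mul_smul, plug_eq, hG,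
    multilinear_update_units]
  congr 2
  have ha' := plug_mem (i := i) (g := G.treeOp (shifted 𝒜 μ) h'.nodup h'.complete h'.width) ha hmem
  rw [plug_eq] at ha'
  rw [cycloMap_cell_apply 𝒜 hμ hT h hd ha']
  congr 1
  rw [Forest.forestOp_apply, Forest.forestOp_apply,
    vals_comp _ F (Forest.vals_eq_treeOp _ G h'.nodup h'.complete h'.width _)]

end CycloMap

end

section

variable {m n : ℕ}

/-! ### Brackets that can be added to a composite bracketing. -/

section Infixes

variable {α β : Type*}

theorem Nested.of_map {f : α → β} (hf : Function.Injective f) {l l' : List α}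
    (h : Nested (l.map f) (l'.map f)) : Nested l l' := by
  have key : ∀ {u v : List α}, u.map f <:+: v.map f → u <:+: v := by
    intro u v h
    obtain ⟨w, hw, h⟩ := List.infix_map_iff.1 h
    rwa [List.map_injective_iff.2 hf h]
  rcases h with h | h | h
  · exact Or.inl (key h)
  · exact Or.inr (Or.inl (key h))
  · exact Or.inr (Or.inr fun x hx hx' => h (List.mem_map_of_mem hx) (List.mem_map_of_mem hx'))

/-- A partial inverse of the substitution of a word with first letter `v` at `i`. -/
def collapseLetter (i : Fin (m + 1)) (v : Fin (n + 1)) (x : Fin (m + n + 1)) : Option (Fin (m + 1)) :=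
  if x = inLab n i v then some i
  else if h : ∃ j, j ≠ i ∧ x = outLab n i j then some h.choose else none

theorem collapse_subst (i : Fin (m + 1)) {v : Fin (n + 1)} {w : List (Fin (n + 1))}
    (hn : (v :: w).Nodup) (l : List (Fin (m + 1))) :
    (substWord i (v :: w) l).filterMap (collapseLetter i v) = l := by
  have hin : ∀ y, y ≠ v → collapseLetter (m := m) i v (inLab n i y) = none := by
    intro y hy
    rw [collapseLetter, if_neg fun h => hy (inLab_inj h), dif_neg]
    rintro ⟨j, hj, h⟩
    exact outLab_ne_inLab hj _ h.symm
  have hw : (w.map (inLab n i)).filterMap (collapseLetter (m := m) i v) = [] := by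
    rw [List.filterMap_eq_nil_iff]
    intro x hx
    obtain ⟨y, hy, rfl⟩ := List.mem_map.1 hx
    refine hin y ?_
    rintro rfl
    exact (List.nodup_cons.1 hn).1 hy
  induction l with
  | nil => rfl
  | cons j l ih =>
    by_cases hj : j = i
    · subst hj
      have h0 : collapseLetter j v (inLab n j v) = some j := if_pos rfl
      rw [subst_cons_self, List.filterMap_append, ih, List.map_cons, List.filterMap_cons_some h0, hw]
      rfl
    · have h : ∃ j', j' ≠ i ∧ outLab n i j = outLab n i j' := ⟨j, hj, rfl⟩
      have h1 : collapseLetter i v (outLab n i j) = some j := by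
        rw [collapseLetter, if_neg (outLab_ne_inLab hj v), dif_pos h]
        exact congrArg some (outLab_inj h.choose_spec.2).symm
      rw [subst_cons_ne hj, List.filterMap_cons_some h1, ih]

/-- Keeping only the first letter of the inserted word inverts the substitution, and such a partial
map of letters preserves subwords. -/
theorem Nested.of_subst {i : Fin (m + 1)} {v : List (Fin (n + 1))} (hv : v ≠ []) (hn : v.Nodup)
    {l l' : List (Fin (m + 1))} (h : Nested (substWord i v l) (substWord i v l')) : Nested l l' := by
  obtain ⟨y, w, rfl⟩ := List.exists_cons_of_ne_nil hv
  have key : ∀ {u u' : List (Fin (m + 1))}, substWord i (y :: w) u <:+: substWord i (y :: w) u' →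
      u <:+: u' := by
    intro u u' h
    have := h.filterMap (collapseLetter i y)
    rwa [collapse_subst i hn, collapse_subst i hn] at this
  rcases h with h | h | h
  · exact Or.inl (key h)
  · exact Or.inr (Or.inl (key h))
  · refine Or.inr (Or.inr fun x hx hx' => ?_)
    by_cases hxi : x = i
    · subst hxi
      exact h (inLab_mem_subst.2 ⟨hx, List.mem_cons_self⟩) (inLab_mem_subst.2 ⟨hx', List.mem_cons_self⟩)
    · exact h ((outLab_mem_subst hxi).2 hx) ((outLab_mem_subst hxi).2 hx')

theorem substWord_split (i : Fin (m + 1)) (v : List (Fin (n + 1))) {w₁ w₂ : List (Fin (m + 1))}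
    (hw : (w₁ ++ i :: w₂).Nodup) : substWord i v (w₁ ++ i :: w₂) =
      w₁.map (outLab n i) ++ (v.map (inLab n i) ++ w₂.map (outLab n i)) := by
  have h1 : i ∉ w₁ := fun h => (List.nodup_append.1 hw).2.2 i h i List.mem_cons_self rfl
  have h2 : i ∉ w₂ := (List.nodup_cons.1 (List.nodup_append.1 hw).2.1).1
  rw [subst_append, subst_cons_self, substWord_of_notMem v h1, substWord_of_notMem v h2]

theorem append_inj_of_nodup {α : Type*} {u a b c d : List α} (hu : u ≠ [])
    (hn : (a ++ (u ++ b)).Nodup) (h : a ++ (u ++ b) = c ++ (u ++ d)) : a = c ∧ b = d := by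
  obtain ⟨x, u, rfl⟩ := List.exists_cons_of_ne_nil hu
  rw [List.cons_append, List.cons_append] at h
  rw [List.cons_append] at hn
  have h1 : x ∉ a := fun h => (List.nodup_append.1 hn).2.2 x h x List.mem_cons_self rfl
  have h2 : x ∉ u ++ b := (List.nodup_cons.1 (List.nodup_append.1 hn).2.1).1
  obtain ⟨h3, -, h4⟩ := (List.append_cons_inj_of_notMem h1 h2).1 h
  exact ⟨h3, List.append_cancel_left h4⟩

/-- With distinct letters the inserted block occurs only once. A subword that contains it is
completed by outer letters on both sides, and one that avoids it lies wholly on one side of it; both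
come from the outer word. -/
theorem exists_subst_of_infix {i : Fin (m + 1)} {v : List (Fin (n + 1))} (hv : v ≠ []) (hvn : v.Nodup)
    {w : List (Fin (m + 1))} (hi : i ∈ w) (hw : w.Nodup)
    {l : List (Fin (m + n + 1))} (hne : l ≠ []) (hl : l <:+: substWord i v w)
    (h : v.map (inLab n i) <:+: l ∨ l.Disjoint (v.map (inLab n i))) :
    ∃ l₀, l₀ <:+: w ∧ substWord i v l₀ = l := by
  have hn := subst_nodup hvn hw (i := i)
  obtain ⟨w₁, w₂, rfl⟩ := List.append_of_mem hi
  have hu : v.map (inLab n i) ≠ [] := by simpa using hv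
  have h1 : i ∉ w₁ := fun h => (List.nodup_append.1 hw).2.2 i h i List.mem_cons_self rfl
  have h2 : i ∉ w₂ := (List.nodup_cons.1 (List.nodup_append.1 hw).2.1).1
  rw [substWord_split i v hw] at hl hn
  rcases h with ⟨s, t, rfl⟩ | h
  · obtain ⟨p, q, hpq⟩ := hl
    obtain ⟨h4, h5⟩ := append_inj_of_nodup (c := p ++ s) (d := t ++ q) hu hn (by rw [← hpq]; simp)
    obtain ⟨p₀, s₀, rfl, rfl, rfl⟩ := List.map_eq_append_iff.1 h4
    obtain ⟨t₀, q₀, rfl, rfl, rfl⟩ := List.map_eq_append_iff.1 h5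
    refine ⟨s₀ ++ i :: t₀, ⟨p₀, q₀, by simp⟩, ?_⟩
    rw [substWord_split i v]
    · simp
    · refine hw.sublist (List.IsInfix.sublist ⟨p₀, q₀, by simp⟩)
  · have key : l <:+: w₁.map (outLab n i) ∨ l <:+: w₂.map (outLab n i) := by
      obtain ⟨p, q, hpq⟩ := hl
      rw [List.append_assoc] at hpq
      rcases List.append_eq_append_iff.1 hpq with ⟨r, hr, hr'⟩ | ⟨r, hr, hr'⟩
      · rcases List.append_eq_append_iff.1 hr' with ⟨r', h6, h7⟩ | ⟨r', h6, h7⟩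
        · left
          exact ⟨p, r', by rw [hr, h6, List.append_assoc]⟩
        · left
          cases r' with
          | nil => exact ⟨p, [], by rw [hr, h6, List.append_nil, List.append_nil]⟩
          | cons x r' =>
            obtain ⟨y, u, hyu⟩ := List.exists_cons_of_ne_nil hu
            rw [hyu, List.cons_append, List.cons_append] at h7
            obtain rfl := (List.cons.inj h7).1
            exact absurd (h (a := y) (by rw [h6]; simp)) (by rw [hyu]; simp)
      · right
        refine infix_of_disjoint (u := v.map (inLab n i)) ?_ hne h
        exact ⟨r, q, by rw [hr', List.append_assoc]⟩
    have fin : ∀ w', w' <:+: w₁ ++ i :: w₂ → i ∉ w' → l <:+: w'.map (outLab n i) →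
        ∃ l₀, l₀ <:+: w₁ ++ i :: w₂ ∧ substWord i v l₀ = l := by
      intro w' hw' hi' h
      obtain ⟨l₀, hl₀, rfl⟩ := List.infix_map_iff.1 h
      exact ⟨l₀, hl₀.trans hw', substWord_of_notMem v fun h => hi' (hl₀.subset h)⟩
    rcases key with h | h
    · exact fin w₁ ⟨[], i :: w₂, rfl⟩ h1 h
    · exact fin w₂ ⟨w₁ ++ [i], [], by simp⟩ h2 h

/-- A new bracket is nested with the inserted block: either it lies inside and is a bracket of the
inner word, or it contains or avoids the block and comes from the outer word. A preimage with one
letter would give the block itself or a single letter. Hence a facet of a product of faces is a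
facet of one factor times the other. -/
theorem new_bracket {i : Fin (m + 1)} {v : List (Fin (n + 1))} (hv : v ≠ []) (hvn : v.Nodup)
    {w : List (Fin (m + 1))} (hi : i ∈ w) (hw : w.Nodup) {l : List (Fin (m + n + 1))}
    (h2 : 2 ≤ l.length) (hl : l <:+: substWord i v w) (h : Nested l (v.map (inLab n i))) :
    (∃ l', l' <:+: v ∧ l'.map (inLab n i) = l) ∨
      ∃ l₀, 2 ≤ l₀.length ∧ l₀ <:+: w ∧ substWord i v l₀ = l := by
  by_cases h1 : l <:+: v.map (inLab n i)
  · obtain ⟨l', hl', rfl⟩ := List.infix_map_iff.1 h1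
    exact Or.inl ⟨l', hl', rfl⟩
  · obtain ⟨l₀, h3, h4⟩ := exists_subst_of_infix hv hvn hi hw
      (by rintro rfl; simp at h2) hl (h.resolve_left h1)
    refine Or.inr ⟨l₀, ?_, h3, h4⟩
    by_contra hlt
    rcases l₀ with _ | ⟨j, _ | ⟨j', t⟩⟩
    · rw [subst_nil] at h4; rw [← h4] at h2; simp at h2
    · by_cases hj : j = i
      · subst hj
        rw [subst_cons_self, subst_nil, List.append_nil] at h4
        exact h1 (h4 ▸ List.infix_rfl)
      · rw [subst_cons_ne hj, subst_nil] at h4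
        rw [← h4] at h2; simp at h2
    · simp at hlt

theorem eq_of_isRotated_cons {α : Type*} {x : α} {s t : List α} (hn : (x :: s).Nodup)
    (h : (x :: s) ~r (x :: t)) : s = t := by
  obtain ⟨r, hr, h⟩ := List.isRotated_iff_mod.1 h
  rw [List.rotate_eq_drop_append_take hr] at h
  have hs := List.take_append_drop r (x :: s)
  rcases hd : (x :: s).drop r with _ | ⟨y, d⟩
  · rw [hd] at h hs
    rw [List.append_nil] at hs
    rw [List.nil_append, hs] at h
    exact (List.cons.inj h).2
  · rcases ht : (x :: s).take r with _ | ⟨y', c⟩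
    · rw [ht] at h hs
      rw [List.nil_append] at hs
      rw [List.append_nil, hs] at h
      exact (List.cons.inj h).2
    · rw [hd, ht] at h hs
      rw [List.cons_append] at h hs
      rw [← hs, (List.cons.inj h).1, (List.cons.inj hs).1] at hn
      simp at hn

theorem nested_of_length_one {α : Type*} {l u : List α} (h : u.length = 1) : Nested l u := by
  obtain ⟨x, rfl⟩ := List.length_eq_one_iff.1 h
  by_cases hx : x ∈ l
  · obtain ⟨s, t, rfl⟩ := List.append_of_mem hx
    exact Or.inr (Or.inl ⟨s, t, by simp⟩)
  · exact Or.inr (Or.inr (by simpa using hx))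

/-- The block is the outermost bracket of the inner word, except when it has one letter, and a
single letter is nested with everything. -/
theorem LinBr.nested_word (b' : LinBr n) {i : Fin (m + 1)} {B : Finset (List (Fin (m + 1)))}
    {Z : Finset (List (Fin (m + n + 1)))} (hZ : ∀ l ∈ Z, ∀ l' ∈ Z, Nested l l')
    (h : brComp i B b' ⊆ Z) {l} (hl : l ∈ Z) : Nested l (b'.word.map (inLab n i)) := by
  rcases Nat.eq_zero_or_pos n with rfl | hn
  · refine nested_of_length_one ?_
    have h1 := b'.nodup.length_le_card
    have h2 := List.length_pos_iff.2 b'.word_ne_nil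
    simp at h1 ⊢
    omega
  · exact hZ l hl _ (h (Finset.mem_union_right _ (Finset.mem_image_of_mem _ (b'.outer hn))))

/-- Add an inner bracket to a bracketing. -/
theorem LinBr.exists_insert_inner (b' : LinBr n) {i : Fin (m + 1)} {B : Finset (List (Fin (m + 1)))}
    {Z : Finset (List (Fin (m + n + 1)))} (hZ : ∀ l ∈ Z, ∀ l' ∈ Z, Nested l l') 
    (h2 : ∀ l ∈ Z, 2 ≤ l.length) (h : brComp i B b' ⊆ Z)
    {l} (hl : l <:+: b'.word) (hlZ : l.map (inLab n i) ∈ Z) :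
    ∃ c' : LinBr n, c'.word = b'.word ∧ c'.br = insert l b'.br := by
  have hb : ∀ l' ∈ insert l b'.br, l'.map (inLab n i) ∈ Z := by
    intro l' hl'
    rcases Finset.mem_insert.1 hl' with rfl | hl'
    · exact hlZ
    · exact h (Finset.mem_union_right _ (Finset.mem_image_of_mem _ hl'))
  refine ⟨⟨b'.word, b'.nodup, b'.complete, insert l b'.br, ?_, ?_, ?_, ?_⟩, rfl, rfl⟩
  · intro l' hl'
    rcases Finset.mem_insert.1 hl' with rfl | hl'
    · exact hl
    · exact b'.br_infix _ hl'
  · intro l' hl'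
    simpa using h2 _ (hb l' hl')
  · intro l₁ h₁ l₂ h₂
    exact Nested.of_map (inLab_injective i) (hZ _ (hb _ h₁) _ (hb _ h₂))
  · exact fun hn => Finset.mem_insert_of_mem (b'.outer hn)

theorem brComp_insert_left (i : Fin (m + 1)) (l) (B : Finset (List (Fin (m + 1)))) (b' : LinBr n) :
    brComp i (insert l B) b' = insert (substWord i b'.word l) (brComp i B b') := by
  rw [brComp, brComp, Finset.image_insert, Finset.insert_union]

theorem brComp_insert_right (i : Fin (m + 1)) (l) (B : Finset (List (Fin (m + 1)))) {b' c' : LinBr n}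
    (hw : c'.word = b'.word) (hb : c'.br = insert l b'.br) :
    brComp i B c' = insert (l.map (inLab n i)) (brComp i B b') := by
  rw [brComp, brComp, hb, hw, Finset.image_insert, Finset.union_insert]

theorem nested_insert_outer {i : Fin (m + 1)} {B : Finset (List (Fin (m + 1)))} {b' : LinBr n}
    {Z : Finset (List (Fin (m + n + 1)))} (hZ : ∀ l ∈ Z, ∀ l' ∈ Z, Nested l l') 
    (h : brComp i B b' ⊆ Z) {l} (hlZ : substWord i b'.word l ∈ Z) :
    ∀ l₁ ∈ insert l B, ∀ l₂ ∈ insert l B, Nested l₁ l₂ := by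
  have hb : ∀ l' ∈ insert l B, substWord i b'.word l' ∈ Z := by
    intro l' hl'
    rcases Finset.mem_insert.1 hl' with rfl | hl'
    · exact hlZ
    · exact h (Finset.mem_union_left _ (Finset.mem_image_of_mem _ hl'))
  intro l₁ h₁ l₂ h₂
  exact Nested.of_subst b'.word_ne_nil b'.nodup (hZ _ (hb _ h₁) _ (hb _ h₂))

theorem LinBr.eq_comp_of_insert {b : LinBr m} {b' : LinBr n} {i : Fin (m + 1)} {z : LinBr (m + n)}
    {l} (hw : z.word = (b.comp i b').word) (hb : z.br = insert l (b.comp i b').br) :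
    (∃ (c' : LinBr n) (l' : _), c'.word = b'.word ∧ c'.br = insert l' b'.br ∧ z = b.comp i c') ∨
      ∃ (c : LinBr m) (l' : _), c.word = b.word ∧ c.br = insert l' b.br ∧ z = c.comp i b' := by
  have hl : l ∈ z.br := hb ▸ Finset.mem_insert_self _ _
  have hs : brComp i b.br b' ⊆ z.br := hb ▸ Finset.subset_insert _ _
  rcases new_bracket b'.word_ne_nil b'.nodup (b.complete i) b.nodup (z.two_le l hl)
    (by have := z.br_infix l hl; rw [hw] at this; exact this) (b'.nested_word z.nested hs hl) with ⟨l', h1, rfl⟩ | ⟨l', h1, h2, rfl⟩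
  · obtain ⟨c', h3, h4⟩ := b'.exists_insert_inner z.nested z.two_le hs h1 hl
    refine Or.inl ⟨c', l', h3, h4, LinBr.ext ?_ ?_⟩
    · rw [hw]; change substWord _ _ _ = substWord _ _ _; rw [h3]
    · rw [hb]; exact (brComp_insert_right i l' b.br h3 h4).symm
  · refine Or.inr ⟨⟨b.word, b.nodup, b.complete, insert l' b.br, ?_, ?_,
      nested_insert_outer z.nested hs hl, fun hn => Finset.mem_insert_of_mem (b.outer hn)⟩, l', rfl, rfl,
      LinBr.ext hw ?_⟩
    · intro u hu
      rcases Finset.mem_insert.1 hu with h | hu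
      on_goal 1 => rw [h]
      exacts [h2, b.br_infix _ hu]
    · intro u hu
      rcases Finset.mem_insert.1 hu with h | hu
      on_goal 1 => rw [h]
      exacts [h1, b.two_le _ hu]
    · exact hb.trans (brComp_insert_left i l' b.br b').symm

/-- Once the outer cyclic word is cut so that the new bracket is a subword after the substitution,
the linear dichotomy `new_bracket` applies. -/
theorem CycBr.eq_comp_of_insert {b : CycBr m} {b' : LinBr n} {i : Fin (m + 1)} {z : CycBr (m + n)}
    {l} (hw : z.word = (b.comp i b').word) (hb : z.br = insert l (b.comp i b').br) :
    (∃ (c' : LinBr n) (l' : _), c'.word = b'.word ∧ c'.br = insert l' b'.br ∧ z = b.comp i c') ∨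
      ∃ (c : CycBr m) (l' : _), c.word = b.word ∧ c.br = insert l' b.br ∧ z = c.comp i b' := by
  have hl : l ∈ z.br := hb ▸ Finset.mem_insert_self _ _
  have hs : brComp i b.br b' ⊆ z.br := hb ▸ Finset.subset_insert _ _
  -- The cyclic word of `z` is cut outside all its brackets. The inserted block is then not cut
  -- either, and the cut comes from a cut of the outer word.
  obtain ⟨w, hwb, hlw⟩ : ∃ w : List (Fin (m + 1)), (w : Cycle (Fin (m + 1))) = b.word ∧
      l <:+: substWord i b'.word w := by
    obtain ⟨F, hF⟩ := z.exists_rep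
    have hlF : l <:+: F.leaves := Forest.infix_of_mem_brs ((hF.mem_brs l).2 hl)
    have hU : b'.word.map (inLab n i) <:+: F.leaves := by
      rcases Nat.eq_zero_or_pos n with rfl | hn
      · have h1 := b'.nodup.length_le_card
        have h2 := List.length_pos_iff.2 b'.word_ne_nil
        obtain ⟨x, hx⟩ := List.length_eq_one_iff.1
          (show b'.word.length = 1 by simp at h1; omega)
        obtain ⟨s, t, hst⟩ := List.append_of_mem (hF.complete (inLab 0 i x))
        exact ⟨s, t, by rw [hx, hst]; simp⟩
      · exact Forest.infix_of_mem_brs ((hF.mem_brs _).2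
          (hs (Finset.mem_union_right _ (Finset.mem_image_of_mem _ (b'.outer hn)))))
    obtain ⟨w, hwb⟩ := Quotient.exists_rep b.word
    have hwb : (w : Cycle (Fin (m + 1))) = b.word := hwb
    have hnw : w.Nodup := Cycle.nodup_coe_iff.1 (hwb ▸ b.nodup)
    have hiw : i ∈ w := Cycle.mem_coe_iff.1 (hwb ▸ b.complete i)
    obtain ⟨w₁, w₂, rfl⟩ := List.append_of_mem hiw
    have hrot : F.leaves ~r substWord i b'.word (w₁ ++ i :: w₂) := by
      rw [← Cycle.coe_eq_coe, hF.leaves, hw, ← substCycle_coe, hwb]; rfl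
    obtain ⟨P, Q, hPQ⟩ := hU
    rw [substWord_split i _ hnw] at hrot
    have h1 : (P ++ b'.word.map (inLab n i) ++ Q) ~r (b'.word.map (inLab n i) ++ (Q ++ P)) := by
      rw [List.append_assoc, ← List.append_assoc _ Q P]
      exact List.isRotated_append
    have h2 : b'.word.map (inLab n i) ++ (w₂.map (outLab n i) ++ w₁.map (outLab n i)) ~r
        b'.word.map (inLab n i) ++ (Q ++ P) := by
      rw [← List.append_assoc]
      refine List.isRotated_append.trans (hrot.symm.trans ?_)
      rw [← hPQ]; exact h1
    have hnd : (b'.word.map (inLab n i) ++ (Q ++ P)).Nodup := by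
      refine h1.nodup_iff.1 ?_
      rw [hPQ]; exact hF.nodup
    -- Both words are rotated so as to start with the block; as no letter repeats, the remainders
    -- coincide.
    have h3 : w₂.map (outLab n i) ++ w₁.map (outLab n i) = Q ++ P := by
      obtain ⟨y, u, hyu⟩ := List.exists_cons_of_ne_nil
        (show b'.word.map (inLab n i) ≠ [] by simpa using b'.word_ne_nil)
      rw [hyu, List.cons_append, List.cons_append] at h2
      rw [hyu, List.cons_append] at hnd
      exact List.append_cancel_left (eq_of_isRotated_cons (h2.nodup_iff.2 hnd) h2)
    rw [← List.map_append] at h3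
    obtain ⟨q, p, hqp, rfl, rfl⟩ := List.map_eq_append_iff.1 h3
    have hr : (p ++ i :: q) ~r (w₁ ++ i :: w₂) := by
      refine List.isRotated_append.trans ?_
      rw [List.cons_append, ← hqp, ← List.cons_append]
      exact List.isRotated_append
    refine ⟨p ++ i :: q, ?_, ?_⟩
    · rw [← hwb, Cycle.coe_eq_coe]; exact hr
    · rw [substWord_split i _ (hr.nodup_iff.2 hnw), ← List.append_assoc, hPQ]
      exact hlF
  rcases new_bracket b'.word_ne_nil b'.nodup (Cycle.mem_coe_iff.1 (hwb ▸ b.complete i))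
    (Cycle.nodup_coe_iff.1 (hwb ▸ b.nodup)) (z.two_le l hl) hlw
    (b'.nested_word z.nested hs hl) with ⟨l', h1, rfl⟩ | ⟨l', h1, h2, rfl⟩
  · obtain ⟨c', h3, h4⟩ := b'.exists_insert_inner z.nested z.two_le hs h1 hl
    refine Or.inl ⟨c', l', h3, h4, CycBr.ext ?_ ?_⟩
    · rw [hw]; change substCycle _ _ _ = substCycle _ _ _; rw [h3]
    · rw [hb]; exact (brComp_insert_right i l' b.br h3 h4).symm
  · refine Or.inr ⟨⟨b.word, b.nodup, b.complete, insert l' b.br, ?_, ?_,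
      nested_insert_outer z.nested hs hl⟩, l', rfl, rfl, CycBr.ext hw ?_⟩
    · intro u hu
      rcases Finset.mem_insert.1 hu with h | hu
      on_goal 1 => rw [h]
      exacts [⟨w, hwb, h2⟩, b.br_infix _ hu]
    · intro u hu
      rcases Finset.mem_insert.1 hu with h | hu
      on_goal 1 => rw [h]
      exacts [h1, b.two_le _ hu]
    · exact hb.trans (brComp_insert_left i l' b.br b').symm

end Infixes

end

/-! ### Facets and the cellular boundary. -/

section

variable {k : Type u} [Field k] {m n : ℕ}

local notation "ι" => ExteriorAlgebra.ι k

instance : Fintype (LinBr n) := Fintype.ofFinite _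

instance : Fintype (CycBr n) := Fintype.ofFinite _

namespace FacePoset

variable {X : FacePoset k n}

theorem boundaryAux_single (b : X.Cell) (ω) : X.boundaryAux (Finsupp.single b ω) =
    ∑ c with X.IsFacet c b, Finsupp.single c (CliffordAlgebra.contractLeft (X.outward c b) ω) := by
  rw [boundaryAux, Finsupp.lsum_single, LinearMap.sum_apply]
  rfl

theorem IsFacet.exists_insert {c b : X.Cell} (h : X.IsFacet c b) :
    ∃ l, l ∉ X.br b ∧ X.br c = insert l (X.br b) := by
  have hs := X.br_subset h.1
  have hc : (X.br c \ X.br b).card = 1 := by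
    rw [Finset.card_sdiff_of_subset hs, h.2]; omega
  obtain ⟨l, hl⟩ := Finset.card_eq_one.1 hc
  have hm : l ∈ X.br c \ X.br b := hl ▸ Finset.mem_singleton_self l
  refine ⟨l, (Finset.mem_sdiff.1 hm).2, ?_⟩
  rw [← Finset.sdiff_union_of_subset hs, hl]
  rfl

theorem outward_eq {c b : X.Cell} {l} (hl : l ∉ X.br b) (h : X.br c = insert l (X.br b)) :
    X.outward c b = -gapSum k l := by
  rw [outward, h, Finset.insert_sdiff_of_notMem _ hl, Finset.sdiff_self]
  simp

/-- The orientations of points are scalars, which contractions kill. -/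
theorem boundaryAux_eq_zero {x} (hx : x ∈ X.chains 0) : X.boundaryAux x = 0 := by
  rw [boundaryAux, Finsupp.lsum_apply]
  refine Finset.sum_eq_zero fun b _ => ?_
  beta_reduce
  rw [LinearMap.sum_apply]
  refine Finset.sum_eq_zero fun c _ => ?_
  have := (hx b).1
  rw [pow_zero, Submodule.mem_one] at this
  obtain ⟨r, hr⟩ := this
  rw [LinearMap.comp_apply, ← hr, CliffordAlgebra.contractLeft_algebraMap, map_zero]

end FacePoset

/-- The facets of the faces `comp b b'`. -/
structure CompFacets (X : FacePoset k m) (Z : FacePoset k (m + n))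
    (comp : X.Cell → LinBr n → Z.Cell) (i : Fin (m + 1)) : Prop where
  br_comp : ∀ b b', Z.br (comp b b') = brComp i (X.br b) b'
  two_le : ∀ b, ∀ l ∈ X.br b, 2 ≤ l.length
  nodup : ∀ b, ∀ l ∈ X.br b, l.Nodup
  ext : ∀ {b c c'}, X.IsFacet c b → X.IsFacet c' b → X.br c = X.br c' → c = c'
  facet_iff : ∀ {b b' z}, Z.IsFacet z (comp b b') ↔
    (∃ c, X.IsFacet c b ∧ comp c b' = z) ∨ ∃ c', (associahedron k n).IsFacet c' b' ∧ comp b c' = z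

theorem assoc_facet_iff {c b : LinBr n} : (associahedron k n).IsFacet c b ↔
    c.word = b.word ∧ ∃ l, l ∉ b.br ∧ c.br = insert l b.br := by
  constructor
  · exact fun h => ⟨h.1.1, h.exists_insert⟩
  · rintro ⟨h, l, hl, h'⟩
    refine ⟨⟨h, h' ▸ Finset.subset_insert _ _⟩, ?_⟩
    change c.br.card = _
    rw [h', Finset.card_insert_of_notMem hl]

theorem cyclo_facet_iff {c b : CycBr n} : (cyclohedron k n).IsFacet c b ↔
    c.word = b.word ∧ ∃ l, l ∉ b.br ∧ c.br = insert l b.br := by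
  constructor
  · exact fun h => ⟨h.1.1, h.exists_insert⟩
  · rintro ⟨h, l, hl, h'⟩
    refine ⟨⟨h, h' ▸ Finset.subset_insert _ _⟩, ?_⟩
    change c.br.card = _
    rw [h', Finset.card_insert_of_notMem hl]

theorem subst_mem_brComp {i : Fin (m + 1)} {B : Finset (List (Fin (m + 1)))} {b' : LinBr n}
    {l} (hn : l.Nodup) (h2 : 2 ≤ l.length) : substWord i b'.word l ∈ brComp i B b' ↔ l ∈ B := by
  simp only [brComp, Finset.mem_union, Finset.mem_image]
  constructor
  · rintro (⟨u, hu, h⟩ | ⟨u, hu, h⟩)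
    · rwa [← subst_inj b'.word_ne_nil h]
    · exact absurd h.symm (subst_ne_map hn h2)
  · exact fun h => Or.inl ⟨l, h, rfl⟩

theorem map_mem_brComp {i : Fin (m + 1)} {B : Finset (List (Fin (m + 1)))} {b' : LinBr n}
    (hn : ∀ l ∈ B, l.Nodup) (h2 : ∀ l ∈ B, 2 ≤ l.length) {l} :
    l.map (inLab n i) ∈ brComp i B b' ↔ l ∈ b'.br := by
  simp only [brComp, Finset.mem_union, Finset.mem_image]
  constructor
  · rintro (⟨u, hu, h⟩ | ⟨u, hu, h⟩)
    · exact absurd h (subst_ne_map (hn u hu) (h2 u hu))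
    · rwa [← List.map_injective_iff.2 (inLab_injective i) h]
  · exact fun h => Or.inr ⟨l, h, rfl⟩

theorem assocCompFacets (i : Fin (m + 1)) : CompFacets (k := k) (n := n) (associahedron k m)
    (associahedron k (m + n)) (fun b b' => LinBr.comp i b b') i where
  br_comp _ _ := rfl
  two_le := LinBr.two_le
  nodup b _ h := LinBr.br_nodup b h
  ext h h' he := LinBr.ext (h.1.1.trans h'.1.1.symm) he
  facet_iff {b b' z} := by
    constructor
    · intro h
      obtain ⟨h1, l, h2, h3⟩ := assoc_facet_iff.1 h
      rcases LinBr.eq_comp_of_insert h1 h3 with ⟨c', l', h4, h5, rfl⟩ | ⟨c, l', h4, h5, rfl⟩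
      · refine Or.inr ⟨c', assoc_facet_iff.2 ⟨h4, l', fun h => ?_, h5⟩, rfl⟩
        refine h2 ?_
        have h6 : insert (l'.map (inLab n i)) (brComp i b.br b') = insert l (brComp i b.br b') :=
          (brComp_insert_right i l' b.br h4 h5).symm.trans h3
        rw [Finset.insert_eq_of_mem ((map_mem_brComp (fun _ => b.br_nodup) b.two_le).2 h)] at h6
        change l ∈ brComp i b.br b'
        exact h6 ▸ Finset.mem_insert_self _ _
      · refine Or.inl ⟨c, assoc_facet_iff.2 ⟨h4, l', fun h => ?_, h5⟩, rfl⟩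
        refine h2 ?_
        have h6 : insert (substWord i b'.word l') (brComp i b.br b') = insert l (brComp i b.br b') := by
          rw [← brComp_insert_left, ← h5]; exact h3
        rw [Finset.insert_eq_of_mem ((subst_mem_brComp (b.br_nodup h) (b.two_le _ h)).2 h)] at h6
        change l ∈ brComp i b.br b'
        exact h6 ▸ Finset.mem_insert_self _ _
    · rintro (⟨c, h, rfl⟩ | ⟨c', h, rfl⟩)
      · obtain ⟨h1, l, h2, h3⟩ := assoc_facet_iff.1 h
        have hl : l ∈ c.br := h3 ▸ Finset.mem_insert_self _ _
        refine assoc_facet_iff.2 ⟨congrArg (substWord i b'.word) h1, _, ?_,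
          (congrArg (fun B => brComp i B b') h3).trans (brComp_insert_left i l b.br b')⟩
        exact fun h => h2 ((subst_mem_brComp (c.br_nodup hl) (c.two_le _ hl)).1 h)
      · obtain ⟨h1, l, h2, h3⟩ := assoc_facet_iff.1 h
        refine assoc_facet_iff.2 ⟨congrArg (fun v => substWord i v b.word) h1, _, ?_,
          brComp_insert_right i l b.br h1 h3⟩
        exact fun h => h2 ((map_mem_brComp (fun _ => b.br_nodup) b.two_le).1 h)

theorem cycloCompFacets (i : Fin (m + 1)) : CompFacets (k := k) (n := n) (cyclohedron k m)
    (cyclohedron k (m + n)) (fun b b' => CycBr.comp i b b') i where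
  br_comp _ _ := rfl
  two_le := CycBr.two_le
  nodup b _ h := CycBr.br_nodup b h
  ext h h' he := CycBr.ext (h.1.1.trans h'.1.1.symm) he
  facet_iff {b b' z} := by
    constructor
    · intro h
      obtain ⟨h1, l, h2, h3⟩ := cyclo_facet_iff.1 h
      rcases CycBr.eq_comp_of_insert h1 h3 with ⟨c', l', h4, h5, rfl⟩ | ⟨c, l', h4, h5, rfl⟩
      · refine Or.inr ⟨c', assoc_facet_iff.2 ⟨h4, l', fun h => ?_, h5⟩, rfl⟩
        refine h2 ?_
        have h6 : insert (l'.map (inLab n i)) (brComp i b.br b') = insert l (brComp i b.br b') :=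
          (brComp_insert_right i l' b.br h4 h5).symm.trans h3
        rw [Finset.insert_eq_of_mem ((map_mem_brComp (fun _ => b.br_nodup) b.two_le).2 h)] at h6
        change l ∈ brComp i b.br b'
        exact h6 ▸ Finset.mem_insert_self _ _
      · refine Or.inl ⟨c, cyclo_facet_iff.2 ⟨h4, l', fun h => ?_, h5⟩, rfl⟩
        refine h2 ?_
        have h6 : insert (substWord i b'.word l') (brComp i b.br b') = insert l (brComp i b.br b') := by
          rw [← brComp_insert_left, ← h5]; exact h3
        rw [Finset.insert_eq_of_mem ((subst_mem_brComp (b.br_nodup h) (b.two_le _ h)).2 h)] at h6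
        change l ∈ brComp i b.br b'
        exact h6 ▸ Finset.mem_insert_self _ _
    · rintro (⟨c, h, rfl⟩ | ⟨c', h, rfl⟩)
      · obtain ⟨h1, l, h2, h3⟩ := cyclo_facet_iff.1 h
        have hl : l ∈ c.br := h3 ▸ Finset.mem_insert_self _ _
        refine cyclo_facet_iff.2 ⟨congrArg (substCycle i b'.word) h1, _, ?_,
          (congrArg (fun B => brComp i B b') h3).trans (brComp_insert_left i l b.br b')⟩
        exact fun h => h2 ((subst_mem_brComp (c.br_nodup hl) (c.two_le _ hl)).1 h)
      · obtain ⟨h1, l, h2, h3⟩ := assoc_facet_iff.1 h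
        refine cyclo_facet_iff.2 ⟨congrArg (fun v => substCycle i v b.word) h1, _, ?_,
          brComp_insert_right i l b.br h1 h3⟩
        exact fun h => h2 ((map_mem_brComp (fun _ => b.br_nodup) b.two_le).1 h)

/-! ### The boundary is a derivation for the compositions. -/

section Derivation

variable {X : FacePoset k m} {Z : FacePoset k (m + n)} {comp : X.Cell → LinBr n → Z.Cell}
  {i : Fin (m + 1)}

namespace CompFacets

theorem comp_left_inj (C : CompFacets X Z comp i) {b c c' b'} (h : X.IsFacet c b) (h' : X.IsFacet c' b)
    (he : comp c b' = comp c' b') : c = c' := by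
  refine C.ext h h' ?_
  have := congrArg Z.br he
  rw [C.br_comp, C.br_comp] at this
  ext l
  constructor <;> intro hl
  · rw [← subst_mem_brComp (i := i) (b' := b') (C.nodup _ _ hl) (C.two_le _ _ hl), ← this]
    exact (subst_mem_brComp (C.nodup _ _ hl) (C.two_le _ _ hl)).2 hl
  · rw [← subst_mem_brComp (i := i) (b' := b') (C.nodup _ _ hl) (C.two_le _ _ hl), this]
    exact (subst_mem_brComp (C.nodup _ _ hl) (C.two_le _ _ hl)).2 hl

theorem comp_right_inj (C : CompFacets X Z comp i) {b} {b' c c' : LinBr n}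
    (h : (associahedron k n).IsFacet c b') (h' : (associahedron k n).IsFacet c' b')
    (he : comp b c = comp b c') : c = c' := by
  refine LinBr.ext (h.1.1.trans h'.1.1.symm) ?_
  have := congrArg Z.br he
  rw [C.br_comp, C.br_comp] at this
  ext l
  rw [← map_mem_brComp (i := i) (b' := c) (C.nodup b) (C.two_le b), this,
    map_mem_brComp (C.nodup b) (C.two_le b)]

theorem comp_left_ne_right (C : CompFacets X Z comp i) {b c} {b' c' : LinBr n}
    (h : X.IsFacet c b) (h' : (associahedron k n).IsFacet c' b') : comp c b' ≠ comp b c' := by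
  intro he
  obtain ⟨l, h1, h2⟩ := h.exists_insert
  have hl : l ∈ X.br c := h2 ▸ Finset.mem_insert_self _ _
  have := congrArg Z.br he
  rw [C.br_comp, C.br_comp] at this
  have h3 := (subst_mem_brComp (i := i) (b' := b') (C.nodup _ _ hl) (C.two_le _ _ hl)).2 hl
  rw [this, ← h'.1.1, subst_mem_brComp (C.nodup _ _ hl) (C.two_le _ _ hl)] at h3
  exact h1 h3

theorem outward_left (C : CompFacets X Z comp i) {b c b'} (h : X.IsFacet c b) :
    ∃ l, X.outward c b = -gapSum k l ∧
      Z.outward (comp c b') (comp b b') = -gapSum k (substWord i b'.word l) := by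
  obtain ⟨l, h1, h2⟩ := h.exists_insert
  have hl : l ∈ X.br c := h2 ▸ Finset.mem_insert_self _ _
  refine ⟨l, FacePoset.outward_eq h1 h2, FacePoset.outward_eq ?_ ?_⟩
  · rw [C.br_comp]
    exact fun h => h1 ((subst_mem_brComp (C.nodup _ _ hl) (C.two_le _ _ hl)).1 h)
  · rw [C.br_comp, C.br_comp, h2, brComp_insert_left]

theorem outward_right (C : CompFacets X Z comp i) {b} {c' b' : LinBr n}
    (h : (associahedron k n).IsFacet c' b') :
    ∃ l, l ∈ c'.br ∧ (associahedron k n).outward c' b' = -gapSum k l ∧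
      Z.outward (comp b c') (comp b b') = -gapSum k (l.map (inLab n i)) := by
  obtain ⟨hw, l, h1, h2⟩ := assoc_facet_iff.1 h
  refine ⟨l, h2 ▸ Finset.mem_insert_self _ _, FacePoset.outward_eq h1 h2, FacePoset.outward_eq ?_ ?_⟩
  · rw [C.br_comp]
    exact fun h => h1 ((map_mem_brComp (C.nodup _) (C.two_le _)).1 h)
  · rw [C.br_comp, C.br_comp, brComp_insert_right i l _ hw h2]

/-- The facets of the product split into those of the two factors. The conormal of a new outer
bracket contracts the inner orientation to zero and so acts on the left factor; that of a new inner
bracket vanishes on the outer directions and acts on the right factor, after passing the left one,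
which has degree `d`. -/
theorem boundaryAux_single (C : CompFacets X Z comp i) {b b' ω ω'} {d e : ℕ}
    (hω : ω ∈ ((X.dir b).map ι) ^ d) (hω' : ω' ∈ (((associahedron k n).dir b').map ι) ^ e) :
    Z.boundaryAux (compAux X Z comp i (Finsupp.single b ω) (Finsupp.single b' ω')) =
      compAux X Z comp i (X.boundaryAux (Finsupp.single b ω)) (Finsupp.single b' ω') +
      sg d • compAux X Z comp i (Finsupp.single b ω)
        ((associahedron k n).boundaryAux (Finsupp.single b' ω')) := by
  have hsum_left : ∀ (s : Finset X.Cell) (f : X.Cell → _) y,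
      compAux X Z comp i (∑ c ∈ s, f c) y = ∑ c ∈ s, compAux X Z comp i (f c) y := by
    intro s f y
    exact map_sum (AddMonoidHom.mk' (fun x => compAux X Z comp i x y)
      fun x x' => compAux_add_left comp i x x' y) f s
  have hsum_right : ∀ (s : Finset (LinBr n)) (f : LinBr n → _) x,
      compAux X Z comp i x (∑ c ∈ s, f c) = ∑ c ∈ s, compAux X Z comp i x (f c) := by
    intro s f x
    exact map_sum (AddMonoidHom.mk' (fun y => compAux X Z comp i x y)
      fun y y' => compAux_add_right comp i x y y') f s
  have hfac : (Finset.univ.filter fun z => Z.IsFacet z (comp b b')) =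
      (Finset.univ.filter fun c => X.IsFacet c b).image (fun c => comp c b') ∪
      (Finset.univ.filter fun c' => (associahedron k n).IsFacet c' b').image (fun c' => comp b c') := by
    ext z
    simp only [Finset.mem_filter, Finset.mem_univ, true_and, Finset.mem_union, Finset.mem_image]
    exact C.facet_iff
  rw [compAux_single, FacePoset.boundaryAux_single, hfac, Finset.sum_union, Finset.sum_image,
    Finset.sum_image, FacePoset.boundaryAux_single, hsum_left, FacePoset.boundaryAux_single,
    hsum_right, Finset.smul_sum]
  · congr 1
    · refine Finset.sum_congr rfl fun c hc => ?_
      obtain ⟨l, h1, h2⟩ := C.outward_left (b' := b') (Finset.mem_filter.1 hc).2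
      rw [compAux_single, h1, h2]
      congr 1
      rw [contractLeft_mul_of_right, contractLeft_map]
      · have h3 : (-gapSum k (substWord i b'.word l)) ∘ₗ push (b'.outGap i) = -gapSum k l :=
          LinearMap.ext fun t => congrArg Neg.neg (b'.gapSum_subst_out i t l)
        rw [h3]
      · rw [contractLeft_map, contractLeft_eq_zero _ _ e ω' hω', map_zero]
        intro s hs
        simp [b'.gapSum_subst_in i hs]
    · refine Finset.sum_congr rfl fun c' hc' => ?_
      have hf := (Finset.mem_filter.1 hc').2
      obtain ⟨l, hl, h1, h2⟩ := C.outward_right (b := b) hf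
      have hlast : c'.last = b'.last := by simp only [LinBr.last, hf.1.1]
      have hout : c'.outGap i = b'.outGap i := by
        funext j; simp only [LinBr.outGap, hlast]
      rw [compAux_single, ← single_units_smul, h1, h2, hout]
      congr 1
      rw [contractLeft_mul_of_left (S := (X.dir b).map (push (b'.outGap i))) (d := d) ?_ ?_,
        contractLeft_map]
      · have h3 : (-gapSum k (l.map (inLab n i))) ∘ₗ push (inLab n i) = -gapSum k l :=
          LinearMap.ext fun t => congrArg Neg.neg (gapSum_map (inLab_injective i) l t)
        rw [h3]
      · rintro _ ⟨t, -, rfl⟩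
        rw [LinearMap.neg_apply, neg_eq_zero, gapSum, ← List.map_dropLast]
        exact b'.sumOver_in_out i t (hlast ▸ c'.last_notMem_br hl)
      · exact map_mem_pow _ (fun v hv => Submodule.mem_map_of_mem hv) hω
  · intro c hc c' hc' h
    exact C.comp_right_inj (Finset.mem_filter.1 hc).2 (Finset.mem_filter.1 hc').2 h
  · intro c hc c' hc' h
    exact C.comp_left_inj (Finset.mem_filter.1 hc).2 (Finset.mem_filter.1 hc').2 h
  · rw [Finset.disjoint_left]
    intro z hz hz'
    obtain ⟨c, hc, rfl⟩ := Finset.mem_image.1 hz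
    obtain ⟨c', hc', h⟩ := Finset.mem_image.1 hz'
    exact C.comp_left_ne_right (Finset.mem_filter.1 hc).2 (Finset.mem_filter.1 hc').2 h.symm

theorem boundaryAux_compAux (C : CompFacets X Z comp i) {d e : ℕ} (x : X.chains d)
    (y : (associahedron k n).chains e) :
    Z.boundaryAux (compAux X Z comp i x.1 y.1) = compAux X Z comp i (X.boundaryAux x.1) y.1 +
      sg d • compAux X Z comp i x.1 ((associahedron k n).boundaryAux y.1) := by
  induction x using FacePoset.chains_induction with
  | zero =>
    have h : ∀ y, compAux X Z comp i 0 y = 0 := fun y => by simp [compAux]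
    simp [h]
  | add x x' hx hx' =>
    change Z.boundaryAux (compAux X Z comp i (x.1 + x'.1) y.1) =
      compAux X Z comp i (X.boundaryAux (x.1 + x'.1)) y.1 +
      sg d • compAux X Z comp i (x.1 + x'.1) ((associahedron k n).boundaryAux y.1)
    rw [compAux_add_left, map_add, map_add, compAux_add_left, compAux_add_left, hx, hx', smul_add]
    abel
  | single b ω hω hd =>
    induction y using FacePoset.chains_induction with
    | zero =>
      have h : ∀ x, compAux X Z comp i x 0 = 0 := fun y => by simp [compAux]
      simp [h]
    | add y y' hy hy' =>
      change Z.boundaryAux (compAux X Z comp i (Finsupp.single b ω) (y.1 + y'.1)) =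
        compAux X Z comp i (X.boundaryAux (Finsupp.single b ω)) (y.1 + y'.1) +
        sg d • compAux X Z comp i (Finsupp.single b ω) ((associahedron k n).boundaryAux (y.1 + y'.1))
      change Z.boundaryAux (compAux X Z comp i (Finsupp.single b ω) y.1) = _ at hy
      change Z.boundaryAux (compAux X Z comp i (Finsupp.single b ω) y'.1) = _ at hy'
      rw [compAux_add_right, map_add, map_add, compAux_add_right, compAux_add_right, hy, hy', smul_add]
      abel
    | single b' ω' hω' he => exact C.boundaryAux_single hω hω'

end CompFacets

end Derivation

/-! ### The boundary is equivariant. -/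

section Relabel

/-- A relabelling of faces is compatible with facets. -/
structure RelabelFacets (X : FacePoset k n) (act : X.Cell → X.Cell) (σ : Equiv.Perm (Fin (n + 1))) :
    Prop where
  bijective : Function.Bijective act
  br_act : ∀ b, X.br (act b) = relabelBr σ (X.br b)
  facet_iff : ∀ {c b}, X.IsFacet (act c) (act b) ↔ X.IsFacet c b

/-- Facets correspond to facets, and the conormal of a relabelled facet pulls back to the original
conormal. -/
theorem RelabelFacets.boundaryAux {X : FacePoset k n} {act : X.Cell → X.Cell}
    {σ : Equiv.Perm (Fin (n + 1))} (R : RelabelFacets X act σ) (x) :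
    X.boundaryAux (relabelAux X act σ x) = relabelAux X act σ (X.boundaryAux x) := by
  induction x using Finsupp.induction_linear with
  | zero => simp
  | add x y hx hy => simp only [map_add, hx, hy]
  | single b ω =>
    rw [relabelAux_single, FacePoset.boundaryAux_single, FacePoset.boundaryAux_single, map_sum]
    symm
    refine Finset.sum_bij (fun c _ => act c) (fun c hc => ?_) (fun c _ c' _ h => R.bijective.1 h)
      (fun c hc => ?_) (fun c hc => ?_)
    · exact Finset.mem_filter.2 ⟨Finset.mem_univ _, R.facet_iff.2 (Finset.mem_filter.1 hc).2⟩
    · obtain ⟨c, rfl⟩ := R.bijective.2 c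
      exact ⟨c, Finset.mem_filter.2 ⟨Finset.mem_univ _, R.facet_iff.1 (Finset.mem_filter.1 hc).2⟩, rfl⟩
    · obtain ⟨l, h1, h2⟩ := (Finset.mem_filter.1 hc).2.exists_insert
      have hinj := List.map_injective_iff.2 (Equiv.injective σ⁻¹)
      have h3 : X.outward (act c) (act b) = -gapSum k (l.map ⇑(σ⁻¹)) := by
        refine FacePoset.outward_eq ?_ ?_
        · rw [R.br_act, relabelBr, Finset.mem_image]
          rintro ⟨l', hl', h⟩
          exact h1 (hinj h ▸ hl')
        · rw [R.br_act, R.br_act, h2, relabelBr, Finset.image_insert]; rfl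
      rw [relabelAux_single, FacePoset.outward_eq h1 h2, h3, contractLeft_map]
      have h4 : (-gapSum k (l.map ⇑(σ⁻¹))) ∘ₗ push ⇑(σ⁻¹) = -gapSum k l :=
        LinearMap.ext fun t => congrArg Neg.neg (gapSum_map (Equiv.injective _) l t)
      rw [h4]

theorem relabelBr_relabelBr (σ τ : Equiv.Perm (Fin (n + 1))) (h : τ⁻¹ * σ⁻¹ = 1) (B) :
    relabelBr τ (relabelBr σ B) = B := by
  have h' : ⇑(τ⁻¹) ∘ ⇑(σ⁻¹) = id := by rw [← Equiv.Perm.coe_mul, h]; rfl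
  have h2 : List.map ⇑(τ⁻¹) ∘ List.map ⇑(σ⁻¹) = id := by
    funext l
    rw [Function.comp_apply, List.map_map, h', List.map_id, id]
  rw [relabelBr, relabelBr, Finset.image_image, h2, Finset.image_id]

theorem relabelBr_insert (σ : Equiv.Perm (Fin (n + 1))) {B C : Finset (List (Fin (n + 1)))}
    (h : ∃ l, l ∉ B ∧ C = insert l B) :
    ∃ l, l ∉ relabelBr σ B ∧ relabelBr σ C = insert l (relabelBr σ B) := by
  obtain ⟨l, h1, rfl⟩ := h
  refine ⟨l.map ⇑(σ⁻¹), ?_, by rw [relabelBr, Finset.image_insert]; rfl⟩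
  rw [relabelBr, Finset.mem_image]
  rintro ⟨l', hl', h⟩
  exact h1 (List.map_injective_iff.2 (Equiv.injective σ⁻¹) h ▸ hl')

theorem LinBr.relabel_relabel (σ τ : Equiv.Perm (Fin (n + 1))) (h : τ⁻¹ * σ⁻¹ = 1) (b : LinBr n) :
    (b.relabel σ).relabel τ = b := by
  refine LinBr.ext ?_ (relabelBr_relabelBr σ τ h b.br)
  have h' : ⇑(τ⁻¹) ∘ ⇑(σ⁻¹) = id := by rw [← Equiv.Perm.coe_mul, h]; rfl
  change (b.word.map ⇑(σ⁻¹)).map ⇑(τ⁻¹) = b.word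
  rw [List.map_map, h', List.map_id]

theorem CycBr.relabel_relabel (σ τ : Equiv.Perm (Fin (n + 1))) (h : τ⁻¹ * σ⁻¹ = 1) (b : CycBr n) :
    (b.relabel σ).relabel τ = b := by
  refine CycBr.ext ?_ (relabelBr_relabelBr σ τ h b.br)
  have h' : ⇑(τ⁻¹) ∘ ⇑(σ⁻¹) = id := by rw [← Equiv.Perm.coe_mul, h]; rfl
  change (b.word.map ⇑(σ⁻¹)).map ⇑(τ⁻¹) = b.word
  obtain ⟨w, hw⟩ := Quotient.exists_rep b.word
  have hw : (w : Cycle (Fin (n + 1))) = b.word := hw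
  rw [← hw, Cycle.map_coe, Cycle.map_coe, List.map_map, h', List.map_id]

theorem assocRelabelFacets (σ : Equiv.Perm (Fin (n + 1))) :
    RelabelFacets (associahedron k n) (fun b => LinBr.relabel b σ) σ := by
  have key : ∀ (σ : Equiv.Perm (Fin (n + 1))) {c b : LinBr n}, (associahedron k n).IsFacet c b →
      (associahedron k n).IsFacet (c.relabel σ) (b.relabel σ) := fun σ c b h => by
    obtain ⟨h1, h2⟩ := assoc_facet_iff.1 h
    exact assoc_facet_iff.2 ⟨congrArg (List.map ⇑(σ⁻¹)) h1, relabelBr_insert σ h2⟩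
  have hi : ∀ b : LinBr n, (b.relabel σ).relabel σ⁻¹ = b := LinBr.relabel_relabel _ _ (by simp)
  refine ⟨Function.bijective_iff_has_inverse.2 ⟨fun b => LinBr.relabel b σ⁻¹, hi,
    LinBr.relabel_relabel _ _ (by simp)⟩, fun _ => rfl, fun {c b} => ⟨fun h => ?_, key σ⟩⟩
  have := key σ⁻¹ h
  rwa [hi, hi] at this

theorem cycloRelabelFacets (σ : Equiv.Perm (Fin (n + 1))) :
    RelabelFacets (cyclohedron k n) (fun b => CycBr.relabel b σ) σ := by
  have key : ∀ (σ : Equiv.Perm (Fin (n + 1))) {c b : CycBr n}, (cyclohedron k n).IsFacet c b →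
      (cyclohedron k n).IsFacet (c.relabel σ) (b.relabel σ) := fun σ c b h => by
    obtain ⟨h1, h2⟩ := cyclo_facet_iff.1 h
    exact cyclo_facet_iff.2 ⟨congrArg (Cycle.map ⇑(σ⁻¹)) h1, relabelBr_insert σ h2⟩
  have hi : ∀ b : CycBr n, (b.relabel σ).relabel σ⁻¹ = b := CycBr.relabel_relabel _ _ (by simp)
  refine ⟨Function.bijective_iff_has_inverse.2 ⟨fun b => CycBr.relabel b σ⁻¹, hi,
    CycBr.relabel_relabel _ _ (by simp)⟩, fun _ => rfl, fun {c b} => ⟨fun h => ?_, key σ⟩⟩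
  have := key σ⁻¹ h
  rwa [hi, hi] at this

end Relabel

end

section

variable {k : Type u} [Field k] {m n : ℕ}

/-! ### Degrees in front of a letter of a composite. -/

section DegBefore

theorem degBefore_eq_sum {N : ℕ} (i : ℕ) (p : Fin N → ℤ) :
    degBefore i p = ∑ x : Fin N, if (x : ℕ) < i then p x else 0 := by
  rw [degBefore, Finset.sum_filter]

theorem degBefore_update_of_le {N i : ℕ} (p : Fin N → ℤ) {j : Fin N} (h : i ≤ j) (q : ℤ) :
    degBefore i (Function.update p j q) = degBefore i p := by
  rw [degBefore_eq_sum, degBefore_eq_sum]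
  refine Finset.sum_congr rfl fun x _ => ?_
  by_cases hx : x = j
  · subst hx
    rw [if_neg (by omega), if_neg (by omega)]
  · rw [Function.update_of_ne hx]

theorem degBefore_update_of_lt {N i : ℕ} (p : Fin N → ℤ) {j : Fin N} (h : (j : ℕ) < i) (q : ℤ) :
    degBefore i (Function.update p j q) = degBefore i p - p j + q := by
  rw [degBefore_eq_sum, degBefore_eq_sum, ← Finset.add_sum_erase _ _ (Finset.mem_univ j),
    ← Finset.add_sum_erase _ (fun x : Fin N => if (x : ℕ) < i then p x else 0) (Finset.mem_univ j),
    if_pos h, if_pos h, Function.update_self]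
  have : ∑ x ∈ Finset.univ.erase j, (if (x : ℕ) < i then Function.update p j q x else 0) =
      ∑ x ∈ Finset.univ.erase j, if (x : ℕ) < i then p x else 0 :=
    Finset.sum_congr rfl fun x hx => by rw [Function.update_of_ne (Finset.ne_of_mem_erase hx)]
  rw [this]
  ring

theorem degBefore_outLab_of_lt {i j : Fin (m + 1)} (h : j < i) (p : Fin (m + n + 1) → ℤ) (q : ℤ) :
    degBefore (outLab n i j) p = degBefore j (Function.update (p ∘ outLab n i) i q) := by
  have h' : (j : ℕ) < i := h
  rw [degBefore_eq_sum, sum_lab i, degBefore_eq_sum]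
  refine Finset.sum_congr rfl fun x _ => ?_
  have hj : ((outLab n i j : Fin (m + n + 1)) : ℕ) = j := if_pos h'.le
  by_cases hx : x = i
  · subst hx
    rw [if_pos rfl, if_neg (by omega)]
    refine Finset.sum_eq_zero fun y _ => if_neg ?_
    rw [hj]; simp only [inLab]; omega
  · rw [if_neg hx, Function.update_of_ne hx, hj, Function.comp_apply]
    have hx' : (x : ℕ) ≠ i := fun h => hx (Fin.ext h)
    refine if_congr ?_ rfl rfl
    simp only [outLab]; split <;> omega

theorem degBefore_outLab_of_gt {i j : Fin (m + 1)} (h : i < j) (p : Fin (m + n + 1) → ℤ) (e : ℤ) :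
    degBefore (outLab n i j) p + e =
      degBefore j (Function.update (p ∘ outLab n i) i (∑ y, p (inLab n i y) + e)) := by
  have h' : (i : ℕ) < j := h
  have hj : ((outLab n i j : Fin (m + n + 1)) : ℕ) = j + n := if_neg (by omega)
  rw [degBefore_update_of_lt _ h', degBefore_eq_sum, sum_lab i, degBefore_eq_sum,
    ← Finset.add_sum_erase _ _ (Finset.mem_univ i),
    ← Finset.add_sum_erase _ (fun x : Fin (m + 1) => if (x : ℕ) < j then (p ∘ outLab n i) x else 0)
      (Finset.mem_univ i), if_pos rfl, if_pos h']
  have h1 : ∑ y : Fin (n + 1), (if ((inLab n i y : Fin (m + n + 1)) : ℕ) < (outLab n i j : Fin (m + n + 1))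
      then p (inLab n i y) else 0) = ∑ y, p (inLab n i y) := by
    refine Finset.sum_congr rfl fun y _ => if_pos ?_
    have := y.2
    rw [hj]; simp only [inLab]; omega
  have h2 : ∑ x ∈ Finset.univ.erase i, (if x = i then ∑ y : Fin (n + 1),
      (if ((inLab n i y : Fin (m + n + 1)) : ℕ) < (outLab n i j : Fin (m + n + 1))
      then p (inLab n i y) else 0) else if ((outLab n i x : Fin (m + n + 1)) : ℕ) <
        (outLab n i j : Fin (m + n + 1)) then p (outLab n i x) else 0) =
      ∑ x ∈ Finset.univ.erase i, if (x : ℕ) < j then (p ∘ outLab n i) x else 0 := by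
    refine Finset.sum_congr rfl fun x hx => ?_
    rw [if_neg (Finset.ne_of_mem_erase hx), hj]
    refine if_congr ?_ rfl rfl
    have hx' : (x : ℕ) ≠ i := fun h => Finset.ne_of_mem_erase hx (Fin.ext h)
    simp only [outLab]; split <;> omega
  rw [h2, h1]
  ring

theorem degBefore_inLab (i : Fin (m + 1)) (y : Fin (n + 1)) (p : Fin (m + n + 1) → ℤ) :
    degBefore (inLab n i y) p = degBefore i p + degBefore y (p ∘ inLab n i) := by
  rw [degBefore_eq_sum, sum_lab i, degBefore_eq_sum (i : ℕ), sum_lab i, degBefore_eq_sum (y : ℕ),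
    ← Finset.add_sum_erase _ _ (Finset.mem_univ i), add_comm,
    ← Finset.add_sum_erase _ (fun x : Fin (m + 1) => if x = i then ∑ y : Fin (n + 1),
      (if ((inLab n i y : Fin (m + n + 1)) : ℕ) < i then p (inLab n i y) else 0) else
      if ((outLab n i x : Fin (m + n + 1)) : ℕ) < i then p (outLab n i x) else 0)
      (Finset.mem_univ i), if_pos rfl, if_pos rfl]
  have h1 : ∑ y : Fin (n + 1), (if ((inLab n i y : Fin (m + n + 1)) : ℕ) < i
      then p (inLab n i y) else 0) = 0 :=
    Finset.sum_eq_zero fun y _ => if_neg (by simp only [inLab]; omega)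
  rw [h1, zero_add]
  congr 1
  · refine Finset.sum_congr rfl fun x hx => ?_
    rw [if_neg (Finset.ne_of_mem_erase hx), if_neg (Finset.ne_of_mem_erase hx)]
    refine if_congr ?_ rfl rfl
    have hx' : (x : ℕ) ≠ i := fun h => Finset.ne_of_mem_erase hx (Fin.ext h)
    have := y.2
    simp only [outLab, inLab]; split <;> omega
  · refine Finset.sum_congr rfl fun x hx => if_congr ?_ rfl rfl
    simp only [inLab]; omega

end DegBefore

/-! ### The differential of multilinear maps. -/

section HomDiff

variable {A : Type v} [AddCommGroup A] [Module k A] {W : Type w} [AddCommGroup W] [Module k W]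

theorem update_comp_of_notMem {α β γ : Type*} [DecidableEq β] (a : β → γ) (g : α → β) {j : β} (x : γ)
    (h : ∀ y, g y ≠ j) : Function.update a j x ∘ g = a ∘ g := by
  funext y
  exact Function.update_of_ne (h y) _ _

theorem update_comp_of_injective {α β γ : Type*} [DecidableEq α] [DecidableEq β] (a : β → γ) {g : α → β}
    (hg : Function.Injective g) (j : α) (x : γ) :
    Function.update a (g j) x ∘ g = Function.update (a ∘ g) j x :=
  Function.update_comp_eq_of_injective a hg j x

theorem update_mem {N : ℕ} {𝒜 : ℤ → Submodule k A} {p : Fin N → ℤ} {a : Fin N → A}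
    (ha : ∀ j, a j ∈ 𝒜 (p j)) (j : Fin N) {x : A} {q : ℤ} (hx : x ∈ 𝒜 q) (l) :
    Function.update a j x l ∈ 𝒜 (Function.update p j q l) := by
  by_cases h : l = j
  · subst h; simpa using hx
  · rw [Function.update_of_ne h, Function.update_of_ne h]; exact ha l

/-- The Leibniz rule for inserting `h` into `g`. Applying `D` to an outer argument belongs to the
differential of `g`, and to an inner argument to that of `h`; the term with `D` applied to the value
of `h` occurs in both differentials, with opposite signs, and drops out. -/
theorem homDiff_comp {𝒜 : ℤ → Submodule k A} {D : A →ₗ[k] A} {δ : W →ₗ[k] W}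
    (hD : ∀ q, ∀ x ∈ 𝒜 q, D x ∈ 𝒜 (q - 1)) {d e : ℕ} {i : Fin (m + 1)}
    {f : MultilinearMap k (fun _ : Fin (m + n + 1) => A) W}
    {g : MultilinearMap k (fun _ : Fin (m + 1) => A) W}
    {h : MultilinearMap k (fun _ : Fin (n + 1) => A) A}
    (hf : ∀ (p : Fin (m + n + 1) → ℤ) a, (∀ j, a j ∈ 𝒜 (p j)) →
      f a = Int.negOnePow (e * degBefore i p) • g (plug rfl i h a))
    {p : Fin (m + n + 1) → ℤ} {a : Fin (m + n + 1) → A} (ha : ∀ j, a j ∈ 𝒜 (p j)) :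
    homDiff δ D (d + e) f p a =
      Int.negOnePow (e * degBefore i p) • (homDiff δ D d g
        (Function.update (p ∘ outLab n i) i (∑ y, p (inLab n i y) + e)) (plug rfl i h a) +
      sg (d + degBefore i p : ℤ) •
        g (Function.update (a ∘ outLab n i) i (homDiff D D e h (p ∘ inLab n i) (a ∘ inLab n i)))) := by
  simp only [plug_eq] at hf ⊢
  set B := degBefore i p with hB
  set a' := Function.update (a ∘ outLab n i) i (h (a ∘ inLab n i)) with ha'
  set p' := Function.update (p ∘ outLab n i) i (∑ y, p (inLab n i y) + e) with hp'
  have hDB : degBefore i p' = B := by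
    rw [hB, degBefore_eq i p (∑ y, p (inLab n i y) + e), degBefore_eq_sum]
    rfl
  -- When `j` comes before `i`, lowering the degree of its argument by one changes the exponent of
  -- the Koszul sign by `e`.
  have hout : ∀ j, j ≠ i → f (Function.update a (outLab n i j) (D (a (outLab n i j)))) =
      sg ((e * B + if j < i then (e : ℤ) else 0 : ℤ)) •
        g (Function.update a' j (D (a' j))) := by
    intro j hj
    rw [hf (Function.update p (outLab n i j) (p (outLab n i j) - 1)) _
      (update_mem ha _ (hD _ _ (ha _))), negOnePow_eq_sg,
      update_comp_of_notMem a (inLab n i) _ fun y h => outLab_ne_inLab hj y h.symm,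
      update_comp_of_injective a (g := outLab n i) (fun _ _ => outLab_inj) j, Function.update_comm hj.symm]
    have h2 : a' j = a (outLab n i j) := Function.update_of_ne hj _ _
    rw [h2]
    congr 2
    by_cases hlt : j < i
    · have hj' : ((outLab n i j : Fin (m + n + 1)) : ℕ) < i := by
        have : (j : ℕ) < i := hlt
        simp only [outLab]; split <;> omega
      rw [if_pos hlt, degBefore_update_of_lt _ hj']
      push_cast
      have := CharTwo.two_eq_zero (R := ZMod 2)
      rw [← hB]
      linear_combination (-(e : ZMod 2)) * this
    · have hj' : (i : ℕ) ≤ (outLab n i j : Fin (m + n + 1)) := by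
        have : (i : ℕ) ≤ j := not_lt.1 hlt
        simp only [outLab]; split <;> omega
      rw [if_neg hlt, degBefore_update_of_le _ hj', add_zero]
  have hin : ∀ y, f (Function.update a (inLab n i y) (D (a (inLab n i y)))) =
      sg (e * B : ℤ) • g (Function.update (a ∘ outLab n i) i
        (h (Function.update (a ∘ inLab n i) y (D ((a ∘ inLab n i) y))))) := by
    intro y
    rw [hf (Function.update p (inLab n i y) (p (inLab n i y) - 1)) _
      (update_mem ha _ (hD _ _ (ha _))), negOnePow_eq_sg,
      degBefore_update_of_le _ (by simp only [inLab]; omega),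
      update_comp_of_injective a (inLab_injective i) y]
    congr 2
    funext j
    by_cases hj : j = i
    · subst hj; rw [Function.update_self, Function.update_self]; rfl
    · rw [Function.update_of_ne hj, Function.update_of_ne hj, Function.comp_apply,
        Function.update_of_ne (outLab_ne_inLab hj y), Function.comp_apply]
  -- The first term on the right is the one that cancels against the argument `i` in the
  -- differential of `g`.
  have hg : g (Function.update (a ∘ outLab n i) i (homDiff D D e h (p ∘ inLab n i) (a ∘ inLab n i))) =
      g (Function.update a' i (D (a' i))) - sg (e : ℤ) • ∑ y : Fin (n + 1),
        sg (degBefore y (p ∘ inLab n i)) • g (Function.update (a ∘ outLab n i) i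
        (h (Function.update (a ∘ inLab n i) y (D ((a ∘ inLab n i) y))))) := by
    rw [homDiff, MultilinearMap.map_update_sub, negOnePow_eq_sg, multilinear_update_units,
      MultilinearMap.map_update_sum]
    simp only [negOnePow_eq_sg, multilinear_update_units]
    rw [ha', Function.update_self, Function.update_idem]
  rw [homDiff, hf p a ha, ← ha', map_units_int δ, homDiff, hg, sum_lab i,
    ← Finset.add_sum_erase _ _ (Finset.mem_univ i), if_pos rfl,
    ← Finset.add_sum_erase _ (fun x : Fin (m + 1) => (degBefore x p').negOnePow • g (Function.update a' x (D (a' x))))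
      (Finset.mem_univ i), hDB]
  have h1 : ∑ x ∈ Finset.univ.erase i, (if x = i then ∑ y : Fin (n + 1),
      (degBefore (inLab n i y) p).negOnePow • f (Function.update a (inLab n i y) (D (a (inLab n i y))))
      else (degBefore (outLab n i x) p).negOnePow •
        f (Function.update a (outLab n i x) (D (a (outLab n i x))))) =
      sg (e * B + e : ℤ) • ∑ x ∈ Finset.univ.erase i,
        (degBefore x p').negOnePow • g (Function.update a' x (D (a' x))) := by
    rw [Finset.smul_sum]
    refine Finset.sum_congr rfl fun x hx => ?_
    have hne := Finset.ne_of_mem_erase hx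
    rw [if_neg hne, hout x hne, negOnePow_eq_sg, negOnePow_eq_sg, sg_smul_smul, sg_smul_smul]
    congr 2
    have h2 := CharTwo.two_eq_zero (R := ZMod 2)
    rcases lt_or_gt_of_ne hne with hlt | hlt
    · rw [if_pos hlt, degBefore_outLab_of_lt hlt p (∑ y, p (inLab n i y) + e)]
      push_cast
      ring
    · rw [if_neg hlt.asymm, ← degBefore_outLab_of_gt hlt]
      push_cast
      linear_combination (-(e : ZMod 2)) * h2
  have h3 : ∑ y : Fin (n + 1), (degBefore (inLab n i y) p).negOnePow •
      f (Function.update a (inLab n i y) (D (a (inLab n i y)))) =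
      sg (e * B + B : ℤ) • ∑ y : Fin (n + 1),
        sg (degBefore y (p ∘ inLab n i)) • g (Function.update (a ∘ outLab n i) i
        (h (Function.update (a ∘ inLab n i) y (D ((a ∘ inLab n i) y))))) := by
    rw [Finset.smul_sum]
    refine Finset.sum_congr rfl fun y _ => ?_
    rw [hin, degBefore_inLab, negOnePow_eq_sg, sg_smul_smul, sg_smul_smul]
    congr 2
    push_cast
    rw [← hB]
    ring
  rw [h1, h3]
  simp only [negOnePow_eq_sg, smul_add, smul_sub, sg_smul_smul]
  have e1 : ∀ M : W, sg (((d + e : ℕ) : ℤ) + (e * B + B : ℤ) : ZMod 2) • M =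
      sg ((e * B : ℤ) + ((d + B : ℤ) + (e : ℤ)) : ZMod 2) • M := by
    intro M; congr 2; push_cast; ring
  have e2 : ∀ M : W, sg (((d + e : ℕ) : ℤ) + (e * B + e : ℤ) : ZMod 2) • M =
      sg ((e * B : ℤ) + (d : ℤ) : ZMod 2) • M := by
    intro M; congr 2; push_cast
    linear_combination (e : ZMod 2) * CharTwo.two_eq_zero (R := ZMod 2)
  have e3 : ∀ M : W, sg ((e * B : ℤ) + ((d : ℤ) + (B : ℤ)) : ZMod 2) • M =
      sg ((e * B : ℤ) + (d + B : ℤ) : ZMod 2) • M := by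
    intro M; congr 2; push_cast; ring
  rw [e1, e2, e3]
  abel

/-- Only the inversions that involve this letter change. Modulo 2, the degrees of the letters
inverted with it are the difference between the degrees in front of it in the two orders. -/
theorem koszulSign_update {N : ℕ} (τ : Equiv.Perm (Fin N)) (p : Fin N → ℤ) (i : Fin N) :
    koszulSign τ (Function.update p (τ i) (p (τ i) - 1)) =
      koszulSign τ p * sg (degBefore i (p ∘ τ) + degBefore (τ i) p : ℤ) := by
  have hP : ∀ x, ((Function.update p (τ i) (p (τ i) - 1) (τ x) : ℤ) : ZMod 2) =
      p (τ x) + if x = i then 1 else 0 := by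
    intro x
    by_cases h : x = i
    · subst h
      rw [Function.update_self, if_pos rfl]
      push_cast
      linear_combination -CharTwo.two_eq_zero (R := ZMod 2)
    · rw [Function.update_of_ne fun h' => h (τ.injective h'), if_neg h, add_zero]
  have h1 : ((degBefore i (p ∘ τ) : ℤ) : ZMod 2) = ∑ x, if x < i then (p (τ x) : ZMod 2) else 0 := by
    rw [degBefore_eq_sum]
    push_cast
    rfl
  have h2 : ((degBefore (τ i) p : ℤ) : ZMod 2) = ∑ x, if τ x < τ i then (p (τ x) : ZMod 2) else 0 := by
    rw [degBefore_eq_sum, ← Equiv.sum_comp τ]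
    push_cast
    rfl
  have key : ∀ x y : Fin N, (if x < y then if τ y < τ x then
      ((p (τ x) : ZMod 2) + if x = i then 1 else 0) * (p (τ y) + if y = i then 1 else 0)
      else 0 else 0) = (if x < y then if τ y < τ x then (p (τ x) : ZMod 2) * p (τ y) else 0 else 0) +
      ((if x = i then if i < y then if τ y < τ i then (p (τ y) : ZMod 2) else 0 else 0 else 0) +
      (if y = i then if x < i then if τ i < τ x then (p (τ x) : ZMod 2) else 0 else 0 else 0)) := by
    intro x y
    by_cases hx : x = i <;> by_cases hy : y = i
    · subst hx hy; simp
    · subst hx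
      simp only [if_pos, if_neg hy, add_zero]
      split
      · split
        · ring
        · simp
      · simp
    · subst hy
      simp only [if_pos, if_neg hx, add_zero]
      split
      · split
        · ring
        · simp
      · simp
    · simp [hx, hy]
  rw [sg_kos_finRange, sg_kos_finRange, ← sg_add, kos, kos, pairSum_map, pairSum_map,
    pairSum_finRange, pairSum_finRange]
  congr 1
  simp only [hP, key, Finset.sum_add_distrib]
  congr 1
  push_cast
  rw [h1, h2, Finset.sum_comm (f := fun x y : Fin N => if y = i then
    if x < i then if τ i < τ x then (p (τ x) : ZMod 2) else 0 else 0 else 0)]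
  have h3 : ∀ (f : Fin N → ZMod 2), ∑ x, ∑ y, (if x = i then f y else 0) = ∑ y, f y := by
    intro f
    rw [Finset.sum_comm]
    exact Finset.sum_congr rfl fun y _ => by simp
  rw [h3 fun y => if i < y then if τ y < τ i then (p (τ y) : ZMod 2) else 0 else 0,
    h3 fun x => if x < i then if τ i < τ x then (p (τ x) : ZMod 2) else 0 else 0,
    ← Finset.sum_add_distrib, ← Finset.sum_add_distrib]
  refine Finset.sum_congr rfl fun x _ => ?_
  rcases lt_trichotomy x i with h | rfl | h
  · rw [if_neg h.asymm, if_pos h, if_pos h, zero_add]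
    have hne : τ x ≠ τ i := fun h' => h.ne (τ.injective h')
    rcases lt_or_gt_of_ne hne with h' | h'
    · rw [if_neg h'.asymm, if_pos h', CharTwo.add_self_eq_zero]
    · rw [if_pos h', if_neg h'.asymm, add_zero]
  · simp
  · simp [h, h.asymm]

/-- By `koszulSign_update`, the change of the Koszul sign when `D` is applied to an argument
compensates the different positions of that argument. -/
theorem homDiff_perm {𝒜 : ℤ → Submodule k A} {D : A →ₗ[k] A} {δ : W →ₗ[k] W}
    (hD : ∀ q, ∀ x ∈ 𝒜 q, D x ∈ 𝒜 (q - 1)) {d N : ℕ} {τ : Equiv.Perm (Fin N)}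
    {f g : MultilinearMap k (fun _ : Fin N => A) W}
    (hf : ∀ (p : Fin N → ℤ) a, (∀ j, a j ∈ 𝒜 (p j)) → f a = koszulSign τ p • g (a ∘ τ))
    {p : Fin N → ℤ} {a : Fin N → A} (ha : ∀ j, a j ∈ 𝒜 (p j)) :
    homDiff δ D d f p a = koszulSign τ p • homDiff δ D d g (p ∘ τ) (a ∘ τ) := by
  rw [homDiff, homDiff, hf p a ha, map_units_int δ, smul_sub]
  congr 1
  rw [smul_comm]
  congr 1
  rw [← Equiv.sum_comp τ, Finset.smul_sum]
  refine Finset.sum_congr rfl fun i _ => ?_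
  rw [hf (Function.update p (τ i) (p (τ i) - 1)) _ (update_mem ha _ (hD _ _ (ha _))),
    update_comp_of_injective a τ.injective, koszulSign_update, smul_smul, smul_smul,
    negOnePow_eq_sg, negOnePow_eq_sg]
  congr 1
  push_cast
  rw [sg_add, mul_left_comm, mul_left_comm (sg ((degBefore (τ i) p : ℤ) : ZMod 2)), sg_mul_self, mul_one]

end HomDiff

/-! ### Compatibility with boundaries passes to generated chains. -/

section Boundary

variable {A : Type v} [AddCommGroup A] [Module k A] {W : Type w} [AddCommGroup W] [Module k W]

/-- The operations `F x` of the `d`-chain `x` satisfy `F (∂ x) = ∂ (F x)`. -/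
def BoundaryCompat (𝒜 : ℤ → Submodule k A) (D : A →ₗ[k] A) (δ : W →ₗ[k] W) {X : FacePoset k n}
    (F : (X.Cell →₀ ExteriorAlgebra k (Fin (n + 1) → k)) →ₗ[k]
      MultilinearMap k (fun _ : Fin (n + 1) => A) W) (d : ℕ)
    (x : X.Cell →₀ ExteriorAlgebra k (Fin (n + 1) → k)) : Prop :=
  ∀ (p : Fin (n + 1) → ℤ) a, (∀ j, a j ∈ 𝒜 (p j)) → F (X.boundaryAux x) a = homDiff δ D d (F x) p a

section

variable {𝒜 : ℤ → Submodule k A} {D : A →ₗ[k] A} {δ : W →ₗ[k] W} {X : FacePoset k n}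
  {F : (X.Cell →₀ ExteriorAlgebra k (Fin (n + 1) → k)) →ₗ[k]
      MultilinearMap k (fun _ : Fin (n + 1) => A) W} {d : ℕ}

theorem BoundaryCompat.zero : BoundaryCompat 𝒜 D δ F d 0 := by
  intro p a _
  simp [homDiff]

theorem BoundaryCompat.add {x y} (hx : BoundaryCompat 𝒜 D δ F d x) (hy : BoundaryCompat 𝒜 D δ F d y) :
    BoundaryCompat 𝒜 D δ F d (x + y) := by
  intro p a ha
  rw [map_add, map_add, _root_.add_apply, hx p a ha, hy p a ha, map_add]
  simp only [homDiff, _root_.add_apply, map_add, smul_add, Finset.sum_add_distrib]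
  abel

theorem BoundaryCompat.smul (c : k) {x} (hx : BoundaryCompat 𝒜 D δ F d x) :
    BoundaryCompat 𝒜 D δ F d (c • x) := by
  intro p a ha
  rw [map_smul, map_smul, _root_.smul_apply, hx p a ha, map_smul]
  simp only [homDiff, _root_.smul_apply, map_smul, smul_sub, Finset.smul_sum]
  simp only [smul_comm c]

/-- Both differentials are equivariant. Degree 0 is treated apart since the equivariance of `F` is
given on graded chains and a point has boundary zero. -/
theorem BoundaryCompat.relabel {act : X.Cell → X.Cell} {σ : Equiv.Perm (Fin (n + 1))}
    (hD : ∀ q, ∀ x ∈ 𝒜 q, D x ∈ 𝒜 (q - 1))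
    (R : RelabelFacets X act σ) (hF : ∀ (e : ℕ) (x : X.chains e) (p : Fin (n + 1) → ℤ) a, (∀ j, a j ∈ 𝒜 (p j)) →
      F (relabelAux X act σ x.1) a = koszulSign σ⁻¹ p • F x.1 (a ∘ ⇑(σ⁻¹)))
    {x : X.chains d} (hx : BoundaryCompat 𝒜 D δ F d x.1) :
    BoundaryCompat 𝒜 D δ F d (relabelAux X act σ x.1) := by
  intro p a ha
  rw [R.boundaryAux, homDiff_perm hD (hF d x) ha, ← hx (p ∘ ⇑(σ⁻¹)) (a ∘ ⇑(σ⁻¹)) fun j => ha _]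
  cases d with
  | zero =>
    rw [FacePoset.boundaryAux_eq_zero x.2]
    simp
  | succ d => exact hF d ⟨_, X.boundaryAux_mem x.2⟩ p a ha

end

/-- Both differentials satisfy the same Leibniz rule. The exponents of the signs of the inner terms
differ by the degree in front of `i`, because taking the boundary lowers the degree `e` in the
Koszul sign by one. -/
theorem BoundaryCompat.comp {𝒜 : ℤ → Submodule k A} {D : A →ₗ[k] A} {δ : W →ₗ[k] W}
    (hD : ∀ q, ∀ x ∈ 𝒜 q, D x ∈ 𝒜 (q - 1)) {X : FacePoset k m} {Z : FacePoset k (m + n)}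
    {c : X.Cell → LinBr n → Z.Cell} {i : Fin (m + 1)} (C : CompFacets X Z c i)
    {F : (Z.Cell →₀ ExteriorAlgebra k (Fin (m + n + 1) → k)) →ₗ[k]
      MultilinearMap k (fun _ : Fin (m + n + 1) => A) W}
    {G : (X.Cell →₀ ExteriorAlgebra k (Fin (m + 1) → k)) →ₗ[k]
      MultilinearMap k (fun _ : Fin (m + 1) => A) W}
    {H : (LinBr n →₀ ExteriorAlgebra k (Fin (n + 1) → k)) →ₗ[k]
      MultilinearMap k (fun _ : Fin (n + 1) => A) A}
    (hF : ∀ (d e : ℕ) (x : X.chains d) (y : (associahedron k n).chains e) (p : Fin (m + n + 1) → ℤ) a,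
      (∀ j, a j ∈ 𝒜 (p j)) → F (compAux X Z c i x.1 y.1) a =
        Int.negOnePow (e * degBefore i p) • G x.1 (plug rfl i (H y.1) a))
    {d e : ℕ} {x : X.chains d} {y : (associahedron k n).chains e} (hH : HasDegree 𝒜 𝒜 e (H y.1))
    (hx : BoundaryCompat 𝒜 D δ G d x.1) (hy : BoundaryCompat (X := associahedron k n) 𝒜 D D H e y.1) :
    BoundaryCompat 𝒜 D δ F (d + e) (compAux X Z c i x.1 y.1) := by
  intro p a ha
  rw [homDiff_comp hD (fun p a ha => hF d e x y p a ha) ha, C.boundaryAux_compAux, map_add, map_units_int F,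
    _root_.add_apply, multilinear_units_smul, smul_add]
  have h1 : F (compAux X Z c i (X.boundaryAux x.1) y.1) a = Int.negOnePow (e * degBefore i p) •
      homDiff δ D d (G x.1) (Function.update (p ∘ outLab n i) i (∑ y, p (inLab n i y) + e))
        (plug rfl i (H y.1) a) := by
    rw [← hx _ _ (plug_mem ha (hH _ _ fun j => ha _))]
    cases d with
    | zero =>
      rw [FacePoset.boundaryAux_eq_zero x.2]
      simp [compAux]
    | succ d => exact hF d e ⟨_, X.boundaryAux_mem x.2⟩ y p a ha
  have h2 : F (compAux X Z c i x.1 ((associahedron k n).boundaryAux y.1)) a =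
      sg ((e + 1) * degBefore i p : ℤ) • G x.1 (Function.update (a ∘ outLab n i) i
        (homDiff D D e (H y.1) (p ∘ inLab n i) (a ∘ inLab n i))) := by
    rw [← hy (p ∘ inLab n i) (a ∘ inLab n i) fun j => ha _]
    cases e with
    | zero =>
      rw [FacePoset.boundaryAux_eq_zero y.2]
      simp [compAux]
    | succ e =>
      rw [hF d e x ⟨_, (associahedron k n).boundaryAux_mem y.2⟩ p a ha, plug_eq, negOnePow_eq_sg]
      congr 2
      push_cast
      linear_combination -(degBefore i p : ZMod 2) * CharTwo.two_eq_zero (R := ZMod 2)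
  rw [h1, h2, negOnePow_eq_sg, sg_smul_smul, sg_smul_smul]
  congr 3
  push_cast
  ring

end Boundary

end

section

variable {k : Type u} [Field k] {m n : ℕ}

local notation "ι" => ExteriorAlgebra.ι k

/-! ### Facets of the top cell of the associahedron. -/

section Facets

theorem map_inLab_finRange (i : Fin (m + 1)) :
    (List.finRange (n + 1)).map (inLab n i) = ((List.finRange (m + n + 1)).drop i).take (n + 1) := by
  refine List.ext_getElem ?_ fun j h1 h2 => ?_
  · have := i.2
    simp; omega
  · simp [inLab]

theorem infix_finRange_eq {N : ℕ} {s l t : List (Fin N)} (h : s ++ l ++ t = List.finRange N) :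
    l = ((List.finRange N).drop s.length).take l.length := by
  rw [← h]
  simp

/-- The bracketing with one inner bracket, around the `l + 1` letters from the letter `i` on. -/
def LinBr.castComp {m l N : ℕ} (h : m + l = N) (i : Fin (m + 1)) : LinBr N :=
  h ▸ (LinBr.top m).comp i (LinBr.top l)

theorem LinBr.castComp_word {m l N : ℕ} (h : m + l = N) (i : Fin (m + 1)) :
    (LinBr.castComp h i).word = List.finRange (N + 1) := by
  subst h
  exact substWord_finRange i

theorem LinBr.castComp_br {m l N : ℕ} (h : m + l = N) (i : Fin (m + 1)) (hm : 0 < m) (hl : 0 < l) :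
    (LinBr.castComp h i).br =
      {List.finRange (N + 1), ((List.finRange (N + 1)).drop i).take (l + 1)} := by
  subst h
  change brComp i (LinBr.top m).br (LinBr.top l) = _
  rw [brComp]
  simp only [LinBr.top, if_pos hm, if_pos hl, Finset.image_singleton, substWord_finRange,
    map_inLab_finRange]
  rfl

theorem LinBr.castComp_new {m l N : ℕ} {h : m + l = N} (i : Fin (m + 1)) (hm : 0 < m) (hl : 0 < l) :
    ((List.finRange (N + 1)).drop i).take (l + 1) ∉ (LinBr.top N).br ∧
      (LinBr.castComp h i).br = insert (((List.finRange (N + 1)).drop i).take (l + 1)) (LinBr.top N).br := by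
  constructor
  · simp only [LinBr.top, if_pos (show 0 < N by omega), Finset.mem_singleton]
    intro h'
    have := congrArg List.length h'
    simp at this
    omega
  · rw [LinBr.castComp_br h i hm hl, Finset.pair_comm]
    simp only [LinBr.top, if_pos (show 0 < N by omega)]

theorem top_facet_castComp {m l N : ℕ} (h : m + l = N) (i : Fin (m + 1)) (hm : 0 < m) (hl : 0 < l) :
    (associahedron k N).IsFacet (LinBr.castComp h i) (LinBr.top N) :=
  assoc_facet_iff.2 ⟨LinBr.castComp_word h i, _, LinBr.castComp_new i hm hl⟩

/-- The new bracket is an interval of the standard word, determined by its first letter and its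
length. It is neither a single letter nor the whole word, hence the bounds on `l`. -/
theorem exists_castComp {N : ℕ} (hN : 0 < N) {c : LinBr N}
    (hc : (associahedron k N).IsFacet c (LinBr.top N)) :
    ∃ (l : Fin (N + 1)) (i : Fin (N - l + 1)), (0 < (l : ℕ) ∧ (l : ℕ) < N) ∧
      LinBr.castComp (Nat.sub_add_cancel (Nat.le_of_lt_succ l.2)) i = c := by
  obtain ⟨h1, L, h2, h3⟩ := assoc_facet_iff.1 hc
  have h1 : c.word = List.finRange (N + 1) := h1
  simp only [LinBr.top, if_pos hN, Finset.mem_singleton] at h2 h3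
  have hL : L ∈ c.br := h3 ▸ Finset.mem_insert_self _ _
  obtain ⟨s, t, hst⟩ := c.br_infix L hL
  rw [h1] at hst
  have h4 := c.two_le L hL
  have h5 := infix_finRange_eq hst
  have h6 := congrArg List.length hst
  have h7 : L.length ≠ N + 1 := by
    intro h
    simp only [List.length_append, List.length_finRange, h] at h6
    obtain rfl : s = [] := List.length_eq_zero_iff.1 (by omega)
    obtain rfl : t = [] := List.length_eq_zero_iff.1 (by omega)
    exact h2 (by simpa using hst)
  simp at h6
  have hlt : 0 < L.length - 1 ∧ L.length - 1 < N := by omega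
  refine ⟨⟨L.length - 1, by omega⟩, ⟨s.length, by simp only; omega⟩, hlt, LinBr.ext ?_ ?_⟩
  · rw [h1, LinBr.castComp_word]
  · rw [h3, LinBr.castComp_br _ _ (by simp only; omega) (by simp only; omega), Finset.pair_comm]
    simp only
    rw [Nat.sub_add_cancel (by omega), ← h5]

theorem castComp_inj {N : ℕ} {l l' : Fin (N + 1)} {i : Fin (N - l + 1)} {i' : Fin (N - l' + 1)}
    (hl : 0 < (l : ℕ) ∧ (l : ℕ) < N) (hl' : 0 < (l' : ℕ) ∧ (l' : ℕ) < N)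
    (h : LinBr.castComp (Nat.sub_add_cancel (Nat.le_of_lt_succ l.2)) i =
      LinBr.castComp (Nat.sub_add_cancel (Nat.le_of_lt_succ l'.2)) i') :
    (⟨l, i⟩ : Σ l : Fin (N + 1), Fin (N - l + 1)) = ⟨l', i'⟩ := by
  have hb := congrArg LinBr.br h
  rw [LinBr.castComp_br _ _ (by omega) (by omega), LinBr.castComp_br _ _ (by omega) (by omega)] at hb
  have hlen : ∀ (l : Fin (N + 1)) (i : Fin (N - l + 1)),
      (((List.finRange (N + 1)).drop i).take (l + 1)).length = l + 1 := by
    intro l i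
    have := i.2
    have := l.2
    simp; omega
  have hmem : ((List.finRange (N + 1)).drop i).take (l + 1) ∈
      ({List.finRange (N + 1), ((List.finRange (N + 1)).drop i').take (l' + 1)} : Finset _) := by
    rw [← hb]; simp
  rw [Finset.mem_insert, Finset.mem_singleton] at hmem
  rcases hmem with h0 | h0
  · have := congrArg List.length h0
    rw [hlen, List.length_finRange] at this
    omega
  · have h1 := congrArg List.length h0
    rw [hlen, hlen] at h1
    have h2 : l = l' := Fin.ext (by omega)
    subst h2
    have h3 := congrArg (fun L => L[0]?) h0
    have hi := i.2
    have hi' := i'.2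
    simp at h3
    rw [List.getElem?_eq_getElem (by simp; omega), List.getElem?_eq_getElem (by simp; omega)] at h3
    simp at h3
    rw [Fin.ext h3]

/-- The excluded values of `l` are the single letter and the whole word. They index the terms of the
A(∞) relation with a unary operation, which are no facets but make up the differential of the top
operation. -/
theorem sum_top_facets {N : ℕ} (hN : 0 < N) {M : Type*} [AddCommMonoid M] (f : LinBr N → M) :
    ∑ c with (associahedron k N).IsFacet c (LinBr.top N), f c =
      ∑ l : Fin (N + 1), ∑ i : Fin (N - l + 1), if 0 < (l : ℕ) ∧ (l : ℕ) < N then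
        f (LinBr.castComp (Nat.sub_add_cancel (Nat.le_of_lt_succ l.2)) i) else 0 := by
  rw [Finset.sum_sigma', ← Finset.sum_filter]
  symm
  refine Finset.sum_bij (fun x _ => LinBr.castComp (Nat.sub_add_cancel (Nat.le_of_lt_succ x.1.2)) x.2)
    (fun x hx => ?_) (fun x hx y hy h => ?_) (fun c hc => ?_) fun x hx => rfl
  · have := (Finset.mem_filter.1 hx).2
    exact Finset.mem_filter.2 ⟨Finset.mem_univ _, top_facet_castComp _ _ (by omega) this.1⟩
  · exact castComp_inj (Finset.mem_filter.1 hx).2 (Finset.mem_filter.1 hy).2 h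
  · obtain ⟨l, i, h, rfl⟩ := exists_castComp hN (Finset.mem_filter.1 hc).2
    exact ⟨⟨l, i⟩, Finset.mem_filter.2 ⟨by simp, h⟩, rfl⟩

end Facets

/-! ### The boundary of the top cell of the associahedron. -/

section AssocTop

variable {A : Type v} [AddCommGroup A] [Module k A] (𝒜 : ℤ → Submodule k A) [DirectSum.Decomposition 𝒜]
  {μ : ∀ n : ℕ, MultilinearMap k (fun _ : Fin (n + 1) => A) A}

/-- `assocMap` on all chains of oriented cells. -/
def assocRaw (μ : ∀ n : ℕ, MultilinearMap k (fun _ : Fin (n + 1) => A) A) (n : ℕ) :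
    (LinBr n →₀ ExteriorAlgebra k (Fin (n + 1) → k)) →ₗ[k]
    MultilinearMap k (fun _ : Fin (n + 1) => A) A :=
  Finsupp.lsum k fun b : LinBr n => (b.exists_map 𝒜 μ).choose

theorem assocMap_apply (n d : ℕ) (x : (associahedron k n).chains d) :
    assocMap 𝒜 μ n d x = assocRaw 𝒜 μ n x.1 := rfl

/-- The sign of the forest with one vertex cancels the part of the shift sign that depends on the
arguments. The triangular number left over determines the orientation in which the top cell acts as
`μ`. -/
theorem assocMap_top (μ : ∀ n : ℕ, MultilinearMap k (fun _ : Fin (n + 1) => A) A) (n : ℕ) :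
    assocMap 𝒜 μ (n + 1) n (assocTop k n) = sg (((n + 1) * (n + 2) / 2 : ℕ) : ZMod 2) • μ (n + 1) := by
  refine multilinear_ext 𝒜 fun p a ha => ?_
  have h1 : Forest.treeOp (shifted 𝒜 μ) (Forest.node (Forest.ofLeaves (List.finRange (n + 2))) .nil)
      (topRep_assoc n).nodup (topRep_assoc n).complete (topRep_assoc n).width a =
      shifted 𝒜 μ (n + 1) a := by
    rw [Forest.treeOp_apply, Forest.vals, Forest.vals_ofLeaves, List.headD_cons, ← List.ofFn_eq_map,
      evalList_ofFn]
  rw [assocTop_eq, assocMap_cell_apply 𝒜 μ _ _ ha, multilinear_units_smul, h1, shifted_apply 𝒜 μ ha,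
    sg_smul_smul]
  congr 2
  rw [shiftSign, Forest.sign, Forest.inter, Forest.inter_ofLeaves, Forest.inter, Forest.leaves_node,
    Forest.leaves_ofLeaves, Forest.leaves_nil, List.append_nil, wordSign_finRange, Forest.brs_nil,
    List.length_nil, Nat.cast_zero, mul_zero, add_zero, add_zero, ← add_assoc, add_zero,
    CharTwo.add_self_eq_zero, zero_add]

theorem assocRaw_top (μ : ∀ n : ℕ, MultilinearMap k (fun _ : Fin (n + 1) => A) A) (n : ℕ) :
    assocRaw 𝒜 μ (n + 1) (assocTop k n).1 = sg (((n + 1) * (n + 2) / 2 : ℕ) : ZMod 2) • μ (n + 1) :=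
  assocMap_top 𝒜 μ n

theorem compAux_top (m n : ℕ) (i : Fin (m + 1 + 1)) :
    (assocComp (k := k) i (assocTop k m) (assocTop k n)).1 =
      sg ((m + 1 : ℕ) + (n + 1 : ℕ) * ((m + 1 : ℕ) + i) : ZMod 2) •
      Finsupp.single ((LinBr.top (m + 1)).comp i (LinBr.top (n + 1)))
        (orient (LinearMap.proj ((LinBr.top (m + 1)).comp i (LinBr.top (n + 1))).last)
          [List.finRange (m + 1 + (n + 1) + 1), (List.finRange (n + 1 + 1)).map (inLab (n + 1) i)]) := by
  rw [assocTop_eq, assocTop_eq]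
  refine (compAux_single _ i _ _ _ _).trans ?_
  rw [orient_comp (topRep_assoc n) i
    (ψ := LinearMap.proj ((LinBr.top (m + 1)).comp i (LinBr.top (n + 1))).last), single_units_smul]
  · simp only [Forest.brs_node, Forest.leaves_ofLeaves, Forest.brs_ofLeaves, Forest.brs_nil,
      List.append_nil, List.map_cons, List.map_nil, List.length_singleton]
    have : substWord i (LinBr.top (n + 1)).word (List.finRange (m + 1 + 1)) =
      List.finRange (m + 1 + (n + 1) + 1) := substWord_finRange i
    rw [this]
    congr 2
    push_cast
    ring
  · rw [LinBr.last_comp]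
    exact LinearMap.ext fun t => push_apply_self ((LinBr.top (n + 1)).outGap_inj i) t _
  · exact fun s hs => (LinBr.mem_dir _ (LinBr.push_in_dir i (LinBr.top (m + 1)) (LinBr.top (n + 1)) s hs)).1

theorem triangle_add (m l : ℕ) : (((m + l) * (m + l + 1) / 2 : ℕ) : ZMod 2) =
    ((m * (m + 1) / 2 : ℕ) : ZMod 2) + ((l * (l + 1) / 2 : ℕ) : ZMod 2) + m * l := by
  have h : (m + l) * (m + l + 1) / 2 = m * (m + 1) / 2 + l * (l + 1) / 2 + m * l := by
    obtain ⟨x, hx⟩ := (Nat.even_mul_succ_self m).two_dvd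
    obtain ⟨y, hy⟩ := (Nat.even_mul_succ_self l).two_dvd
    have hx' : m * (m + 1) = 2 * x := hx
    have hy' : l * (l + 1) = 2 * y := hy
    have : (m + l) * (m + l + 1) = 2 * (x + y + m * l) := by linear_combination hx' + hy'
    rw [this, hx', hy', Nat.mul_div_cancel_left _ two_pos, Nat.mul_div_cancel_left _ two_pos,
      Nat.mul_div_cancel_left _ two_pos]
  rw [h]
  push_cast
  ring

theorem plug_units {A : Type v} [AddCommGroup A] [Module k A] {B : Type w} [AddCommGroup B] [Module k B]
    (i : Fin (m + 1)) (u : ℤˣ) (f : MultilinearMap k (fun _ : Fin (m + 1) => A) B)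
    (g : MultilinearMap k (fun _ : Fin (n + 1) => A) A) (a : Fin (m + n + 1) → A) :
    f (plug rfl i (u • g) a) = u • f (plug rfl i g a) := by
  rw [plug_eq, plug_eq, multilinear_units_smul, multilinear_update_units]

/-- The facet is a composite of two top cells. The minus sign comes from the outward conormal;
moving the new gap sum behind the two functionals already present costs nothing. -/
theorem assocRaw_facet (hμ : ∀ n : ℕ, HasDegree 𝒜 𝒜 ((n : ℤ) - 1) (μ n)) {m l N : ℕ} (h : m + l = N)
    (i : Fin (m + 1)) (hm : 0 < m) (hl : 0 < l) {p : Fin (N + 1) → ℤ} {a : Fin (N + 1) → A}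
    (ha : ∀ j, a j ∈ 𝒜 (p j)) :
    assocRaw 𝒜 μ N (Finsupp.single (LinBr.castComp h i) (CliffordAlgebra.contractLeft
      ((associahedron k N).outward (LinBr.castComp h i) (LinBr.top N))
      (orient (LinearMap.proj (LinBr.top N).last) [List.finRange (N + 1)]))) a =
      -(sg (((N * (N + 1) / 2 : ℕ) : ZMod 2) + (m + l * i + (l + 1) * (degBefore i p : ℤ))) •
        μ m (plug h i (μ l) a)) := by
  subst h
  obtain ⟨m, rfl⟩ := Nat.exists_eq_add_one_of_ne_zero hm.ne'
  obtain ⟨l, rfl⟩ := Nat.exists_eq_add_one_of_ne_zero hl.ne'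
  have hout : (associahedron k (m + 1 + (l + 1))).outward (LinBr.castComp rfl i) (LinBr.top _) =
      -gapSum k ((List.finRange (l + 1 + 1)).map (inLab (l + 1) i)) := by
    rw [map_inLab_finRange]
    exact FacePoset.outward_eq (LinBr.castComp_new (h := rfl) i hm hl).1
      (LinBr.castComp_new (h := rfl) i hm hl).2
  have hor : CliffordAlgebra.contractLeft (-gapSum k ((List.finRange (l + 1 + 1)).map (inLab (l + 1) i)))
      (orient (LinearMap.proj (LinBr.top (m + 1 + (l + 1))).last) [List.finRange (m + 1 + (l + 1) + 1)]) =
      -orient (LinearMap.proj (LinBr.top (m + 1 + (l + 1))).last) [List.finRange (m + 1 + (l + 1) + 1),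
        (List.finRange (l + 1 + 1)).map (inLab (l + 1) i)] := by
    rw [map_neg, LinearMap.neg_apply, neg_inj]
    have := contr_swap [gapSum k ((List.finRange (l + 1 + 1)).map (inLab (l + 1) i))]
      [LinearMap.proj (LinBr.top (m + 1 + (l + 1))).last, gapSum k (List.finRange (m + 1 + (l + 1) + 1))]
      (vol k (m + 1 + (l + 1) + 1))
    rw [show sg ((([gapSum k ((List.finRange (l + 1 + 1)).map (inLab (l + 1) i))].length : ℕ) : ZMod 2) *
      (([LinearMap.proj (LinBr.top (m + 1 + (l + 1))).last,
        gapSum k (List.finRange (m + 1 + (l + 1) + 1))].length : ℕ) : ZMod 2)) = 1 from by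
        simp only [List.length_cons, List.length_nil]; decide, one_smul] at this
    exact this
  have hlast : (LinBr.top (m + 1 + (l + 1))).last = ((LinBr.top (m + 1)).comp i (LinBr.top (l + 1))).last := by
    simp only [LinBr.last]
    congr 1
    exact (substWord_finRange i).symm
  have h1 : Finsupp.single (LinBr.castComp rfl i) (CliffordAlgebra.contractLeft
      ((associahedron k (m + 1 + (l + 1))).outward (LinBr.castComp rfl i) (LinBr.top _))
      (orient (LinearMap.proj (LinBr.top (m + 1 + (l + 1))).last)
        [List.finRange (m + 1 + (l + 1) + 1)])) = -(sg ((m + 1 : ℕ) + (l + 1 : ℕ) * ((m + 1 : ℕ) + i) : ZMod 2) •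
        (assocComp (k := k) i (assocTop k m) (assocTop k l)).1) := by
    rw [hout, hor, compAux_top, smul_smul, ← sg_add, CharTwo.add_self_eq_zero, sg_zero, one_smul, hlast,
      ← Finsupp.single_neg]
    rfl
  rw [h1, map_neg, _root_.neg_apply, map_units_int (assocRaw 𝒜 μ _), multilinear_units_smul,
    ← assocMap_apply, assocMap_comp 𝒜 hμ _ _ _ _ _ _ _ _ _ ha, assocMap_top, assocMap_top, plug_units,
    multilinear_units_smul, negOnePow_eq_sg, sg_smul_smul, sg_smul_smul, sg_smul_smul, triangle_add (m + 1)]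
  congr 3
  push_cast
  linear_combination (-((degBefore i p : ℤ) : ZMod 2)) * CharTwo.two_eq_zero (R := ZMod 2)

theorem sum_eq_ends_add {N : ℕ} (hN : 0 < N) {M : Type*} [AddCommMonoid M] (g : Fin (N + 1) → M) :
    ∑ l, g l = g 0 + g (Fin.last N) + ∑ l : Fin (N + 1), if 0 < (l : ℕ) ∧ (l : ℕ) < N then g l else 0 := by
  obtain ⟨N, rfl⟩ := Nat.exists_eq_add_one_of_ne_zero hN.ne'
  rw [Fin.sum_univ_succ, Fin.sum_univ_castSucc, Fin.sum_univ_succ (n := N + 1), Fin.sum_univ_castSucc (n := N)]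
  have : ∀ x : Fin N, (if 0 < (x.castSucc.succ : ℕ) ∧ (x.castSucc.succ : ℕ) < N + 1 then g x.castSucc.succ
      else 0) = g x.castSucc.succ := fun x => if_pos (by simp)
  simp only [this]
  simp only [Fin.val_zero, lt_irrefl, false_and, if_false, Fin.val_last, and_false, zero_add,
    add_zero, Fin.succ_last]
  rw [add_comm (∑ i : Fin N, _)]
  exact (add_assoc _ _ _).symm

theorem plug_unary {A : Type v} [AddCommGroup A] [Module k A] {N : ℕ} (h : N + 0 = N) (i : Fin (N + 1))
    (f : MultilinearMap k (fun _ : Fin 1 => A) A) (a : Fin (N + 1) → A) [DecidableEq (Fin (N + 1))] :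
    plug h i f a = Function.update a i (unary f (a i)) := by
  funext j
  by_cases hj : j = i
  · subst hj
    rw [Function.update_self, plug, if_neg (lt_irrefl _), if_pos rfl]
    change _ = f _
    congr 1
    funext r
    congr 1
    ext
    simp
  · rw [Function.update_of_ne hj, plug, if_neg hj]
    split <;> rfl

theorem unary_plug {A : Type v} [AddCommGroup A] [Module k A] {B : Type w} [AddCommGroup B] [Module k B]
    {N : ℕ} (h : 0 + N = N) (i : Fin (0 + 1))
    (f : MultilinearMap k (fun _ : Fin (0 + 1) => A) B) (g : (Fin (N + 1) → A) → A) (a : Fin (N + 1) → A) :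
    f (plug h i g a) = f fun _ => g a := by
  congr 1
  funext j
  rw [plug, if_neg (by omega), if_pos (Fin.ext (by omega))]
  congr 1
  funext r
  congr 1
  ext
  simp

theorem sum_plug_whole {A : Type v} [AddCommGroup A] [Module k A] {B : Type w} [AddCommGroup B] [Module k B]
    {N r : ℕ} (hr : r = 0) (h : r + N = N) (ε : ℕ → ℤˣ)
    (f : ∀ r, MultilinearMap k (fun _ : Fin (r + 1) => A) B) (g : (Fin (N + 1) → A) → A) (a : Fin (N + 1) → A) :
    ∑ i : Fin (r + 1), ε i • f r (plug h i g a) = ε 0 • f 0 fun _ => g a := by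
  subst hr
  rw [Fin.sum_univ_one, unary_plug h]
  rfl

/-- In the A(∞) relation the terms with both operations of at least two arguments are the facets.
The terms with inner `μ 0` and the one with outer `μ 0` are, up to a common sign, the differential
of `μ (n + 1)`. -/
theorem assocTop_boundaryCompat (hA : IsAInfinityAlgebra 𝒜 μ) (n : ℕ) :
    BoundaryCompat (X := associahedron k (n + 1)) 𝒜 (unary (μ 0)) (unary (μ 0)) (assocRaw 𝒜 μ (n + 1)) n
      (assocTop k n).1 := by
  intro p a ha
  have hrel := hA.relation (n + 1) p a ha
  rw [sum_eq_ends_add (Nat.succ_pos n)] at hrel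
  -- The terms with a unary inner operation: in the exponent the position is counted twice, so only
  -- the degree in front remains, and an overall minus sign.
  have h0 : ∑ i : Fin (n + 1 - (0 : Fin (n + 1 + 1)) + 1), Int.negOnePow ((((0 : Fin (n + 1 + 1)) : ℕ) : ℤ) + 1 + i +
      i * ((((0 : Fin (n + 1 + 1)) : ℕ) : ℤ) + 1) + ((((0 : Fin (n + 1 + 1)) : ℕ) : ℤ) + 1) * degBefore i p) •
      μ (n + 1 - (0 : Fin (n + 1 + 1))) (plug (Nat.sub_add_cancel (Nat.le_of_lt_succ (0 : Fin (n + 1 + 1)).2)) i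
        (μ (0 : Fin (n + 1 + 1))) a) =
      -∑ i : Fin (n + 2), Int.negOnePow (degBefore i p) •
        μ (n + 1) (Function.update a i (unary (μ 0) (a i))) := by
    rw [← Finset.sum_neg_distrib]
    refine Finset.sum_congr rfl fun (i : Fin (n + 1 + 1)) _ => ?_
    change _ • μ (n + 1) (plug (rfl : n + 1 + 0 = n + 1) i (μ 0) a) = _
    rw [plug_unary, ← Units.neg_smul]
    congr 1
    rw [negOnePow_eq_sg, negOnePow_eq_sg, ← neg_one_mul, ← sg_one, ← sg_add]
    congr 1
    change (((0 : ℕ) + 1 + (i : ℕ) + (i : ℕ) * ((0 : ℕ) + 1) + ((0 : ℕ) + 1) * degBefore i p : ℤ) : ZMod 2) = _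
    push_cast
    linear_combination ((i : ℕ) : ZMod 2) * CharTwo.two_eq_zero (R := ZMod 2)
  -- The term with a unary outer operation: the inner operation takes all the arguments, so only the
  -- position 0 occurs.
  have h1 := sum_plug_whole (Nat.sub_self (n + 1)) (Nat.sub_add_cancel le_rfl) (fun i =>
    Int.negOnePow (((n + 1 : ℕ) : ℤ) + 1 + i + i * (((n + 1 : ℕ) : ℤ) + 1) +
      (((n + 1 : ℕ) : ℤ) + 1) * degBefore i p)) μ (μ (n + 1)) a
  have h2 : Int.negOnePow (((n + 1 : ℕ) : ℤ) + 1 + (0 : ℕ) + (0 : ℕ) * (((n + 1 : ℕ) : ℤ) + 1) +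
      (((n + 1 : ℕ) : ℤ) + 1) * degBefore 0 p) = sg n := by
    rw [negOnePow_eq_sg]
    congr 1
    simp only [degBefore, Nat.not_lt_zero, Finset.filter_false, Finset.sum_empty]
    push_cast
    linear_combination CharTwo.two_eq_zero (R := ZMod 2)
  rw [h2] at h1
  have hb : (associahedron k (n + 1)).boundaryAux (assocTop k n).1 =
      ∑ c with (associahedron k (n + 1)).IsFacet c (LinBr.top (n + 1)), Finsupp.single c
        (CliffordAlgebra.contractLeft ((associahedron k (n + 1)).outward c (LinBr.top (n + 1)))
          (orient (LinearMap.proj (LinBr.top (n + 1)).last) [List.finRange (n + 1 + 1)])) := by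
    rw [assocTop_eq, assocCell]
    refine (FacePoset.boundaryAux_single _ _).trans ?_
    simp only [Forest.brs_node, Forest.leaves_ofLeaves, Forest.brs_ofLeaves, Forest.brs_nil, List.append_nil]
  rw [hb, map_sum, sum_apply, sum_top_facets (Nat.succ_pos n)]
  have h3 : ∀ l : Fin (n + 1 + 1), (∑ i : Fin (n + 1 - l + 1), if 0 < (l : ℕ) ∧ (l : ℕ) < n + 1 then
      assocRaw 𝒜 μ (n + 1) (Finsupp.single (LinBr.castComp (Nat.sub_add_cancel (Nat.le_of_lt_succ l.2)) i)
        (CliffordAlgebra.contractLeft ((associahedron k (n + 1)).outward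
          (LinBr.castComp (Nat.sub_add_cancel (Nat.le_of_lt_succ l.2)) i) (LinBr.top (n + 1)))
          (orient (LinearMap.proj (LinBr.top (n + 1)).last) [List.finRange (n + 1 + 1)]))) a else 0) =
      sg (((((n + 1) * (n + 2) / 2 : ℕ) : ZMod 2)) + n + 1) • if 0 < (l : ℕ) ∧ (l : ℕ) < n + 1 then
        ∑ i : Fin (n + 1 - l + 1), Int.negOnePow ((l : ℤ) + 1 + i + i * ((l : ℤ) + 1) +
          ((l : ℤ) + 1) * degBefore i p) • μ (n + 1 - l)
            (plug (Nat.sub_add_cancel (Nat.le_of_lt_succ l.2)) i (μ l) a) else 0 := by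
    intro l
    split_ifs with h
    · rw [Finset.smul_sum]
      refine Finset.sum_congr rfl fun i _ => ?_
      rw [assocRaw_facet 𝒜 hA.degree _ i (by omega) h.1 ha, ← Units.neg_smul, negOnePow_eq_sg, sg_smul_smul]
      congr 1
      rw [← neg_one_mul, ← sg_one, ← sg_add, Nat.cast_sub (by omega)]
      congr 1
      push_cast
      linear_combination (-(l : ZMod 2) - i) * CharTwo.two_eq_zero (R := ZMod 2)
    · simp
  rw [Finset.sum_congr rfl fun l _ => h3 l, ← Finset.smul_sum]
  have h4 := (congrArg₂ (· + ·) (congrArg₂ (· + ·) h0.symm h1.symm) rfl).trans hrel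
  rw [eq_neg_of_add_eq_zero_right h4, assocRaw_top, homDiff]
  simp only [_root_.smul_apply, map_units_int, negOnePow_eq_sg, smul_neg, smul_add, neg_add, neg_neg,
    sg_smul_smul, Finset.smul_sum]
  rw [add_comm, sub_eq_add_neg, ← Finset.sum_neg_distrib]
  simp only [← Units.neg_smul]
  have hneg : ∀ x : ZMod 2, -sg x = sg (1 + x) := by decide
  congr 1
  · rw [hneg]
    congr 2
    linear_combination (1 + n : ZMod 2) * CharTwo.two_eq_zero (R := ZMod 2)
  · refine Finset.sum_congr rfl fun i _ => ?_
    rw [hneg]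
    congr 2
    push_cast
    ring

end AssocTop

end

/-! ### The algebra structure, and uniqueness of morphisms. -/

section

variable {k : Type u} [Field k] {m n : ℕ} {A : Type v} [AddCommGroup A] [Module k A]
  (𝒜 : ℤ → Submodule k A) [DirectSum.Decomposition 𝒜]
  {μ : ∀ n : ℕ, MultilinearMap k (fun _ : Fin (n + 1) => A) A}

theorem unary_mem {𝒜 : ℤ → Submodule k A} (hμ : ∀ n : ℕ, HasDegree 𝒜 𝒜 ((n : ℤ) - 1) (μ n)) (q : ℤ) (x : A)
    (hx : x ∈ 𝒜 q) : unary (μ 0) x ∈ 𝒜 (q - 1) := by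
  have := hμ 0 (fun _ => q) (fun _ => x) fun _ => hx
  have h : ∑ _j : Fin (0 + 1), q + (((0 : ℕ) : ℤ) - 1) = q - 1 := by simp [sub_eq_add_neg]
  rw [h] at this
  exact this

/-- By generation, only the unit and the top cells need to be considered; the unit acts as the
identity, which is a cycle. -/
theorem assocMap_boundaryCompat (hA : IsAInfinityAlgebra 𝒜 μ) (n d : ℕ) (x : (associahedron k n).chains d) :
    BoundaryCompat (X := associahedron k n) 𝒜 (unary (μ 0)) (unary (μ 0)) (assocRaw 𝒜 μ n) d x.1 := by
  refine assoc_generation (P := fun n d x => BoundaryCompat (X := associahedron k n) 𝒜 (unary (μ 0))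
    (unary (μ 0)) (assocRaw 𝒜 μ n) d x.1) (fun n d => BoundaryCompat.zero) (fun n d x y hx hy => hx.add hy)
    (fun n d c x hx => hx.smul c) ?_ (assocTop_boundaryCompat 𝒜 hA) (fun n d σ x hx => ?_)
    (fun m n d e i x y hx hy => ?_) n d x
  · intro p a ha
    have h1 : ∀ a, assocRaw 𝒜 μ 0 (assocUnit k).1 a = a 0 := assocMap_unit 𝒜 μ
    rw [FacePoset.boundaryAux_eq_zero (assocUnit k).2, homDiff, map_zero, h1]
    simp [h1, degBefore]
  · exact BoundaryCompat.relabel (unary_mem hA.degree) (assocRelabelFacets σ)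
      (fun e x p a ha => assocMap_equivariant 𝒜 μ n e σ x p a ha) hx
  · exact BoundaryCompat.comp (unary_mem hA.degree) (assocCompFacets i)
      (fun d e x y p a ha => assocMap_comp 𝒜 hA.degree m n d e i x y p a ha)
      (assocMap_degree 𝒜 hA.degree n e y) hx hy

theorem assocMap_isOperadAlgebra (hA : IsAInfinityAlgebra 𝒜 μ) :
    IsOperadAlgebra 𝒜 (unary (μ 0)) (assocMap 𝒜 μ) where
  degree := assocMap_degree 𝒜 hA.degree
  boundary_zero n x p a ha := by
    have := assocMap_boundaryCompat 𝒜 hA n 0 x p a ha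
    rw [FacePoset.boundaryAux_eq_zero x.2, map_zero] at this
    exact this.symm
  boundary_succ n d x p a ha := assocMap_boundaryCompat 𝒜 hA n (d + 1) x p a ha
  equivariant := assocMap_equivariant 𝒜 μ
  unit := assocMap_unit 𝒜 μ
  comp := assocMap_comp 𝒜 hA.degree

/-- Operad algebras that agree on the top cells agree. -/
theorem IsOperadAlgebra.ext {𝒜 : ℤ → Submodule k A} [DirectSum.Decomposition 𝒜] {D : A →ₗ[k] A}
    {α β : ∀ n d : ℕ, (associahedron k n).chains d →ₗ[k] MultilinearMap k (fun _ : Fin (n + 1) => A) A}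
    (hα : IsOperadAlgebra 𝒜 D α) (hβ : IsOperadAlgebra 𝒜 D β)
    (h : ∀ n, α (n + 1) n (assocTop k n) = β (n + 1) n (assocTop k n)) : α = β := by
  funext n d
  refine LinearMap.ext fun x => ?_
  refine assoc_generation (P := fun n d x => α n d x = β n d x) (fun n d => by rw [map_zero, map_zero])
    (fun n d x y hx hy => by rw [map_add, map_add, hx, hy])
    (fun n d c x hx => by rw [map_smul, map_smul, hx]) ?_ h (fun n d σ x hx => ?_)
    (fun m n d e i x y hx hy => ?_) n d x
  · exact MultilinearMap.ext fun a => by rw [hα.unit, hβ.unit]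
  · exact multilinear_ext 𝒜 fun p a ha => by
      rw [hα.equivariant n d σ x p a ha, hβ.equivariant n d σ x p a ha, hx]
  · exact multilinear_ext 𝒜 fun p a ha => by
      rw [hα.comp m n d e i x y p a ha, hβ.comp m n d e i x y p a ha, hx, hy]

/-- Morphisms of right modules that agree on the top cells agree. -/
theorem cyclo_module_ext {W : Type w} [AddCommGroup W] [Module k W]
    {α : ∀ n d : ℕ, (associahedron k n).chains d →ₗ[k] MultilinearMap k (fun _ : Fin (n + 1) => A) A}
    {s t : ∀ n d : ℕ, (cyclohedron k n).chains d →ₗ[k] MultilinearMap k (fun _ : Fin (n + 1) => A) W}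
    (hs : ∀ (n d : ℕ) (σ : Equiv.Perm (Fin (n + 1))) x (p : Fin (n + 1) → ℤ) a, (∀ j, a j ∈ 𝒜 (p j)) →
      s n d (cycloRelabel d σ x) a = koszulSign σ⁻¹ p • s n d x (a ∘ ⇑(σ⁻¹)))
    (ht : ∀ (n d : ℕ) (σ : Equiv.Perm (Fin (n + 1))) x (p : Fin (n + 1) → ℤ) a, (∀ j, a j ∈ 𝒜 (p j)) →
      t n d (cycloRelabel d σ x) a = koszulSign σ⁻¹ p • t n d x (a ∘ ⇑(σ⁻¹)))
    (hs' : ∀ (m n d e : ℕ) (i : Fin (m + 1)) (x : (cyclohedron k m).chains d)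
      (y : (associahedron k n).chains e) (p : Fin (m + n + 1) → ℤ) a, (∀ j, a j ∈ 𝒜 (p j)) →
      s (m + n) (d + e) (cycloComp i x y) a =
        Int.negOnePow (e * degBefore i p) • s m d x (plug rfl i (α n e y) a))
    (ht' : ∀ (m n d e : ℕ) (i : Fin (m + 1)) (x : (cyclohedron k m).chains d)
      (y : (associahedron k n).chains e) (p : Fin (m + n + 1) → ℤ) a, (∀ j, a j ∈ 𝒜 (p j)) →
      t (m + n) (d + e) (cycloComp i x y) a =
        Int.negOnePow (e * degBefore i p) • t m d x (plug rfl i (α n e y) a))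
    (h : ∀ n, s n n (cycloTop k n) = t n n (cycloTop k n)) : s = t := by
  funext n d
  refine LinearMap.ext fun x => ?_
  refine cyclo_generation (P := fun n d x => s n d x = t n d x) (fun n d => by rw [map_zero, map_zero])
    (fun n d x y hx hy => by rw [map_add, map_add, hx, hy])
    (fun n d c x hx => by rw [map_smul, map_smul, hx]) h (fun n d σ x hx => ?_)
    (fun m n d e i x y hx => ?_) n d x
  · exact multilinear_ext 𝒜 fun p a ha => by rw [hs n d σ x p a ha, ht n d σ x p a ha, hx]
  · exact multilinear_ext 𝒜 fun p a ha => by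
      rw [hs' m n d e i x y p a ha, ht' m n d e i x y p a ha, hx]

end

section

variable {k : Type u} [Field k] {m n : ℕ}

/-! ### Cyclic permutations as rotations of the standard word. -/

section Rotations

theorem map_finRotate_pow (r : ℕ) :
    (List.finRange (n + 1)).map (finRotate (n + 1) ^ r : Equiv.Perm (Fin (n + 1))) =
      (List.finRange (n + 1)).rotate r := by
  induction r with
  | zero => simp
  | succ r ih =>
    have h1 : (List.finRange (n + 1)).map (finRotate (n + 1)) = (List.finRange (n + 1)).rotate 1 := by
      rw [map_finRotate, List.finRange_succ, List.rotate_cons_succ, List.rotate_zero]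
    rw [pow_succ, Equiv.Perm.coe_mul, ← List.map_map, h1, List.map_rotate, ih, List.rotate_rotate]

theorem mem_zpowers_finRotate {σ : Equiv.Perm (Fin (n + 1))} :
    σ ∈ Subgroup.zpowers (finRotate (n + 1)) ↔
      List.finRange (n + 1) ~r (List.finRange (n + 1)).map σ := by
  constructor
  · intro h
    obtain ⟨r, rfl⟩ := (Submonoid.mem_powers_iff _ _).1 (mem_powers_iff_mem_zpowers.2 h)
    exact ⟨r, (map_finRotate_pow r).symm⟩
  · rintro ⟨r, h⟩
    rw [← map_finRotate_pow r, List.map_inj_left] at h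
    rw [← Equiv.ext (f := finRotate (n + 1) ^ r) (g := σ) fun x => h x (List.mem_finRange x)]
    exact Subgroup.npow_mem_zpowers _ _

/-- A rotation of a word without repetitions is determined by its first letter. Rotations can thus
index the first letters of cyclic intervals. -/
theorem zpowers_finRotate_ext {σ τ : Equiv.Perm (Fin (n + 1))}
    (hσ : σ ∈ Subgroup.zpowers (finRotate (n + 1))) (hτ : τ ∈ Subgroup.zpowers (finRotate (n + 1)))
    (h : σ 0 = τ 0) : σ = τ := by
  have h1 := (mem_zpowers_finRotate.1 hσ).symm.trans (mem_zpowers_finRotate.1 hτ)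
  have h2 := (List.nodup_finRange (n + 1)).map σ.injective
  rw [List.finRange_succ, List.map_cons] at h2
  rw [List.finRange_succ, List.map_cons, List.map_cons, ← h] at h1
  have h3 := eq_of_isRotated_cons h2 h1
  have h4 : (List.finRange (n + 1)).map σ = (List.finRange (n + 1)).map τ := by
    rw [List.finRange_succ, List.map_cons, List.map_cons, h3, h]
  exact Equiv.ext fun x => List.map_inj_left.1 h4 x (List.mem_finRange x)

theorem exists_zpowers_finRotate (i : Fin (n + 1)) :
    ∃ σ ∈ Subgroup.zpowers (finRotate (n + 1)), σ 0 = i := by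
  refine ⟨finRotate (n + 1) ^ (i : ℕ), Subgroup.npow_mem_zpowers _ _, ?_⟩
  have h := congrArg (fun L => L[0]?) (map_finRotate_pow (n := n) i)
  simp only [List.getElem?_map] at h
  rw [List.getElem?_rotate (by simp)] at h
  simp [Nat.mod_eq_of_lt i.2, List.finRange_succ] at h
  rw [← List.finRange_succ, List.getElem?_eq_getElem (by simpa using i.is_le)] at h
  simpa using h

end Rotations

/-! ### Facets of the top cell of the cyclohedron. -/

section Facets

/-- The face of the cyclohedron with one bracket, around its first `l + 1` letters. -/
def CycBr.castComp {m l N : ℕ} (h : m + l = N) : CycBr N :=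
  h ▸ (CycBr.top m).comp 0 (LinBr.top l)

theorem CycBr.castComp_word {m l N : ℕ} (h : m + l = N) :
    (CycBr.castComp h).word = (List.finRange (N + 1) : List (Fin (N + 1))) := by
  subst h
  exact congrArg _ (substWord_finRange 0)

theorem CycBr.castComp_br {m l N : ℕ} (h : m + l = N) (hl : 0 < l) :
    (CycBr.castComp h).br = {(List.finRange (N + 1)).take (l + 1)} := by
  subst h
  change brComp 0 (CycBr.top m).br (LinBr.top l) = _
  rw [brComp]
  simp only [CycBr.top, LinBr.top, if_pos hl, Finset.image_singleton, map_inLab_finRange,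
    Finset.image_empty, Finset.empty_union]
  rfl

theorem CycBr.castComp_relabel_word {m l N : ℕ} (h : m + l = N) {σ : Equiv.Perm (Fin (N + 1))}
    (hσ : σ ∈ Subgroup.zpowers (finRotate (N + 1))) :
    ((CycBr.castComp h).relabel σ⁻¹).word = (CycBr.top N).word := by
  change (CycBr.castComp h).word.map ⇑(σ⁻¹⁻¹) = _
  rw [castComp_word, inv_inv, Cycle.map_coe]
  exact Cycle.coe_eq_coe.2 (mem_zpowers_finRotate.1 hσ).symm

theorem CycBr.castComp_relabel_br {m l N : ℕ} (h : m + l = N) (hl : 0 < l) (σ : Equiv.Perm (Fin (N + 1))) :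
    ((CycBr.castComp h).relabel σ⁻¹).br = insert (((List.finRange (N + 1)).take (l + 1)).map σ) (CycBr.top N).br := by
  change relabelBr σ⁻¹ (CycBr.castComp h).br = _
  rw [castComp_br h hl, relabelBr, Finset.image_singleton, inv_inv]
  rfl

theorem top_facet_castComp_relabel {m l N : ℕ} (h : m + l = N) (hl : 0 < l) {σ : Equiv.Perm (Fin (N + 1))}
    (hσ : σ ∈ Subgroup.zpowers (finRotate (N + 1))) :
    (cyclohedron k N).IsFacet ((CycBr.castComp h).relabel σ⁻¹) (CycBr.top N) :=
  cyclo_facet_iff.2 ⟨CycBr.castComp_relabel_word h hσ, _, by simp [CycBr.top],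
    CycBr.castComp_relabel_br h hl σ⟩

/-- Rotating the cyclic word so that the bracket comes first gives `σ`; the length of the bracket
gives `l`. -/
theorem exists_castComp_relabel {N : ℕ} {c : CycBr N} (hc : (cyclohedron k N).IsFacet c (CycBr.top N)) :
    ∃ σ ∈ Subgroup.zpowers (finRotate (N + 1)), ∃ l : Fin (N + 1), 0 < (l : ℕ) ∧
      (CycBr.castComp (Nat.sub_add_cancel (Nat.le_of_lt_succ l.2))).relabel σ⁻¹ = c := by
  obtain ⟨h1, L, -, h3⟩ := cyclo_facet_iff.1 hc
  have hL : L ∈ c.br := h3 ▸ Finset.mem_insert_self _ _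
  obtain ⟨w, hw, s, t, hst⟩ := c.br_infix L hL
  have h4 := c.two_le L hL
  have hw' : List.finRange (N + 1) ~r L ++ (t ++ s) := by
    refine (Cycle.coe_eq_coe.1 (hw.trans h1)).symm.trans ?_
    rw [← hst, List.append_assoc, ← List.append_assoc L]
    exact List.isRotated_append
  obtain ⟨σ, hσ⟩ := exists_perm_of_word (hw'.nodup_iff.1 (List.nodup_finRange _))
    fun x => hw'.mem_iff.1 (List.mem_finRange x)
  have hlen := hw'.perm.length_eq
  simp at hlen
  have hz := mem_zpowers_finRotate.2 (hσ ▸ hw')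
  refine ⟨σ, hz, ⟨L.length - 1, by omega⟩, by simp only; omega, CycBr.ext ?_ ?_⟩
  · rw [CycBr.castComp_relabel_word _ hz, h1]
  · rw [CycBr.castComp_relabel_br _ (by simp only; omega), h3]
    congr 1
    simp only
    rw [Nat.sub_add_cancel (by omega), List.map_take, hσ, List.take_left]

theorem castComp_relabel_inj {N : ℕ} {l l' : Fin (N + 1)} (hl : 0 < (l : ℕ)) (hl' : 0 < (l' : ℕ))
    {σ τ : Equiv.Perm (Fin (N + 1))} (hσ : σ ∈ Subgroup.zpowers (finRotate (N + 1)))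
    (hτ : τ ∈ Subgroup.zpowers (finRotate (N + 1)))
    (h : (CycBr.castComp (Nat.sub_add_cancel (Nat.le_of_lt_succ l.2))).relabel σ⁻¹ =
      (CycBr.castComp (Nat.sub_add_cancel (Nat.le_of_lt_succ l'.2))).relabel τ⁻¹) : σ = τ ∧ l = l' := by
  have hb := congrArg CycBr.br h
  rw [CycBr.castComp_relabel_br _ hl, CycBr.castComp_relabel_br _ hl'] at hb
  have hb : ((List.finRange (N + 1)).take (l + 1)).map σ = ((List.finRange (N + 1)).take (l' + 1)).map τ :=
    Finset.singleton_injective hb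
  have h1 := congrArg List.length hb
  simp at h1
  have := l.2
  have := l'.2
  refine ⟨zpowers_finRotate_ext hσ hτ ?_, Fin.ext (by omega)⟩
  rw [List.finRange_succ] at hb
  exact (List.cons.inj hb).1

/-- A facet has one bracket, a cyclic interval given by its first letter, that is by a rotation, and
its length. Only `l = 0` is excluded: brackets around all letters are facets, one for each place to
cut the cyclic word, because nothing is required of a cyclic bracketing to begin with. -/
theorem sum_cyclo_top_facets {N : ℕ} {M : Type*} [AddCommMonoid M] (f : CycBr N → M) :
    ∑ c with (cyclohedron k N).IsFacet c (CycBr.top N), f c =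
      ∑ σ with σ ∈ Subgroup.zpowers (finRotate (N + 1)), ∑ l : Fin (N + 1), if 0 < (l : ℕ) then
        f ((CycBr.castComp (Nat.sub_add_cancel (Nat.le_of_lt_succ l.2))).relabel σ⁻¹) else 0 := by
  rw [← Finset.sum_product', ← Finset.sum_filter]
  symm
  refine Finset.sum_bij (fun x _ => (CycBr.castComp (Nat.sub_add_cancel (Nat.le_of_lt_succ x.2.2))).relabel x.1⁻¹)
    (fun x hx => ?_) (fun x hx y hy h => ?_) (fun c hc => ?_) fun x hx => rfl
  · simp only [Finset.mem_filter, Finset.mem_product, Finset.mem_univ, true_and, and_true] at hx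
    exact Finset.mem_filter.2 ⟨Finset.mem_univ _, top_facet_castComp_relabel _ hx.2 hx.1⟩
  · simp only [Finset.mem_filter, Finset.mem_product, Finset.mem_univ, true_and, and_true] at hx hy
    have := castComp_relabel_inj hx.2 hy.2 hx.1 hy.1 h
    exact Prod.ext this.1 this.2
  · obtain ⟨σ, hσ, l, hl, rfl⟩ := exists_castComp_relabel (Finset.mem_filter.1 hc).2
    exact ⟨⟨σ, l⟩, by simpa using ⟨hσ, hl⟩, rfl⟩

end Facets

end

/-! ### The boundary of the top cell of the cyclohedron. -/

section

variable {k : Type u} [Field k] {m n : ℕ} {A : Type v} [AddCommGroup A] [Module k A]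
  {W : Type w} [AddCommGroup W] [Module k W]
  (𝒜 : ℤ → Submodule k A) [DirectSum.Decomposition 𝒜]
  {μ : ∀ n : ℕ, MultilinearMap k (fun _ : Fin (n + 1) => A) A}
  {T : ∀ n : ℕ, MultilinearMap k (fun _ : Fin (n + 1) => A) W}
  (hμ : ∀ n : ℕ, HasDegree 𝒜 𝒜 ((n : ℤ) - 1) (μ n))
  (hT : ∀ (n : ℕ) (p : Fin (n + 1) → ℤ) a, (∀ j, a j ∈ 𝒜 (p j)) →
    T n a = chi (finRotate (n + 1)) p • T n (a ∘ finRotate (n + 1)))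

/-- `cycloMap` on all chains of oriented cells. -/
def cycloRaw (hμ : ∀ n : ℕ, HasDegree 𝒜 𝒜 ((n : ℤ) - 1) (μ n))
    (hT : ∀ (n : ℕ) (p : Fin (n + 1) → ℤ) a, (∀ j, a j ∈ 𝒜 (p j)) →
      T n a = chi (finRotate (n + 1)) p • T n (a ∘ finRotate (n + 1))) (n : ℕ) :
    (CycBr n →₀ ExteriorAlgebra k (Fin (n + 1) → k)) →ₗ[k]
    MultilinearMap k (fun _ : Fin (n + 1) => A) W :=
  Finsupp.lsum k fun b : CycBr n => (b.exists_map 𝒜 hμ hT).choose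

theorem cycloMap_apply (n d : ℕ) (x : (cyclohedron k n).chains d) :
    cycloMap 𝒜 hμ hT n d x = cycloRaw 𝒜 hμ hT n x.1 := rfl

theorem cycloMap_topCell (n : ℕ) : cycloMap 𝒜 hμ hT n n (cycloCell (topRep_cyclo n) (by simp)) =
    sg ((n * (n + 1) / 2 : ℕ) : ZMod 2) • T n := by
  refine multilinear_ext 𝒜 fun p a ha => ?_
  have h1 : Forest.forestOp (shifted 𝒜 μ) (shifted 𝒜 T) (Forest.ofLeaves (List.finRange (n + 1)))
      (topRep_cyclo n).nodup (topRep_cyclo n).complete a = shifted 𝒜 T n a := by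
    rw [Forest.forestOp_apply, Forest.vals_ofLeaves, ← List.ofFn_eq_map, evalList_ofFn]
  rw [cycloMap_cell_apply 𝒜 hμ hT _ _ ha, h1, shifted_apply 𝒜 T ha, sg_smul_smul]
  rw [_root_.smul_apply]
  congr 2
  rw [shiftSign, Forest.sign, Forest.inter_ofLeaves, Forest.leaves_ofLeaves, wordSign_finRange,
    add_zero, ← add_assoc, CharTwo.add_self_eq_zero, zero_add]

theorem cycloMap_top (n : ℕ) : cycloMap 𝒜 hμ hT n n (cycloTop k n) =
    sg ((n : ZMod 2) + ((n * (n + 1) / 2 : ℕ) : ZMod 2)) • T n := by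
  rw [cycloTop_eq, chains_linear_units_smul, cycloMap_topCell, sg_smul_smul]

theorem compAux_cyclo_top (m l : ℕ) :
    (cycloComp (k := k) (0 : Fin (m + 1)) (cycloCell (d := m) (topRep_cyclo m) (by simp)) (assocTop k l)).1 =
      sg ((m : ZMod 2) + (l + 1 : ℕ) * m) •
      Finsupp.single ((CycBr.top m).comp 0 (LinBr.top (l + 1)))
        (orient (total k (m + (l + 1))) [(List.finRange (l + 1 + 1)).map (inLab (l + 1) 0)]) := by
  rw [assocTop_eq]
  refine (compAux_single _ _ _ _ _ _).trans ?_
  rw [orient_comp (topRep_assoc l) _ (ψ := total k (m + (l + 1))), single_units_smul]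
  · simp only [Forest.brs_node, Forest.leaves_ofLeaves, Forest.brs_ofLeaves, Forest.brs_nil,
      List.append_nil, List.map_cons, List.map_nil, List.length_singleton, List.nil_append]
    congr 2
    simp
  · exact LinearMap.ext fun t => by
      rw [LinearMap.comp_apply, total_apply, total_apply, sum_push]
  · exact fun s hs => by
      have := ((CycBr.mem_dir _).1 (CycBr.push_in_dir 0 (CycBr.top m) (LinBr.top (l + 1)) s hs)).1
      rwa [total_apply]

/-- The facet is a rotated composite at the letter 0 of two top cells. Relabelling the orientation
contributes the sign of `σ` and equivariance its Koszul sign, together `chi`. The minus of the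
outward conormal is consumed by moving the new gap sum behind the functional `total`. -/
theorem cycloRaw_facet {m l N : ℕ} (h : m + l = N) (hl : 0 < l)
    {σ : Equiv.Perm (Fin (N + 1))} (hσ : σ ∈ Subgroup.zpowers (finRotate (N + 1)))
    {p : Fin (N + 1) → ℤ} {a : Fin (N + 1) → A} (ha : ∀ j, a j ∈ 𝒜 (p j)) :
    cycloRaw 𝒜 hμ hT N (Finsupp.single ((CycBr.castComp h).relabel σ⁻¹) (CliffordAlgebra.contractLeft
      ((cyclohedron k N).outward ((CycBr.castComp h).relabel σ⁻¹) (CycBr.top N))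
      (orient (total k N) []))) a =
      (sg (((N * (N + 1) / 2 : ℕ) : ZMod 2) + m) * chi σ p) • T m (plug h 0 (μ l) (a ∘ σ)) := by
  subst h
  obtain ⟨l, rfl⟩ := Nat.exists_eq_add_one_of_ne_zero hl.ne'
  have hL : (List.finRange (m + (l + 1) + 1)).take (l + 1 + 1) =
      (List.finRange (l + 1 + 1)).map (inLab (l + 1) (0 : Fin (m + 1))) := by
    rw [map_inLab_finRange]
    rfl
  have hout : (cyclohedron k (m + (l + 1))).outward ((CycBr.castComp rfl).relabel σ⁻¹) (CycBr.top _) =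
      -gapSum k (((List.finRange (l + 1 + 1)).map (inLab (l + 1) (0 : Fin (m + 1)))).map σ) := by
    rw [← hL]
    exact FacePoset.outward_eq (Finset.notMem_empty _) (CycBr.castComp_relabel_br rfl hl σ)
  have hor : CliffordAlgebra.contractLeft
      (-gapSum k (((List.finRange (l + 1 + 1)).map (inLab (l + 1) (0 : Fin (m + 1)))).map σ))
      (orient (total k (m + (l + 1))) []) = orient (total k (m + (l + 1)))
        [((List.finRange (l + 1 + 1)).map (inLab (l + 1) (0 : Fin (m + 1)))).map σ] := by
    rw [map_neg, LinearMap.neg_apply]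
    exact neg_eq_iff_eq_neg.2 (CliffordAlgebra.contractLeft_comm _ _ _)
  have h1 : (Finsupp.single ((CycBr.castComp rfl).relabel σ⁻¹) (orient (total k (m + (l + 1)))
      [((List.finRange (l + 1 + 1)).map (inLab (l + 1) (0 : Fin (m + 1)))).map σ]) :
        CycBr (m + (l + 1)) →₀ ExteriorAlgebra k (Fin (m + (l + 1) + 1) → k)) =
      (sg ((m : ZMod 2) + (l + 1 : ℕ) * m) * Equiv.Perm.sign σ) •
        (cycloRelabel (k := k) (m + l) σ⁻¹ (cycloComp (0 : Fin (m + 1))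
          (cycloCell (d := m) (topRep_cyclo m) (by simp)) (assocTop k l))).1 := by
    change _ = _ • relabelAux (cyclohedron k (m + (l + 1))) (fun b => CycBr.relabel b σ⁻¹) σ⁻¹
      (cycloComp (k := k) (0 : Fin (m + 1)) (cycloCell (d := m) (topRep_cyclo m) (by simp)) (assocTop k l)).1
    rw [compAux_cyclo_top]
    have h2 := relabelAux_single (X := cyclohedron k (m + (l + 1))) (fun b => CycBr.relabel b σ⁻¹) σ⁻¹
      ((CycBr.top m).comp 0 (LinBr.top (l + 1)))
      (orient (total k (m + (l + 1))) [(List.finRange (l + 1 + 1)).map (inLab (l + 1) 0)])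
    rw [map_units_int (relabelAux (cyclohedron k (m + (l + 1))) (fun b => CycBr.relabel b σ⁻¹) σ⁻¹)]
    refine Eq.trans ?_ (congrArg _ (congrArg _ h2)).symm
    rw [map_push_orient (φ' := total k (m + (l + 1))), single_units_smul, smul_smul, smul_smul]
    · rw [inv_inv, mul_assoc, mul_assoc, mul_comm (Equiv.Perm.sign σ), mul_assoc, Int.units_mul_self, mul_one,
        sg_mul_self, one_smul]
      rfl
    · exact LinearMap.ext fun t => by
        rw [LinearMap.comp_apply, total_apply, total_apply, sum_push]
  rw [hout, hor, h1, map_units_int (cycloRaw 𝒜 hμ hT _), multilinear_units_smul,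
    ← cycloMap_apply, cycloMap_equivariant 𝒜 hμ hT _ _ _ _ p a ha, inv_inv,
    cycloMap_comp 𝒜 hμ hT _ _ _ _ _ _ _ (p ∘ σ) (a ∘ σ) fun j => ha _, assocMap_top, cycloMap_topCell, plug_units,
    multilinear_units_smul, negOnePow_eq_sg, sg_smul_smul, sg_smul_smul, chi, triangle_add m, smul_smul, smul_smul]
  congr 1
  have h2 : sg (((m * (m + 1) / 2 : ℕ) : ZMod 2) + (((l + 1) * (l + 1 + 1) / 2 : ℕ) : ZMod 2) +
      (m : ZMod 2) * ((l + 1 : ℕ) : ZMod 2) + m) = sg ((m : ZMod 2) + ((l + 1 : ℕ) : ZMod 2) * m) *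
      sg (((l * degBefore ((0 : Fin (m + 1)) : ℕ) (p ∘ σ) : ℤ) : ZMod 2) + (((l + 1) * (l + 2) / 2 : ℕ) : ZMod 2) +
        ((m * (m + 1) / 2 : ℕ) : ZMod 2)) := by
    have h0 : degBefore ((0 : Fin (m + 1)) : ℕ) (p ∘ σ) = 0 := by simp [degBefore]
    rw [← sg_add, h0]
    congr 1
    push_cast
    ring
  rw [h2]
  ac_rfl

/-- Each argument is brought to the front by exactly one rotation. Cyclic symmetry moves it back,
and since `D` lowers its degree by one, the sign of the degrees in front of it remains. -/
theorem sum_rotations_update {𝒜 : ℤ → Submodule k A} {T : MultilinearMap k (fun _ : Fin (n + 1) => A) W} {D : A →ₗ[k] A}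
    (hD : ∀ q, ∀ x ∈ 𝒜 q, D x ∈ 𝒜 (q - 1))
    (hT : ∀ σ ∈ Subgroup.zpowers (finRotate (n + 1)),
      ∀ (p : Fin (n + 1) → ℤ) a, (∀ j, a j ∈ 𝒜 (p j)) → T a = chi σ p • T (a ∘ σ))
    {p : Fin (n + 1) → ℤ} {a : Fin (n + 1) → A} (ha : ∀ j, a j ∈ 𝒜 (p j)) :
    ∑ σ with σ ∈ Subgroup.zpowers (finRotate (n + 1)),
        chi σ p • T (Function.update (a ∘ σ) 0 (D ((a ∘ σ) 0))) =
      ∑ i : Fin (n + 1), Int.negOnePow (degBefore i p) • T (Function.update a i (D (a i))) := by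
  refine Finset.sum_bij (fun σ _ => σ 0) (fun _ _ => Finset.mem_univ _)
    (fun σ hσ τ hτ h => zpowers_finRotate_ext (Finset.mem_filter.1 hσ).2 (Finset.mem_filter.1 hτ).2 h)
    (fun i _ => ?_) fun σ hσ => ?_
  · obtain ⟨σ, hσ, h⟩ := exists_zpowers_finRotate i
    exact ⟨σ, Finset.mem_filter.2 ⟨Finset.mem_univ _, hσ⟩, h⟩
  · rw [hT σ (Finset.mem_filter.1 hσ).2 (Function.update p (σ 0) (p (σ 0) - 1)) _
      (fun j => update_mem ha (σ 0) (hD _ _ (ha (σ 0))) j), update_comp_of_injective a σ.injective, chi, chi, koszulSign_update,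
      smul_smul, negOnePow_eq_sg]
    congr 1
    have h0 : degBefore ((0 : Fin (n + 1)) : ℕ) (p ∘ σ) = 0 := by simp [degBefore]
    rw [h0, zero_add, mul_left_comm (sg _), mul_left_comm (sg _), sg_mul_self, mul_one]

/-- In condition (ii), the terms with `l > 0` are the facets, and by `sum_rotations_update` the
terms with `l = 0` are the part of the differential of `T n` that involves `μ 0`. The triangular
sign is common to both sides and cancels, so the two equations say the same. -/
theorem cycloRaw_topCell_iff (hcyc : ∀ (n : ℕ), ∀ σ ∈ Subgroup.zpowers (finRotate (n + 1)),
      ∀ (p : Fin (n + 1) → ℤ) a, (∀ j, a j ∈ 𝒜 (p j)) → T n a = chi σ p • T n (a ∘ σ))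
    (δ : W →ₗ[k] W) {p : Fin (n + 1) → ℤ} {a : Fin (n + 1) → A} (ha : ∀ j, a j ∈ 𝒜 (p j)) :
    cycloRaw 𝒜 hμ hT n ((cyclohedron k n).boundaryAux
        (cycloCell (k := k) (d := n) (topRep_cyclo n) (by simp)).1) a =
      homDiff δ (unary (μ 0)) n (cycloRaw 𝒜 hμ hT n (cycloCell (d := n) (topRep_cyclo n) (by simp)).1) p a ↔
    δ (T n a) = ∑ σ with σ ∈ Subgroup.zpowers (finRotate (n + 1)), chi σ p •
      ∑ l : Fin (n + 1), Int.negOnePow (((l : ℤ) + 1) + ((n : ℤ) + 1)) •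
        T (n - l) (plug (Nat.sub_add_cancel (Nat.le_of_lt_succ l.2)) 0 (μ l) (a ∘ σ)) := by
  have hb : (cyclohedron k n).boundaryAux (cycloCell (k := k) (d := n) (topRep_cyclo n) (by simp)).1 =
      ∑ c with (cyclohedron k n).IsFacet c (CycBr.top n), Finsupp.single c
        (CliffordAlgebra.contractLeft ((cyclohedron k n).outward c (CycBr.top n)) (orient (total k n) [])) := by
    refine (FacePoset.boundaryAux_single _ _).trans ?_
    simp only [Forest.brs_ofLeaves]
  have ht : cycloRaw 𝒜 hμ hT n (cycloCell (d := n) (topRep_cyclo n) (by simp)).1 = _ :=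
    cycloMap_topCell 𝒜 hμ hT n
  have hl : ∀ (σ : Equiv.Perm (Fin (n + 1))), σ ∈ Subgroup.zpowers (finRotate (n + 1)) → ∀ l : Fin (n + 1),
      (if 0 < (l : ℕ) then
        cycloRaw 𝒜 hμ hT n (Finsupp.single
          ((CycBr.castComp (Nat.sub_add_cancel (Nat.le_of_lt_succ l.2))).relabel σ⁻¹)
          (CliffordAlgebra.contractLeft ((cyclohedron k n).outward
            ((CycBr.castComp (Nat.sub_add_cancel (Nat.le_of_lt_succ l.2))).relabel σ⁻¹) (CycBr.top n))
          (orient (total k n) []))) a else 0) =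
      sg ((n * (n + 1) / 2 : ℕ) : ZMod 2) • chi σ p • if 0 < (l : ℕ) then
        Int.negOnePow (((l : ℤ) + 1) + ((n : ℤ) + 1)) • T (n - l)
          (plug (Nat.sub_add_cancel (Nat.le_of_lt_succ l.2)) 0 (μ l) (a ∘ σ)) else 0 := by
    intro σ hσ l
    split_ifs with h
    · rw [cycloRaw_facet 𝒜 hμ hT _ h hσ ha, negOnePow_eq_sg, smul_smul, smul_smul]
      congr 1
      rw [sg_add, mul_assoc, mul_assoc, mul_comm (chi σ p)]
      congr 3
      have := l.2
      rw [Nat.cast_sub (by omega)]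
      push_cast
      linear_combination (-1 - l : ZMod 2) * CharTwo.two_eq_zero (R := ZMod 2)
    · simp
  have h0 : ∀ (σ : Equiv.Perm (Fin (n + 1))), ∑ l : Fin (n + 1), Int.negOnePow (((l : ℤ) + 1) + ((n : ℤ) + 1)) •
        T (n - l) (plug (Nat.sub_add_cancel (Nat.le_of_lt_succ l.2)) 0 (μ l) (a ∘ σ)) =
      sg n • T n (Function.update (a ∘ σ) 0 (unary (μ 0) ((a ∘ σ) 0))) + ∑ l : Fin (n + 1), if 0 < (l : ℕ) then
        Int.negOnePow (((l : ℤ) + 1) + ((n : ℤ) + 1)) • T (n - l)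
          (plug (Nat.sub_add_cancel (Nat.le_of_lt_succ l.2)) 0 (μ l) (a ∘ σ)) else 0 := by
    intro σ
    rw [Fin.sum_univ_succ, Fin.sum_univ_succ (n := n), if_neg (by simp), zero_add]
    congr 1
    · rw [← plug_unary rfl]
      refine congrArg₂ (· • ·) ?_ rfl
      rw [negOnePow_eq_sg]
      congr 1
      rw [Fin.val_zero]
      push_cast
      linear_combination CharTwo.two_eq_zero (R := ZMod 2)
  rw [hb, map_sum, sum_apply, sum_cyclo_top_facets, ht, homDiff, Finset.sum_congr rfl fun σ hσ =>
    Finset.sum_congr rfl fun l _ => hl σ (Finset.mem_filter.1 hσ).2 l]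
  simp only [_root_.smul_apply, map_units_int, h0, smul_add, Finset.sum_add_distrib, ← Finset.smul_sum]
  have hX : ∑ σ with σ ∈ Subgroup.zpowers (finRotate (n + 1)), chi σ p • sg (n : ZMod 2) •
      T n (Function.update (a ∘ σ) 0 (unary (μ 0) ((a ∘ σ) 0))) = Int.negOnePow n •
      ∑ i : Fin (n + 1), Int.negOnePow (degBefore i p) • T n (Function.update a i (unary (μ 0) (a i))) := by
    rw [← sum_rotations_update (unary_mem hμ) (hcyc n) ha, Finset.smul_sum, negOnePow_eq_sg, Int.cast_natCast]
    exact Finset.sum_congr rfl fun σ _ => smul_comm _ _ _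
  simp only [smul_comm (Int.negOnePow (degBefore _ p)), ← Finset.smul_sum]
  rw [hX, smul_comm (Int.negOnePow n), ← smul_sub, smul_left_cancel_iff, eq_sub_iff_add_eq, eq_comm]
  exact Iff.of_eq (congrArg (δ (T n a) = ·) (add_comm _ _))

end

/-! ### Homotopy traces and module morphisms. -/

section

variable {k : Type u} [Field k] {m n : ℕ} {A : Type v} [AddCommGroup A] [Module k A]
  {W : Type w} [AddCommGroup W] [Module k W]
  {𝒜 : ℤ → Submodule k A}
  {μ : ∀ n : ℕ, MultilinearMap k (fun _ : Fin (n + 1) => A) A}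
  {T : ∀ n : ℕ, MultilinearMap k (fun _ : Fin (n + 1) => A) W}
  {𝒲 : ℤ → Submodule k W} {δ : W →ₗ[k] W}

theorem IsHomotopyTrace.rotate (hT : IsHomotopyTrace 𝒜 μ 𝒲 δ T) (n : ℕ) (p : Fin (n + 1) → ℤ)
    (a : Fin (n + 1) → A) (ha : ∀ j, a j ∈ 𝒜 (p j)) :
    T n a = chi (finRotate (n + 1)) p • T n (a ∘ finRotate (n + 1)) :=
  hT.cyclic n _ (Subgroup.mem_zpowers _) p a ha

theorem BoundaryCompat.units {D : A →ₗ[k] A} {X : FacePoset k n}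
    {F : (X.Cell →₀ ExteriorAlgebra k (Fin (n + 1) → k)) →ₗ[k]
      MultilinearMap k (fun _ : Fin (n + 1) => A) W} {d : ℕ} (u : ℤˣ) {x}
    (hx : BoundaryCompat 𝒜 D δ F d x) : BoundaryCompat 𝒜 D δ F d (u • x) := by
  rcases Int.units_eq_one_or u with rfl | rfl
  · rwa [one_smul]
  · rw [Units.neg_smul, one_smul, ← neg_one_smul k]
    exact hx.smul _

/-- A rotation fixes the cyclic word, and the top face has no brackets; so only the volume form
changes, by the sign of `σ`. Combined with equivariance this is condition (i). -/
theorem cycloRelabel_cycloTop {σ : Equiv.Perm (Fin (n + 1))}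
    (hσ : σ ∈ Subgroup.zpowers (finRotate (n + 1))) :
    cycloRelabel (k := k) n σ⁻¹ (cycloTop k n) = Equiv.Perm.sign σ • cycloTop k n := by
  have hb : (CycBr.top n).relabel σ⁻¹ = CycBr.top n := by
    refine CycBr.ext ?_ (Finset.image_empty _)
    change ((List.finRange (n + 1) : Cycle _)).map ⇑(σ⁻¹⁻¹) = _
    rw [inv_inv, Cycle.map_coe]
    exact Cycle.coe_eq_coe.2 (mem_zpowers_finRotate.1 hσ).symm
  have h : cycloRelabel (k := k) n σ⁻¹ (cycloCell (topRep_cyclo n) (by simp)) =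
      Equiv.Perm.sign σ • cycloCell (topRep_cyclo n) (by simp) := by
    rw [cycloRelabel_cell]
    refine congrArg₂ (· • ·) (congrArg _ (inv_inv σ)) ?_
    refine Subtype.ext ?_
    change Finsupp.single ((CycBr.top n).relabel σ⁻¹) _ = Finsupp.single (CycBr.top n) _
    rw [hb, Forest.brs_map, Forest.brs_ofLeaves]
    rfl
  rw [cycloTop_eq]
  refine Subtype.ext ?_
  have h' := congrArg Subtype.val h
  rw [units_smul_val] at h'
  change relabelAux (cyclohedron k n) (fun b => CycBr.relabel b σ⁻¹) σ⁻¹ (sg (n : ZMod 2) • _ : (cyclohedron k n).chains n).1 = _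
  rw [units_smul_val, map_units_int (relabelAux (cyclohedron k n) (fun b => CycBr.relabel b σ⁻¹) σ⁻¹),
    units_smul_val, units_smul_val, smul_comm]
  exact congrArg _ h'

theorem IsCyclohedronTrace.cyclic {α : ∀ n d : ℕ, (associahedron k n).chains d →ₗ[k]
      MultilinearMap k (fun _ : Fin (n + 1) => A) A} {D : A →ₗ[k] A}
    {t : ∀ n d : ℕ, (cyclohedron k n).chains d →ₗ[k] MultilinearMap k (fun _ : Fin (n + 1) => A) W}
    (ht : IsCyclohedronTrace 𝒜 D α 𝒲 δ t) {σ : Equiv.Perm (Fin (n + 1))}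
    (hσ : σ ∈ Subgroup.zpowers (finRotate (n + 1))) {p : Fin (n + 1) → ℤ} {a : Fin (n + 1) → A}
    (ha : ∀ j, a j ∈ 𝒜 (p j)) : t n n (cycloTop k n) a = chi σ p • t n n (cycloTop k n) (a ∘ σ) := by
  have h := ht.equivariant n n σ⁻¹ (cycloTop k n) p a ha
  rw [cycloRelabel_cycloTop hσ, chains_linear_units_smul, _root_.smul_apply, inv_inv] at h
  rw [chi, mul_smul, ← h, smul_smul, Int.units_mul_self, one_smul]

variable [DirectSum.Decomposition 𝒜]

/-- On the generating top cells the claim is condition (ii), and it passes to relabellings and to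
composites with arbitrary chains of associahedra. -/
theorem cycloMap_boundaryCompat (hA : IsAInfinityAlgebra 𝒜 μ) (hT : IsHomotopyTrace 𝒜 μ 𝒲 δ T)
    (n d : ℕ) (x : (cyclohedron k n).chains d) :
    BoundaryCompat (X := cyclohedron k n) 𝒜 (unary (μ 0)) δ (cycloRaw 𝒜 hA.degree hT.rotate n) d x.1 := by
  refine cyclo_generation (P := fun n d x => BoundaryCompat (X := cyclohedron k n) 𝒜 (unary (μ 0))
    δ (cycloRaw 𝒜 hA.degree hT.rotate n) d x.1) (fun n d => BoundaryCompat.zero)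
    (fun n d x y hx hy => hx.add hy) (fun n d c x hx => hx.smul c) (fun n => ?_) (fun n d σ x hx => ?_)
    (fun m n d e i x y hx => ?_) n d x
  · rw [cycloTop_eq, units_smul_val]
    exact BoundaryCompat.units _ fun p a ha => (cycloRaw_topCell_iff 𝒜 hA.degree hT.rotate hT.cyclic δ ha).2
      (hT.boundary n p a ha)
  · exact BoundaryCompat.relabel (unary_mem hA.degree) (cycloRelabelFacets σ)
      (fun e x p a ha => cycloMap_equivariant 𝒜 hA.degree hT.rotate n e σ x p a ha) hx
  · exact BoundaryCompat.comp (unary_mem hA.degree) (cycloCompFacets i)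
      (fun d e x y p a ha => cycloMap_comp 𝒜 hA.degree hT.rotate m n d e i x y p a ha)
      (assocMap_degree 𝒜 hA.degree n e y) hx (assocMap_boundaryCompat 𝒜 hA n e y)

theorem cycloMap_isCyclohedronTrace (hA : IsAInfinityAlgebra 𝒜 μ) (hT : IsHomotopyTrace 𝒜 μ 𝒲 δ T) :
    IsCyclohedronTrace 𝒜 (unary (μ 0)) (assocMap 𝒜 μ) 𝒲 δ (cycloMap 𝒜 hA.degree hT.rotate) where
  degree := cycloMap_degree 𝒜 hA.degree hT.rotate hT.degree
  boundary_zero n x p a ha := by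
    have := cycloMap_boundaryCompat hA hT n 0 x p a ha
    rw [FacePoset.boundaryAux_eq_zero x.2, map_zero] at this
    exact this.symm
  boundary_succ n d x p a ha := cycloMap_boundaryCompat hA hT n (d + 1) x p a ha
  equivariant := cycloMap_equivariant 𝒜 hA.degree hT.rotate
  comp := cycloMap_comp 𝒜 hA.degree hT.rotate

/-- The values on the top cells are cyclic, hence extend to `cycloMap`. This extension agrees with
`t` on generators, so it is `t`, and the compatibility of `t` with the boundary of the top cell can
be read through `cycloRaw_topCell_iff`. -/
theorem IsCyclohedronTrace.isHomotopyTrace (hA : IsAInfinityAlgebra 𝒜 μ)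
    {t : ∀ n d : ℕ, (cyclohedron k n).chains d →ₗ[k] MultilinearMap k (fun _ : Fin (n + 1) => A) W}
    (ht : IsCyclohedronTrace 𝒜 (unary (μ 0)) (assocMap 𝒜 μ) 𝒲 δ t) :
    IsHomotopyTrace 𝒜 μ 𝒲 δ fun n =>
      sg ((n : ZMod 2) + ((n * (n + 1) / 2 : ℕ) : ZMod 2)) • t n n (cycloTop k n) := by
  set T : ∀ n : ℕ, MultilinearMap k (fun _ : Fin (n + 1) => A) W := fun n =>
    sg ((n : ZMod 2) + ((n * (n + 1) / 2 : ℕ) : ZMod 2)) • t n n (cycloTop k n) with hT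
  have hcyc : ∀ (n : ℕ), ∀ σ ∈ Subgroup.zpowers (finRotate (n + 1)),
      ∀ (p : Fin (n + 1) → ℤ) a, (∀ j, a j ∈ 𝒜 (p j)) → T n a = chi σ p • T n (a ∘ σ) := by
    intro n σ hσ p a ha
    simp only [hT, multilinear_units_smul]
    rw [ht.cyclic hσ ha, smul_comm]
  have hrot : ∀ (n : ℕ) (p : Fin (n + 1) → ℤ) a, (∀ j, a j ∈ 𝒜 (p j)) →
      T n a = chi (finRotate (n + 1)) p • T n (a ∘ finRotate (n + 1)) :=
    fun n => hcyc n _ (Subgroup.mem_zpowers _)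
  -- The sign in the definition of `T` is that of `cycloMap_top`, so it cancels on top cells.
  have heq : cycloMap 𝒜 hA.degree hrot = t := by
    refine cyclo_module_ext 𝒜 (cycloMap_equivariant 𝒜 hA.degree hrot) ht.equivariant
      (cycloMap_comp 𝒜 hA.degree hrot) ht.comp fun n => ?_
    rw [cycloMap_top]
    simp only [hT]
    rw [sg_smul_smul, CharTwo.add_self_eq_zero, sg_zero, one_smul]
  refine ⟨fun n p a ha => ?_, hcyc, fun n p a ha => ?_⟩
  · simp only [hT, multilinear_units_smul]
    exact units_mem _ _ (ht.degree n n _ p a ha)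
  rw [← cycloRaw_topCell_iff 𝒜 hA.degree hrot hcyc δ ha]
  -- For one letter the top cell is a point, and the condition on degree 0 takes the place of the
  -- boundary formula.
  cases n with
  | zero =>
    have := ht.boundary_zero 0 (cycloCell (topRep_cyclo 0) (by simp)) p a ha
    rw [← heq] at this
    rw [FacePoset.boundaryAux_eq_zero (cycloCell (topRep_cyclo 0) (by simp)).2, map_zero]
    exact this.symm
  | succ n =>
    have := ht.boundary_succ (n + 1) n (cycloCell (topRep_cyclo (n + 1)) (by simp)) p a ha
    rw [← heq] at this
    exact this

end

end Cyclohedron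

end

/-! ### Choice of the orientations and conclusion. -/

namespace Cyclohedron

theorem units_cast_smul {R : Type u} [Field R] {M : Type v} [AddCommGroup M] [Module R M] (u : ℤˣ) (x : M) :
    ((u : ℤ) : R) • x = u • x := by
  rcases Int.units_eq_one_or u with rfl | rfl <;> simp

theorem units_cast_smul_eq_or {R : Type u} [Field R] {M : Type v} [AddCommGroup M] [Module R M] (u : ℤˣ)
    (x : M) : ((u : ℤ) : R) • x = x ∨ ((u : ℤ) : R) • x = -x := by
  rcases Int.units_eq_one_or u with rfl | rfl <;> simp

end Cyclohedron

theorem proposition2p1 {k : Type u} [Field k] :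
    ∃ (c : ∀ n : ℕ, (Cyclohedron.associahedron k (n + 1)).chains n)
      (f : ∀ n : ℕ, (Cyclohedron.cyclohedron k n).chains n),
      (∀ n, c n = Cyclohedron.assocTop k n ∨ c n = -Cyclohedron.assocTop k n) ∧
      (∀ n, f n = Cyclohedron.cycloTop k n ∨ f n = -Cyclohedron.cycloTop k n) ∧
      ∀ (A : Type v) [AddCommGroup A] [Module k A] (𝒜 : ℤ → Submodule k A)
        [DirectSum.Decomposition 𝒜]
        (m : ∀ n : ℕ, MultilinearMap k (fun _ : Fin (n + 1) => A) A),
        Cyclohedron.IsAInfinityAlgebra 𝒜 m →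
        ∃ α : ∀ n d : ℕ, (Cyclohedron.associahedron k n).chains d →ₗ[k]
            MultilinearMap k (fun _ : Fin (n + 1) => A) A,
          Cyclohedron.IsOperadAlgebra 𝒜 (Cyclohedron.unary (m 0)) α ∧
          (∀ n, α (n + 1) n (c n) = m (n + 1)) ∧
          (∀ β, Cyclohedron.IsOperadAlgebra 𝒜 (Cyclohedron.unary (m 0)) β →
            (∀ n, β (n + 1) n (c n) = m (n + 1)) → β = α) ∧
          ∀ (W : Type w) [AddCommGroup W] [Module k W] (𝒲 : ℤ → Submodule k W)
            [DirectSum.Decomposition 𝒲] (δ : W →ₗ[k] W), Cyclohedron.IsDGSpace 𝒲 δ →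
            Set.BijOn
              (fun (t : ∀ n d : ℕ, (Cyclohedron.cyclohedron k n).chains d →ₗ[k]
                MultilinearMap k (fun _ : Fin (n + 1) => A) W) n => t n n (f n))
              {t | Cyclohedron.IsCyclohedronTrace 𝒜 (Cyclohedron.unary (m 0)) α 𝒲 δ t}
              {T | Cyclohedron.IsHomotopyTrace 𝒜 m 𝒲 δ T} := by
  -- The orientations are chosen to cancel the signs in `assocMap_top` and `cycloMap_top`: the
  -- triangular numbers come from desuspension, and the extra `n` from `cycloTop_eq`.
  refine ⟨fun n => ((Cyclohedron.sg (((n + 1) * (n + 2) / 2 : ℕ) : ZMod 2) : ℤ) : k) •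
      Cyclohedron.assocTop k n,
    fun n => ((Cyclohedron.sg ((n : ZMod 2) + ((n * (n + 1) / 2 : ℕ) : ZMod 2)) : ℤ) : k) •
      Cyclohedron.cycloTop k n,
    fun n => Cyclohedron.units_cast_smul_eq_or (Cyclohedron.sg (((n + 1) * (n + 2) / 2 : ℕ) : ZMod 2))
      (Cyclohedron.assocTop k n),
    fun n => Cyclohedron.units_cast_smul_eq_or (Cyclohedron.sg ((n : ZMod 2) + ((n * (n + 1) / 2 : ℕ) : ZMod 2)))
      (Cyclohedron.cycloTop k n), ?_⟩
  intro A _ _ 𝒜 _ m hA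
  have hc : ∀ n, Cyclohedron.assocMap 𝒜 m (n + 1) n
      (((Cyclohedron.sg (((n + 1) * (n + 2) / 2 : ℕ) : ZMod 2) : ℤ) : k) • Cyclohedron.assocTop k n) =
      m (n + 1) := fun n => by
    rw [map_smul, Cyclohedron.units_cast_smul, Cyclohedron.assocMap_top, Cyclohedron.sg_smul_smul,
      CharTwo.add_self_eq_zero, Cyclohedron.sg_zero, one_smul]
  refine ⟨Cyclohedron.assocMap 𝒜 m, Cyclohedron.assocMap_isOperadAlgebra 𝒜 hA, hc, ?_, ?_⟩
  · intro β hβ hβc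
    refine hβ.ext (Cyclohedron.assocMap_isOperadAlgebra 𝒜 hA) fun n => ?_
    have h := (hβc n).trans (hc n).symm
    rwa [map_smul, map_smul, Cyclohedron.units_cast_smul, Cyclohedron.units_cast_smul,
      smul_left_cancel_iff] at h
  · intro W _ _ 𝒲 _ δ _
    refine ⟨fun t ht => ?_, fun s hs t ht h => ?_, fun T hT => ?_⟩
    · have := Cyclohedron.IsCyclohedronTrace.isHomotopyTrace hA ht
      simpa only [Set.mem_ofPred_eq, map_smul, Cyclohedron.units_cast_smul] using this
    · refine Cyclohedron.cyclo_module_ext 𝒜 hs.equivariant ht.equivariant hs.comp ht.comp fun n => ?_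
      have h := congrFun h n
      simpa only [map_smul, Cyclohedron.units_cast_smul, smul_left_cancel_iff] using h
    · refine ⟨_, Cyclohedron.cycloMap_isCyclohedronTrace hA hT, funext fun n => ?_⟩
      simp only [map_smul, Cyclohedron.units_cast_smul]
      rw [Cyclohedron.cycloMap_top, Cyclohedron.sg_smul_smul, CharTwo.add_self_eq_zero,
        Cyclohedron.sg_zero, one_smul]
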